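/- Let $P$ be a path with vertices $v_0,\dots,v_n$ and edges $e_i=(v_i,v_{i+1})$, $0\le i<n$; edge $e_i$ has a length $d_i>0$ (the time needed to traverse it) and a capacity $c_i>0$ (the amount of flow that can enter it per unit time), and the capacities may be different. Place $v_i$ at $x_i=\sum_{j<i}d_j$ and identify $P$ with the segment $[0,x_n]$. Each vertex has a weight range $[w_i^-,w_i^+]$ with $0\le w_i^-\le w_i^+$; a scenario is a vector $s=(w_0(s),\dots,w_n(s))\in\mathcal S=\prod_{i=0}^n[w_i^-,w_i^+]$, where $w_i(s)$ is the amount of (infinitely divisible) flow initially at $v_i$. For a sink $x\in[0,x_n]$ let $\Theta_L(P,x:s)$ be the minimum time in which all flow starting in $[0,x)$ can be moved along the path to $x$, where flow may wait at vertices and the capacities must be respected; let $\Theta_R(P,x:s)$ be the same for the flow starting in $(x,x_n]$, and let $\Theta(P,x:s)=\max\{\Theta_L(P,x:s),\Theta_R(P,x:s)\}$. Put $$\Theta_{OPT}(P:s)=\min_{y\in[0,x_n]}\Theta(P,y:s),\qquad R_{\max}(P,x)=\max_{s\in\mathcal S}\bigl(\Theta(P,x:s)-\Theta_{OPT}(P:s)\bigr),\qquad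 R_{OPT}(P)=\min_{x\in[0,x_n]}R_{\max}(P,x).$$ Theorem. The $1$-sink minmax regret location problem on paths with general capacities can be solved in $O(n^4\log n)$ time: there is a real RAM program that, given $n$ and the numbers $d_i,c_i,w_i^-,w_i^+$ of any such path $P$, computes the value $R_{OPT}(P)$ and a point $x\in[0,x_n]$ with $R_{\max}(P,x)=R_{OPT}(P)$ (in particular the minimum is attained), and whose worst-case number of steps over all such paths with $n$ edges is $O(n^4\log n)$. Here the real RAM performs in one step each an arithmetic operation $+,-,\times,\div$ or a comparison on real numbers, an addition, subtraction or comparison of natural numbers used as indices, or an indirect access to memory; its constants are rational reals and natural numbers. -/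

import Mathlib

/-! ## The real RAM

A unit-cost random access machine over the real numbers.  Real numbers are handled only through
the four field operations and comparisons; natural numbers are used for indexing and control and
are handled only through addition, truncated subtraction and comparison.  There is no rounding
and no other passage from real numbers to natural numbers. -/

namespace RealRAM

/-- Instructions.  `i j k` are names of index registers, `a b e` names of real registers, and `l`
is the position of an instruction in the program. -/
inductive Instr : Type
  /-- `ireg i := m` -/
  | iconst (i m : ℕ)
  /-- `ireg i := ireg j + ireg k` -/
  | iadd (i j k : ℕ)
  /-- `ireg i := ireg j - ireg k` (truncated at `0`) -/
  | isub (i j k : ℕ)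
  /-- `ireg i := imem (ireg j)` -/
  | iload (i j : ℕ)
  /-- `imem (ireg i) := ireg j` -/
  | istore (i j : ℕ)
  /-- `rreg a := q`, for a rational constant `q` -/
  | rconst (a : ℕ) (q : ℚ)
  /-- `rreg a := rreg b + rreg e` -/
  | radd (a b e : ℕ)
  /-- `rreg a := rreg b - rreg e` -/
  | rsub (a b e : ℕ)
  /-- `rreg a := rreg b * rreg e` -/
  | rmul (a b e : ℕ)
  /-- `rreg a := rreg b / rreg e` (by convention `0` if the divisor is `0`) -/
  | rdiv (a b e : ℕ)
  /-- `rreg a := rmem (ireg j)` -/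
  | rload (a j : ℕ)
  /-- `rmem (ireg i) := rreg b` -/
  | rstore (i b : ℕ)
  /-- go to instruction `l` -/
  | jump (l : ℕ)
  /-- if `ireg i ≤ ireg j` go to instruction `l` -/
  | jumpILe (i j l : ℕ)
  /-- if `rreg a ≤ rreg b` go to instruction `l` -/
  | jumpRLe (a b l : ℕ)
  /-- stop -/
  | halt

/-- A program is a finite list of instructions. -/
abbrev Program : Type := List Instr

/-- A configuration: the program counter, the index registers, the real registers, and the two
memories, which are accessed indirectly through index registers. -/
structure Config : Type where
  pc : ℕ
  ireg : ℕ → ℕ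
  rreg : ℕ → ℝ
  imem : ℕ → ℕ
  rmem : ℕ → ℝ

open Classical in
/-- The effect of a single instruction; `none` means that the machine stops. -/
noncomputable def exec (c : Config) : Instr → Option Config
  | .iconst i m => some { c with pc := c.pc + 1, ireg := Function.update c.ireg i m }
  | .iadd i j k =>
      some { c with pc := c.pc + 1, ireg := Function.update c.ireg i (c.ireg j + c.ireg k) }
  | .isub i j k =>
      some { c with pc := c.pc + 1, ireg := Function.update c.ireg i (c.ireg j - c.ireg k) }
  | .iload i j =>
      some { c with pc := c.pc + 1, ireg := Function.update c.ireg i (c.imem (c.ireg j)) }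
  | .istore i j =>
      some { c with pc := c.pc + 1, imem := Function.update c.imem (c.ireg i) (c.ireg j) }
  | .rconst a q => some { c with pc := c.pc + 1, rreg := Function.update c.rreg a (q : ℝ) }
  | .radd a b e =>
      some { c with pc := c.pc + 1, rreg := Function.update c.rreg a (c.rreg b + c.rreg e) }
  | .rsub a b e =>
      some { c with pc := c.pc + 1, rreg := Function.update c.rreg a (c.rreg b - c.rreg e) }
  | .rmul a b e =>
      some { c with pc := c.pc + 1, rreg := Function.update c.rreg a (c.rreg b * c.rreg e) }
  | .rdiv a b e =>
      some { c with pc := c.pc + 1, rreg := Function.update c.rreg a (c.rreg b / c.rreg e) }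
  | .rload a j =>
      some { c with pc := c.pc + 1, rreg := Function.update c.rreg a (c.rmem (c.ireg j)) }
  | .rstore i b =>
      some { c with pc := c.pc + 1, rmem := Function.update c.rmem (c.ireg i) (c.rreg b) }
  | .jump l => some { c with pc := l }
  | .jumpILe i j l => some { c with pc := if c.ireg i ≤ c.ireg j then l else c.pc + 1 }
  | .jumpRLe a b l => some { c with pc := if c.rreg a ≤ c.rreg b then l else c.pc + 1 }
  | .halt => none

/-- One step of a program.  The machine stops at a `halt` instruction and when the program
counter leaves the program. -/
noncomputable def step (p : Program) (c : Config) : Option Config :=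
  (p[c.pc]?).bind (exec c)

/-- `HaltsIn p c t f`: started in configuration `c`, the program `p` stops after exactly `t`
steps, in configuration `f`. -/
inductive HaltsIn (p : Program) : Config → ℕ → Config → Prop
  | done {c : Config} (h : step p c = none) : HaltsIn p c 0 c
  | next {c c' f : Config} {t : ℕ} (h : step p c = some c') (h' : HaltsIn p c' t f) :
      HaltsIn p c (t + 1) f

end RealRAM

/-! ## Paths with capacities and interval weights -/

/-- A path with vertices `v_0, …, v_n` and edges `e_i = (v_i, v_{i+1})`, `i < n`, with positive
edge lengths `d` and positive edge capacities `c`, and with an interval `[wlo i, whi i]` of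
possible nonnegative initial weights at each vertex. -/
structure UncertainPath (n : ℕ) where
  d : Fin n → ℝ
  c : Fin n → ℝ
  wlo : Fin (n + 1) → ℝ
  whi : Fin (n + 1) → ℝ
  d_pos : ∀ i, 0 < d i
  c_pos : ∀ i, 0 < c i
  wlo_nonneg : ∀ i, 0 ≤ wlo i
  wlo_le_whi : ∀ i, wlo i ≤ whi i

namespace UncertainPath

variable {n : ℕ} (P : UncertainPath n)

/-- The location `x_i` of vertex `v_i`: the total length of the edges before it. -/
def pos (i : Fin (n + 1)) : ℝ := ∑ j : Fin n, if j.castSucc < i then P.d j else 0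

/-- The points of the path: the segment `[0, x_n]`. -/
def points : Set ℝ := Set.Icc 0 (P.pos (Fin.last n))

/-- The legal scenarios: the box of all weight vectors within the given ranges. -/
def scenarios : Set (Fin (n + 1) → ℝ) := {s | ∀ i, P.wlo i ≤ s i ∧ s i ≤ P.whi i}

/-- Dynamic flows along the path in one direction, edge `i` being directed from `v_(src i)` to
`v_(dst i)`, with initial weights `s`.  `A i t` is the total amount of flow that has entered edge
`i` up to time `t`; it leaves the edge `d i` time units after entering it.  Flow may wait at
vertices. -/
structure IsFlow (src dst : Fin n → Fin (n + 1)) (s : Fin (n + 1) → ℝ) (A : Fin n → ℝ → ℝ) :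
    Prop where
  /-- nothing moves before time `0` -/
  zero : ∀ i t, t ≤ 0 → A i t = 0
  mono : ∀ i, Monotone (A i)
  /-- at most `c i` units of flow enter edge `i` per unit of time -/
  cap : ∀ i t t', t ≤ t' → A i t' - A i t ≤ P.c i * (t' - t)
  /-- what has left a vertex was there initially or has arrived there over the preceding edge -/
  supply : ∀ i t, A i t ≤ s (src i) + ∑ j : Fin n, if dst j = src i then A j (t - P.d j) else 0

/-- All flow starting in `[0, x)` can be moved to the right to `x` by time `T`.  Here `e_k` is the
edge over which the flow reaches `x`. -/
def EvacuatesLeft (s : Fin (n + 1) → ℝ) (x T : ℝ) : Prop :=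
  ∃ A : Fin n → ℝ → ℝ, P.IsFlow Fin.castSucc Fin.succ s A ∧
    ∀ k : Fin n, P.pos k.castSucc < x → x ≤ P.pos k.succ →
      A k (T - (x - P.pos k.castSucc)) = ∑ i : Fin (n + 1), if i ≤ k.castSucc then s i else 0

/-- All flow starting in `(x, x_n]` can be moved to the left to `x` by time `T`.  Here `e_k` is the
edge over which the flow reaches `x`. -/
def EvacuatesRight (s : Fin (n + 1) → ℝ) (x T : ℝ) : Prop :=
  ∃ A : Fin n → ℝ → ℝ, P.IsFlow Fin.succ Fin.castSucc s A ∧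
    ∀ k : Fin n, P.pos k.castSucc ≤ x → x < P.pos k.succ →
      A k (T - (P.pos k.succ - x)) = ∑ i : Fin (n + 1), if k.succ ≤ i then s i else 0

/-- `Θ_L(P, x : s)`, the time needed to evacuate the flow to the left of `x` to `x`. -/
noncomputable def thetaL (x : ℝ) (s : Fin (n + 1) → ℝ) : ℝ :=
  sInf {T : ℝ | 0 ≤ T ∧ P.EvacuatesLeft s x T}

/-- `Θ_R(P, x : s)`, the time needed to evacuate the flow to the right of `x` to `x`. -/
noncomputable def thetaR (x : ℝ) (s : Fin (n + 1) → ℝ) : ℝ :=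
  sInf {T : ℝ | 0 ≤ T ∧ P.EvacuatesRight s x T}

/-- `Θ(P, x : s)`, the time needed to evacuate all the flow to `x`. -/
noncomputable def theta (x : ℝ) (s : Fin (n + 1) → ℝ) : ℝ := max (P.thetaL x s) (P.thetaR x s)

/-- `Θ_OPT(P : s)`, the minimum evacuation time over all sinks. -/
noncomputable def thetaOpt (s : Fin (n + 1) → ℝ) : ℝ := sInf ((fun x => P.theta x s) '' P.points)

/-- `R(P, x : s)`, the regret for the sink `x` under scenario `s`. -/
noncomputable def regret (x : ℝ) (s : Fin (n + 1) → ℝ) : ℝ := P.theta x s - P.thetaOpt s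

/-- `R_max(P, x)`, the maximum regret for the sink `x` over all legal scenarios. -/
noncomputable def maxRegret (x : ℝ) : ℝ := sSup (P.regret x '' P.scenarios)

/-- `R_OPT(P)`, the minimum of the maximum regret over all sinks. -/
noncomputable def minmaxRegret : ℝ := sInf (P.maxRegret '' P.points)

/-- The initial configuration on input `P`: index register `0` holds `n`, the real memory holds
`d_0, …, d_{n-1}, c_0, …, c_{n-1}, wlo_0, …, wlo_n, whi_0, …, whi_n` in consecutive cells from
cell `0` on, and everything else is `0`. -/
def input : RealRAM.Config where
  pc := 0
  ireg := Function.update (fun _ => 0) 0 n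
  rreg := fun _ => 0
  imem := fun _ => 0
  rmem := fun a =>
    (List.ofFn P.d ++ List.ofFn P.c ++ List.ofFn P.wlo ++ List.ofFn P.whi).getD a 0

end UncertainPath

/-! Number the vertices 1, …, n + 1 and fix a sink x with vertices 1, …, k to its left. Let S_i be
the weight of the first i vertices and b the least capacity on the edges i, …, k. All of the flow
reaches x in time T exactly when S_i ≤ b (T − x + x_i) for all i ≤ k with S_i > 0 (`thetaL_le_iff`).
So Θ_L, if positive, equals x − x_i + S_i / b for some i of positive weight (`exists_thetaL_le`,
`le_thetaL`). The position x enters only as a summand. Since the regret is a supremum over scenarios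
s and rival sinks y of Θ(x : s) − Θ(y : s), the scenarios in which the flow from the left is last
contribute max(0, x + α_k), where α_k depends on the edge k alone; the flow from the right is
treated on the reversed path, with a second table β (`maxRegret_eq`). Inside an edge the maximum
regret is thus the maximum of 0, an increasing and a decreasing line of slopes ±1, and the minimum
over the path is attained at a vertex or where these two lines cross (`isLeast_of_le`).

The number α_k is a maximum over i ≤ k, y, t and the scenarios with Θ(y : s) ≤ t of an increasing
function of S_i, minus t. The weights after i may be lowered to their minima, which keeps S_i and
does not slow the evacuation to y; then S_i is the total flow minus a constant. The total splits
into the amounts that the two sides of y can deliver in time. For one side the largest deliverable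
amount is a lower envelope of truncated lines, one per vertex (`Side.carry`, with `Fits.le_carry`
and `WF.exists_fits`). Later lines are at least as steep and start to rise no later, so the envelope
passes only from later to earlier lines. It is therefore convex between breakpoints, of which two
per line suffice (`LineFamily.piecewiseConvex`).

It remains to make the choice of y and t finite. At a vertex y only t varies, and a bounded
piecewise convex function minus a multiple of t is largest at a breakpoint. Inside an edge the
coordinates u = t − y and v = t − (len − y) separate the objective into a function of u plus a
function of v, with v − u confined to an interval. The weights after i are fixed, so the right
summand is concave in the relevant range (`WF.concaveOn_of_fixed_before`). Hence v may be its global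
maximizer and u a breakpoint, unless an end of the edge is reached (`Side.exists_edge_break`); an
end is dominated by the corresponding vertex.

For each i and each vertex or edge this leaves O(n) breakpoints, with O(n) work for each of them,
and O(n^4) steps in total; the logarithm in the claim is slack. The program is written in a small
language whose loops all have 2n + 5 rounds. A verified compiler (`Cmd.code_correct`) and a bound by
the nesting depth of loops (`Cmd.exists_cost_le`), here 4, give the running time. -/

/-! ## A structured language for the real RAM -/

namespace RealRAM

/-- Index expressions. -/
inductive IExpr : Type
  | var (v : ℕ)
  | const (m : ℕ)
  | add (a b : IExpr)
  | sub (a b : IExpr)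

/-- Real expressions; `arr a e` is entry `e` of array `a`, and `cell e` is the raw memory cell
`e`. -/
inductive RExpr : Type
  | var (v : ℕ)
  | const (q : ℚ)
  | add (a b : RExpr)
  | sub (a b : RExpr)
  | mul (a b : RExpr)
  | div (a b : RExpr)
  | max (a b : RExpr)
  | min (a b : RExpr)
  | arr (a : Fin 32) (e : IExpr)
  | cell (e : IExpr)

/-- Conditions. -/
inductive BExpr : Type
  | ile (a b : IExpr)
  | rle (a b : RExpr)
  | and (a b : BExpr)
  | not (a : BExpr)

/-- Commands; `loop v c` runs `c` with `v = 0, …, 2 * N + 4`, where `N` is index variable `0`. -/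
inductive Cmd : Type
  | skip
  | iset (v : ℕ) (e : IExpr)
  | rset (v : ℕ) (e : RExpr)
  | store (a : Fin 32) (idx : IExpr) (e : RExpr)
  | seq (c₁ c₂ : Cmd)
  | ite (b : BExpr) (c₁ c₂ : Cmd)
  | loop (v : ℕ) (c : Cmd)

/-- The values of the variables and of the arrays. -/
@[ext] structure Store : Type where
  I : ℕ → ℕ
  R : ℕ → ℝ
  A : Fin 32 → ℕ → ℝ

namespace Store

/-- Assignment to an index variable. -/
def setI (σ : Store) (v m : ℕ) : Store := { σ with I := Function.update σ.I v m }

/-- Assignment to a real variable. -/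
def setR (σ : Store) (v : ℕ) (x : ℝ) : Store := { σ with R := Function.update σ.R v x }

/-- Assignment to an array entry. -/
def setA (σ : Store) (a : Fin 32) (j : ℕ) (x : ℝ) : Store :=
  { σ with A := Function.update σ.A a (Function.update (σ.A a) j x) }

end Store

/-- The value of an index expression. -/
def IExpr.eval : IExpr → Store → ℕ
  | var v, σ => σ.I v
  | const m, _ => m
  | add a b, σ => a.eval σ + b.eval σ
  | sub a b, σ => a.eval σ - b.eval σ

/-- The value of a real expression. -/
noncomputable def RExpr.eval : RExpr → Store → ℝ
  | var v, σ => σ.R v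
  | const q, _ => q
  | add a b, σ => a.eval σ + b.eval σ
  | sub a b, σ => a.eval σ - b.eval σ
  | mul a b, σ => a.eval σ * b.eval σ
  | div a b, σ => a.eval σ / b.eval σ
  | max a b, σ => Max.max (a.eval σ) (b.eval σ)
  | min a b, σ => Min.min (a.eval σ) (b.eval σ)
  | arr a e, σ => σ.A a (e.eval σ)
  | cell e, σ => σ.A (Fin.ofNat 32 (e.eval σ)) (e.eval σ / 32)

/-- The truth of a condition. -/
def BExpr.eval : BExpr → Store → Prop
  | ile a b, σ => a.eval σ ≤ b.eval σ
  | rle a b, σ => a.eval σ ≤ b.eval σ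
  | and a b, σ => a.eval σ ∧ b.eval σ
  | not a, σ => ¬ a.eval σ

/-- `k` rounds of a loop over `v` with body `f`. -/
def iterate (f : Store → Store) (v : ℕ) (σ : Store) : ℕ → Store
  | 0 => σ.setI v 0
  | k + 1 => (f (iterate f v σ k)).setI v (k + 1)

/-- The number of rounds of a loop. -/
def Store.rounds (σ : Store) : ℕ := 2 * σ.I 0 + 5

open Classical in
/-- The effect of a command. -/
noncomputable def Cmd.run : Cmd → Store → Store
  | skip, σ => σ
  | iset v e, σ => σ.setI v (e.eval σ)
  | rset v e, σ => σ.setR v (e.eval σ)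
  | store a idx e, σ => σ.setA a (idx.eval σ) (e.eval σ)
  | seq c₁ c₂, σ => c₂.run (c₁.run σ)
  | ite b c₁ c₂, σ => if b.eval σ then c₁.run σ else c₂.run σ
  | loop v c, σ => iterate c.run v σ σ.rounds

/-- Whether a command may assign to index variable `x`. -/
def Cmd.writesI (x : ℕ) : Cmd → Bool
  | skip => false
  | iset v _ => v == x
  | rset _ _ => false
  | store _ _ _ => false
  | seq c₁ c₂ => c₁.writesI x || c₂.writesI x
  | ite _ c₁ c₂ => c₁.writesI x || c₂.writesI x
  | loop v c => v == x || c.writesI x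

/-- Whether a command may assign to real variable `x`. -/
def Cmd.writesR (x : ℕ) : Cmd → Bool
  | skip => false
  | iset _ _ => false
  | rset v _ => v == x
  | store _ _ _ => false
  | seq c₁ c₂ => c₁.writesR x || c₂.writesR x
  | ite _ c₁ c₂ => c₁.writesR x || c₂.writesR x
  | loop _ c => c.writesR x

/-- Whether a command may assign to array `x`. -/
def Cmd.writesA (x : Fin 32) : Cmd → Bool
  | skip => false
  | iset _ _ => false
  | rset _ _ => false
  | store a _ _ => a == x
  | seq c₁ c₂ => c₁.writesA x || c₂.writesA x
  | ite _ c₁ c₂ => c₁.writesA x || c₂.writesA x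
  | loop _ c => c.writesA x

/-- No loop body assigns to the loop variable. -/
def Cmd.loopsOK : Cmd → Bool
  | seq c₁ c₂ => c₁.loopsOK && c₂.loopsOK
  | ite _ c₁ c₂ => c₁.loopsOK && c₂.loopsOK
  | loop v c => !c.writesI v && c.loopsOK
  | _ => true

/-! ### Frame properties -/

/-- The criterion is a Boolean computed from the text of the command. For the concrete parts of the
program the side condition therefore holds by `rfl`, and data are carried past a command without any
analysis of what it does. -/
theorem Cmd.run_I_of_not_writesI {x : ℕ} : ∀ {c : Cmd}, c.writesI x = false → ∀ σ,
    (c.run σ).I x = σ.I x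
  | skip, _, _ => rfl
  | iset v e, h, σ => by
    have : v ≠ x := by simpa [writesI] using h
    simp [run, Store.setI, Function.update_of_ne this.symm]
  | rset v e, _, σ => rfl
  | store a i e, _, σ => rfl
  | seq c₁ c₂, h, σ => by
    simp only [writesI, Bool.or_eq_false_iff] at h
    simp [run, run_I_of_not_writesI h.1, run_I_of_not_writesI h.2]
  | ite b c₁ c₂, h, σ => by
    simp only [writesI, Bool.or_eq_false_iff] at h
    simp only [run]
    split_ifs
    · exact run_I_of_not_writesI h.1 σ
    · exact run_I_of_not_writesI h.2 σ
  | loop v c, h, σ => by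
    simp only [writesI, Bool.or_eq_false_iff, beq_eq_false_iff_ne] at h
    have key : ∀ k, (iterate c.run v σ k).I x = σ.I x := by
      intro k
      induction k with
      | zero => simp [iterate, Store.setI, Function.update_of_ne h.1.symm]
      | succ k ih =>
        simp [iterate, Store.setI, Function.update_of_ne h.1.symm, run_I_of_not_writesI h.2, ih]
    exact key _

theorem Cmd.run_R_of_not_writesR {x : ℕ} : ∀ {c : Cmd}, c.writesR x = false → ∀ σ,
    (c.run σ).R x = σ.R x
  | skip, _, _ => rfl
  | rset v e, h, σ => by
    have : v ≠ x := by simpa [writesR] using h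
    simp [run, Store.setR, Function.update_of_ne this.symm]
  | iset v e, _, σ => rfl
  | store a i e, _, σ => rfl
  | seq c₁ c₂, h, σ => by
    simp only [writesR, Bool.or_eq_false_iff] at h
    simp [run, run_R_of_not_writesR h.1, run_R_of_not_writesR h.2]
  | ite b c₁ c₂, h, σ => by
    simp only [writesR, Bool.or_eq_false_iff] at h
    simp only [run]
    split_ifs
    · exact run_R_of_not_writesR h.1 σ
    · exact run_R_of_not_writesR h.2 σ
  | loop v c, h, σ => by
    simp only [writesR] at h
    have key : ∀ k, (iterate c.run v σ k).R x = σ.R x := by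
      intro k
      induction k with
      | zero => simp [iterate, Store.setI]
      | succ k ih => simp [iterate, Store.setI, run_R_of_not_writesR h, ih]
    exact key _

theorem Cmd.run_A_of_not_writesA {x : Fin 32} : ∀ {c : Cmd}, c.writesA x = false → ∀ σ,
    (c.run σ).A x = σ.A x
  | skip, _, _ => rfl
  | rset v e, _, σ => rfl
  | iset v e, _, σ => rfl
  | store a i e, h, σ => by
    have : a ≠ x := by simpa [writesA] using h
    simp [run, Store.setA, Function.update_of_ne this.symm]
  | seq c₁ c₂, h, σ => by
    simp only [writesA, Bool.or_eq_false_iff] at h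
    simp [run, run_A_of_not_writesA h.1, run_A_of_not_writesA h.2]
  | ite b c₁ c₂, h, σ => by
    simp only [writesA, Bool.or_eq_false_iff] at h
    simp only [run]
    split_ifs
    · exact run_A_of_not_writesA h.1 σ
    · exact run_A_of_not_writesA h.2 σ
  | loop v c, h, σ => by
    simp only [writesA] at h
    have key : ∀ k, (iterate c.run v σ k).A x = σ.A x := by
      intro k
      induction k with
      | zero => simp [iterate, Store.setI]
      | succ k ih => simp [iterate, Store.setI, run_A_of_not_writesA h, ih]
    exact key _

theorem iterate_I_self (f : Store → Store) (v : ℕ) (σ : Store) (k : ℕ) :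
    (iterate f v σ k).I v = k := by
  cases k <;> simp [iterate, Store.setI]

theorem iterate_I_zero {c : Cmd} {v : ℕ} (h : (Cmd.loop v c).writesI 0 = false) (σ : Store)
    (k : ℕ) : (iterate c.run v σ k).I 0 = σ.I 0 := by
  simp only [Cmd.writesI, Bool.or_eq_false_iff, beq_eq_false_iff_ne] at h
  induction k with
  | zero => simp [iterate, Store.setI, Function.update_of_ne h.1.symm]
  | succ k ih =>
    simp [iterate, Store.setI, Function.update_of_ne h.1.symm, Cmd.run_I_of_not_writesI h.2, ih]

/-! ### Compilation

Index variable `v` lives in index register `2 * v`, real variable `v` in real register `2 * v`;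
the registers with odd names hold intermediate results. -/

/-- Code that computes an index expression into temporary register `t`. -/
def IExpr.code : IExpr → ℕ → List Instr
  -- There is no instruction that moves a register, so a variable is copied by adding a zero held in
  -- the next temporary register.
  | var v, t => [.iconst (2 * t + 3) 0, .iadd (2 * t + 1) (2 * v) (2 * t + 3)]
  | const m, t => [.iconst (2 * t + 1) m]
  | add a b, t => a.code t ++ (b.code (t + 1) ++ [.iadd (2 * t + 1) (2 * t + 1) (2 * t + 3)])
  | sub a b, t => a.code t ++ (b.code (t + 1) ++ [.isub (2 * t + 1) (2 * t + 1) (2 * t + 3)])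

/-- Code that turns index `j` in temporary register `t` into the address of entry `j` of
array `a`. -/
def addressCode (a : Fin 32) (t : ℕ) : List Instr :=
  let dbl : Instr := .iadd (2 * t + 1) (2 * t + 1) (2 * t + 1)
  [dbl, dbl, dbl, dbl, dbl, .iconst (2 * t + 3) a.val, .iadd (2 * t + 1) (2 * t + 1) (2 * t + 3)]

/-- Code, placed at position `o`, that computes a real expression into temporary register `t`. -/
def RExpr.code : RExpr → ℕ → ℕ → List Instr
  | var v, _, t => [.rconst (2 * t + 3) 0, .radd (2 * t + 1) (2 * v) (2 * t + 3)]
  | const q, _, t => [.rconst (2 * t + 1) q]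
  | add a b, o, t => let l := a.code o t
    l ++ (b.code (o + l.length) (t + 1) ++ [.radd (2 * t + 1) (2 * t + 1) (2 * t + 3)])
  | sub a b, o, t => let l := a.code o t
    l ++ (b.code (o + l.length) (t + 1) ++ [.rsub (2 * t + 1) (2 * t + 1) (2 * t + 3)])
  | mul a b, o, t => let l := a.code o t
    l ++ (b.code (o + l.length) (t + 1) ++ [.rmul (2 * t + 1) (2 * t + 1) (2 * t + 3)])
  | div a b, o, t => let l := a.code o t
    l ++ (b.code (o + l.length) (t + 1) ++ [.rdiv (2 * t + 1) (2 * t + 1) (2 * t + 3)])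
  | max a b, o, t => let l := a.code o t
    let l' := b.code (o + l.length) (t + 1)
    l ++ (l' ++ [.jumpRLe (2 * t + 3) (2 * t + 1) (o + l.length + l'.length + 3),
      .rsub (2 * t + 1) (2 * t + 1) (2 * t + 1), .radd (2 * t + 1) (2 * t + 1) (2 * t + 3)])
  | min a b, o, t => let l := a.code o t
    let l' := b.code (o + l.length) (t + 1)
    l ++ (l' ++ [.jumpRLe (2 * t + 1) (2 * t + 3) (o + l.length + l'.length + 3),
      .rsub (2 * t + 1) (2 * t + 1) (2 * t + 1), .radd (2 * t + 1) (2 * t + 1) (2 * t + 3)])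
  | arr a e, _, t => e.code t ++ (addressCode a t ++ [.rload (2 * t + 1) (2 * t + 1)])
  | cell e, _, t => e.code t ++ [.rload (2 * t + 1) (2 * t + 1)]

/-- Code, placed at position `o`, that computes the truth value (`1` or `0`) of a condition into
temporary index register `t`. -/
def BExpr.code : BExpr → ℕ → ℕ → List Instr
  | ile a b, o, t => let l := a.code t
    let l' := b.code (t + 1)
    l ++ (l' ++ [.jumpILe (2 * t + 1) (2 * t + 3) (o + l.length + l'.length + 3),
      .iconst (2 * t + 1) 0, .jump (o + l.length + l'.length + 4), .iconst (2 * t + 1) 1])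
  | rle a b, o, t => let l := a.code o t
    let l' := b.code (o + l.length) (t + 1)
    l ++ (l' ++ [.jumpRLe (2 * t + 1) (2 * t + 3) (o + l.length + l'.length + 3),
      .iconst (2 * t + 1) 0, .jump (o + l.length + l'.length + 4), .iconst (2 * t + 1) 1])
  | and a b, o, t => let l := a.code o t
    l ++ (b.code (o + l.length) (t + 1) ++ [.iadd (2 * t + 1) (2 * t + 1) (2 * t + 3),
      .iconst (2 * t + 3) 1, .isub (2 * t + 1) (2 * t + 1) (2 * t + 3)])
  | not a, o, t => a.code o t ++
      [.iconst (2 * t + 3) 1, .isub (2 * t + 1) (2 * t + 3) (2 * t + 1)]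

/-- Code, placed at position `o`, for a command. -/
def Cmd.code : Cmd → ℕ → List Instr
  | skip, _ => []
  | iset v e, _ => e.code 0 ++ [.iconst 3 0, .iadd (2 * v) 1 3]
  | rset v e, o => e.code o 0 ++ [.rconst 3 0, .radd (2 * v) 1 3]
  | store a idx e, o => let l := idx.code 0
    l ++ (addressCode a 0 ++ (e.code (o + l.length + 7) 1 ++ [.rstore 1 3]))
  | seq c₁ c₂, o => let l := c₁.code o
    l ++ c₂.code (o + l.length)
  | ite b c₁ c₂, o => let l := b.code o 0
    let l₂ := c₂.code (o + l.length + 2)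
    let l₁ := c₁.code (o + l.length + 2 + l₂.length + 1)
    l ++ ([.iconst 3 1, .jumpILe 3 1 (o + l.length + 2 + l₂.length + 1)] ++
      (l₂ ++ ([.jump (o + l.length + 2 + l₂.length + 1 + l₁.length)] ++ l₁)))
  -- The bound 2N + 5 is held in a temporary register that the body may overwrite. Every round
  -- therefore jumps back to position `o + 1`, where the bound is computed anew.
  | loop v c, o => let l := c.code (o + 5)
    [.iconst (2 * v) 0, .iconst 1 5, .iadd 1 1 0, .iadd 1 1 0,
      .jumpILe 1 (2 * v) (o + 5 + l.length + 3)] ++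
      (l ++ [.iconst 1 1, .iadd (2 * v) (2 * v) 1, .jump (o + 1)])

/-- A bound for the running time of a command whose loops have at most `m` rounds. -/
def Cmd.cost (m : ℕ) : Cmd → ℕ
  | skip => 0
  | iset v e => (iset v e).code 0 |>.length
  | rset v e => (rset v e).code 0 |>.length
  | store a idx e => (store a idx e).code 0 |>.length
  | seq c₁ c₂ => c₁.cost m + c₂.cost m
  | ite b c₁ c₂ => (b.code 0 0).length + 3 + c₁.cost m + c₂.cost m
  -- A round spends four steps on the bound and the test and three on the increment and the jump.
  -- The initialization and the final test account for the five.
  | loop _ c => m * (c.cost m + 7) + 5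

/-! ### Correctness of the compilation -/

/-- The program `p` contains the code `l` at position `o`. -/
def CodeAt (p : Program) : ℕ → List Instr → Prop
  | _, [] => True
  | o, x :: l => p[o]? = some x ∧ CodeAt p (o + 1) l

theorem codeAt_append {p : Program} : ∀ {l l' : List Instr} {o : ℕ},
    CodeAt p o (l ++ l') ↔ CodeAt p o l ∧ CodeAt p (o + l.length) l'
  | [], l', o => by simp [CodeAt]
  | x :: l, l', o => by
    simp [CodeAt, codeAt_append (l := l), and_assoc, add_assoc, add_comm 1]

theorem codeAt_self_append (l₀ l l' : List Instr) : CodeAt (l₀ ++ l ++ l') l₀.length l := by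
  induction l generalizing l₀ with
  | nil => trivial
  | cons x l ih =>
    refine ⟨by simp, ?_⟩
    simpa using ih (l₀ ++ [x])

/-- The configuration `c` represents the store `σ`. -/
structure Sim (σ : Store) (c : Config) : Prop where
  I : ∀ v, c.ireg (2 * v) = σ.I v
  R : ∀ v, c.rreg (2 * v) = σ.R v
  A : ∀ x, c.rmem x = σ.A (Fin.ofNat 32 x) (x / 32)

/-- The program gets from `c` to `c'` in `k` steps. -/
def Runs (p : Program) (c : Config) (k : ℕ) (c' : Config) : Prop :=
  ∀ t f, HaltsIn p c' t f → HaltsIn p c (t + k) f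

/-- The program gets from `c` to `c'`, in at most `m` steps and with the program counter
increased by `len`, and does not change the temporary registers below `t`. -/
structure Exec (p : Program) (len m t : ℕ) (σ' : Store) (c c' : Config) : Prop where
  runs : ∃ k ≤ m, Runs p c k c'
  pc : c'.pc = c.pc + len
  sim : Sim σ' c'
  ireg : ∀ r < t, c'.ireg (2 * r + 1) = c.ireg (2 * r + 1)
  rreg : ∀ r < t, c'.rreg (2 * r + 1) = c.rreg (2 * r + 1)

theorem Runs.trans {p : Program} {c c' c'' : Config} {k k' : ℕ} (h : Runs p c k c')
    (h' : Runs p c' k' c'') : Runs p c (k + k') c'' := fun t f hf => by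
  have := h _ _ (h' _ _ hf)
  rwa [add_assoc, add_comm k' k] at this

theorem Runs.refl (p : Program) (c : Config) : Runs p c 0 c := fun _ _ h => h

theorem runs_one {p : Program} {c c' : Config} {i : Instr} (hi : p[c.pc]? = some i)
    (h : exec c i = some c') : Runs p c 1 c' := fun _ _ hf =>
  HaltsIn.next (by simp [step, hi, h]) hf

theorem Exec.trans {p : Program} {l l' m m' t t' : ℕ} {σ σ' : Store} {c c' c'' : Config}
    (h : Exec p l m t σ c c') (h' : Exec p l' m' t' σ' c' c'') (ht : t ≤ t') :
    Exec p (l + l') (m + m') t σ' c c'' := by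
  obtain ⟨⟨k, hk, hr⟩, hpc, hs, hi, hrr⟩ := h
  obtain ⟨⟨k', hk', hr'⟩, hpc', hs', hi', hrr'⟩ := h'
  exact ⟨⟨k + k', by omega, hr.trans hr'⟩, by omega, hs',
    fun r h => (hi' r (by omega)).trans (hi r h), fun r h => (hrr' r (by omega)).trans (hrr r h)⟩

theorem Exec.mono {p : Program} {l m m' t t' : ℕ} {σ : Store} {c c' : Config}
    (h : Exec p l m t σ c c') (hm : m ≤ m') (ht : t' ≤ t) : Exec p l m' t' σ c c' := by
  obtain ⟨⟨k, hk, hr⟩, hpc, hs, hi, hrr⟩ := h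
  exact ⟨⟨k, by omega, hr⟩, hpc, hs, fun r h => hi r (by omega), fun r h => hrr r (by omega)⟩

theorem Exec.refl {p : Program} {σ : Store} {c : Config} (h : Sim σ c) (t : ℕ) :
    Exec p 0 0 t σ c c :=
  ⟨⟨0, le_rfl, Runs.refl p c⟩, rfl, h, fun _ _ => rfl, fun _ _ => rfl⟩

theorem update_odd_two_mul {α : Type*} (f : ℕ → α) (r v : ℕ) (x : α) :
    Function.update f (2 * r + 1) x (2 * v) = f (2 * v) :=
  Function.update_of_ne (by omega) _ _

theorem update_odd_odd_of_lt {α : Type*} (f : ℕ → α) {r v : ℕ} (h : r < v) (x : α) :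
    Function.update f (2 * v + 1) x (2 * r + 1) = f (2 * r + 1) :=
  Function.update_of_ne (by omega) _ _

theorem exec_ireg {p : Program} {σ : Store} {c : Config} {i : Instr} {t r x : ℕ}
    (hs : Sim σ c) (hi : p[c.pc]? = some i) (htr : t ≤ r)
    (h : exec c i = some { c with pc := c.pc + 1, ireg := Function.update c.ireg (2 * r + 1) x }) :
    Exec p 1 1 t σ c { c with pc := c.pc + 1, ireg := Function.update c.ireg (2 * r + 1) x } :=
  ⟨⟨1, le_rfl, runs_one hi h⟩, rfl,
    ⟨fun v => by simp [update_odd_two_mul, hs.I], hs.R, hs.A⟩,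
    fun _ h => update_odd_odd_of_lt _ (h.trans_le htr) _, fun _ _ => rfl⟩

theorem exec_rreg {p : Program} {σ : Store} {c : Config} {i : Instr} {t r : ℕ} {x : ℝ}
    (hs : Sim σ c) (hi : p[c.pc]? = some i) (htr : t ≤ r)
    (h : exec c i = some { c with pc := c.pc + 1, rreg := Function.update c.rreg (2 * r + 1) x }) :
    Exec p 1 1 t σ c { c with pc := c.pc + 1, rreg := Function.update c.rreg (2 * r + 1) x } :=
  ⟨⟨1, le_rfl, runs_one hi h⟩, rfl,
    ⟨hs.I, fun v => by simp [update_odd_two_mul, hs.R], hs.A⟩,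
    fun _ _ => rfl, fun _ h => update_odd_odd_of_lt _ (h.trans_le htr) _⟩

/-- A step that only moves the program counter. -/
theorem exec_pc {p : Program} {σ : Store} {c : Config} {i : Instr} {l len t : ℕ}
    (hs : Sim σ c) (hi : p[c.pc]? = some i) (hl : l = c.pc + len)
    (h : exec c i = some { c with pc := l }) :
    Exec p len 1 t σ c { c with pc := l } :=
  ⟨⟨1, le_rfl, runs_one hi h⟩, hl, ⟨hs.I, hs.R, hs.A⟩, fun _ _ => rfl, fun _ _ => rfl⟩

/-- The second operand is computed in temporary register `t + 1`, and code for `t + 1` leaves the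
lower temporaries alone. This is why `Exec` records the preserved registers: the first operand
survives until the final instruction. -/
theorem IExpr.code_correct {p : Program} {σ : Store} : ∀ (e : IExpr) (t : ℕ) (c : Config),
    Sim σ c → CodeAt p c.pc (e.code t) →
    ∃ c', Exec p (e.code t).length (e.code t).length t σ c c' ∧ c'.ireg (2 * t + 1) = e.eval σ
  | var v, t, c, hs, hc => by
    obtain ⟨h0, h1, -⟩ := hc
    have e1 := exec_ireg (t := t) (r := t + 1) (x := 0) hs h0 (by omega) rfl
    have e2 := exec_ireg (t := t) (r := t) e1.sim h1 le_rfl rfl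
    refine ⟨_, e1.trans e2 le_rfl, ?_⟩
    have : ∀ x, Function.update c.ireg (2 * (t + 1) + 1) x (2 * t + 3) = x := fun x =>
      Function.update_self (2 * t + 3) x c.ireg
    simp [this, update_odd_two_mul, hs.I, eval]
  | const m, t, c, hs, hc => by
    obtain ⟨h0, -⟩ := hc
    have e1 := exec_ireg (t := t) (r := t) hs h0 le_rfl rfl
    exact ⟨_, e1, by simp [eval]⟩
  | add a b, t, c, hs, hc => by
    simp only [code, codeAt_append] at hc
    obtain ⟨ha, hb, h0, -⟩ := hc
    obtain ⟨c1, e1, v1⟩ := code_correct a t c hs ha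
    rw [← e1.pc] at hb h0
    obtain ⟨c2, e2, v2⟩ := code_correct b (t + 1) c1 e1.sim hb
    rw [← e2.pc] at h0
    have e3 := exec_ireg (t := t) (r := t) e2.sim h0 le_rfl rfl
    have e := (e1.trans e2 (by omega)).trans e3 le_rfl
    refine ⟨_, by simpa [code, add_assoc] using e, ?_⟩
    have h1 := e2.ireg t (by omega)
    rw [show 2 * (t + 1) + 1 = 2 * t + 3 by ring] at v2
    simp [h1, v1, v2, eval]
  | sub a b, t, c, hs, hc => by
    simp only [code, codeAt_append] at hc
    obtain ⟨ha, hb, h0, -⟩ := hc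
    obtain ⟨c1, e1, v1⟩ := code_correct a t c hs ha
    rw [← e1.pc] at hb h0
    obtain ⟨c2, e2, v2⟩ := code_correct b (t + 1) c1 e1.sim hb
    rw [← e2.pc] at h0
    have e3 := exec_ireg (t := t) (r := t) e2.sim h0 le_rfl rfl
    have e := (e1.trans e2 (by omega)).trans e3 le_rfl
    refine ⟨_, by simpa [code, add_assoc] using e, ?_⟩
    have h1 := e2.ireg t (by omega)
    rw [show 2 * (t + 1) + 1 = 2 * t + 3 by ring] at v2
    simp [h1, v1, v2, eval]

/-- Entry j of array a is memory cell 32 j + a, so that 32 unbounded arrays are interleaved. The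
machine does not multiply indices, and the factor 32 comes from five doublings. -/
theorem addressCode_correct {p : Program} {σ : Store} (a : Fin 32) (t : ℕ) (c : Config)
    (hs : Sim σ c) (hc : CodeAt p c.pc (addressCode a t)) :
    ∃ c', Exec p 7 7 t σ c c' ∧ c'.ireg (2 * t + 1) = 32 * c.ireg (2 * t + 1) + a.val ∧
      c'.rreg = c.rreg := by
  obtain ⟨h0, h1, h2, h3, h4, h5, h6, -⟩ := hc
  have e0 := exec_ireg (t := t) (r := t) hs h0 le_rfl rfl
  have e1 := exec_ireg (t := t) (r := t) e0.sim h1 le_rfl rfl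
  have e2 := exec_ireg (t := t) (r := t) e1.sim h2 le_rfl rfl
  have e3 := exec_ireg (t := t) (r := t) e2.sim h3 le_rfl rfl
  have e4 := exec_ireg (t := t) (r := t) e3.sim h4 le_rfl rfl
  have e5 := exec_ireg (t := t) (r := t + 1) (x := a.val) e4.sim h5 (by omega) rfl
  have e6 := exec_ireg (t := t) (r := t) e5.sim h6 le_rfl rfl
  refine ⟨_, (((((e0.trans e1 le_rfl).trans e2 le_rfl).trans e3 le_rfl).trans e4 le_rfl).trans e5
    le_rfl).trans e6 le_rfl, ?_, rfl⟩
  have : ∀ (f : ℕ → ℕ) x, Function.update f (2 * (t + 1) + 1) x (2 * t + 3) = x := fun f x =>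
      Function.update_self (2 * t + 3) x f
  simp [this]
  ring

/-- The cost of a command is read off its code at position 0, whereas the code that runs is placed
elsewhere and uses other temporaries. The two have the same length. -/
theorem IExpr.length_code : ∀ (e : IExpr) (t t' : ℕ),
    (e.code t).length = (e.code t').length := by
  intro e
  induction e with
  | var v => intros; rfl
  | const m => intros; rfl
  | add a b iha ihb | sub a b iha ihb =>
    intro t t'; simp [IExpr.code, iha t t', ihb (t + 1) (t' + 1)]

theorem RExpr.length_code : ∀ (e : RExpr) (o o' t t' : ℕ),
    (e.code o t).length = (e.code o' t').length := by
  intro e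
  induction e with
  | var v => intros; rfl
  | const m => intros; rfl
  | arr a e => intro o o' t t'; simp [code, IExpr.length_code e t t', addressCode]
  | cell e => intro o o' t t'; simp [code, IExpr.length_code e t t']
  | add a b iha ihb | sub a b iha ihb | mul a b iha ihb | div a b iha ihb | max a b iha ihb
  | min a b iha ihb =>
    intro o o' t t'
    simp only [code, List.length_append, List.length_cons, List.length_nil]
    rw [iha o o' t t', ihb _ (o' + (a.code o' t').length) (t + 1) (t' + 1)]

theorem RExpr.code_correct_binary {p : Program} {σ : Store} {a b e : RExpr} {t : ℕ} {c : Config}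
    {i : Instr} {f : ℝ → ℝ → ℝ}
    (hcode : e.code c.pc t = a.code c.pc t ++
      (b.code (c.pc + (a.code c.pc t).length) (t + 1) ++ [i]))
    (heval : e.eval σ = f (a.eval σ) (b.eval σ))
    (hi : ∀ c : Config, exec c i = some { c with
      pc := c.pc + 1
      rreg := Function.update c.rreg (2 * t + 1) (f (c.rreg (2 * t + 1)) (c.rreg (2 * t + 3))) })
    (iha : ∀ (t : ℕ) (c : Config), Sim σ c → CodeAt p c.pc (a.code c.pc t) →
      ∃ c', Exec p (a.code c.pc t).length (a.code c.pc t).length t σ c c' ∧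
        c'.rreg (2 * t + 1) = a.eval σ)
    (ihb : ∀ (t : ℕ) (c : Config), Sim σ c → CodeAt p c.pc (b.code c.pc t) →
      ∃ c', Exec p (b.code c.pc t).length (b.code c.pc t).length t σ c c' ∧
        c'.rreg (2 * t + 1) = b.eval σ)
    (hs : Sim σ c) (hc : CodeAt p c.pc (e.code c.pc t)) :
    ∃ c', Exec p (e.code c.pc t).length (e.code c.pc t).length t σ c c' ∧
      c'.rreg (2 * t + 1) = e.eval σ := by
  rw [hcode] at hc ⊢
  simp only [codeAt_append] at hc
  obtain ⟨ha, hb, h0, -⟩ := hc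
  obtain ⟨c1, e1, v1⟩ := iha t c hs ha
  rw [← e1.pc] at hb h0 ⊢
  obtain ⟨c2, e2, v2⟩ := ihb (t + 1) c1 e1.sim hb
  rw [← e2.pc] at h0
  have e3 := exec_rreg (t := t) (r := t) e2.sim h0 le_rfl (hi c2)
  have e := (e1.trans e2 (by omega)).trans e3 le_rfl
  refine ⟨_, by simpa [add_assoc] using e, ?_⟩
  have h1 := e2.rreg t (by omega)
  rw [show 2 * (t + 1) + 1 = 2 * t + 3 by ring] at v2
  simp [h1, v1, v2, heval]

/-- The compared registers `r` and `r'` are kept general: maximum and minimum share all of the code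
except for the order of the comparison. -/
theorem RExpr.code_correct_select {p : Program} {σ : Store} {a b e : RExpr} {t : ℕ} {c : Config}
    {r r' : ℕ}
    (hcode : e.code c.pc t = a.code c.pc t ++
      (b.code (c.pc + (a.code c.pc t).length) (t + 1) ++
        [.jumpRLe r r' (c.pc + (a.code c.pc t).length +
          (b.code (c.pc + (a.code c.pc t).length) (t + 1)).length + 3),
        .rsub (2 * t + 1) (2 * t + 1) (2 * t + 1), .radd (2 * t + 1) (2 * t + 1) (2 * t + 3)]))
    (heval : ∀ c' : Config, c'.rreg (2 * t + 1) = a.eval σ → c'.rreg (2 * t + 3) = b.eval σ →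
      (c'.rreg r ≤ c'.rreg r' → e.eval σ = a.eval σ) ∧
      (¬ c'.rreg r ≤ c'.rreg r' → e.eval σ = b.eval σ))
    (iha : ∀ (t : ℕ) (c : Config), Sim σ c → CodeAt p c.pc (a.code c.pc t) →
      ∃ c', Exec p (a.code c.pc t).length (a.code c.pc t).length t σ c c' ∧
        c'.rreg (2 * t + 1) = a.eval σ)
    (ihb : ∀ (t : ℕ) (c : Config), Sim σ c → CodeAt p c.pc (b.code c.pc t) →
      ∃ c', Exec p (b.code c.pc t).length (b.code c.pc t).length t σ c c' ∧
        c'.rreg (2 * t + 1) = b.eval σ)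
    (hs : Sim σ c) (hc : CodeAt p c.pc (e.code c.pc t)) :
    ∃ c', Exec p (e.code c.pc t).length (e.code c.pc t).length t σ c c' ∧
      c'.rreg (2 * t + 1) = e.eval σ := by
  rw [hcode] at hc ⊢
  simp only [codeAt_append] at hc
  obtain ⟨ha, hb, h0, h1, h2, -⟩ := hc
  obtain ⟨c1, e1, v1⟩ := iha t c hs ha
  rw [← e1.pc] at hb h0 h1 h2 ⊢
  obtain ⟨c2, e2, v2⟩ := ihb (t + 1) c1 e1.sim hb
  rw [← e2.pc] at h0 h1 h2
  have h3 := e2.rreg t (by omega)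
  rw [show 2 * (t + 1) + 1 = 2 * t + 3 by ring] at v2
  have hv := heval c2 (h3.trans v1) v2
  by_cases hle : c2.rreg r ≤ c2.rreg r'
  · have e3 := exec_pc (t := t) (len := 3) (l := c2.pc + 3) e2.sim h0 rfl (by simp [exec, hle])
    have e := (e1.trans e2 (by omega)).trans e3 le_rfl
    refine ⟨_, Exec.mono (by simpa [add_assoc] using e) (by simp) le_rfl, ?_⟩
    simp [h3, v1, hv.1 hle]
  · have e3 := exec_pc (t := t) (len := 1) (l := c2.pc + 1) e2.sim h0 rfl (by simp [exec, hle])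
    have e4 := exec_rreg (t := t) (r := t) e3.sim h1 le_rfl rfl
    have e5 := exec_rreg (t := t) (r := t) e4.sim h2 le_rfl rfl
    have e := (((e1.trans e2 (by omega)).trans e3 le_rfl).trans e4 le_rfl).trans e5 le_rfl
    refine ⟨_, by simpa [add_assoc] using e, ?_⟩
    simp [v2, hv.2 hle]

theorem RExpr.code_correct {p : Program} {σ : Store} : ∀ (e : RExpr) (t : ℕ) (c : Config),
    Sim σ c → CodeAt p c.pc (e.code c.pc t) →
    ∃ c', Exec p (e.code c.pc t).length (e.code c.pc t).length t σ c c' ∧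
      c'.rreg (2 * t + 1) = e.eval σ
  | var v, t, c, hs, hc => by
    obtain ⟨h0, h1, -⟩ := hc
    have e1 := exec_rreg (t := t) (r := t + 1) (x := ((0 : ℚ) : ℝ)) hs h0 (by omega) rfl
    have e2 := exec_rreg (t := t) (r := t) e1.sim h1 le_rfl rfl
    refine ⟨_, e1.trans e2 le_rfl, ?_⟩
    have : ∀ x, Function.update c.rreg (2 * (t + 1) + 1) x (2 * t + 3) = x := fun x =>
      Function.update_self (2 * t + 3) x c.rreg
    simp [this, update_odd_two_mul, hs.R, eval]
  | const q, t, c, hs, hc => by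
    obtain ⟨h0, -⟩ := hc
    have e1 := exec_rreg (t := t) (r := t) hs h0 le_rfl rfl
    exact ⟨_, e1, by simp [eval]⟩
  | add a b, t, c, hs, hc => code_correct_binary (f := fun x y => x + y) rfl rfl (fun _ => rfl)
      (code_correct a) (code_correct b) hs hc
  | sub a b, t, c, hs, hc => code_correct_binary (f := fun x y => x - y) rfl rfl (fun _ => rfl)
      (code_correct a) (code_correct b) hs hc
  | mul a b, t, c, hs, hc => code_correct_binary (f := fun x y => x * y) rfl rfl (fun _ => rfl)
      (code_correct a) (code_correct b) hs hc
  | div a b, t, c, hs, hc => code_correct_binary (f := fun x y => x / y) rfl rfl (fun _ => rfl)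
      (code_correct a) (code_correct b) hs hc
  | max a b, t, c, hs, hc => by
    refine code_correct_select rfl (fun c' h h' => ?_) (code_correct a) (code_correct b) hs hc
    rw [h, h']
    exact ⟨fun h => max_eq_left h, fun h => max_eq_right (le_of_not_ge h)⟩
  | min a b, t, c, hs, hc => by
    refine code_correct_select rfl (fun c' h h' => ?_) (code_correct a) (code_correct b) hs hc
    rw [h, h']
    exact ⟨fun h => min_eq_left h, fun h => min_eq_right (le_of_not_ge h)⟩
  | arr a e, t, c, hs, hc => by
    simp only [code, codeAt_append] at hc
    obtain ⟨ha, hb, h0, -⟩ := hc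
    obtain ⟨c1, e1, v1⟩ := e.code_correct t c hs ha
    rw [← e1.pc] at hb h0
    obtain ⟨c2, e2, v2, -⟩ := addressCode_correct a t c1 e1.sim hb
    have h0 : p[c2.pc]? = some (.rload (2 * t + 1) (2 * t + 1)) := by rw [e2.pc]; exact h0
    have e3 := exec_rreg (t := t) (r := t) e2.sim h0 le_rfl rfl
    have e4 := (e1.trans e2 (by omega)).trans e3 le_rfl
    refine ⟨_, by simpa [code, add_assoc, addressCode] using e4, ?_⟩
    have ha := a.isLt
    have h1 : Fin.ofNat 32 (32 * e.eval σ + a.val) = a := by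
      apply Fin.ext; simp only [Fin.ofNat]; omega
    have h2 : (32 * e.eval σ + a.val) / 32 = e.eval σ := by omega
    simp only [Function.update_self, v2, v1, e2.sim.A, h1, h2, eval]
  | cell e, t, c, hs, hc => by
    simp only [code, codeAt_append] at hc
    obtain ⟨ha, h0, -⟩ := hc
    obtain ⟨c1, e1, v1⟩ := e.code_correct t c hs ha
    rw [← e1.pc] at h0
    have e3 := exec_rreg (t := t) (r := t) e1.sim h0 le_rfl rfl
    have e4 := e1.trans e3 le_rfl
    refine ⟨_, by simpa [code, add_assoc] using e4, ?_⟩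
    simp only [Function.update_self, v1, e1.sim.A, eval]

end RealRAM

/-! ### Compiled conditions and commands, and their running time -/

namespace RealRAM

theorem BExpr.length_code : ∀ (e : BExpr) (o o' t t' : ℕ),
    (e.code o t).length = (e.code o' t').length := by
  intro e
  induction e with
  | ile a b =>
    intro o o' t t'
    simp [code, IExpr.length_code a t t', IExpr.length_code b (t + 1) (t' + 1)]
  | rle a b =>
    intro o o' t t'
    simp only [code, List.length_append, List.length_cons, List.length_nil]
    rw [RExpr.length_code a o o' t t',
      RExpr.length_code b _ (o' + (a.code o' t').length) (t + 1) (t' + 1)]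
  | and a b iha ihb =>
    intro o o' t t'
    simp only [code, List.length_append, List.length_cons, List.length_nil]
    rw [iha o o' t t', ihb _ (o' + (a.code o' t').length) (t + 1) (t' + 1)]
  | not a iha => intro o o' t t'; simp [code, iha o o' t t']

open Classical in
theorem BExpr.code_correct_compare {p : Program} {σ : Store} {e : BExpr} {t len : ℕ}
    {c c2 : Config} {i : Instr}
    (e2 : Exec p len len t σ c c2)
    (h0 : p[c2.pc]? = some i) (h1 : p[c2.pc + 1]? = some (.iconst (2 * t + 1) 0))
    (h2 : p[c2.pc + 2]? = some (.jump (c2.pc + 4)))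
    (h3 : p[c2.pc + 3]? = some (.iconst (2 * t + 1) 1))
    (hi : e.eval σ → exec c2 i = some { c2 with pc := c2.pc + 3 })
    (hi' : ¬ e.eval σ → exec c2 i = some { c2 with pc := c2.pc + 1 }) :
    ∃ c', Exec p (len + 4) (len + 4) t σ c c' ∧
      c'.ireg (2 * t + 1) = if e.eval σ then 1 else 0 := by
  by_cases hle : e.eval σ
  · have e3 := exec_pc (t := t) (len := 3) (l := c2.pc + 3) e2.sim h0 rfl (hi hle)
    have e4 := exec_ireg (t := t) (r := t) e3.sim h3 le_rfl rfl
    have e := (e2.trans e3 le_rfl).trans e4 le_rfl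
    exact ⟨_, Exec.mono e (by omega) le_rfl, by simp [hle]⟩
  · have e3 := exec_pc (t := t) (len := 1) (l := c2.pc + 1) e2.sim h0 rfl (hi' hle)
    have e4 := exec_ireg (t := t) (r := t) e3.sim h1 le_rfl rfl
    have e5 := exec_pc (t := t) (len := 2) (l := c2.pc + 4) e4.sim h2 rfl rfl
    have e := ((e2.trans e3 le_rfl).trans e4 le_rfl).trans e5 le_rfl
    exact ⟨_, Exec.mono e (by omega) le_rfl, by simp [hle]⟩

open Classical in
theorem BExpr.code_correct {p : Program} {σ : Store} : ∀ (e : BExpr) (t : ℕ) (c : Config),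
    Sim σ c → CodeAt p c.pc (e.code c.pc t) →
    ∃ c', Exec p (e.code c.pc t).length (e.code c.pc t).length t σ c c' ∧
      c'.ireg (2 * t + 1) = if e.eval σ then 1 else 0
  | ile a b, t, c, hs, hc => by
    simp only [code, codeAt_append] at hc
    obtain ⟨ha, hb, h0, h1, h2, h3, -⟩ := hc
    obtain ⟨c1, e1, v1⟩ := a.code_correct t c hs ha
    rw [← e1.pc] at hb h0 h1 h2 h3
    obtain ⟨c2, e2, v2⟩ := b.code_correct (t + 1) c1 e1.sim hb
    rw [← e2.pc] at h0 h1 h2 h3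
    have h4 := e2.ireg t (by omega)
    rw [show 2 * (t + 1) + 1 = 2 * t + 3 by ring] at v2
    obtain ⟨c', h⟩ := code_correct_compare (e := ile a b) (e1.trans e2 (by omega)) h0 h1 h2 h3
      (fun h => by simp [exec, h4, v1, v2, show a.eval σ ≤ b.eval σ from h]) (fun h => by
        simp only [eval] at h; simp [exec, h4, v1, v2, h])
    exact ⟨c', by simpa [code, add_assoc] using h⟩
  | rle a b, t, c, hs, hc => by
    simp only [code, codeAt_append] at hc
    obtain ⟨ha, hb, h0, h1, h2, h3, -⟩ := hc
    obtain ⟨c1, e1, v1⟩ := a.code_correct t c hs ha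
    rw [← e1.pc] at hb h0 h1 h2 h3
    obtain ⟨c2, e2, v2⟩ := b.code_correct (t + 1) c1 e1.sim hb
    rw [← e2.pc] at h0 h1 h2 h3
    have h4 := e2.rreg t (by omega)
    rw [show 2 * (t + 1) + 1 = 2 * t + 3 by ring] at v2
    obtain ⟨c', h⟩ := code_correct_compare (e := rle a b) (e1.trans e2 (by omega)) h0 h1 h2 h3
      (fun h => by simp [exec, h4, v1, v2, show a.eval σ ≤ b.eval σ from h]) (fun h => by
        simp only [eval] at h; simp [exec, h4, v1, v2, h])
    rw [e1.pc] at h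
    exact ⟨c', by simpa [code, add_assoc] using h⟩
  | and a b, t, c, hs, hc => by
    simp only [code, codeAt_append] at hc
    obtain ⟨ha, hb, h0, h1, h2, -⟩ := hc
    obtain ⟨c1, e1, v1⟩ := code_correct a t c hs ha
    rw [← e1.pc] at hb h0 h1 h2
    obtain ⟨c2, e2, v2⟩ := code_correct b (t + 1) c1 e1.sim hb
    rw [← e2.pc] at h0 h1 h2
    have h4 := e2.ireg t (by omega)
    rw [show 2 * (t + 1) + 1 = 2 * t + 3 by ring] at v2
    have e3 := exec_ireg (t := t) (r := t) e2.sim h0 le_rfl rfl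
    have e4 := exec_ireg (t := t) (r := t + 1) (x := 1) e3.sim h1 (by omega) rfl
    have e5 := exec_ireg (t := t) (r := t) e4.sim h2 le_rfl rfl
    have e := (((e1.trans e2 (by omega)).trans e3 le_rfl).trans e4 le_rfl).trans e5 le_rfl
    rw [e1.pc] at e
    refine ⟨_, by simpa [code, add_assoc] using e, ?_⟩
    have : ∀ (f : ℕ → ℕ) x, Function.update f (2 * (t + 1) + 1) x (2 * t + 3) = x := fun f x =>
      Function.update_self (2 * t + 3) x f
    by_cases p1 : a.eval σ <;> by_cases p2 : b.eval σ <;>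
      simp [this, eval, h4, v1, v2, p1, p2]
  | not a, t, c, hs, hc => by
    simp only [code, codeAt_append] at hc
    obtain ⟨ha, h1, h2, -⟩ := hc
    obtain ⟨c1, e1, v1⟩ := code_correct a t c hs ha
    rw [← e1.pc] at h1 h2
    have e4 := exec_ireg (t := t) (r := t + 1) (x := 1) e1.sim h1 (by omega) rfl
    have e5 := exec_ireg (t := t) (r := t) e4.sim h2 le_rfl rfl
    have e := (e1.trans e4 le_rfl).trans e5 le_rfl
    refine ⟨_, by simpa [code, add_assoc] using e, ?_⟩
    have : ∀ (f : ℕ → ℕ) x, Function.update f (2 * (t + 1) + 1) x (2 * t + 3) = x := fun f x =>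
      Function.update_self (2 * t + 3) x f
    by_cases p1 : a.eval σ <;> simp [this, eval, v1, p1]

theorem exec_ireg_var {p : Program} {σ : Store} {c : Config} {i : Instr} {v x : ℕ}
    (hs : Sim σ c) (hi : p[c.pc]? = some i)
    (h : exec c i = some { c with pc := c.pc + 1, ireg := Function.update c.ireg (2 * v) x }) :
    Exec p 1 1 0 (σ.setI v x) c
      { c with pc := c.pc + 1, ireg := Function.update c.ireg (2 * v) x } := by
  refine ⟨⟨1, le_rfl, runs_one hi h⟩, rfl, ⟨fun w => ?_, hs.R, hs.A⟩,
    fun _ h => absurd h (Nat.not_lt_zero _), fun _ h => absurd h (Nat.not_lt_zero _)⟩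
  by_cases hw : w = v
  · subst hw; simp [Store.setI]
  · simp [Store.setI, Function.update_of_ne hw,
      Function.update_of_ne (show 2 * w ≠ 2 * v by omega), hs.I]

theorem exec_rreg_var {p : Program} {σ : Store} {c : Config} {i : Instr} {v : ℕ} {x : ℝ}
    (hs : Sim σ c) (hi : p[c.pc]? = some i)
    (h : exec c i = some { c with pc := c.pc + 1, rreg := Function.update c.rreg (2 * v) x }) :
    Exec p 1 1 0 (σ.setR v x) c
      { c with pc := c.pc + 1, rreg := Function.update c.rreg (2 * v) x } := by
  refine ⟨⟨1, le_rfl, runs_one hi h⟩, rfl, ⟨hs.I, fun w => ?_, hs.A⟩,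
    fun _ h => absurd h (Nat.not_lt_zero _), fun _ h => absurd h (Nat.not_lt_zero _)⟩
  by_cases hw : w = v
  · subst hw; simp [Store.setR]
  · simp [Store.setR, Function.update_of_ne hw,
      Function.update_of_ne (show 2 * w ≠ 2 * v by omega), hs.R]

/-- Structural induction on the command. That index variable 0 is never written keeps the number of
rounds the same for every loop, so that one bound `σ.rounds` serves all nested costs; that bodies do
not write their loop variable makes the compiled counter agree with `iterate`. -/
theorem Cmd.code_correct {p : Program} : ∀ (cmd : Cmd) (σ : Store) (c : Config),
    cmd.loopsOK = true → cmd.writesI 0 = false → Sim σ c → CodeAt p c.pc (cmd.code c.pc) →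
    ∃ c', Exec p (cmd.code c.pc).length (cmd.cost σ.rounds) 0 (cmd.run σ) c c'
  | skip, σ, c, _, _, hs, _ => ⟨c, Exec.refl hs 0⟩
  | iset v e, σ, c, _, _, hs, hc => by
    simp only [code, codeAt_append] at hc
    obtain ⟨ha, h1, h2, -⟩ := hc
    obtain ⟨c1, e1, v1⟩ := e.code_correct 0 c hs ha
    rw [← e1.pc] at h1 h2
    have e4 := exec_ireg (t := 0) (r := 1) (x := 0) e1.sim h1 (by omega) rfl
    have e5 := exec_ireg_var (v := v) (x := e.eval σ) e4.sim h2 (by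
      simp only [exec, mul_zero, zero_add] at v1 ⊢
      simp [v1])
    have e6 := (e1.trans e4 le_rfl).trans e5 le_rfl
    exact ⟨_, by simpa [code, run, cost, add_assoc] using e6⟩
  | rset v e, σ, c, _, _, hs, hc => by
    simp only [code, codeAt_append] at hc
    obtain ⟨ha, h1, h2, -⟩ := hc
    obtain ⟨c1, e1, v1⟩ := e.code_correct 0 c hs ha
    rw [← e1.pc] at h1 h2
    have e4 := exec_rreg (t := 0) (r := 1) (x := ((0 : ℚ) : ℝ)) e1.sim h1 (by omega) rfl
    simp only [mul_zero, zero_add] at v1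
    have e5 := exec_rreg_var (v := v) (x := e.eval σ) e4.sim h2 (by simp [exec, v1])
    have e6 := (e1.trans e4 le_rfl).trans e5 le_rfl
    exact ⟨_, by simpa [code, run, cost, add_assoc, RExpr.length_code e 0 c.pc 0 0] using e6⟩
  | store a idx e, σ, c, _, _, hs, hc => by
    simp only [code, codeAt_append] at hc
    obtain ⟨ha, hb, h1, h2, -⟩ := hc
    obtain ⟨c1, e1, v1⟩ := idx.code_correct 0 c hs ha
    rw [← e1.pc] at hb h1 h2
    obtain ⟨c2, e2, v2, -⟩ := addressCode_correct a 0 c1 e1.sim hb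
    have hl7 : (addressCode a 0).length = 7 := rfl
    rw [hl7, ← e2.pc] at h1 h2
    obtain ⟨c3, e3, v3⟩ := e.code_correct 1 c2 e2.sim (by simpa [e2.pc, e1.pc] using h1)
    have h2 : p[c3.pc]? = some (.rstore 1 3) := by
      rw [e3.pc]; exact h2
    have hi3 := e3.ireg 0 one_pos
    simp only [mul_zero, zero_add, mul_one] at v1 v2 v3 hi3
    have hal := a.isLt
    have e4 : Exec p 1 1 0 (σ.setA a (idx.eval σ) (e.eval σ)) _ _ :=
      ⟨⟨1, le_rfl, runs_one h2 rfl⟩, rfl, ⟨e3.sim.I, e3.sim.R, fun x => ?_⟩,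
        fun _ h => absurd h (Nat.not_lt_zero _), fun _ h => absurd h (Nat.not_lt_zero _)⟩
    · have e4 := ((e1.trans e2 le_rfl).trans e3 (Nat.zero_le _)).trans e4 le_rfl
      refine ⟨{ c3 with
        pc := c3.pc + 1, rmem := Function.update c3.rmem (c3.ireg 1) (c3.rreg 3) }, ?_⟩
      have h7 : ((store a idx e).code c.pc).length =
          (idx.code 0).length + 7 + (e.code c2.pc 1).length + 1 := by
        simp [code, addressCode, RExpr.length_code e _ c2.pc 1 1]; omega
      have h8 : (store a idx e).cost σ.rounds =
          (idx.code 0).length + 7 + (e.code c2.pc 1).length + 1 := by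
        simp [cost, code, addressCode, RExpr.length_code e _ c2.pc 1 1]; omega
      rw [h7, h8]
      exact e4
    · have hA := e3.sim.A x
      simp only [Store.setA, v3, hi3, v2, v1]
      by_cases hx : x = 32 * idx.eval σ + a.val
      · have h1 : Fin.ofNat 32 x = a := by
          apply Fin.ext; simp only [Fin.ofNat]; omega
        have h2 : x / 32 = idx.eval σ := by omega
        rw [h1, h2]; simp [hx]
      · rw [Function.update_of_ne hx, hA]
        by_cases h1 : Fin.ofNat 32 x = a
        · have h2 : x / 32 ≠ idx.eval σ := by
            intro h
            have : x % 32 = a.val := by rw [← h1]; rfl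
            omega
          rw [h1]; simp [Function.update_of_ne h2]
        · rw [Function.update_of_ne h1]
  | seq c₁ c₂, σ, c, ho, hw, hs, hc => by
    simp only [code, codeAt_append] at hc
    simp only [loopsOK, Bool.and_eq_true] at ho
    simp only [writesI, Bool.or_eq_false_iff] at hw
    obtain ⟨ha, hb⟩ := hc
    obtain ⟨d1, e1⟩ := code_correct c₁ σ c ho.1 hw.1 hs ha
    rw [← e1.pc] at hb
    obtain ⟨d2, e2⟩ := code_correct c₂ _ d1 ho.2 hw.2 e1.sim hb
    have hr : (c₁.run σ).rounds = σ.rounds := by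
      simp [Store.rounds, run_I_of_not_writesI hw.1]
    rw [hr, e1.pc] at e2
    exact ⟨d2, by simpa [code, run, cost] using e1.trans e2 le_rfl⟩
  | ite b c₁ c₂, σ, c, ho, hw, hs, hc => by
    simp only [code, codeAt_append] at hc
    simp only [loopsOK, Bool.and_eq_true] at ho
    simp only [writesI, Bool.or_eq_false_iff] at hw
    obtain ⟨ha, ⟨h1, h2, -⟩, hc2, ⟨h3, -⟩, hc1⟩ := hc
    obtain ⟨d1, e1, v1⟩ := b.code_correct 0 c hs ha
    have hl := BExpr.length_code b c.pc 0 0 0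
    have e2 := exec_ireg (t := 0) (r := 1) (x := 1) e1.sim (by rw [e1.pc]; exact h1) (by omega) rfl
    have e2pc := e2.pc
    simp only [mul_zero, zero_add] at v1
    simp only [List.length_cons, List.length_nil, zero_add] at hc1 hc2 h3
    set B := b.code c.pc 0 with hB
    set o₂ := c.pc + B.length + 2 with ho₂
    set l₂ := c₂.code o₂ with hl₂
    set o₁ := o₂ + l₂.length + 1 with ho₁
    set l₁ := c₁.code o₁ with hl₁
    have hlen : (Cmd.code (ite b c₁ c₂) c.pc).length = B.length + 3 + l₂.length + l₁.length := by
      simp only [code, ← hB, ← ho₂, ← hl₂, ← ho₁, ← hl₁, List.length_append, List.length_cons,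
        List.length_nil]
      omega
    rw [hlen]
    simp only [cost, ← hl, run]
    by_cases hb : b.eval σ
    · rw [if_pos hb] at v1 ⊢
      have e3 := exec_pc (t := 0) (len := l₂.length + 2) (l := o₁) e2.sim
        (by rw [e2pc, e1.pc]; exact h2) (by rw [e2pc, e1.pc]; omega) (by simp [exec, v1])
      obtain ⟨d4, e4⟩ := code_correct c₁ σ _ ho.1 hw.1 e3.sim
        (by convert hc1 using 1)
      have e := ((e1.trans e2 le_rfl).trans e3 le_rfl).trans e4 le_rfl
      refine ⟨d4, Exec.mono ?_ (m := B.length + 1 + 1 + c₁.cost σ.rounds) (by omega) le_rfl⟩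
      convert e using 1
      simp only [← hl₁]
      omega
    · rw [if_neg hb] at v1 ⊢
      have e3 := exec_pc (t := 0) (len := 1) (l := o₂) e2.sim
        (by rw [e2pc, e1.pc]; exact h2) (by rw [e2pc, e1.pc])
        (by simp [exec, v1, e1.pc, ho₂])
      obtain ⟨d4, e4⟩ := code_correct c₂ σ _ ho.2 hw.2 e3.sim
        (by convert hc2 using 1)
      have e4pc := e4.pc
      simp only [← hl₂] at e4 e4pc
      have e5 := exec_pc (t := 0) (len := l₁.length + 1) (l := o₁ + l₁.length) e4.sim
        (by rw [e4pc]; exact h3) (by rw [e4pc]; omega) rfl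
      have e := (((e1.trans e2 le_rfl).trans e3 le_rfl).trans e4 le_rfl).trans e5 le_rfl
      rw [show B.length + 3 + l₂.length + l₁.length =
        B.length + 1 + 1 + l₂.length + (l₁.length + 1) by omega]
      exact ⟨_, e.mono (by omega) le_rfl⟩
  | loop v body, σ, c, ho, hw, hs, hc => by
    have hw' := hw
    simp only [code, codeAt_append] at hc
    simp only [loopsOK, Bool.and_eq_true, Bool.not_eq_true'] at ho
    simp only [writesI, Bool.or_eq_false_iff, beq_eq_false_iff_ne] at hw
    obtain ⟨⟨h0, h1, h2, h3, h4, -⟩, hb, h5, h6, h7, -⟩ := hc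
    simp only [List.length_cons, List.length_nil, zero_add] at hb h5 h6 h7
    set o := c.pc with hpc
    set l := body.code (o + 5) with hl
    -- The test at the top of round `k`, which ends either behind the loop or at the start of the
    -- body.
    have head : ∀ k d, d.pc = o + 1 → Sim (iterate body.run v σ k) d →
        ∃ d', (∃ s ≤ 4, Runs p d s d') ∧ d'.pc = (if σ.rounds ≤ k then o + 5 + l.length + 3 else o +
          5) ∧
          Sim (iterate body.run v σ k) d' := by
      intro k d hd hsd
      have hI0 := iterate_I_zero hw' σ k
      have hIv := iterate_I_self body.run v σ k
      have e1 := exec_ireg (t := 0) (r := 0) (x := 5) hsd (by rw [hd]; exact h1) le_rfl rfl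
      have e2 := exec_ireg (t := 0) (r := 0) (x := 5 + σ.I 0) e1.sim
        (by rw [e1.pc, hd]; exact h2) le_rfl
        (by have := hsd.I 0; simp only [mul_zero] at this; simp [exec, this, hI0])
      have e3 := exec_ireg (t := 0) (r := 0) (x := σ.rounds) e2.sim
        (by rw [e2.pc, e1.pc, hd]; exact h3) le_rfl
        (by
          have := hsd.I 0
          simp only [mul_zero] at this
          simp [exec, this, hI0, Store.rounds]
          ring_nf)
      have hr := ((e1.trans e2 le_rfl).trans e3 le_rfl)
      have hv := hsd.I v
      have h1 : 2 * v ≠ 1 := by omega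
      by_cases hk : σ.rounds ≤ k
      · have e4 := exec_pc (t := 0) (l := o + 5 + l.length + 3) (len := l.length + 4) e3.sim
          (by rw [e3.pc, e2.pc, e1.pc, hd]; exact h4) (by rw [e3.pc, e2.pc, e1.pc, hd]; omega)
          (by simp [exec, hv, hIv, hk])
        rw [if_pos hk]
        exact ⟨_, (hr.trans e4 le_rfl).runs, rfl, e4.sim⟩
      · have e4 := exec_pc (t := 0) (l := o + 5) (len := 1) e3.sim
          (by rw [e3.pc, e2.pc, e1.pc, hd]; exact h4) (by rw [e3.pc, e2.pc, e1.pc, hd])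
          (by simp [exec, hv, hIv, hk, hd])
        rw [if_neg hk]
        exact ⟨_, (hr.trans e4 le_rfl).runs, rfl, e4.sim⟩
    -- Induction on the number `m` of rounds still to come; the store reached so far is described by
    -- `iterate` after `k` rounds.
    have key : ∀ m k d, k + m = σ.rounds → d.pc = o + 1 → Sim (iterate body.run v σ k) d →
        ∃ d', (∃ s ≤ m * (body.cost σ.rounds + 7) + 4, Runs p d s d') ∧
          d'.pc = o + 5 + l.length + 3 ∧ Sim (iterate body.run v σ σ.rounds) d' := by
      intro m
      induction m with
      | zero =>
        intro k d hk hd hsd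
        have test := head k d hd hsd
        rw [if_pos (by omega)] at test
        obtain ⟨d', hr, hpc', hsd'⟩ := test
        rw [add_zero] at hk
        exact ⟨d', hr.imp fun s h => ⟨by omega, h.2⟩, hpc', hk ▸ hsd'⟩
      | succ m ih =>
        intro k d hk hd hsd
        have test := head k d hd hsd
        rw [if_neg (by omega)] at test
        obtain ⟨d1, hr1, hpc1, hsd1⟩ := test
        obtain ⟨d2, e2⟩ := code_correct body _ d1 ho.2 hw.2 hsd1
          (by rw [hpc1]; exact hb)
        have e2pc := e2.pc
        rw [hpc1, ← hl] at e2pc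
        have e3 := exec_ireg (t := 0) (r := 0) (x := 1) e2.sim (by rw [e2pc]; exact h5) le_rfl rfl
        have hIv : (body.run (iterate body.run v σ k)).I v = k := by
          rw [run_I_of_not_writesI ho.1, iterate_I_self]
        obtain ⟨d4, e4⟩ : ∃ d4, Exec p 1 1 0 (iterate body.run v σ (k + 1)) _ d4 :=
          ⟨_, exec_ireg_var (v := v) (x := k + 1) e3.sim
          (by rw [e3.pc, e2pc]; exact h6) (by
            have := e2.sim.I v
            rw [hIv] at this
            simp [exec, this])⟩
        have hpc4 := e4.pc
        rw [e3.pc, e2pc] at hpc4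
        obtain ⟨s1, hs1, hr1⟩ := hr1
        obtain ⟨s2, hs2, hr2⟩ := ((e2.trans e3 le_rfl).trans e4 le_rfl).runs
        have hr3 : Runs p d4 1 { d4 with pc := o + 1 } :=
          runs_one (i := .jump (o + 1)) (by rw [hpc4]; exact h7) rfl
        have hrd : (iterate body.run v σ k).rounds = σ.rounds := by
          simp [Store.rounds, iterate_I_zero hw' σ k]
        rw [hrd] at hs2
        obtain ⟨d', ⟨s, hs', hr'⟩, hd'⟩ := ih (k + 1) { d4 with pc := o + 1 } (by omega) rfl
          ⟨e4.sim.I, e4.sim.R, e4.sim.A⟩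
        refine ⟨d', ⟨_, ?_, ((hr1.trans hr2).trans hr3).trans hr'⟩, hd'⟩
        rw [Nat.succ_mul]
        omega
    have e0 := exec_ireg_var (v := v) (x := 0) hs h0 rfl
    obtain ⟨d', ⟨s, hs1, hr⟩, hd, hsd⟩ := key σ.rounds 0 _ (zero_add _) e0.pc e0.sim
    obtain ⟨k, hk, hr0⟩ := e0.runs
    refine ⟨d', ⟨k + s, ?_, hr0.trans hr⟩, ?_, hsd,
      fun _ h => absurd h (Nat.not_lt_zero _), fun _ h => absurd h (Nat.not_lt_zero _)⟩
    · simp only [cost]; omega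
    · rw [hd]; simp [code, ← hl]; omega

/-- The nesting depth of the loops. -/
def Cmd.depth : Cmd → ℕ
  | seq c₁ c₂ => Nat.max c₁.depth c₂.depth
  | ite _ c₁ c₂ => Nat.max c₁.depth c₂.depth
  | loop _ c => c.depth + 1
  | _ => 0

/-- Each loop multiplies the cost by the number of rounds, up to an overhead that the constant
absorbs. The base is `m + 1` so that powers of it increase with the exponent even when `m = 0`. -/
theorem Cmd.exists_cost_le : ∀ c : Cmd, ∃ C : ℕ, ∀ m, c.cost m ≤ C * (m + 1) ^ c.depth
  | skip => ⟨0, fun m => by simp [cost]⟩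
  | iset v e => ⟨_, fun m => by simp only [cost, depth, pow_zero, mul_one]; exact le_rfl⟩
  | rset v e => ⟨_, fun m => by simp only [cost, depth, pow_zero, mul_one]; exact le_rfl⟩
  | store a i e => ⟨_, fun m => by simp only [cost, depth, pow_zero, mul_one]; exact le_rfl⟩
  | seq c₁ c₂ => by
    obtain ⟨C₁, h₁⟩ := exists_cost_le c₁
    obtain ⟨C₂, h₂⟩ := exists_cost_le c₂
    refine ⟨C₁ + C₂, fun m => ?_⟩
    have e₁ : (m + 1) ^ c₁.depth ≤ (m + 1) ^ (seq c₁ c₂).depth :=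
      Nat.pow_le_pow_right (by omega) (Nat.le_max_left _ _)
    have e₂ : (m + 1) ^ c₂.depth ≤ (m + 1) ^ (seq c₁ c₂).depth :=
      Nat.pow_le_pow_right (by omega) (Nat.le_max_right _ _)
    rw [add_mul]
    exact add_le_add ((h₁ m).trans (Nat.mul_le_mul_left _ e₁))
      ((h₂ m).trans (Nat.mul_le_mul_left _ e₂))
  | ite b c₁ c₂ => by
    obtain ⟨C₁, h₁⟩ := exists_cost_le c₁
    obtain ⟨C₂, h₂⟩ := exists_cost_le c₂
    refine ⟨(b.code 0 0).length + 3 + C₁ + C₂, fun m => ?_⟩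
    have e₁ : (m + 1) ^ c₁.depth ≤ (m + 1) ^ (ite b c₁ c₂).depth :=
      Nat.pow_le_pow_right (by omega) (Nat.le_max_left _ _)
    have e₂ : (m + 1) ^ c₂.depth ≤ (m + 1) ^ (ite b c₁ c₂).depth :=
      Nat.pow_le_pow_right (by omega) (Nat.le_max_right _ _)
    rw [add_mul, add_mul]
    exact add_le_add (add_le_add (Nat.le_mul_of_pos_right _ (by positivity))
      ((h₁ m).trans (Nat.mul_le_mul_left _ e₁))) ((h₂ m).trans (Nat.mul_le_mul_left _ e₂))
  | loop v c => by
    obtain ⟨C, h⟩ := exists_cost_le c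
    -- The 12 is 7 + 5: seven extra steps in every round and five outside the rounds.
    refine ⟨C + 12, fun m => ?_⟩
    have h1 := h m
    have h2 : 1 ≤ (m + 1) ^ c.depth := Nat.one_le_pow _ _ (by omega)
    simp only [cost, depth, pow_succ]
    nlinarith

/-- A command, followed by a copy of real variable `1` to real register `1`. -/
def Cmd.program (c : Cmd) : Program :=
  c.code 0 ++ [.rconst 1 0, .radd 1 1 2]

/-- Real variable 0 already lives in register 0, but variable 1 lives in register 2. Two more
instructions copy it to register 1, after which the program counter leaves the program. -/
theorem Cmd.program_correct {c : Cmd} {σ : Store} {cfg : Config} (ho : c.loopsOK = true)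
    (hw : c.writesI 0 = false) (hs : Sim σ cfg) (hpc : cfg.pc = 0) :
    ∃ t f, HaltsIn c.program cfg t f ∧ t ≤ c.cost σ.rounds + 2 ∧
      f.rreg 0 = (c.run σ).R 0 ∧ f.rreg 1 = (c.run σ).R 1 := by
  have hcode : CodeAt c.program cfg.pc (c.code cfg.pc) := by
    rw [hpc]
    exact codeAt_self_append [] (c.code 0) _
  obtain ⟨c1, e1⟩ := code_correct c σ cfg ho hw hs hcode
  have hpc1 : c1.pc = (c.code 0).length := by rw [e1.pc, hpc, zero_add]
  have e2 := exec_rreg (p := c.program) (t := 0) (r := 0) (x := ((0 : ℚ) : ℝ))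
    (i := .rconst 1 0) e1.sim (by simp [hpc1, program]) le_rfl rfl
  have e3 := exec_rreg (p := c.program) (t := 0) (r := 0) (x := (c.run σ).R 1)
    (i := .radd 1 1 2) e2.sim (by simp [hpc1, program]) le_rfl (by
      have := e1.sim.R 1
      simp only [mul_one] at this
      simp [exec, this])
  obtain ⟨k, hk, hr⟩ := ((e1.trans e2 le_rfl).trans e3 le_rfl).runs
  refine ⟨0 + k, _, hr 0 _ (HaltsIn.done ?_), by omega, ?_, ?_⟩
  · simp [step, hpc1, program]
  · have := e3.sim.R 0
    simpa using this
  · simp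

end RealRAM

/-! ## Evacuation times in closed form

Vertices are numbered `1, …, n + 1` and edges `1, …, n`, edge `k` joining vertices `k` and
`k + 1`. -/

/-- The extension of a finite sequence by `0`. -/
noncomputable def extend {m : ℕ} (f : Fin m → ℝ) (j : ℕ) : ℝ := if h : j < m then f ⟨j, h⟩ else 0

theorem extend_val {m : ℕ} (f : Fin m → ℝ) (i : Fin m) : extend f i = f i := by
  simp [extend]

/-- Partial sums. -/
noncomputable def partialSum (w : ℕ → ℝ) (k : ℕ) : ℝ := ∑ j ∈ Finset.range k, w j

theorem partialSum_zero (w : ℕ → ℝ) : partialSum w 0 = 0 := by simp [partialSum]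

theorem partialSum_succ (w : ℕ → ℝ) (k : ℕ) : partialSum w (k + 1) = partialSum w k + w k := by
  simp [partialSum, Finset.sum_range_succ]

theorem partialSum_nonneg {w : ℕ → ℝ} (h : ∀ j, 0 ≤ w j) (k : ℕ) : 0 ≤ partialSum w k :=
  Finset.sum_nonneg fun j _ => h j

/-- The least of the numbers `C l, …, C k`. -/
noncomputable def bottleneck (C : ℕ → ℝ) (k l : ℕ) : ℝ := (Finset.Icc l k).fold min (C l) C

theorem le_bottleneck {C : ℕ → ℝ} {k l : ℕ} (h : l ≤ k) {r : ℝ} :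
    r ≤ bottleneck C k l ↔ ∀ t, l ≤ t → t ≤ k → r ≤ C t := by
  simp only [bottleneck, Finset.le_fold_min, Finset.mem_Icc, and_imp]
  exact ⟨fun h => h.2, fun h' => ⟨h' l le_rfl h, h'⟩⟩

theorem bottleneck_le {C : ℕ → ℝ} {k l t : ℕ} (h : l ≤ t) (h' : t ≤ k) :
    bottleneck C k l ≤ C t :=
  (le_bottleneck (h.trans h')).1 le_rfl t h h'

theorem bottleneck_anti {C : ℕ → ℝ} {k l k' l' : ℕ} (h : l ≤ l') (h' : l' ≤ k') (h'' : k' ≤ k) :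
    bottleneck C k l ≤ bottleneck C k' l' :=
  (le_bottleneck h').2 fun _ ht ht' => bottleneck_le (h.trans ht) (ht'.trans h'')

theorem exists_bottleneck_eq (C : ℕ → ℝ) {k l : ℕ} (h : l ≤ k) :
    ∃ t, l ≤ t ∧ t ≤ k ∧ bottleneck C k l = C t := by
  obtain ⟨t, ht, hmin⟩ := Finset.exists_min_image (Finset.Icc l k) C ⟨l, by simp [h]⟩
  rw [Finset.mem_Icc] at ht
  exact ⟨t, ht.1, ht.2, le_antisymm (bottleneck_le ht.1 ht.2)
    ((le_bottleneck h).2 fun t' h1 h2 => hmin t' (by simp [h1, h2]))⟩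

theorem bottleneck_pos {C : ℕ → ℝ} {k l : ℕ} (h : l ≤ k) (hC : ∀ t, l ≤ t → t ≤ k → 0 < C t) :
    0 < bottleneck C k l := by
  obtain ⟨t, h1, h2, h3⟩ := exists_bottleneck_eq C h
  rw [h3]; exact hC t h1 h2

/-! ### Flows in terms of edge numbers, and the criterion for evacuation -/

namespace UncertainPath

variable {n : ℕ} (P : UncertainPath n)

/-- The location of vertex `k`. -/
noncomputable def loc (k : ℕ) : ℝ := partialSum (extend P.d) (k - 1)

/-- The capacity of edge `k`. -/
noncomputable def capac (k : ℕ) : ℝ := if k = 0 then 0 else extend P.c (k - 1)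

theorem loc_one : P.loc 1 = 0 := partialSum_zero _

theorem capac_pos {k : ℕ} (h : 1 ≤ k) (h' : k ≤ n) : 0 < P.capac k := by
  rw [capac, if_neg (by omega), extend, dif_pos (by omega)]
  exact P.c_pos _

theorem pos_eq (i : Fin (n + 1)) : P.pos i = P.loc (i + 1) := by
  have h : ∀ j : Fin n, (if j.castSucc < i then P.d j else 0) =
      (fun j => if j < (i : ℕ) then extend P.d j else 0) j := by
    intro j
    simp [Fin.lt_def, extend_val]
  rw [pos, Finset.sum_congr rfl fun j _ => h j,
    Fin.sum_univ_eq_sum_range (fun j => if j < (i : ℕ) then extend P.d j else 0) n, loc, partialSum,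
    Nat.add_sub_cancel, ← Finset.sum_filter]
  congr 1
  ext j
  have := i.isLt
  simp
  omega

theorem loc_lt_succ {k : ℕ} (h : 1 ≤ k) (h' : k ≤ n) : P.loc k < P.loc (k + 1) := by
  obtain ⟨k, rfl⟩ : ∃ j, k = j + 1 := ⟨k - 1, by omega⟩
  simp only [loc, Nat.add_sub_cancel, partialSum_succ, extend]
  rw [dif_pos (by omega)]
  linarith [P.d_pos ⟨k, by omega⟩]

theorem loc_strictMono {k l : ℕ} (h : 1 ≤ k) (hl : l ≤ n + 1) (hkl : k < l) :
    P.loc k < P.loc l := by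
  induction l, hkl using Nat.le_induction with
  | base => exact P.loc_lt_succ h (by omega)
  | succ l hkl ih => exact (ih (by omega)).trans (P.loc_lt_succ (by omega) (by omega))

theorem loc_mono {k l : ℕ} (h : 1 ≤ k) (hl : l ≤ n + 1) (hkl : k ≤ l) : P.loc k ≤ P.loc l := by
  rcases hkl.eq_or_lt with rfl | hkl
  · exact le_rfl
  · exact (P.loc_strictMono h hl hkl).le

theorem points_eq : P.points = Set.Icc 0 (P.loc (n + 1)) := by
  simp [points, pos_eq]

theorem extend_nonneg {m : ℕ} {s : Fin m → ℝ} (hs : ∀ i, 0 ≤ s i) (j : ℕ) : 0 ≤ extend s j := by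
  unfold extend; split_ifs
  · exact hs _
  · exact le_rfl

/-- A flow to the right, in terms of edge numbers. -/
structure NatFlow (w : ℕ → ℝ) (G : ℕ → ℝ → ℝ) : Prop where
  edge_zero : ∀ t, G 0 t = 0
  zero : ∀ k ≤ n, ∀ t ≤ 0, G k t = 0
  cap : ∀ k, 1 ≤ k → k ≤ n → ∀ t t', t ≤ t' → G k t' - G k t ≤ P.capac k * (t' - t)
  supply : ∀ k, 1 ≤ k → k ≤ n → ∀ t,
    G k t ≤ w (k - 1) + G (k - 1) (t - (P.loc k - P.loc (k - 1)))

theorem sum_ite_succ_eq_castSucc (f : Fin n → ℝ) (i : Fin n) :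
    (∑ j : Fin n, if j.succ = i.castSucc then f j else 0) =
      if h : 0 < i.val then f ⟨i.val - 1, by omega⟩ else 0 := by
  split_ifs with h
  · rw [Finset.sum_eq_single (⟨i.val - 1, by omega⟩ : Fin n)]
    · rw [if_pos]
      apply Fin.ext; simp; omega
    · intro j _ hj
      rw [if_neg]
      intro h'
      apply hj
      have := congrArg Fin.val h'
      simp at this
      apply Fin.ext; simp; omega
    · simp
  · apply Finset.sum_eq_zero
    intro j _
    rw [if_neg]
    intro h'
    have := congrArg Fin.val h'
    simp at this
    omega

theorem IsFlow.natFlow {P : UncertainPath n} {s : Fin (n + 1) → ℝ} {A : Fin n → ℝ → ℝ}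
    (h : P.IsFlow Fin.castSucc Fin.succ s A) :
    P.NatFlow (extend s) fun k t => if k = 0 then 0 else extend (fun i => A i t) (k - 1) where
  edge_zero t := by simp
  zero k _ t ht := by
    simp only [extend]
    split_ifs <;> simp [h.zero _ t ht]
  cap k h1 h2 t t' htt := by
    have hk : k ≠ 0 := by omega
    have hk' : k - 1 < n := by omega
    simp only [extend, capac, if_neg hk, dif_pos hk']
    exact h.cap _ _ _ htt
  supply k h1 h2 t := by
    have hk : k ≠ 0 := by omega
    have hk' : k - 1 < n := by omega
    have hk'' : k - 1 < n + 1 := by omega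
    simp only [extend, if_neg hk, dif_pos hk', dif_pos hk'']
    have := h.supply ⟨k - 1, hk'⟩ t
    rw [sum_ite_succ_eq_castSucc (fun j => A j (t - P.d j))] at this
    refine this.trans (add_le_add le_rfl ?_)
    by_cases h0 : k = 1
    · subst h0; simp
    · have h3 : 0 < k - 1 := by omega
      have h4 : k - 1 ≠ 0 := by omega
      have h5 : k - 1 - 1 < n := by omega
      rw [dif_pos h3, if_neg h4, dif_pos h5]
      have : P.loc k - P.loc (k - 1) = P.d ⟨k - 1 - 1, h5⟩ := by
        obtain ⟨j, rfl⟩ : ∃ j, k = j + 2 := ⟨k - 2, by omega⟩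
        simp only [loc, show j + 2 - 1 = j + 1 by omega, show j + 1 - 1 = j by omega,
          partialSum_succ, extend]
        rw [dif_pos (by omega)]; ring
      rw [this]

theorem NatFlow.isFlow {P : UncertainPath n} {s : Fin (n + 1) → ℝ} {G : ℕ → ℝ → ℝ}
    (hm : ∀ k, Monotone (G k)) (h : P.NatFlow (extend s) G) :
    P.IsFlow Fin.castSucc Fin.succ s fun i => G (i + 1) where
  zero i t ht := h.zero _ (by omega) t ht
  mono i := hm _
  cap i t t' htt := by
    have := h.cap (i + 1) (by omega) (by omega) t t' htt
    simpa [capac, extend_val] using this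
  supply i t := by
    have := h.supply (i + 1) (by omega) (by omega) t
    rw [sum_ite_succ_eq_castSucc (fun j => G (j + 1) (t - P.d j))]
    have e : extend s i = s i.castSucc := extend_val s i.castSucc
    simp only [Nat.add_sub_cancel, e] at this
    refine this.trans (add_le_add le_rfl ?_)
    split_ifs with h0
    · have h5 : i.val - 1 < n := by omega
      have : P.loc (i + 1) - P.loc i = P.d ⟨i.val - 1, h5⟩ := by
        obtain ⟨j, hj⟩ : ∃ j, i.val = j + 1 := ⟨i.val - 1, by omega⟩
        simp only [hj, loc, Nat.add_sub_cancel, partialSum_succ, extend]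
        rw [dif_pos (by omega)]; ring
      rw [this]
      simp only [show i.val - 1 + 1 = i.val by omega, le_refl]
    · have : i.val = 0 := by omega
      simp [this, h.edge_zero]

/-- The condition for evacuation, in terms of the time `u` at which flow from the origin would have
to leave. -/
def Movable (C X S : ℕ → ℝ) (k : ℕ) (u : ℝ) : Prop :=
  ∀ l, 1 ≤ l → l ≤ k → 0 < S l → S l ≤ bottleneck C k l * (u + X l)

/-- Necessity of the criterion. Backwards from edge k, `a` shows that S_j units have entered edge j
by time u + loc j. Forwards from vertex l, `b` shows that at most S_j − S_l units have entered it by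
time loc j − loc l, because flow from the first l vertices cannot have come so far. If j is the
narrowest edge between l and k, then at least S_l units pass it within u + loc l. -/
theorem NatFlow.movable {P : UncertainPath n} {w : ℕ → ℝ} {G : ℕ → ℝ → ℝ}
    (h : P.NatFlow w G) {k : ℕ} (hk : k ≤ n) {u : ℝ}
    (hG : partialSum w k ≤ G k (u + P.loc k)) :
    Movable P.capac P.loc (partialSum w) k u := by
  have a : ∀ m l, l + m = k → partialSum w l ≤ G l (u + P.loc l) := by
    intro m
    induction m with
    | zero => rintro l rfl; exact hG
    | succ m ih =>
      intro l hl
      have h1 := ih (l + 1) (by omega)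
      have h2 := h.supply (l + 1) (by omega) (by omega) (u + P.loc (l + 1))
      rw [partialSum_succ] at h1
      simp only [Nat.add_sub_cancel] at h2
      rw [show u + P.loc (l + 1) - (P.loc (l + 1) - P.loc l) = u + P.loc l by ring] at h2
      linarith
  intro l hl hlk hpos
  have b : ∀ j, l ≤ j → j ≤ k → G j (P.loc j - P.loc l) ≤ partialSum w j - partialSum w l := by
    intro j hj
    induction j, hj using Nat.le_induction with
    | base => intro _; rw [sub_self, sub_self, h.zero _ (by omega) 0 le_rfl]
    | succ j hj ih =>
      intro hjk
      have h2 := h.supply (j + 1) (by omega) (by omega) (P.loc (j + 1) - P.loc l)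
      simp only [Nat.add_sub_cancel] at h2
      rw [show P.loc (j + 1) - P.loc l - (P.loc (j + 1) - P.loc j) = P.loc j - P.loc l by ring]
        at h2
      have := ih (by omega)
      rw [partialSum_succ]
      linarith
  -- The two times compared below must come in this order; otherwise nothing could have entered edge
  -- l yet, although S_l > 0 units must have.
  have hu : 0 ≤ u + P.loc l := by
    by_contra hneg
    have h1 := a (k - l) l (by omega)
    rw [h.zero l (by omega) _ (by linarith)] at h1
    linarith
  obtain ⟨j, hlj, hjk, hj⟩ := exists_bottleneck_eq P.capac hlk
  have h1 := a (k - j) j (by omega)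
  have h2 := b j hlj hjk
  have h3 := h.cap j (by omega) (by omega) (P.loc j - P.loc l) (u + P.loc j) (by linarith)
  rw [hj]
  rw [show u + P.loc j - (P.loc j - P.loc l) = u + P.loc l by ring] at h3
  linarith

/-- Sufficiency of the criterion. Flow enters edge l ≤ k at the constant rate of the bottleneck from
l to k, timed so that its last unit enters at u + loc l; the edges after k stay empty. The
hypothesis on u says exactly that no edge has to start before time 0. -/
theorem exists_natFlow {w : ℕ → ℝ} (hw : ∀ j, 0 ≤ w j) {k : ℕ} (hk : k ≤ n) {u : ℝ}
    (hu : Movable P.capac P.loc (partialSum w) k u) :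
    ∃ G, (∀ j, Monotone (G j)) ∧ P.NatFlow w G ∧ G k (u + P.loc k) = partialSum w k := by
  set S := partialSum w with hS
  have hS0 : ∀ j, 0 ≤ S j := partialSum_nonneg hw
  have hbn : ∀ l, 1 ≤ l → l ≤ k → 0 < bottleneck P.capac k l := fun l h h' =>
    bottleneck_pos h' fun t h1 h2 => P.capac_pos (by omega) (by omega)
  refine ⟨fun l t => if 1 ≤ l ∧ l ≤ k then
    max 0 (min (S l) (S l - bottleneck P.capac k l * (u + P.loc l - t))) else 0, ?_, ⟨?_, ?_, ?_,
      ?_⟩,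
    ?_⟩
  · intro j t t' htt
    dsimp only
    split_ifs with hj
    · have := hbn j hj.1 hj.2
      gcongr
    · exact le_rfl
  · intro t; simp
  · intro j _ t ht
    split_ifs with hj
    · rw [max_eq_left]
      rcases (hS0 j).eq_or_lt with h0 | h0
      · rw [← h0]; exact min_le_left _ _
      · have h1 := hu j hj.1 hj.2 h0
        have h2 := mul_nonneg (hbn j hj.1 hj.2).le (neg_nonneg.2 ht)
        refine (min_le_right _ _).trans ?_
        linarith
    · rfl
  · intro j _ _ t t' htt
    have h3 : 0 ≤ P.capac j * (t' - t) :=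
      mul_nonneg (P.capac_pos (by omega) (by omega)).le (by linarith)
    split_ifs with hj
    · have h1 := mul_le_mul_of_nonneg_right (bottleneck_le (C := P.capac) le_rfl hj.2)
        (sub_nonneg.2 htt)
      rw [sub_le_iff_le_add]
      refine max_le (by positivity) ?_
      rcases le_total (S j) (S j - bottleneck P.capac k j * (u + P.loc j - t)) with h | h
      · have : S j ≤ max 0 (min (S j) (S j - bottleneck P.capac k j * (u + P.loc j - t))) :=
          le_max_of_le_right (le_min le_rfl h)
        have := min_le_left (S j) (S j - bottleneck P.capac k j * (u + P.loc j - t'))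
        linarith
      · have : S j - bottleneck P.capac k j * (u + P.loc j - t) ≤
            max 0 (min (S j) (S j - bottleneck P.capac k j * (u + P.loc j - t))) :=
          le_max_of_le_right (le_min h le_rfl)
        have := min_le_right (S j) (S j - bottleneck P.capac k j * (u + P.loc j - t'))
        linarith
    · simpa using h3
  · intro j hj _ t
    by_cases hjk : j ≤ k
    · rw [if_pos ⟨hj, hjk⟩]
      obtain ⟨l, rfl⟩ : ∃ l, j = l + 1 := ⟨j - 1, by omega⟩
      simp only [Nat.add_sub_cancel]
      by_cases hl : 1 ≤ l
      · rw [if_pos ⟨hl, by omega⟩]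
        have hSl : S (l + 1) = S l + w l := partialSum_succ w l
        rw [show u + P.loc l - (t - (P.loc (l + 1) - P.loc l)) = u + P.loc (l + 1) - t by ring]
        refine max_le (add_nonneg (hw l) (le_max_left _ _)) ?_
        -- The rate of edge l is at most that of edge l + 1, and both finish at matching times.
        -- Hence edge l is ahead of what edge l + 1 takes away.
        have h1 : bottleneck P.capac k l ≤ bottleneck P.capac k (l + 1) :=
          bottleneck_anti (by omega) hjk le_rfl
        have h2 := hbn l hl (by omega)
        rw [← sub_le_iff_le_add']
        refine le_max_of_le_right (le_min ?_ ?_)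
        · have := min_le_left (S (l + 1))
            (S (l + 1) - bottleneck P.capac k (l + 1) * (u + P.loc (l + 1) - t))
          linarith
        · rcases le_total 0 (u + P.loc (l + 1) - t) with h | h
          · have := min_le_right (S (l + 1))
              (S (l + 1) - bottleneck P.capac k (l + 1) * (u + P.loc (l + 1) - t))
            have := mul_le_mul_of_nonneg_right h1 h
            linarith
          · have := min_le_left (S (l + 1))
              (S (l + 1) - bottleneck P.capac k (l + 1) * (u + P.loc (l + 1) - t))
            have := mul_nonneg h2.le (neg_nonneg.2 h)
            linarith
      · obtain rfl : l = 0 := by omega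
        have hS1 : S (0 + 1) = w 0 := by rw [hS, partialSum_succ, partialSum_zero, zero_add]
        simp only [hS1]
        simpa using hw 0
    · rw [if_neg (by omega)]
      split_ifs
      · exact add_nonneg (hw _) (le_max_left _ _)
      · simpa using hw _
  · dsimp only
    split_ifs with h
    · simp [hS0 k]
    · obtain rfl : k = 0 := by omega
      rw [hS, partialSum_zero]

/-- Vertices `1, …, k` are those strictly to the left of the point `x`. -/
structure LeftOf (k : ℕ) (x : ℝ) : Prop where
  le : k ≤ n
  lt : 1 ≤ k → P.loc k < x
  le_loc : x ≤ P.loc (k + 1)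

theorem evacuatesLeft_iff {s : Fin (n + 1) → ℝ} (hs : ∀ i, 0 ≤ s i) {k : ℕ} {x : ℝ}
    (hx : P.LeftOf k x) (T : ℝ) :
    P.EvacuatesLeft s x T ↔ Movable P.capac P.loc (partialSum (extend s)) k (T - x) := by
  have hsum : ∀ i : Fin n, (∑ j : Fin (n + 1), if j ≤ i.castSucc then s j else 0) =
      partialSum (extend s) (i + 1) := by
    intro i
    have h : ∀ j : Fin (n + 1), (if j ≤ i.castSucc then s j else 0) =
        (fun j => if j ≤ (i : ℕ) then extend s j else 0) j := by
      intro j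
      simp [Fin.le_def, extend_val]
    rw [Finset.sum_congr rfl fun j _ => h j,
      Fin.sum_univ_eq_sum_range (fun j => if j ≤ (i : ℕ) then extend s j else 0) (n + 1),
      partialSum, ← Finset.sum_filter]
    congr 1
    ext j
    simp
    omega
  have hw := extend_nonneg hs
  have hkn := hx.le
  constructor
  · rintro ⟨A, hA, hT⟩
    by_cases hk : 1 ≤ k
    · refine hA.natFlow.movable hx.le ?_
      have hk' : k - 1 < n := by omega
      have := hT ⟨k - 1, hk'⟩ (by simpa [pos_eq, Nat.sub_add_cancel hk] using hx.lt hk)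
        (by simpa [pos_eq, Nat.sub_add_cancel hk] using hx.le_loc)
      rw [hsum, pos_eq] at this
      simp only [Fin.val_castSucc, Nat.sub_add_cancel hk] at this
      simp only [if_neg (show k ≠ 0 by omega), extend, dif_pos hk']
      rw [show T - x + P.loc k = T - (x - P.loc k) by ring, this]
    · intro l h1 h2; omega
  · intro hu
    obtain ⟨G, hm, hG, hGk⟩ := P.exists_natFlow hw hx.le hu
    refine ⟨_, hG.isFlow hm, fun i h1 h2 => ?_⟩
    rw [hsum]
    rw [pos_eq] at h1 h2 ⊢
    simp only [Fin.val_castSucc, Fin.val_succ] at h1 h2 ⊢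
    -- The definition speaks of every edge over which x may be reached; the locations increase
    -- strictly, so edge k is the only one.
    have hik : i.val + 1 = k := by
      by_contra hne
      rcases lt_or_gt_of_ne hne with h | h
      · have := hx.lt (by omega)
        have := P.loc_mono (k := i + 1 + 1) (l := k) (by omega) (by omega) (by omega)
        linarith
      · have := hx.le_loc
        have := P.loc_mono (k := k + 1) (l := i + 1) (by omega) (by omega) (by omega)
        linarith
    rw [hik, ← hGk]
    congr 1
    ring

/-- Evacuation is possible at all. Otherwise the infimum defining Θ_L could be the default value 0
of the empty set. -/
theorem exists_movable {w : ℕ → ℝ} {k : ℕ} (hk : k ≤ n) :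
    ∃ u₀, ∀ u, u₀ ≤ u → Movable P.capac P.loc (partialSum w) k u := by
  obtain ⟨M, hM⟩ := ((Finset.Icc 1 k).image fun l =>
    partialSum w l / bottleneck P.capac k l - P.loc l).exists_le
  refine ⟨M, fun u hu l h1 h2 _ => ?_⟩
  have := hM _ (Finset.mem_image_of_mem _ (Finset.mem_Icc.2 ⟨h1, h2⟩))
  have hb : 0 < bottleneck P.capac k l :=
    bottleneck_pos h2 fun t h3 h4 => P.capac_pos (by omega) (by omega)
  rw [← div_le_iff₀' hb]
  linarith

theorem thetaL_nonneg (x : ℝ) (s : Fin (n + 1) → ℝ) : 0 ≤ P.thetaL x s :=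
  Real.sInf_nonneg fun _ h => h.1

theorem theta_nonneg (x : ℝ) (s : Fin (n + 1) → ℝ) : 0 ≤ P.theta x s :=
  le_max_of_le_left (P.thetaL_nonneg x s)

/-- The criterion is a finite system of weak linear inequalities in T, so the infimum satisfies it
as well, by a limit argument in each inequality. -/
theorem thetaL_le_iff {s : Fin (n + 1) → ℝ} (hs : ∀ i, 0 ≤ s i) {k : ℕ} {x : ℝ}
    (hx : P.LeftOf k x) {T : ℝ} (hT : 0 ≤ T) :
    P.thetaL x s ≤ T ↔ Movable P.capac P.loc (partialSum (extend s)) k (T - x) := by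
  have hset : {T : ℝ | 0 ≤ T ∧ P.EvacuatesLeft s x T} =
      {T : ℝ | 0 ≤ T ∧ Movable P.capac P.loc (partialSum (extend s)) k (T - x)} := by
    ext T; simp [P.evacuatesLeft_iff hs hx]
  have hkn := hx.le
  rw [thetaL, hset]
  constructor
  · intro h l h1 h2 h3
    have hb : 0 < bottleneck P.capac k l :=
      bottleneck_pos h2 fun t h3 h4 => P.capac_pos (by omega) (by omega)
    rw [← div_le_iff₀' hb]
    refine le_of_forall_pos_le_add fun ε hε => ?_
    obtain ⟨u₀, hu₀⟩ := P.exists_movable (w := extend s) hx.le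
    obtain ⟨T', ⟨-, hT'⟩, hlt⟩ := exists_lt_of_csInf_lt
      ⟨max 0 (u₀ + x), Set.mem_ofPred.2 ⟨le_max_left _ _, hu₀ _ (by
        have := le_max_right 0 (u₀ + x); linarith)⟩⟩ (h.trans_lt (lt_add_of_pos_right T hε))
    have := hT' l h1 h2 h3
    rw [← div_le_iff₀' hb] at this
    linarith
  · intro h
    exact csInf_le ⟨0, fun _ h => h.1⟩ ⟨hT, h⟩

end UncertainPath

/-! ### The closed form of the evacuation time -/

namespace UncertainPath

variable {n : ℕ} (P : UncertainPath n)

/-- If all terms for vertices of positive weight were smaller than Θ_L, then their maximum with 0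
would already be a feasible time. The vertex is required to have positive weight of its own, since
later this forces its flow to have started, also on the way to a rival sink. -/
theorem exists_thetaL_le {s : Fin (n + 1) → ℝ} (hs : ∀ i, 0 ≤ s i) {k : ℕ} {x : ℝ}
    (hx : P.LeftOf k x) (hpos : 0 < P.thetaL x s) :
    ∃ i, 1 ≤ i ∧ i ≤ k ∧ 0 < extend s (i - 1) ∧
      P.thetaL x s ≤ x - P.loc i + partialSum (extend s) i / bottleneck P.capac k i := by
  by_contra! hcon
  have hkn := hx.le
  have hb : ∀ l, 1 ≤ l → l ≤ k → 0 < bottleneck P.capac k l := fun l h h' =>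
    bottleneck_pos h' fun t h1 h2 => P.capac_pos (by omega) (by omega)
  obtain ⟨T, hT0, hT, hTl⟩ : ∃ T, 0 ≤ T ∧ T < P.thetaL x s ∧ ∀ i, 1 ≤ i → i ≤ k →
      0 < extend s (i - 1) →
      x - P.loc i + partialSum (extend s) i / bottleneck P.capac k i ≤ T := by
    let F := ((Finset.Icc 1 k).filter fun i => 0 < extend s (i - 1))
    let f := fun i => x - P.loc i + partialSum (extend s) i / bottleneck P.capac k i
    refine ⟨F.fold max 0 f, (Finset.le_fold_max _).2 (Or.inl le_rfl), (Finset.fold_max_lt _).2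
      ⟨hpos, fun i hi => ?_⟩, fun i h1 h2 h3 => (Finset.le_fold_max _).2 (Or.inr ⟨i, ?_, le_rfl⟩)⟩
    · simp only [F, Finset.mem_filter, Finset.mem_Icc] at hi
      exact hcon i hi.1.1 hi.1.2 hi.2
    · simp only [F, Finset.mem_filter, Finset.mem_Icc]
      exact ⟨⟨h1, h2⟩, h3⟩
  refine absurd ((P.thetaL_le_iff hs hx hT0).2 fun l h1 h2 h3 => ?_) (not_le.2 hT)
  -- The last vertex i ≤ l of positive weight has the same partial sum as l, a bottleneck that is no
  -- larger and a location that is no greater. Its term dominates that of l.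
  have hlast : ∀ l, 0 < partialSum (extend s) l → ∃ i, 1 ≤ i ∧ i ≤ l ∧ 0 < extend s (i - 1) ∧
      partialSum (extend s) i = partialSum (extend s) l := by
    intro l
    induction l with
    | zero => intro h; rw [partialSum_zero] at h; exact absurd h (lt_irrefl _)
    | succ l ih =>
      intro h
      rcases (extend_nonneg hs l).eq_or_lt with h0 | h0
      · have e : partialSum (extend s) (l + 1) = partialSum (extend s) l := by
          rw [partialSum_succ, ← h0, add_zero]
        rw [e] at h ⊢
        obtain ⟨i, h1, h2, h3⟩ := ih h
        exact ⟨i, h1, by omega, h3⟩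
      · exact ⟨l + 1, by omega, le_rfl, by simpa using h0, rfl⟩
  obtain ⟨i, hi1, hil, hi, hsum⟩ := hlast l h3
  have h4 := hTl i hi1 (by omega) hi
  rw [hsum] at h4
  have h5 : partialSum (extend s) l / bottleneck P.capac k l ≤
      partialSum (extend s) l / bottleneck P.capac k i :=
    div_le_div_of_nonneg_left h3.le (hb i hi1 (by omega)) (bottleneck_anti hil h2 le_rfl)
  have h6 := P.loc_mono (k := i) (l := l) hi1 (by omega) hil
  rw [← div_le_iff₀' (hb l h1 h2)]
  linarith

theorem le_thetaL {s : Fin (n + 1) → ℝ} (hs : ∀ i, 0 ≤ s i) {k : ℕ} {x : ℝ}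
    (hx : P.LeftOf k x) {i : ℕ} (hi : 1 ≤ i) (hik : i ≤ k)
    (hpos : 0 < partialSum (extend s) i) :
    x - P.loc i + partialSum (extend s) i / bottleneck P.capac k i ≤ P.thetaL x s := by
  have hkn := hx.le
  have h := (P.thetaL_le_iff hs hx (P.thetaL_nonneg x s)).1 le_rfl i hi hik hpos
  rw [← div_le_iff₀' (bottleneck_pos hik fun t h1 h2 => P.capac_pos (by omega) (by omega))] at h
  linarith

/-! ### Reversal -/

/-- The path with its direction reversed. -/
def rev : UncertainPath n where
  d i := P.d i.rev
  c i := P.c i.rev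
  wlo i := P.wlo i.rev
  whi i := P.whi i.rev
  d_pos _ := P.d_pos _
  c_pos _ := P.c_pos _
  wlo_nonneg _ := P.wlo_nonneg _
  wlo_le_whi _ := P.wlo_le_whi _

theorem rev_rev : P.rev.rev = P := by
  simp [rev]

/-- The total length. -/
noncomputable def len : ℝ := P.loc (n + 1)

theorem extend_comp_rev {m : ℕ} (f : Fin m → ℝ) {j : ℕ} (hj : j < m) :
    extend (fun i => f i.rev) j = extend f (m - 1 - j) := by
  have : m - 1 - j < m := by omega
  simp only [extend, dif_pos hj, dif_pos this]
  congr 1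
  apply Fin.ext
  simp [Fin.rev]; omega

theorem partialSum_extend_rev {m : ℕ} (f : Fin m → ℝ) {k : ℕ} (hk : k ≤ m) :
    partialSum (extend fun i => f i.rev) k =
      partialSum (extend f) m - partialSum (extend f) (m - k) := by
  induction k with
  | zero => simp [partialSum_zero]
  | succ k ih =>
    rw [partialSum_succ, ih (by omega), extend_comp_rev f (by omega)]
    obtain ⟨j, hj⟩ : ∃ j, m - k = j + 1 := ⟨m - k - 1, by omega⟩
    rw [hj, partialSum_succ, show m - (k + 1) = j by omega, show m - 1 - k = j by omega]
    ring

theorem loc_rev {k : ℕ} (h : 1 ≤ k) (hk : k ≤ n + 1) :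
    P.rev.loc k = P.len - P.loc (n + 2 - k) := by
  have := partialSum_extend_rev P.d (k := k - 1) (by omega)
  rw [show n - (k - 1) = n + 2 - k - 1 by omega] at this
  simp only [loc, len, Nat.add_sub_cancel]
  exact this

theorem len_rev : P.rev.len = P.len := by
  rw [len, loc_rev _ (by omega) le_rfl, show n + 2 - (n + 1) = 1 by omega, loc_one, sub_zero]

theorem capac_rev {k : ℕ} (h : 1 ≤ k) (hk : k ≤ n) : P.rev.capac k = P.capac (n + 1 - k) := by
  simp only [capac, if_neg (show k ≠ 0 by omega), if_neg (show n + 1 - k ≠ 0 by omega)]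
  have := extend_comp_rev P.c (j := k - 1) (by omega)
  rw [show n - 1 - (k - 1) = n + 1 - k - 1 by omega] at this
  exact this

theorem pos_rev (i : Fin (n + 1)) : P.rev.pos i = P.len - P.pos i.rev := by
  rw [pos_eq, pos_eq, loc_rev _ (by omega) (by omega)]
  congr 2
  simp [Fin.rev]; omega

theorem IsFlow.rev {P : UncertainPath n} {s : Fin (n + 1) → ℝ} {A : Fin n → ℝ → ℝ}
    {src dst src' dst' : Fin n → Fin (n + 1)} (h : P.IsFlow src dst s A)
    (hsrc : ∀ i, src' i = (src i.rev).rev) (hdst : ∀ i, dst' i = (dst i.rev).rev) :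
    P.rev.IsFlow src' dst' (fun i => s i.rev) fun i => A i.rev where
  zero i := h.zero _
  mono i := h.mono _
  cap i := h.cap _
  supply i t := by
    refine (h.supply i.rev t).trans (le_of_eq ?_)
    rw [hsrc, Fin.rev_rev]
    congr 1
    rw [← Equiv.sum_comp Fin.revPerm]
    refine Finset.sum_congr rfl fun j _ => ?_
    simp only [Fin.revPerm_apply, hdst, Fin.rev_inj]
    rfl

theorem EvacuatesRight.rev {P : UncertainPath n} {s : Fin (n + 1) → ℝ} {x T : ℝ}
    (h : P.EvacuatesRight s x T) : P.rev.EvacuatesLeft (fun i => s i.rev) (P.len - x) T := by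
  obtain ⟨A, hA, hT⟩ := h
  refine ⟨_, hA.rev (fun i => ?_) (fun i => ?_), fun k h1 h2 => ?_⟩
  · rw [Fin.rev_succ, Fin.rev_rev]
  · rw [Fin.rev_castSucc, Fin.rev_rev]
  · rw [pos_rev] at h1 h2 ⊢
    rw [Fin.rev_castSucc] at h1 ⊢
    rw [Fin.rev_succ] at h2
    have := hT k.rev (by linarith) (by linarith)
    rw [show P.len - x - (P.len - P.pos k.rev.succ) = P.pos k.rev.succ - x by ring, this]
    rw [← Equiv.sum_comp Fin.revPerm]
    refine Finset.sum_congr rfl fun j _ => ?_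
    simp only [Fin.revPerm_apply]
    congr 1
    rw [← Fin.rev_castSucc, Fin.rev_le_rev]

theorem EvacuatesLeft.rev {P : UncertainPath n} {s : Fin (n + 1) → ℝ} {x T : ℝ}
    (h : P.EvacuatesLeft s x T) : P.rev.EvacuatesRight (fun i => s i.rev) (P.len - x) T := by
  obtain ⟨A, hA, hT⟩ := h
  refine ⟨_, hA.rev (fun i => ?_) (fun i => ?_), fun k h1 h2 => ?_⟩
  · rw [Fin.rev_castSucc, Fin.rev_rev]
  · rw [Fin.rev_succ, Fin.rev_rev]
  · rw [pos_rev] at h1 h2 ⊢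
    rw [Fin.rev_succ] at h2 ⊢
    rw [Fin.rev_castSucc] at h1
    have := hT k.rev (by linarith) (by linarith)
    rw [show P.len - P.pos k.rev.castSucc - (P.len - x) = x - P.pos k.rev.castSucc by ring, this]
    rw [← Equiv.sum_comp Fin.revPerm]
    refine Finset.sum_congr rfl fun j _ => ?_
    simp only [Fin.revPerm_apply]
    congr 1
    rw [← Fin.rev_succ, Fin.rev_le_rev]

/-- With this, evacuation from the right needs no analysis of its own: every statement about the
left is applied to the reversed path. -/
theorem evacuatesRight_iff (s : Fin (n + 1) → ℝ) (x T : ℝ) :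
    P.EvacuatesRight s x T ↔ P.rev.EvacuatesLeft (fun i => s i.rev) (P.len - x) T := by
  refine ⟨EvacuatesRight.rev, fun h => ?_⟩
  have := h.rev
  rw [rev_rev, len_rev] at this
  simpa using this

theorem thetaR_eq (s : Fin (n + 1) → ℝ) (x : ℝ) :
    P.thetaR x s = P.rev.thetaL (P.len - x) fun i => s i.rev := by
  simp only [thetaR, thetaL, evacuatesRight_iff]

theorem thetaL_eq (s : Fin (n + 1) → ℝ) (x : ℝ) :
    P.thetaL x s = P.rev.thetaR (P.len - x) fun i => s i.rev := by
  rw [thetaR_eq, rev_rev, len_rev]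
  simp

theorem theta_rev (s : Fin (n + 1) → ℝ) (x : ℝ) :
    P.rev.theta (P.len - x) (fun i => s i.rev) = P.theta x s := by
  rw [theta, theta, ← thetaL_eq, ← thetaR_eq, max_comm]

theorem mem_points_rev {x : ℝ} : P.len - x ∈ P.rev.points ↔ x ∈ P.points := by
  rw [points_eq, points_eq]
  have : P.rev.loc (n + 1) = P.len := P.len_rev
  rw [this, Set.mem_Icc, Set.mem_Icc, ← len]
  constructor <;> rintro ⟨h1, h2⟩ <;> constructor <;> linarith

theorem mem_scenarios_rev {s : Fin (n + 1) → ℝ} :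
    (fun i => s i.rev) ∈ P.rev.scenarios ↔ s ∈ P.scenarios := by
  simp only [scenarios, Set.mem_ofPred, rev]
  refine ⟨fun h i => by simpa using h i.rev, fun h i => h i.rev⟩

theorem LeftOf.vertex {h : ℕ} (h1 : 1 ≤ h) (hn : h ≤ n + 1) : P.LeftOf (h - 1) (P.loc h) where
  le := by omega
  lt h' := P.loc_strictMono h' hn (by omega)
  le_loc := by rw [Nat.sub_add_cancel h1]

theorem LeftOf.vertex_rev {h : ℕ} (h1 : 1 ≤ h) (hn : h ≤ n + 1) :
    P.rev.LeftOf (n + 1 - h) (P.len - P.loc h) := by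
  have := LeftOf.vertex P.rev (h := n + 2 - h) (by omega) (by omega)
  rwa [loc_rev _ (by omega) (by omega), show n + 2 - (n + 2 - h) = h by omega,
    show n + 2 - h - 1 = n + 1 - h by omega] at this

theorem LeftOf.edge_rev {h : ℕ} {y : ℝ} (hn : h ≤ n) (hlt : P.loc h ≤ y)
    (hgt : y < P.loc (h + 1)) (h1 : 1 ≤ h) : P.rev.LeftOf (n + 1 - h) (P.len - y) where
  le := by omega
  lt h' := by
    rw [loc_rev _ h' (by omega), show n + 2 - (n + 1 - h) = h + 1 by omega]
    linarith
  le_loc := by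
    rw [loc_rev _ (by omega) (by omega), show n + 2 - (n + 1 - h + 1) = h by omega]
    linarith

theorem theta_le_iff {s : Fin (n + 1) → ℝ} (hs : ∀ i, 0 ≤ s i) {p q : ℕ} {y : ℝ}
    (hp : P.LeftOf p y) (hq : P.rev.LeftOf q (P.len - y)) {T : ℝ} (hT : 0 ≤ T) :
    P.theta y s ≤ T ↔ Movable P.capac P.loc (partialSum (extend s)) p (T - y) ∧
      Movable P.rev.capac P.rev.loc (partialSum (extend fun i => s i.rev)) q
        (T - (P.len - y)) := by
  rw [theta, max_le_iff, P.thetaL_le_iff hs hp hT, thetaR_eq,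
    P.rev.thetaL_le_iff (fun i => hs i.rev) hq hT]

end UncertainPath

/-! ## Piecewise convex functions and their breakpoints -/

/-- `F` is convex between any two consecutive breakpoints in `c`, to the right of `t₀`. -/
def PiecewiseConvex (F : ℝ → ℝ) (t₀ : ℝ) (c : Set ℝ) : Prop :=
  ∀ t₁ t₂, t₀ ≤ t₁ → t₁ < t₂ → (∀ x ∈ c, x ∉ Set.Ioo t₁ t₂) → ConvexOn ℝ (Set.Icc t₁ t₂) F

namespace PiecewiseConvex

variable {F G : ℝ → ℝ} {t₀ : ℝ} {c d : Set ℝ}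

theorem add (hF : PiecewiseConvex F t₀ c) (hG : PiecewiseConvex G t₀ d) :
    PiecewiseConvex (fun t => F t + G t) t₀ (c ∪ d) := fun t₁ t₂ h1 h2 h =>
  (hF t₁ t₂ h1 h2 fun x hx => h x (Or.inl hx)).add (hG t₁ t₂ h1 h2 fun x hx => h x (Or.inr hx))

theorem mono {t₀' : ℝ} (hF : PiecewiseConvex F t₀ c) (h₀ : t₀ ≤ t₀') (hcd : ∀ x ∈ c,
    t₀' < x → x ∈ d) :
    PiecewiseConvex F t₀' d := fun t₁ t₂ h1 h2 h =>
  hF t₁ t₂ (h₀.trans h1) h2 fun x hx hx' => h x (hcd x hx (h1.trans_lt hx'.1)) hx'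

theorem mul_add_linear (hF : PiecewiseConvex F t₀ c) {a : ℝ} (ha : 0 ≤ a) (b e : ℝ) :
    PiecewiseConvex (fun t => a * F t + (b * t + e)) t₀ c := fun t₁ t₂ h1 h2 h => by
  refine ((hF t₁ t₂ h1 h2 h).smul ha).add ⟨convex_Icc _ _, fun x _ y _ p q _ _ hpq => ?_⟩
  simp only [smul_eq_mul]
  have : p * (b * x + e) + q * (b * y + e) = b * (p * x + q * y) + (p + q) * e := by ring
  rw [this, hpq, one_mul]

theorem comp_sub (hF : PiecewiseConvex F t₀ c) (y : ℝ) :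
    PiecewiseConvex (fun t => F (t - y)) (t₀ + y) ((fun x => x + y) '' c) :=
  fun t₁ t₂ h1 h2 h => by
    have := hF (t₁ - y) (t₂ - y) (by linarith) (by linarith) fun x hx hx' =>
      h (x + y) ⟨x, hx, rfl⟩ ⟨by linarith [hx'.1], by linarith [hx'.2]⟩
    refine ⟨convex_Icc _ _, fun x hx z hz p q hp hq hpq => ?_⟩
    have h3 := this.2 (x := x - y) ⟨by linarith [hx.1], by linarith [hx.2]⟩ (y := z - y)
      ⟨by linarith [hz.1], by linarith [hz.2]⟩ hp hq hpq
    simp only [smul_eq_mul] at h3 ⊢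
    have e : p * (x - y) + q * (z - y) = p * x + q * z - y := by
      have : p * (x - y) + q * (z - y) = p * x + q * z - (p + q) * y := by ring
      rw [this, hpq, one_mul]
    rwa [e] at h3

/-- Between consecutive breakpoints a convex function is at most the larger of its values at the two
ends. The hypothesis `h₀` keeps the left end from falling below `t₀`. -/
theorem exists_le (hF : PiecewiseConvex F t₀ c) (hc : c.Finite) (h₀ : t₀ ∈ c) {lo hi t : ℝ}
    (hlo : lo ≤ t) (hhi : t ≤ hi) (ht : t₀ ≤ t) :
    ∃ t', lo ≤ t' ∧ t' ≤ hi ∧ t₀ ≤ t' ∧ F t ≤ F t' ∧ (t' ∈ c ∨ t' = lo ∨ t' = hi) := by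
  rcases hhi.eq_or_lt with rfl | hhi
  · exact ⟨t, hlo, le_rfl, ht, le_rfl, Or.inr (Or.inr rfl)⟩
  -- `a` is the last breakpoint or `lo` up to t, and `b` is the first breakpoint or `hi` after t.
  obtain ⟨a, ⟨ha, hat⟩, hamax⟩ := Set.exists_max_image ((c ∪ {lo}) ∩ Set.Iic t) id
    ((hc.union (Set.finite_singleton lo)).inter_of_left _) ⟨t₀, Or.inl h₀, ht⟩
  obtain ⟨b, ⟨hb, hbt⟩, hbmin⟩ := Set.exists_min_image ((c ∪ {hi}) ∩ Set.Ioi t) id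
    ((hc.union (Set.finite_singleton hi)).inter_of_left _) ⟨hi, Or.inr rfl, hhi⟩
  simp only [id, Set.mem_Iic, Set.mem_Ioi] at hat hbt hamax hbmin
  have ha0 : t₀ ≤ a := hamax t₀ ⟨Or.inl h₀, ht⟩
  have hal : lo ≤ a := hamax lo ⟨Or.inr rfl, hlo⟩
  have hbh : b ≤ hi := hbmin hi ⟨Or.inr rfl, hhi⟩
  have hconv := hF a b ha0 (hat.trans_lt hbt) fun x hx hx' => by
    rcases le_or_gt x t with h | h
    · exact absurd (hamax x ⟨Or.inl hx, h⟩) (not_le.2 hx'.1)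
    · exact absurd (hbmin x ⟨Or.inl hx, h⟩) (not_le.2 hx'.2)
  have hle := hconv.le_max_of_mem_Icc (x := a) (y := b) (z := t)
    (Set.left_mem_Icc.2 (hat.trans hbt.le)) (Set.right_mem_Icc.2 (hat.trans hbt.le)) ⟨hat, hbt.le⟩
  rcases le_max_iff.1 hle with h | h
  · refine ⟨a, hal, hat.trans hhi.le, ha0, h, ?_⟩
    rcases ha with ha | ha
    · exact Or.inl ha
    · exact Or.inr (Or.inl ha)
  · refine ⟨b, hlo.trans hbt.le, hbh, ht.trans hbt.le, h, ?_⟩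
    rcases hb with hb | hb
    · exact Or.inl hb
    · exact Or.inr (Or.inr hb)

/-- A bounded piecewise convex function minus the identity is maximal at a breakpoint. -/
theorem exists_mem_le (hF : PiecewiseConvex F t₀ c) (hc : c.Finite) (h₀ : t₀ ∈ c) {a b M t : ℝ}
    (ha : 0 ≤ a) (hb : 0 < b) (hM : ∀ t, F t ≤ M) (ht : t₀ ≤ t) :
    ∃ t' ∈ c, t₀ ≤ t' ∧ a * F t - b * t ≤ a * F t' - b * t' := by
  have hF' := hF.mul_add_linear ha (-b) 0
  -- The right end is so far out that even a M − b t' is below the value at t, so it cannot be the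
  -- point found.
  obtain ⟨t', h1, h2, h3, h4, h5⟩ := hF'.exists_le hc h₀ ht (le_max_left t ((a * M -
      (a * F t - b * t)) / b + 1)) ht
  have h6 : a * F t - b * t ≤ a * F t' - b * t' := by linarith
  rcases h5 with h5 | h5 | h5
  · exact ⟨t', h5, h3, h6⟩
  · exact ⟨t', h5 ▸ h₀, h3, h6⟩
  · exfalso
    have h7 : (a * M - (a * F t - b * t)) / b + 1 ≤ t' := by
      rw [h5]; exact le_max_right _ _
    have h8 : (a * M - (a * F t - b * t)) / b < t' := by linarith
    rw [div_lt_iff₀ hb] at h8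
    have := mul_le_mul_of_nonneg_left (hM t') ha
    linarith

end PiecewiseConvex

/-! ## Lower envelopes of truncated lines -/

/-- The truncated line with slope `m`, which leaves its minimum `K` at `-x`. -/
noncomputable def truncLine (m x K u : ℝ) : ℝ := m * max (u + x) 0 + K

theorem truncLine_mono {m x K : ℝ} (hm : 0 ≤ m) : Monotone (truncLine m x K) := fun u v h => by
  unfold truncLine; gcongr

theorem le_truncLine {m x K u : ℝ} (hm : 0 ≤ m) : K ≤ truncLine m x K u := by
  have := mul_nonneg hm (le_max_right (u + x) 0)
  unfold truncLine; linarith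

theorem linear_le_truncLine {m x K u : ℝ} (hm : 0 ≤ m) : m * (u + x) + K ≤ truncLine m x K u := by
  have := mul_le_mul_of_nonneg_left (le_max_left (u + x) 0) hm
  unfold truncLine; linarith

theorem truncLine_eq {m x K u : ℝ} (hm : 0 ≤ m) (h : K < truncLine m x K u) :
    0 < m ∧ 0 < u + x ∧ truncLine m x K u = m * (u + x) + K := by
  unfold truncLine at *
  have h1 : 0 < m * max (u + x) 0 := by linarith
  have hm' : m ≠ 0 := by rintro rfl; simp at h1
  have h2 : 0 < u + x := by
    by_contra hn
    rw [max_eq_right (not_lt.1 hn), mul_zero] at h1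
    exact lt_irrefl _ h1
  exact ⟨lt_of_le_of_ne hm hm'.symm, h2, by rw [max_eq_left h2.le]⟩

/-- A family of truncated lines of increasing steepness that leave their decreasing minima in
the reverse order; the line number `0` is constant. -/
structure LineFamily (k : ℕ) (m X K : ℕ → ℝ) : Prop where
  zero : m 0 = 0
  mono : ∀ i j, i ≤ j → j ≤ k → m i ≤ m j
  anti : ∀ i j, i ≤ j → j ≤ k → K j ≤ K i
  loc : ∀ i j, 1 ≤ i → i ≤ j → j ≤ k → X i ≤ X j

/-- The lower envelope of the truncated lines. -/
noncomputable def lineEnvelope (k : ℕ) (m X K : ℕ → ℝ) (u : ℝ) : ℝ :=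
  (Finset.Icc 0 k).fold min (K 0) fun l => truncLine (m l) (X l) (K l) u

/-- The first point, not before `u₀`, after which all steeper lines from the family are above the
line with slope `μ` through the starting point of line `l`. -/
noncomputable def lineCrossing (k : ℕ) (m X K : ℕ → ℝ) (u₀ : ℝ) (l : ℕ) (μ : ℝ) : ℝ :=
  ((Finset.Ioc l k).filter fun j => μ < m j).fold max u₀ fun j =>
    (K l - K j + μ * X l - m j * X j) / (m j - μ)

/-- The possible breakpoints of the lower envelope. -/
def lineBreaks (k : ℕ) (m X K : ℕ → ℝ) (u₀ : ℝ) : Set ℝ :=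
  {x | ∃ l ≤ k, x = lineCrossing k m X K u₀ l 0 ∨ x = lineCrossing k m X K u₀ l (m l)}

theorem lineBreaks_finite (k : ℕ) (m X K : ℕ → ℝ) (u₀ : ℝ) : (lineBreaks k m X K u₀).Finite := by
  refine (((Set.finite_Iic k).image fun l => lineCrossing k m X K u₀ l 0).union
    ((Set.finite_Iic k).image fun l => lineCrossing k m X K u₀ l (m l))).subset ?_
  rintro x ⟨l, hl, rfl | rfl⟩
  · exact Or.inl ⟨l, hl, rfl⟩
  · exact Or.inr ⟨l, hl, rfl⟩

theorem le_lineCrossing (k : ℕ) (m X K : ℕ → ℝ) (u₀ : ℝ) (l : ℕ) (μ : ℝ) :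
    u₀ ≤ lineCrossing k m X K u₀ l μ :=
  (Finset.le_fold_max _).2 (Or.inl le_rfl)

theorem le_of_mem_lineBreaks {k : ℕ} {m X K : ℕ → ℝ} {u₀ x : ℝ}
    (h : x ∈ lineBreaks k m X K u₀) : u₀ ≤ x := by
  obtain ⟨l, -, rfl | rfl⟩ := h <;> exact le_lineCrossing _ _ _ _ _ _ _

theorem start_mem_lineBreaks (k : ℕ) (m X K : ℕ → ℝ) (u₀ : ℝ) : u₀ ∈ lineBreaks k m X K u₀ :=
  ⟨k, le_rfl, Or.inl (by simp [lineCrossing])⟩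

theorem le_lineEnvelope {k : ℕ} {m X K : ℕ → ℝ} {u r : ℝ} :
    r ≤ lineEnvelope k m X K u ↔ r ≤ K 0 ∧ ∀ l ≤ k, r ≤ truncLine (m l) (X l) (K l) u := by
  simp [lineEnvelope, Finset.le_fold_min]

namespace LineFamily

variable {k : ℕ} {m X K : ℕ → ℝ}

theorem nonneg (h : LineFamily k m X K) {l : ℕ} (hl : l ≤ k) : 0 ≤ m l :=
  h.zero ▸ h.mono 0 l (Nat.zero_le _) hl

theorem envelope_le {l : ℕ} (hl : l ≤ k) (u : ℝ) :
    lineEnvelope k m X K u ≤ truncLine (m l) (X l) (K l) u :=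
  (le_lineEnvelope.1 le_rfl).2 l hl

/-- Ties are broken in favour of the greatest index. The strict inequality against all later lines
makes the choice unique, which `exists_eqOn` needs. -/
theorem exists_top (h : LineFamily k m X K) (u : ℝ) : ∃ l ≤ k,
    lineEnvelope k m X K u = truncLine (m l) (X l) (K l) u ∧
    ∀ j, l < j → j ≤ k → truncLine (m l) (X l) (K l) u < truncLine (m j) (X j) (K j) u := by
  classical
  obtain ⟨l₀, hl₀, hmin⟩ := Finset.exists_min_image (Finset.Icc 0 k)
    (fun l => truncLine (m l) (X l) (K l) u) ⟨0, by simp⟩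
  have h₀ : lineEnvelope k m X K u = truncLine (m l₀) (X l₀) (K l₀) u := by
    refine le_antisymm (envelope_le (X := X) (K := K)
      (m := m) (by simpa using hl₀) u) (le_lineEnvelope.2
      ⟨(hmin 0 (by simp)).trans ?_, fun l hl => hmin l (by simpa using hl)⟩)
    simp [truncLine, h.zero]
  let p := fun l => truncLine (m l) (X l) (K l) u = lineEnvelope k m X K u
  have hp : p (Nat.findGreatest p k) :=
    Nat.findGreatest_spec (P := p) (by simpa using hl₀) h₀.symm
  refine ⟨Nat.findGreatest p k, Nat.findGreatest_le k, hp.symm, fun j h1 h2 => ?_⟩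
  rw [hp]
  exact lt_of_le_of_ne (envelope_le (X := X) (K := K)
      (m := m) h2 u) fun e => Nat.findGreatest_is_greatest h1 h2 e.symm

theorem increment_le (h : LineFamily k m X K) {l j : ℕ} (hlj : l < j) (hj : j ≤ k) {s t : ℝ}
    (hst : s ≤ t) :
    truncLine (m l) (X l) (K l) t - truncLine (m l) (X l) (K l) s ≤
      truncLine (m j) (X j) (K j) t - truncLine (m j) (X j) (K j) s := by
  rcases Nat.eq_zero_or_pos l with rfl | hl
  · have := truncLine_mono (x := X j) (K := K j) (h.nonneg hj) hst
    simp only [truncLine, h.zero] at *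
    linarith
  · have hx := h.loc l j hl hlj.le hj
    have hm := h.mono l j hlj.le hj
    have hm0 := h.nonneg (hlj.le.trans hj)
    have h1 : max (t + X l) 0 - max (s + X l) 0 ≤ max (t + X j) 0 - max (s + X j) 0 := by
      rcases max_cases (t + X l) 0 with ⟨e1, _⟩ | ⟨e1, _⟩ <;>
      rcases max_cases (s + X l) 0 with ⟨e2, _⟩ | ⟨e2, _⟩ <;>
      rcases max_cases (t + X j) 0 with ⟨e3, _⟩ | ⟨e3, _⟩ <;>
      rcases max_cases (s + X j) 0 with ⟨e4, _⟩ | ⟨e4, _⟩ <;>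
      rw [e1, e2, e3, e4] <;> linarith
    have h2 : 0 ≤ max (t + X l) 0 - max (s + X l) 0 := by
      rw [sub_nonneg]; gcongr
    have h3 := mul_le_mul hm h1 h2 (hm0.trans hm)
    simp only [truncLine]
    linarith

/-- Line l is passed by line j at some time in [s, t] and lies below all later lines at time t. The
last crossing of l with a steeper line is therefore no later than t, and the crossing with j is no
earlier than s. -/
theorem exists_break_mem_Icc (h : LineFamily k m X K) {u₀ s t : ℝ} (hs : u₀ ≤ s) (hst : s < t)
    {l j : ℕ} (hlj : l < j) (hj : j ≤ k)
    (hsle : truncLine (m j) (X j) (K j) s ≤ truncLine (m l) (X l) (K l) s)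
    (htlt : ∀ j, l < j → j ≤ k →
      truncLine (m l) (X l) (K l) t < truncLine (m j) (X j) (K j) t) :
    ∃ x ∈ lineBreaks k m X K u₀, s ≤ x ∧ x ≤ t := by
  have hl : l ≤ k := hlj.le.trans hj
  have hle : ∀ μ, μ * (t + X l) + K l ≤ truncLine (m l) (X l) (K l) t →
      lineCrossing k m X K u₀ l μ ≤ t := by
    intro μ hμ
    refine (Finset.fold_max_le _).2 ⟨hs.trans hst.le, fun i hi => ?_⟩
    simp only [Finset.mem_filter, Finset.mem_Ioc] at hi
    obtain ⟨⟨hli, hik⟩, hμi⟩ := hi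
    have h1 := htlt i hli hik
    obtain ⟨-, -, h2⟩ := truncLine_eq (h.nonneg hik) (((h.anti l i hli.le hik).trans
      (le_truncLine (h.nonneg hl))).trans_lt h1)
    rw [div_le_iff₀ (by linarith)]
    linarith
  have hge : ∀ μ, μ < m j → m j * (s + X j) + K j ≤ μ * (s + X l) + K l →
      s ≤ lineCrossing k m X K u₀ l μ := by
    intro μ hμ h1
    refine (Finset.le_fold_max _).2 (Or.inr ⟨j, by simp [hlj, hj, hμ], ?_⟩)
    rw [le_div_iff₀ (by linarith)]
    linarith
  have hmj := h.nonneg hj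
  have hml := h.nonneg hl
  obtain ⟨hmj0, htj, hjt⟩ := truncLine_eq hmj (((h.anti l j hlj.le hj).trans
    (le_truncLine hml)).trans_lt (htlt j hlj hj))
  -- If line j at time s is at most the minimum of line l, the crossing with that level is the
  -- breakpoint. Otherwise line l is on its slanted part at s, and the crossing with slope m l is
  -- used.
  rcases le_or_gt (truncLine (m j) (X j) (K j) s) (K l) with hK | hK
  · refine ⟨_, ⟨l, hl, Or.inl rfl⟩, hge 0 hmj0 ?_, hle 0 ?_⟩
    · have := linear_le_truncLine (x := X j) (K := K j) (u := s) hmj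
      linarith
    · have := le_truncLine (x := X l) (K := K l) (u := t) hml
      linarith
  · obtain ⟨hml0, hsl, hls⟩ := truncLine_eq hml (hK.trans_le hsle)
    have h1 := linear_le_truncLine (x := X j) (K := K j) (u := s) hmj
    refine ⟨_, ⟨l, hl, Or.inr rfl⟩, hge (m l) ?_ (by linarith), hle (m l) ?_⟩
    · have hl1 : 1 ≤ l := by
        rcases Nat.eq_zero_or_pos l with rfl | h'
        · rw [h.zero] at hml0; exact absurd hml0 (lt_irrefl _)
        · exact h'
      by_contra hmm
      have hmm := not_lt.1 hmm
      have h2 := htlt j hlj hj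
      have h3 := linear_le_truncLine (x := X l) (K := K l) (u := t) hml
      have h4 : m j * (t - s) ≤ m l * (t - s) :=
        mul_le_mul_of_nonneg_right hmm (by linarith)
      linarith
    · exact linear_le_truncLine hml

theorem continuous_envelope (k : ℕ) (m X K : ℕ → ℝ) : Continuous (lineEnvelope k m X K) := by
  unfold lineEnvelope
  induction Finset.Icc 0 k using Finset.induction_on with
  | empty => simpa using continuous_const
  | insert a s ha ih =>
    simp only [Finset.fold_insert ha]
    refine Continuous.min ?_ ih
    unfold truncLine
    fun_prop

/-- As time grows, the line on the envelope cannot change to a later one by `increment_le`, and a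
change to an earlier one would produce a breakpoint by `exists_break_mem_Icc`. So a single line
realizes the envelope on the open interval. -/
theorem exists_eqOn (h : LineFamily k m X K) {u₀ t₁ t₂ : ℝ} (h₀ : u₀ ≤ t₁) (h12 : t₁ < t₂)
    (hbreak : ∀ x ∈ lineBreaks k m X K u₀, x ∉ Set.Ioo t₁ t₂) :
    ∃ l ≤ k, Set.EqOn (lineEnvelope k m X K) (truncLine (m l) (X l) (K l)) (Set.Icc t₁ t₂) := by
  have key : ∀ s t, t₁ < s → s < t → t < t₂ → ∀ l ≤ k, ∀ j ≤ k,
      lineEnvelope k m X K s = truncLine (m j) (X j) (K j) s →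
      (∀ i, j < i → i ≤ k → truncLine (m j) (X j) (K j) s < truncLine (m i) (X i) (K i) s) →
      lineEnvelope k m X K t = truncLine (m l) (X l) (K l) t →
      (∀ i, l < i → i ≤ k → truncLine (m l) (X l) (K l) t < truncLine (m i) (X i) (K i) t) →
      l = j := by
    intro s t hs hst ht l hl j hj e1 h1 e2 h2
    rcases lt_trichotomy l j with hlj | rfl | hlj
    · exfalso
      obtain ⟨x, hx, hsx, hxt⟩ := h.exists_break_mem_Icc (h₀.trans hs.le) hst hlj hj
        (e1 ▸ envelope_le (X := X) (K := K) (m := m) hl s) h2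
      exact hbreak x hx ⟨hs.trans_le hsx, hxt.trans_lt ht⟩
    · rfl
    · exfalso
      have h3 := h1 l hlj hl
      have h4 := h.increment_le hlj hl hst.le
      have h5 := envelope_le (X := X) (K := K) (m := m) hj t
      rw [e2] at h5
      linarith
  obtain ⟨l, hl, e, htop⟩ := h.exists_top ((t₁ + t₂) / 2)
  refine ⟨l, hl, ?_⟩
  have hopen : Set.EqOn (lineEnvelope k m X K) (truncLine (m l) (X l) (K l)) (Set.Ioo t₁ t₂) := by
    intro s hs
    obtain ⟨j, hj, e', htop'⟩ := h.exists_top s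
    have : l = j := by
      rcases lt_trichotomy s ((t₁ + t₂) / 2) with h' | h' | h'
      · exact key s _ hs.1 h' (by linarith) l hl j hj e' htop' e htop
      · subst h'
        rcases lt_trichotomy l j with hlj | hlj | hlj
        · have := htop j hlj hj; rw [← e, e'] at this; exact absurd this (lt_irrefl _)
        · exact hlj
        · have := htop' l hlj hl; rw [← e', e] at this; exact absurd this (lt_irrefl _)
      · exact (key _ s (by linarith) h' hs.2 j hj l hl e htop e' htop').symm
    rw [this, e']
  -- Breakpoints are excluded only from the open interval; its ends are reached by continuity.
  have := hopen.closure (continuous_envelope k m X K) (by unfold truncLine; fun_prop)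
  rwa [closure_Ioo h12.ne] at this

theorem piecewiseConvex (h : LineFamily k m X K) (u₀ : ℝ) :
    PiecewiseConvex (lineEnvelope k m X K) u₀ (lineBreaks k m X K u₀) := by
  intro t₁ t₂ h1 h2 h3
  obtain ⟨l, hl, he⟩ := h.exists_eqOn h1 h2 h3
  refine ConvexOn.congr ⟨convex_Icc _ _, fun x _ y _ p q hp hq hpq => ?_⟩ he.symm
  have hm := h.nonneg hl
  have h4 : max (p * x + q * y + X l) 0 ≤ p * max (x + X l) 0 + q * max (y + X l) 0 := by
    refine max_le ?_ (by positivity)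
    have e1 := mul_le_mul_of_nonneg_left (le_max_left (x + X l) 0) hp
    have e2 := mul_le_mul_of_nonneg_left (le_max_left (y + X l) 0) hq
    have e3 : p * x + q * y + X l = p * (x + X l) + q * (y + X l) := by
      have : p * (x + X l) + q * (y + X l) = p * x + q * y + (p + q) * X l := by ring
      rw [this, hpq, one_mul]
    linarith
  have h5 := mul_le_mul_of_nonneg_left h4 hm
  simp only [truncLine, smul_eq_mul]
  have e4 : p * (m l * max (x + X l) 0 + K l) + q * (m l * max (y + X l) 0 + K l) =
      m l * (p * max (x + X l) 0 + q * max (y + X l) 0) + (p + q) * K l := by ring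
  rw [e4, hpq, one_mul]
  linarith

end LineFamily

/-! ## The flow towards a sink from one side -/

/-- The vertices `1, …, k` on one side of a sink, with capacities `C`, locations `X`, and partial
sums `A` and `B` of the smallest and the largest weights; the vertex `idx`, if on this side, is to
have started to evacuate. -/
structure Side where
  C : ℕ → ℝ
  X : ℕ → ℝ
  A : ℕ → ℝ
  B : ℕ → ℝ
  k : ℕ
  idx : ℕ

namespace Side

/-- The data are those of a path. -/
structure WF (D : Side) : Prop where
  C_zero : D.C 0 = 0
  C_pos : ∀ t, 1 ≤ t → t ≤ D.k → 0 < D.C t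
  X_mono : ∀ i j, 1 ≤ i → i ≤ j → j ≤ D.k + 1 → D.X i ≤ D.X j
  A_zero : D.A 0 = 0
  B_zero : D.B 0 = 0
  A_step : ∀ l < D.k, 0 ≤ D.A (l + 1) - D.A l
  B_step : ∀ l < D.k, D.A (l + 1) - D.A l ≤ D.B (l + 1) - D.B l
  idx_pos : 1 ≤ D.idx

variable (D : Side)

/-- The slope belonging to vertex `l`. -/
noncomputable def slope (l : ℕ) : ℝ := bottleneck D.C D.k l

/-- The amount of flow that can be evacuated, in terms of the departure time from the origin. -/
noncomputable def carry : ℝ → ℝ := lineEnvelope D.k D.slope D.X fun l => D.B D.k - D.B l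

/-- The departure time from which on the smallest weights can be evacuated. -/
noncomputable def start : ℝ :=
  ((Finset.Icc 1 D.k).filter fun l => 0 < D.A l).fold max
    (if D.idx ≤ D.k then max (-D.X (D.k + 1)) (-D.X D.idx) else -D.X (D.k + 1))
    fun l => D.A l / D.slope l - D.X l

/-- The possible breakpoints of `carry`. -/
def breaks : Set ℝ := lineBreaks D.k D.slope D.X (fun l => D.B D.k - D.B l) D.start

/-- Weights within the given range, in terms of their partial sums. -/
structure Fits (W : ℕ → ℝ) : Prop where
  zero : W 0 = 0
  lower : ∀ l < D.k, D.A (l + 1) - D.A l ≤ W (l + 1) - W l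
  upper : ∀ l < D.k, W (l + 1) - W l ≤ D.B (l + 1) - D.B l

variable {D}

theorem WF.slope_pos (h : D.WF) {l : ℕ} (h1 : 1 ≤ l) (hl : l ≤ D.k) : 0 < D.slope l :=
  bottleneck_pos hl fun t h2 h3 => h.C_pos t (by omega) h3

theorem WF.slope_zero (h : D.WF) : D.slope 0 = 0 := by
  refine le_antisymm (h.C_zero ▸ bottleneck_le le_rfl (Nat.zero_le _))
    ((le_bottleneck (Nat.zero_le _)).2 fun t _ ht => ?_)
  rcases Nat.eq_zero_or_pos t with rfl | h'
  · rw [h.C_zero]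
  · exact (h.C_pos t h' ht).le

theorem diff_mono {f g : ℕ → ℝ} {k : ℕ} (h : ∀ l < k, f (l + 1) - f l ≤ g (l + 1) - g l) {i j : ℕ}
    (hij : i ≤ j) (hj : j ≤ k) : f j - f i ≤ g j - g i := by
  induction j, hij using Nat.le_induction with
  | base => simp
  | succ j hij ih => linarith [ih (by omega), h j (by omega)]

theorem WF.A_mono (h : D.WF) {i j : ℕ} (hij : i ≤ j) (hj : j ≤ D.k) : D.A i ≤ D.A j := by
  have := diff_mono (f := fun _ => 0) (g := D.A) (fun l hl => by simpa using h.A_step l hl) hij hj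
  linarith

theorem WF.B_mono (h : D.WF) {i j : ℕ} (hij : i ≤ j) (hj : j ≤ D.k) : D.B i ≤ D.B j := by
  have := diff_mono h.B_step hij hj
  linarith [h.A_mono hij hj]

theorem WF.A_nonneg (h : D.WF) {l : ℕ} (hl : l ≤ D.k) : 0 ≤ D.A l :=
  h.A_zero ▸ h.A_mono (Nat.zero_le _) hl

theorem WF.lineFamily (h : D.WF) : LineFamily D.k D.slope D.X fun l => D.B D.k - D.B l where
  zero := h.slope_zero
  mono i j hij hj := bottleneck_anti hij hj le_rfl
  anti i j hij hj := by linarith [h.B_mono hij hj]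
  loc i j hi hij hj := h.X_mono i j hi hij (by omega)

theorem WF.piecewiseConvex (h : D.WF) : PiecewiseConvex D.carry D.start D.breaks :=
  h.lineFamily.piecewiseConvex _

theorem breaks_finite (D : Side) : D.breaks.Finite := lineBreaks_finite _ _ _ _ _

theorem start_mem_breaks (D : Side) : D.start ∈ D.breaks := start_mem_lineBreaks _ _ _ _ _

theorem start_le_of_mem {x : ℝ} (h : x ∈ D.breaks) : D.start ≤ x := le_of_mem_lineBreaks h

theorem le_carry {u r : ℝ} : r ≤ D.carry u ↔ r ≤ D.B D.k - D.B 0 ∧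
    ∀ l ≤ D.k, r ≤ truncLine (D.slope l) (D.X l) (D.B D.k - D.B l) u :=
  le_lineEnvelope

theorem WF.carry_le (h : D.WF) (u : ℝ) : D.carry u ≤ D.B D.k := by
  have := (le_carry.1 (le_refl (D.carry u))).1
  rwa [h.B_zero, sub_zero] at this

theorem WF.carry_mono (h : D.WF) : Monotone D.carry := fun u v huv => by
  obtain ⟨h1, h2⟩ := le_carry.1 (le_refl (D.carry u))
  exact le_carry.2 ⟨h1, fun l hl => (h2 l hl).trans (truncLine_mono (h.lineFamily.nonneg hl) huv)⟩

/-- The first bound expresses that the total time is nonnegative for a sink not beyond location X (k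
+ 1). The second is the condition that flow from `idx` has time to leave, and the third is the
criterion for the smallest weights. -/
theorem WF.start_le (h : D.WF) {u : ℝ} : D.start ≤ u ↔ -D.X (D.k + 1) ≤ u ∧
    (D.idx ≤ D.k → -D.X D.idx ≤ u) ∧
    ∀ l, 1 ≤ l → l ≤ D.k → 0 < D.A l → D.A l ≤ D.slope l * (u + D.X l) := by
  have h1 : (if D.idx ≤ D.k then max (-D.X (D.k + 1)) (-D.X D.idx) else -D.X (D.k + 1)) ≤ u ↔
      -D.X (D.k + 1) ≤ u ∧ (D.idx ≤ D.k → -D.X D.idx ≤ u) := by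
    split_ifs with hi
    · simp [hi]
    · simp [hi]
  rw [start, Finset.fold_max_le, h1, and_assoc]
  refine and_congr_right fun _ => and_congr_right fun _ => ?_
  simp only [Finset.mem_filter, Finset.mem_Icc, and_imp]
  refine forall_congr' fun l => forall_congr' fun hl => forall_congr' fun hl' =>
    forall_congr' fun _ => ?_
  rw [← div_le_iff₀' (h.slope_pos hl hl'), sub_le_iff_le_add]

theorem Fits.le (h : D.WF) {W : ℕ → ℝ} (hW : D.Fits W) {l : ℕ} (hl : l ≤ D.k) : D.A l ≤ W l := by
  have := diff_mono hW.lower (Nat.zero_le l) hl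
  rw [hW.zero, h.A_zero] at this
  linarith

/-- For each l, W k is W l plus at most the largest weights after l, and W l is either nonpositive
or limited by the bottleneck. The truncation of line l covers both cases. -/
theorem Fits.le_carry (h : D.WF) {W : ℕ → ℝ} (hW : D.Fits W) {u : ℝ}
    (hu : UncertainPath.Movable D.C D.X W D.k u) : W D.k ≤ D.carry u := by
  rw [Side.le_carry]
  constructor
  · have := diff_mono hW.upper (Nat.zero_le D.k) le_rfl
    rw [hW.zero] at this
    linarith
  · intro l hl
    have h1 := diff_mono hW.upper hl le_rfl
    have h0 := h.lineFamily.nonneg hl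
    rcases le_or_gt (W l) 0 with h2 | h2
    · have := le_truncLine (x := D.X l) (K := D.B D.k - D.B l) (u := u) h0
      linarith
    · have hl1 : 1 ≤ l := by
        rcases Nat.eq_zero_or_pos l with rfl | h'
        · rw [hW.zero] at h2; exact absurd h2 (lt_irrefl _)
        · exact h'
      have h3 := hu l hl1 hl h2
      have := linear_le_truncLine (x := D.X l) (K := D.B D.k - D.B l) (u := u) h0
      simp only [slope] at *
      linarith

theorem Fits.start_le (h : D.WF) {W : ℕ → ℝ} (hW : D.Fits W) {u : ℝ}
    (hu : UncertainPath.Movable D.C D.X W D.k u) (hu0 : -D.X (D.k + 1) ≤ u)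
    (hidx : D.idx ≤ D.k → 0 < W D.idx) : D.start ≤ u := by
  rw [h.start_le]
  refine ⟨hu0, fun hi => ?_, fun l h1 h2 h3 => ?_⟩
  · have h4 := hu D.idx h.idx_pos hi (hidx hi)
    have h5 := (hidx hi).trans_le h4
    have := (pos_iff_pos_of_mul_pos h5).1 (h.slope_pos h.idx_pos hi)
    linarith
  · have h4 := hW.le h h2
    rcases (h3.trans_le h4) with h5
    exact h4.trans (hu l h1 h2 h5)

/-- The weights that let the largest amount of flow be evacuated in time. -/
theorem WF.exists_fits (h : D.WF) {u : ℝ} (hu : D.start < u) : ∃ W, D.Fits W ∧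
    UncertainPath.Movable D.C D.X W D.k u ∧ D.carry u ≤ W D.k := by
  obtain ⟨c1, c2⟩ := Side.le_carry.1 (le_refl (D.carry u))
  obtain ⟨-, -, s3⟩ := h.start_le.1 hu.le
  -- The vertices far from the sink get their smallest weights and those near it, from some vertex
  -- on, their largest: B grows at least as fast as A, so the second term overtakes the first at
  -- most once. Where A is attained, the criterion comes from `start`; elsewhere a positive value
  -- puts line l on its slanted part, which gives the criterion.
  refine ⟨fun l => max (D.A l) (D.carry u - (D.B D.k - D.B l)), ⟨?_, ?_, ?_⟩, ?_, ?_⟩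
  · simp only [h.A_zero]
    exact max_eq_left (by linarith)
  · intro l hl
    have h1 := h.B_step l hl
    have : max (D.A l) (D.carry u - (D.B D.k - D.B l)) ≤
        max (D.A (l + 1)) (D.carry u - (D.B D.k - D.B (l + 1))) - (D.A (l + 1) - D.A l) :=
      max_le (by linarith [le_max_left (D.A (l + 1)) (D.carry u - (D.B D.k - D.B (l + 1)))])
        (by linarith [le_max_right (D.A (l + 1)) (D.carry u - (D.B D.k - D.B (l + 1)))])
    linarith
  · intro l hl
    have h1 := h.B_step l hl
    have : max (D.A (l + 1)) (D.carry u - (D.B D.k - D.B (l + 1))) ≤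
        max (D.A l) (D.carry u - (D.B D.k - D.B l)) + (D.B (l + 1) - D.B l) :=
      max_le (by linarith [le_max_left (D.A l) (D.carry u - (D.B D.k - D.B l))])
        (by linarith [le_max_right (D.A l) (D.carry u - (D.B D.k - D.B l))])
    linarith
  · intro l h1 h2 h3
    rcases max_cases (D.A l) (D.carry u - (D.B D.k - D.B l)) with ⟨e, _⟩ | ⟨e, _⟩
    · dsimp only at h3 ⊢
      rw [e] at h3 ⊢
      exact s3 l h1 h2 h3
    · dsimp only at h3 ⊢
      rw [e] at h3 ⊢
      have h4 := c2 l h2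
      obtain ⟨-, -, h5⟩ := truncLine_eq (h.slope_pos h1 h2).le (lt_of_lt_of_le (by linarith) h4)
      rw [h5] at h4
      simp only [slope] at h4
      linarith
  · exact le_max_of_le_right (by linarith)

/-- If the weights after `idx` are fixed, then some flow from the vertices up to `idx` is
evacuated. -/
theorem WF.pos_of_fixed_after (h : D.WF) {u : ℝ} (hu : D.start < u) (hidx : D.idx ≤ D.k)
    (hfix : ∀ l, D.idx ≤ l → l ≤ D.k → D.B l - D.B D.idx = D.A l - D.A D.idx)
    (hpos : D.B (D.idx - 1) < D.B D.idx) {W : ℕ → ℝ} (hW : D.Fits W)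
    (hle : D.carry u ≤ W D.k) : 0 < W D.idx := by
  obtain ⟨-, s2, s3⟩ := h.start_le.1 (le_refl D.start)
  have s2 := s2 hidx
  have hi := h.idx_pos
  rcases (h.A_nonneg hidx).eq_or_lt with h0 | h0
  swap
  · exact h0.trans_le (hW.le h hidx)
  have h1 := diff_mono hW.upper hidx le_rfl
  -- At most this amount comes from the vertices after `idx`. Lines before `idx` start above it
  -- because `idx` has positive weight in B; the lines from `idx` on exceed it because u is strictly
  -- later than the start.
  suffices hlt : D.B D.k - D.B D.idx < D.carry u by linarith
  have hex : ∃ r, D.B D.k - D.B D.idx < r ∧ r ≤ D.carry u := by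
    have hl : ∀ l ≤ D.k, D.B D.k - D.B D.idx <
        truncLine (D.slope l) (D.X l) (D.B D.k - D.B l) u := by
      intro l hl
      have hnn := h.lineFamily.nonneg hl
      rcases lt_or_ge l D.idx with hlt | hge
      · have := h.B_mono (i := l) (j := D.idx - 1) (by omega) (by omega)
        have := le_truncLine (x := D.X l) (K := D.B D.k - D.B l) (u := u) hnn
        linarith
      · have hs := h.slope_pos (hi.trans hge) hl
        have hlin := linear_le_truncLine (x := D.X l) (K := D.B D.k - D.B l) (u := u) hnn
        have hf := hfix l hge hl
        rcases (h.A_nonneg hl).eq_or_lt with h2 | h2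
        · have hx := h.X_mono D.idx l hi hge (by omega)
          have := mul_pos hs (show 0 < u + D.X l by linarith)
          linarith
        · have h3 := s3 l (hi.trans hge) hl h2
          have : D.slope l * (D.start + D.X l) < D.slope l * (u + D.X l) :=
            mul_lt_mul_of_pos_left (by linarith) hs
          linarith
    obtain ⟨l, hlk, e, -⟩ := h.lineFamily.exists_top u
    exact ⟨D.carry u, by rw [carry, e]; exact hl l hlk, le_rfl⟩
  obtain ⟨r, hr1, hr2⟩ := hex
  linarith

/-- If the weights before `idx` are fixed, then more flow than theirs is evacuated. -/
theorem WF.lt_carry_of_fixed_before (h : D.WF) {u : ℝ} (hu : D.start < u) (hidx : D.idx ≤ D.k)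
    (hfix : ∀ l < D.idx, D.B l = D.A l) (hpos : D.B (D.idx - 1) < D.B D.idx) :
    D.A (D.idx - 1) < D.carry u := by
  obtain ⟨-, s2, s3⟩ := h.start_le.1 (le_refl D.start)
  have s2 := s2 hidx
  have hi := h.idx_pos
  have hl : ∀ l ≤ D.k, D.A (D.idx - 1) <
      truncLine (D.slope l) (D.X l) (D.B D.k - D.B l) u := by
    intro l hl
    have hnn := h.lineFamily.nonneg hl
    have hfx := hfix (D.idx - 1) (by omega)
    have hBk := h.B_mono hidx le_rfl
    have hlin := linear_le_truncLine (x := D.X l) (K := D.B D.k - D.B l) (u := u) hnn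
    have hKl := le_truncLine (x := D.X l) (K := D.B D.k - D.B l) (u := u) hnn
    have hstep : 0 < D.A l → D.A l < D.slope l * (u + D.X l) := by
      intro h2
      have hl1 : 1 ≤ l := by
        rcases Nat.eq_zero_or_pos l with rfl | h'
        · rw [h.A_zero] at h2; exact absurd h2 (lt_irrefl _)
        · exact h'
      have h3 := s3 l hl1 hl h2
      have : D.slope l * (D.start + D.X l) < D.slope l * (u + D.X l) :=
        mul_lt_mul_of_pos_left (by linarith) (h.slope_pos hl1 hl)
      linarith
    rcases lt_or_ge l D.idx with hlt | hge
    · have e := hfix l hlt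
      rcases (h.A_nonneg hl).eq_or_lt with h2 | h2
      · linarith
      · have := hstep h2
        linarith
    · have hB := h.B_mono hl le_rfl
      have hA := h.A_mono (i := D.idx - 1) (j := l) (by omega) hl
      rcases (h.A_nonneg hl).eq_or_lt with h2 | h2
      · have hx := h.X_mono D.idx l hi hge (by omega)
        have := mul_pos (h.slope_pos (hi.trans hge) hl) (show 0 < u + D.X l by linarith)
        linarith
      · have := hstep h2
        linarith
  obtain ⟨l, hlk, e, -⟩ := h.lineFamily.exists_top u
  rw [carry, e]; exact hl l hlk

/-- If the weights before `idx` are fixed, then `carry` is concave. -/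
theorem WF.concaveOn_of_fixed_before (h : D.WF) (hfix : ∀ l < D.idx, l ≤ D.k → D.B l = D.A l) :
    ConcaveOn ℝ (Set.Ici D.start) D.carry := by
  refine ⟨convex_Ici _, fun x hx y hy p q hp hq hpq => ?_⟩
  have hz : D.start ≤ p * x + q * y := by
    have h1 := mul_le_mul_of_nonneg_left (Set.mem_Ici.1 hx) hp
    have h2 := mul_le_mul_of_nonneg_left (Set.mem_Ici.1 hy) hq
    have h3 : p * D.start + q * D.start = D.start := by rw [← add_mul, hpq, one_mul]
    linarith
  have hcap : p * D.carry x + q * D.carry y ≤ D.B D.k := by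
    have h1 := mul_le_mul_of_nonneg_left (h.carry_le x) hp
    have h2 := mul_le_mul_of_nonneg_left (h.carry_le y) hq
    have h3 : p * D.B D.k + q * D.B D.k = D.B D.k := by rw [← add_mul, hpq, one_mul]
    linarith
  simp only [smul_eq_mul]
  refine Side.le_carry.2 ⟨by rwa [h.B_zero, sub_zero], fun l hl => ?_⟩
  have hnn := h.lineFamily.nonneg hl
  -- Lines before `idx` impose nothing beyond the cap B k: there A and B agree, and from the start
  -- on these lines have reached B k. Lines from `idx` on are past their kinks after the start, so
  -- they are linear.
  rcases lt_or_ge l D.idx with hlt | hge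
  · refine hcap.trans ?_
    have e := hfix l hlt hl
    rcases (h.A_nonneg hl).eq_or_lt with h2 | h2
    · have := le_truncLine (x := D.X l) (K := D.B D.k - D.B l) (u := p * x + q * y) hnn
      linarith
    · have hl1 : 1 ≤ l := by
        rcases Nat.eq_zero_or_pos l with rfl | h'
        · rw [h.A_zero] at h2; exact absurd h2 (lt_irrefl _)
        · exact h'
      have := (h.start_le.1 hz).2.2 l hl1 hl h2
      have := linear_le_truncLine (x := D.X l) (K := D.B D.k - D.B l) (u := p * x + q * y) hnn
      linarith
  · have hlin : ∀ z, D.start ≤ z → truncLine (D.slope l) (D.X l) (D.B D.k - D.B l) z =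
        D.slope l * (z + D.X l) + (D.B D.k - D.B l) := by
      intro z hz
      have h1 := (h.start_le.1 hz).2.1 (hge.trans hl)
      have h2 := h.X_mono D.idx l h.idx_pos hge (by omega)
      rw [truncLine, max_eq_left (by linarith)]
    have hx' := mul_le_mul_of_nonneg_left ((Side.le_carry.1 (le_refl (D.carry x))).2 l hl) hp
    have hy' := mul_le_mul_of_nonneg_left ((Side.le_carry.1 (le_refl (D.carry y))).2 l hl) hq
    rw [hlin x hx] at hx'
    rw [hlin y hy] at hy'
    rw [hlin _ hz]
    have e : p * (D.slope l * (x + D.X l) + (D.B D.k - D.B l)) +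
        q * (D.slope l * (y + D.X l) + (D.B D.k - D.B l)) =
        D.slope l * (p * x + q * y + (p + q) * D.X l) + (p + q) * (D.B D.k - D.B l) := by ring
    rw [hpq, one_mul, one_mul] at e
    linarith

end Side

/-! ### Maximization over the time at a vertex and inside an edge -/

namespace Side

variable {D L R : Side}

/-- The side without its last vertex. -/
def shrink (D : Side) : Side := { D with k := D.k - 1 }

/-- Without the last edge no bottleneck is smaller, and the amount lost is at most the largest
weight of the last vertex. This compares an evacuation just beside a vertex with one to the vertex
itself, where that weight is already present. -/
theorem carry_le_shrink (hk : 1 ≤ D.k) (u : ℝ) :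
    D.carry u ≤ D.shrink.carry u + (D.B D.k - D.B (D.k - 1)) := by
  obtain ⟨h1, h2⟩ := le_carry.1 (le_refl (D.carry u))
  rw [← sub_le_iff_le_add]
  refine le_carry.2 ⟨?_, fun l hl => ?_⟩
  · show _ ≤ D.B (D.k - 1) - D.B 0
    linarith
  · have hl' : l ≤ D.k - 1 := hl
    have h3 := h2 l (by omega)
    have h4 : D.slope l ≤ D.shrink.slope l := bottleneck_anti le_rfl hl' (Nat.sub_le _ _)
    have h5 := mul_le_mul_of_nonneg_right h4 (le_max_right (u + D.X l) 0)
    simp only [truncLine] at h3 ⊢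
    show _ ≤ D.shrink.slope l * max (u + D.X l) 0 + (D.B (D.k - 1) - D.B l)
    linarith

theorem WF.shrink (h : D.WF) : D.shrink.WF where
  C_zero := h.C_zero
  C_pos t h1 h2 := h.C_pos t h1 (h2.trans (Nat.sub_le _ _))
  X_mono i j h1 h2 h3 := h.X_mono i j h1 h2 (h3.trans (by simp [Side.shrink]))
  A_zero := h.A_zero
  B_zero := h.B_zero
  A_step l hl := h.A_step l (hl.trans_le (Nat.sub_le _ _))
  B_step l hl := h.B_step l (hl.trans_le (Nat.sub_le _ _))
  idx_pos := h.idx_pos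

/-- The start conditions only relax when the last vertex is dropped, except that the sink is now at
X k, which is the hypothesis `hX`. -/
theorem WF.shrink_start_le (h : D.WF) (hk : 1 ≤ D.k) {u : ℝ} (hu : D.start ≤ u)
    (hX : -D.X D.k ≤ u) : D.shrink.start ≤ u := by
  obtain ⟨h1, h2, h3⟩ := h.start_le.1 hu
  refine h.shrink.start_le.2 ⟨?_, fun hi => h2 (le_trans hi (Nat.sub_le _ _)),
    fun l hl1 hl hA => ?_⟩
  · show -D.X (D.k - 1 + 1) ≤ u
    rwa [Nat.sub_add_cancel hk]
  · have hl' : l ≤ D.k - 1 := hl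
    have h4 : D.slope l ≤ D.shrink.slope l := bottleneck_anti le_rfl hl' (Nat.sub_le _ _)
    have h5 := h3 l hl1 (by omega) hA
    have hA' : 0 < D.A l := hA
    have h6 := (pos_iff_pos_of_mul_pos (hA'.trans_le h5)).1 (h.slope_pos hl1 (by omega))
    exact h5.trans (mul_le_mul_of_nonneg_right h4 h6.le)

/-- The excess over `t` of the time needed, at rate `μ`, by a fixed amount of flow and the largest
amounts that can be evacuated from the two sides, is maximal at a breakpoint of one of the sides. -/
theorem exists_vertex_break (hL : L.WF) (hR : R.WF) {y z μ m t : ℝ} (hμ : 0 < μ)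
    (ht : max (L.start + y) (R.start + z) ≤ t) :
    ∃ t', ((∃ c ∈ L.breaks, t' = max (max (L.start + y) (R.start + z)) (c + y)) ∨
        (∃ c ∈ R.breaks, t' = max (max (L.start + y) (R.start + z)) (c + z))) ∧
      (L.carry (t - y) + m + R.carry (t - z)) / μ - t ≤
        (L.carry (t' - y) + m + R.carry (t' - z)) / μ - t' := by
  set t₀ := max (L.start + y) (R.start + z) with ht₀
  -- Breakpoints are clipped at `t₀` so that each candidate is feasible for both sides. The start of
  -- each side is one of its breakpoints, and so `t₀` itself is a candidate.
  set c : Set ℝ := ((fun x => max t₀ (x + y)) '' L.breaks) ∪ ((fun x => max t₀ (x + z)) '' R.breaks)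
    with hc
  have hF := ((hL.piecewiseConvex.comp_sub y).mono (t₀' := t₀) (d := c) (le_max_left _ _) (by
      rintro _ ⟨x, hx, rfl⟩ hlt
      exact Or.inl ⟨x, hx, max_eq_right hlt.le⟩)).add
    ((hR.piecewiseConvex.comp_sub z).mono (t₀' := t₀) (d := c) (le_max_right _ _) (by
      rintro _ ⟨x, hx, rfl⟩ hlt
      exact Or.inr ⟨x, hx, max_eq_right hlt.le⟩))
  rw [Set.union_self] at hF
  have hfin : c.Finite := (L.breaks_finite.image _).union (R.breaks_finite.image _)
  have hmem : t₀ ∈ c := by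
    rcases max_cases (L.start + y) (R.start + z) with ⟨e, _⟩ | ⟨e, _⟩
    · exact Or.inl ⟨_, L.start_mem_breaks, by
        show max t₀ (L.start + y) = t₀
        rw [ht₀, e, max_self]⟩
    · exact Or.inr ⟨_, R.start_mem_breaks, by
        show max t₀ (R.start + z) = t₀
        rw [ht₀, e, max_self]⟩
  obtain ⟨t', h1, -, h3⟩ := hF.exists_mem_le hfin hmem (a := 1 / μ) (b := 1)
    (M := L.B L.k + R.B R.k)
    (by positivity) one_pos (fun s => add_le_add (hL.carry_le _) (hR.carry_le _)) ht
  refine ⟨t', ?_, ?_⟩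
  · rcases h1 with ⟨x, hx, rfl⟩ | ⟨x, hx, rfl⟩
    · exact Or.inl ⟨x, hx, rfl⟩
    · exact Or.inr ⟨x, hx, rfl⟩
  · have e : ∀ a b : ℝ, (a + m + b) / μ = 1 / μ * (a + b) + m / μ := fun a b => by ring
    rw [e, e]
    linarith

/-- The objective is a function of u plus a function of v, and the constraint involves only v − u.
The function of v is concave with maximizer v₀, so moving v towards v₀ never lowers it. Either this
stops at an end of the interval, or v = v₀, and then the piecewise convex function of u is pushed to
a breakpoint or to an end. -/
theorem exists_edge_break (hL : L.WF) (hR : R.WF)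
    (hfix : ∀ l < R.idx, l ≤ R.k → R.B l = R.A l) {a b μ u v v₀ : ℝ} (hμ : 0 < μ)
    (hu : L.start ≤ u) (hv : R.start ≤ v) (ha : a ≤ v - u) (hb : v - u ≤ b)
    (hv₀ : R.start ≤ v₀)
    (hmax : ∀ c ∈ R.breaks, R.carry c / μ - c / 2 ≤ R.carry v₀ / μ - v₀ / 2) :
    ∃ u' v', L.start ≤ u' ∧ R.start ≤ v' ∧
      (L.carry u + R.carry v) / μ - (u + v) / 2 ≤
        (L.carry u' + R.carry v') / μ - (u' + v') / 2 ∧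
      ((u' ∈ L.breaks ∧ v' = v₀ ∧ a < v' - u' ∧ v' - u' < b) ∨ v' - u' = a ∨ v' - u' = b) := by
  have hmax' : ∀ w, R.start ≤ w → R.carry w / μ - w / 2 ≤ R.carry v₀ / μ - v₀ / 2 := by
    intro w hw
    obtain ⟨c, hc, -, hle⟩ := hR.piecewiseConvex.exists_mem_le R.breaks_finite R.start_mem_breaks
      (a := 1 / μ) (b := 1 / 2) (by positivity) (by norm_num) hR.carry_le hw
    have := hmax c hc
    have e : ∀ s : ℝ, s / μ = 1 / μ * s := fun s => by ring
    rw [e] at this ⊢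
    linarith
  have hconc : ∀ w w' w'', R.start ≤ w → w ≤ w' → w' ≤ w'' →
      min (R.carry w / μ - w / 2) (R.carry w'' / μ - w'' / 2) ≤ R.carry w' / μ - w' / 2 := by
    intro w w' w'' h1 h2 h3
    have hc : ConcaveOn ℝ (Set.Ici R.start) fun s => R.carry s / μ - s / 2 := by
      have h4 := (hR.concaveOn_of_fixed_before hfix).smul (c := μ⁻¹) (by positivity)
      refine ⟨convex_Ici _, fun x hx y hy p q hp hq hpq => ?_⟩
      have := h4.2 hx hy hp hq hpq
      simp only [smul_eq_mul] at this ⊢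
      simp only [div_eq_mul_inv _ μ]
      linarith
    exact hc.min_le_of_mem_Icc h1 (Set.mem_Ici.2 (h1.trans (h2.trans h3))) ⟨h2, h3⟩
  have hsplit : ∀ s s' : ℝ, (L.carry s + R.carry s') / μ - (s + s') / 2 =
      (L.carry s / μ - s / 2) + (R.carry s' / μ - s' / 2) := fun s s' => by ring
  simp only [hsplit]
  -- If v₀ violates one of the bounds for the given u, then the point on that bound lies between v
  -- and v₀; concavity makes it at least as good as v.
  rcases lt_or_ge b (v₀ - u) with h | hb'
  · refine ⟨u, u + b, hu, by linarith, ?_, Or.inr (Or.inr (by ring))⟩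
    have := hconc v (u + b) v₀ hv (by linarith) (by linarith)
    rw [min_eq_left (hmax' v hv)] at this
    linarith
  rcases lt_or_ge (v₀ - u) a with h | ha'
  · refine ⟨u, u + a, hu, by linarith, ?_, Or.inr (Or.inl (by ring))⟩
    have := hconc v₀ (u + a) v hv₀ (by linarith) (by linarith)
    rw [min_eq_right (hmax' v hv)] at this
    linarith
  -- With v = v₀ fixed, u ranges over [v₀ − b, v₀ − a].
  obtain ⟨u', h1, h2, h3, h4, h5⟩ := (hL.piecewiseConvex.mul_add_linear (a := 1 / μ) (by positivity)
    (-(1 / 2)) 0).exists_le L.breaks_finite L.start_mem_breaks (lo := v₀ - b) (hi := v₀ - a)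
    (t := u) (by linarith) (by linarith) hu
  have hval : L.carry u / μ - u / 2 ≤ L.carry u' / μ - u' / 2 := by
    have e : ∀ s : ℝ, s / μ = 1 / μ * s := fun s => by ring
    rw [e, e (L.carry u')]
    linarith
  refine ⟨u', v₀, h3, hv₀, by linarith [hmax' v hv], ?_⟩
  rcases h1.eq_or_lt with h1 | h1
  · exact Or.inr (Or.inr (by linarith))
  rcases h2.eq_or_lt with h2 | h2
  · exact Or.inr (Or.inl (by linarith))
  rcases h5 with h5 | h5 | h5
  · exact Or.inl ⟨h5, rfl, by linarith, by linarith⟩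
  · exact absurd h5 h1.ne'
  · exact absurd h5 h2.ne

end Side

/-! ### Scenarios that send the largest amount of flow to a given sink -/

namespace UncertainPath

variable {n : ℕ} (P : UncertainPath n)

/-- The largest weights for the first `i` vertices and the smallest ones for the others. -/
noncomputable def mixed (i j : ℕ) : ℝ := if j < i then extend P.whi j else extend P.wlo j

/-- The first `k` vertices. -/
noncomputable def leftSide (i k : ℕ) : Side where
  C := P.capac
  X := P.loc
  A := partialSum (extend P.wlo)
  B := partialSum (P.mixed i)
  k := k
  idx := i

/-- The last `k` vertices, seen from the other end. -/
noncomputable def rightSide (i k : ℕ) : Side where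
  C := P.rev.capac
  X := P.rev.loc
  A := partialSum (extend P.rev.wlo)
  B := partialSum fun j => P.mixed i (n - j)
  k := k
  idx := n + 2 - i

theorem extend_wlo_nonneg (j : ℕ) : 0 ≤ extend P.wlo j := extend_nonneg P.wlo_nonneg j

theorem extend_wlo_le_whi (j : ℕ) : extend P.wlo j ≤ extend P.whi j := by
  unfold extend; split_ifs
  · exact P.wlo_le_whi _
  · exact le_rfl

theorem extend_wlo_le_mixed (i j : ℕ) : extend P.wlo j ≤ P.mixed i j := by
  unfold mixed; split_ifs
  · exact P.extend_wlo_le_whi j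
  · exact le_rfl

theorem mixed_le (i j : ℕ) : P.mixed i j ≤ extend P.whi j := by
  unfold mixed; split_ifs
  · exact le_rfl
  · exact P.extend_wlo_le_whi j

theorem extend_rev_wlo {j : ℕ} (hj : j ≤ n) : extend P.rev.wlo j = extend P.wlo (n - j) := by
  have := extend_comp_rev P.wlo (j := j) (by omega)
  rwa [Nat.add_sub_cancel] at this

theorem leftSide_wf {i k : ℕ} (hi : 1 ≤ i) (hk : k ≤ n) : (P.leftSide i k).WF where
  C_zero := by simp [leftSide, capac]
  C_pos t h1 h2 := P.capac_pos h1 (h2.trans hk)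
  X_mono a b h1 h2 h3 := P.loc_mono h1 (h3.trans (by simpa [leftSide] using hk)) h2
  A_zero := by simp [leftSide, partialSum_zero]
  B_zero := by simp [leftSide, partialSum_zero]
  A_step l _ := by simpa [leftSide, partialSum_succ] using P.extend_wlo_nonneg l
  B_step l _ := by simpa [leftSide, partialSum_succ] using P.extend_wlo_le_mixed i l
  idx_pos := hi

theorem rightSide_wf {i k : ℕ} (hi : i ≤ n + 1) (hk : k ≤ n) : (P.rightSide i k).WF where
  C_zero := by simp [rightSide, capac]
  C_pos t h1 h2 := P.rev.capac_pos h1 (h2.trans hk)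
  X_mono a b h1 h2 h3 := P.rev.loc_mono h1 (h3.trans (by simpa [rightSide] using hk)) h2
  A_zero := by simp [rightSide, partialSum_zero]
  B_zero := by simp [rightSide, partialSum_zero]
  A_step l _ := by simpa [rightSide, partialSum_succ] using P.rev.extend_wlo_nonneg l
  B_step l hl := by
    simp only [rightSide] at hl
    simp only [rightSide, partialSum_succ, add_sub_cancel_left]
    rw [P.extend_rev_wlo (by omega)]
    exact P.extend_wlo_le_mixed i (n - l)
  idx_pos := by simp only [rightSide]; omega

/-- From the right end, vertex i has number n + 2 − i. The vertices seen before it are those after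
i, which have their smallest weights. -/
theorem rightSide_fixed_before {i k l : ℕ} (hl : l < (P.rightSide i k).idx) (hln : l ≤ n + 1) :
    (P.rightSide i k).B l = (P.rightSide i k).A l := by
  simp only [rightSide] at *
  refine Finset.sum_congr rfl fun j hj => ?_
  have hj := Finset.mem_range.1 hj
  rw [P.extend_rev_wlo (by omega)]
  exact if_neg (by omega)

theorem leftSide_fixed_after {i k l : ℕ} (hl : i ≤ l) :
    (P.leftSide i k).B l - (P.leftSide i k).B i = (P.leftSide i k).A l - (P.leftSide i k).A i := by
  simp only [leftSide]
  induction l, hl using Nat.le_induction with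
  | base => simp
  | succ l hl ih =>
    rw [partialSum_succ, partialSum_succ]
    have : P.mixed i l = extend P.wlo l := by rw [mixed, if_neg (by omega)]
    linarith

/-- The smallest possible weight of the vertices after `i`. -/
noncomputable def tail (i : ℕ) : ℝ :=
  partialSum (extend P.wlo) (n + 1) - partialSum (extend P.wlo) i

/-- There are `p` vertices to the left and `q` vertices to the right of the point `y`. -/
structure IsSlot (p q : ℕ) (y : ℝ) : Prop where
  left : P.LeftOf p y
  right : P.rev.LeftOf q (P.len - y)
  size : (p + q = n ∧ y = P.loc (p + 1)) ∨ p + q = n + 1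

/-- The largest amount of flow, from all vertices, that can be evacuated to `y` in time `t`. -/
noncomputable def slotWeight (i p q : ℕ) (y t : ℝ) : ℝ :=
  (P.leftSide i p).carry (t - y) + (if p + q = n then P.mixed i p else 0) +
    (P.rightSide i q).carry (t - (P.len - y))

theorem sum_eq_slot (w : Fin (n + 1) → ℝ) {p q : ℕ} (h : p + q = n ∨ p + q = n + 1) :
    partialSum (extend w) (n + 1) = partialSum (extend w) p +
      (if p + q = n then extend w p else 0) + partialSum (extend fun i => w i.rev) q := by
  rw [partialSum_extend_rev w (by omega)]
  rcases h with h | h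
  · rw [if_pos h, show n + 1 - q = p + 1 by omega, partialSum_succ _ p]; ring
  · rw [if_neg (by omega), show n + 1 - q = p by omega]; ring

variable {P}

/-- The extremal weights of the two sides are joined to one scenario. Positivity of the partial sum
at i must be included, since only positive partial sums bound Θ_L from below; this is why both
starts are required to be strictly earlier and the largest weight at i to be positive. -/
theorem IsSlot.exists_scenario {p q : ℕ} {y t : ℝ} (h : P.IsSlot p q y) {i : ℕ} (hi : 1 ≤ i)
    (hin : i ≤ n + 1) (hpos : 0 < extend P.whi (i - 1)) (hL : (P.leftSide i p).start < t - y)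
    (hR : (P.rightSide i q).start < t - (P.len - y)) :
    ∃ s ∈ P.scenarios, P.theta y s ≤ t ∧ 0 < partialSum (extend s) i ∧
      P.slotWeight i p q y t - P.tail i ≤ partialSum (extend s) i := by
  have hp := h.left.le
  have hq := h.right.le
  have hsize : p + q = n ∨ p + q = n + 1 := h.size.imp_left fun h => h.1
  have wL := P.leftSide_wf hi hp
  have wR := P.rightSide_wf hin hq
  obtain ⟨WL, fL, mL, cL⟩ := wL.exists_fits hL
  obtain ⟨WR, fR, mR, cR⟩ := wR.exists_fits hR
  change UncertainPath.Movable P.capac P.loc WL p (t - y) at mL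
  change UncertainPath.Movable P.rev.capac P.rev.loc WR q (t - (P.len - y)) at mR
  change (P.leftSide i p).carry (t - y) ≤ WL p at cL
  change (P.rightSide i q).carry (t - (P.len - y)) ≤ WR q at cR
  have lL : ∀ l < p, extend P.wlo l ≤ WL (l + 1) - WL l := fun l hl => by
    simpa [leftSide, partialSum_succ] using fL.lower l hl
  have uL : ∀ l < p, WL (l + 1) - WL l ≤ P.mixed i l := fun l hl => by
    simpa [leftSide, partialSum_succ] using fL.upper l hl
  have lR : ∀ l < q, extend P.wlo (n - l) ≤ WR (l + 1) - WR l := fun l hl => by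
    have := fR.lower l hl
    simp only [rightSide, partialSum_succ, add_sub_cancel_left] at this
    rwa [P.extend_rev_wlo (by omega)] at this
  have uR : ∀ l < q, WR (l + 1) - WR l ≤ P.mixed i (n - l) := fun l hl => by
    simpa [rightSide, partialSum_succ] using fR.upper l hl
  -- Weights are differences of partial sums, from the left before the sink and from the right after
  -- it. A vertex at the sink itself is unconstrained and gets its mixed weight.
  let f : ℕ → ℝ := fun j => if j < p then WL (j + 1) - WL j else
    if n - j < q then WR (n - j + 1) - WR (n - j) else P.mixed i j
  have hf : ∀ j ≤ n, extend P.wlo j ≤ f j ∧ f j ≤ P.mixed i j := by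
    intro j hj
    simp only [f]
    split_ifs with h1 h2
    · exact ⟨lL j h1, uL j h1⟩
    · have e : n - (n - j) = j := by omega
      exact ⟨by simpa [e] using lR _ h2, by simpa [e] using uR _ h2⟩
    · exact ⟨P.extend_wlo_le_mixed i j, le_rfl⟩
  let s : Fin (n + 1) → ℝ := fun j => f j
  have hs : ∀ j ≤ n, extend s j = f j := fun j hj => by simp [extend, s, Nat.lt_succ_of_le hj]
  have hsc : s ∈ P.scenarios := by
    intro j
    have h1 := hf j (by omega)
    have h2 := P.mixed_le i j
    rw [extend_val] at h1 h2
    exact ⟨h1.1, h1.2.trans h2⟩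
  have hs0 : ∀ j, 0 ≤ s j := fun j => (P.wlo_nonneg j).trans (hsc j).1
  have hSL : ∀ l ≤ p, partialSum (extend s) l = WL l := by
    intro l
    induction l with
    | zero => intro _; rw [partialSum_zero, fL.zero]
    | succ l ih =>
      intro hl
      rw [partialSum_succ, ih (by omega), hs l (by omega)]
      simp only [f, if_pos (show l < p by omega)]
      ring
  have hSR : ∀ l ≤ q, partialSum (extend fun j => s j.rev) l = WR l := by
    intro l
    induction l with
    | zero => intro _; rw [partialSum_zero, fR.zero]
    | succ l ih =>
      intro hl
      rw [partialSum_succ, ih (by omega), extend_comp_rev s (by omega), Nat.add_sub_cancel,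
        hs _ (by omega)]
      simp only [f, if_neg (show ¬ n - l < p by omega), show n - (n - l) = l by omega,
        if_pos (show l < q by omega)]
      ring
  -- After i the lower and upper bounds coincide, which fixes the weights there.
  have htail : partialSum (extend s) (n + 1) - partialSum (extend s) i = P.tail i := by
    have : ∀ m, i ≤ m → m ≤ n + 1 → partialSum (extend s) m - partialSum (extend s) i =
        partialSum (extend P.wlo) m - partialSum (extend P.wlo) i := by
      intro m him
      induction m, him using Nat.le_induction with
      | base => intro _; simp
      | succ m him ih =>
        intro hm
        rw [partialSum_succ, partialSum_succ, hs m (by omega)]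
        have h1 := hf m (by omega)
        have h2 : P.mixed i m = extend P.wlo m := by rw [mixed, if_neg (by omega)]
        have := ih (by omega)
        linarith [h1.1, h1.2]
    exact this _ hin le_rfl
  have hmid : p + q = n → extend s p = P.mixed i p := fun hpq => by
    rw [hs p hp]
    simp only [f, if_neg (lt_irrefl p), if_neg (show ¬ n - p < q by omega)]
  have htotal := sum_eq_slot s hsize
  rw [hSL p le_rfl, hSR q le_rfl] at htotal
  have hmid' : (if p + q = n then extend s p else 0) = if p + q = n then P.mixed i p else 0 := by
    split_ifs with hpq
    · exact hmid hpq
    · rfl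
  rw [hmid'] at htotal
  have hge : P.slotWeight i p q y t - P.tail i ≤ partialSum (extend s) i := by
    rw [slotWeight]; linarith
  have hmixi : P.mixed i (i - 1) = extend P.whi (i - 1) := by rw [mixed, if_pos (by omega)]
  -- Vertex i is left of the sink, right of it, or the sink. On the left `pos_of_fixed_after`
  -- applies; on the right the flow from that side exceeds the tail by `lt_carry_of_fixed_before`;
  -- at the sink the weight of i is its largest one.
  have hT : 0 ≤ t ∧ 0 < partialSum (extend s) i := by
    obtain ⟨sL1, sL2, -⟩ := wL.start_le.1 hL.le
    obtain ⟨sR1, sR2, -⟩ := wR.start_le.1 hR.le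
    change -P.loc (p + 1) ≤ t - y at sL1
    change i ≤ p → -P.loc i ≤ t - y at sL2
    change n + 2 - i ≤ q → -P.rev.loc (n + 2 - i) ≤ t - (P.len - y) at sR2
    rcases le_or_gt i p with hip | hip
    · have h1 := h.left.lt (by omega)
      have h2 := P.loc_mono hi (by omega : p ≤ n + 1) hip
      refine ⟨by linarith [sL2 hip], ?_⟩
      rw [hSL i hip]
      refine wL.pos_of_fixed_after hL hip (fun l h1 _ => P.leftSide_fixed_after h1) ?_ fL cL
      show partialSum (P.mixed i) (i - 1) < partialSum (P.mixed i) i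
      obtain ⟨j, rfl⟩ : ∃ j, i = j + 1 := ⟨i - 1, by omega⟩
      rw [partialSum_succ, Nat.add_sub_cancel]
      rw [Nat.add_sub_cancel] at hmixi hpos
      linarith
    · rcases le_or_gt (n + 2 - i) q with hiq | hiq
      · have h1 := h.right.lt (by omega)
        have h2 := P.rev.loc_mono (k := n + 2 - i) (l := q) (by omega) (by omega) hiq
        refine ⟨by linarith [sR2 hiq], ?_⟩
        have h3 := wR.lt_carry_of_fixed_before hR hiq
          (fun l hl => P.rightSide_fixed_before hl (by
            simp only [rightSide] at hl; omega)) (by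
            show partialSum (fun j => P.mixed i (n - j)) (n + 2 - i - 1) <
              partialSum (fun j => P.mixed i (n - j)) (n + 2 - i)
            rw [show n + 2 - i = n + 2 - i - 1 + 1 by omega, partialSum_succ, Nat.add_sub_cancel,
              show n - (n + 2 - i - 1) = i - 1 by omega]
            linarith)
        change partialSum (extend P.rev.wlo) (n + 2 - i - 1) < _ at h3
        have h4 := partialSum_extend_rev P.wlo (k := n + 2 - i - 1) (by omega)
        rw [show n + 1 - (n + 2 - i - 1) = i by omega] at h4
        have h5 : partialSum (extend P.rev.wlo) (n + 2 - i - 1) = P.tail i := h4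
        have h6 := partialSum_nonneg (extend_nonneg hs0) p
        rw [hSL p le_rfl] at h6
        have h7 : 0 ≤ (if p + q = n then P.mixed i p else 0) := by
          split_ifs
          · exact (P.extend_wlo_nonneg p).trans (P.extend_wlo_le_mixed i p)
          · exact le_rfl
        linarith
      · rcases h.size with ⟨hpq, hy⟩ | hpq
        · have hip' : i = p + 1 := by omega
          subst hip'
          refine ⟨by linarith, ?_⟩
          rw [partialSum_succ, hmid hpq]
          have := partialSum_nonneg (extend_nonneg hs0) p
          rw [Nat.add_sub_cancel] at hmixi hpos
          linarith
        · omega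
  refine ⟨s, hsc, (P.theta_le_iff hs0 h.left h.right hT.1).2 ⟨?_, ?_⟩, hT.2, hge⟩
  · intro l h1 h2
    rw [hSL l h2]
    exact mL l h1 h2
  · intro l h1 h2
    rw [hSR l h2]
    exact mR l h1 h2

/-- Converse to `exists_scenario`. Lowering all weights after i to their minima keeps the partial
sum at i and keeps the evacuation to y feasible, and the partial sums of the lowered weights obey
the bounds for `carry`. -/
theorem IsSlot.le_slotWeight {p q : ℕ} {y : ℝ} (h : P.IsSlot p q y) {i : ℕ} (hi : 1 ≤ i)
    (hin : i ≤ n + 1) {s : Fin (n + 1) → ℝ} (hs : s ∈ P.scenarios) (hpos : 0 < extend s (i - 1)) :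
    (P.leftSide i p).start ≤ P.theta y s - y ∧
    (P.rightSide i q).start ≤ P.theta y s - (P.len - y) ∧
    partialSum (extend s) i ≤ P.slotWeight i p q y (P.theta y s) - P.tail i := by
  have hp := h.left.le
  have hq := h.right.le
  have hsize : p + q = n ∨ p + q = n + 1 := h.size.imp_left fun h => h.1
  have wL := P.leftSide_wf hi hp
  have wR := P.rightSide_wf hin hq
  set t := P.theta y s with ht
  have ht0 : 0 ≤ t := P.theta_nonneg y s
  have hs0 : ∀ j, 0 ≤ s j := fun j => (P.wlo_nonneg j).trans (hs j).1
  obtain ⟨mL, mR⟩ := (P.theta_le_iff hs0 h.left h.right ht0).1 ht.ge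
  -- The scenario `s` with the weights after vertex i lowered.
  let r : Fin (n + 1) → ℝ := fun j => if j.val < i then s j else P.wlo j
  have hr : ∀ j ≤ n, extend r j = if j < i then extend s j else extend P.wlo j := fun j hj => by
    simp [extend, r, Nat.lt_succ_of_le hj]
  have hrs : ∀ j, r j ≤ s j := fun j => by
    simp only [r]; split_ifs
    · exact le_rfl
    · exact (hs j).1
  have hr0 : ∀ j, 0 ≤ r j := fun j => by
    simp only [r]; split_ifs
    · exact hs0 j
    · exact P.wlo_nonneg j
  have hbox : ∀ j ≤ n, extend P.wlo j ≤ extend r j ∧ extend r j ≤ P.mixed i j := by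
    intro j hj
    have hj' : j < n + 1 := by omega
    have hsj := hs ⟨j, hj'⟩
    rw [hr j hj]
    simp only [mixed, extend, dif_pos hj']
    split_ifs
    · exact hsj
    · exact ⟨le_rfl, le_rfl⟩
  have hle : ∀ (w w' : Fin (n + 1) → ℝ), (∀ j, w j ≤ w' j) → ∀ l,
      partialSum (extend w) l ≤ partialSum (extend w') l := fun w w' hw l =>
    Finset.sum_le_sum fun j _ => by
      unfold extend; split_ifs
      · exact hw _
      · exact le_rfl
  have mL' : UncertainPath.Movable P.capac P.loc (partialSum (extend r)) p (t - y) :=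
    fun l h1 h2 h3 => (hle r s hrs l).trans (mL l h1 h2 (h3.trans_le (hle r s hrs l)))
  have hle' := hle (fun j => r j.rev) (fun j => s j.rev) fun j => hrs j.rev
  have mR' : UncertainPath.Movable P.rev.capac P.rev.loc (partialSum (extend fun j => r j.rev)) q
      (t - (P.len - y)) :=
    fun l h1 h2 h3 => (hle' l).trans (mR l h1 h2 (h3.trans_le (hle' l)))
  have fL : (P.leftSide i p).Fits (partialSum (extend r)) := by
    refine ⟨partialSum_zero _, fun l hl => ?_, fun l hl => ?_⟩ <;>
    · change l < p at hl
      simp only [leftSide, partialSum_succ, add_sub_cancel_left]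
      have := hbox l (by omega)
      first | exact this.1 | exact this.2
  have fR : (P.rightSide i q).Fits (partialSum (extend fun j => r j.rev)) := by
    refine ⟨partialSum_zero _, fun l hl => ?_, fun l hl => ?_⟩ <;>
    · change l < q at hl
      simp only [rightSide, partialSum_succ, add_sub_cancel_left]
      have := hbox (n - l) (by omega)
      rw [extend_comp_rev r (by omega), Nat.add_sub_cancel]
      first
        | rw [P.extend_rev_wlo (by omega)]; exact this.1
        | exact this.2
  have hri : 0 < extend r (i - 1) := by rw [hr _ (by omega), if_pos (by omega)]; exact hpos
  have hposL : 0 < partialSum (extend r) i := by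
    obtain ⟨j, rfl⟩ : ∃ j, i = j + 1 := ⟨i - 1, by omega⟩
    rw [partialSum_succ]
    have := partialSum_nonneg (extend_nonneg hr0) j
    rw [Nat.add_sub_cancel] at hri
    linarith
  have hposR : 0 < partialSum (extend fun j => r j.rev) (n + 2 - i) := by
    rw [show n + 2 - i = n + 1 - i + 1 by omega, partialSum_succ,
      extend_comp_rev r (by omega), show n + 1 - 1 - (n + 1 - i) = i - 1 by omega]
    have := partialSum_nonneg (extend_nonneg fun j => hr0 (Fin.rev j)) (n + 1 - i)
    linarith
  have c1 := h.left.le_loc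
  have c2 := h.right.le_loc
  refine ⟨fL.start_le wL mL' ?_ fun _ => hposL, fR.start_le wR mR' ?_ fun _ => hposR, ?_⟩
  · show -P.loc (p + 1) ≤ t - y
    linarith
  · show -P.rev.loc (q + 1) ≤ t - (P.len - y)
    linarith
  · have cL := fL.le_carry wL mL'
    have cR := fR.le_carry wR mR'
    change partialSum (extend r) p ≤ (P.leftSide i p).carry (t - y) at cL
    change partialSum (extend fun j => r j.rev) q ≤ (P.rightSide i q).carry (t - (P.len - y)) at cR
    have htot := sum_eq_slot r hsize
    have hmid : (if p + q = n then extend r p else 0) ≤ if p + q = n then P.mixed i p else 0 := by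
      split_ifs
      · exact (hbox p hp).2
      · exact le_rfl
    have htail : partialSum (extend r) (n + 1) - partialSum (extend r) i = P.tail i := by
      have : ∀ m, i ≤ m → m ≤ n + 1 → partialSum (extend r) m - partialSum (extend r) i =
          partialSum (extend P.wlo) m - partialSum (extend P.wlo) i := by
        intro m him
        induction m, him using Nat.le_induction with
        | base => intro _; simp
        | succ m him ih =>
          intro hm
          rw [partialSum_succ, partialSum_succ, hr m (by omega), if_neg (by omega)]
          linarith [ih (by omega)]
      exact this _ hin le_rfl
    have hSi : partialSum (extend s) i = partialSum (extend r) i := by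
      refine Finset.sum_congr rfl fun j hj => ?_
      have hj := Finset.mem_range.1 hj
      rw [hr j (by omega), if_pos hj]
    rw [slotWeight, hSi]
    linarith

end UncertainPath

/-! ### The maximum regret as a function of the sink -/

namespace UncertainPath

variable {n : ℕ} (P : UncertainPath n)

theorem Movable.anti {C X S S' : ℕ → ℝ} {k : ℕ} {u : ℝ} (h : Movable C X S' k u)
    (hS : ∀ l, S l ≤ S' l) : Movable C X S k u :=
  fun l h1 h2 h3 => (hS l).trans (h l h1 h2 (h3.trans_le (hS l)))

theorem partialSum_extend_mono {m : ℕ} {w w' : Fin m → ℝ} (hw : ∀ j, w j ≤ w' j) (l : ℕ) :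
    partialSum (extend w) l ≤ partialSum (extend w') l :=
  Finset.sum_le_sum fun j _ => by
    unfold extend; split_ifs
    · exact hw _
    · exact le_rfl

variable {P} in
theorem scenario_nonneg {s : Fin (n + 1) → ℝ} (hs : s ∈ P.scenarios) (j : Fin (n + 1)) : 0 ≤ s j :=
  (P.wlo_nonneg j).trans (hs j).1

theorem whi_mem_scenarios : P.whi ∈ P.scenarios := fun i => ⟨P.wlo_le_whi i, le_rfl⟩

/-- Every point is a vertex or lies inside an edge. -/
theorem vertex_or_edge {x : ℝ} (hx : x ∈ P.points) :
    (∃ h, 1 ≤ h ∧ h ≤ n + 1 ∧ x = P.loc h) ∨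
      ∃ h, 1 ≤ h ∧ h ≤ n ∧ P.loc h < x ∧ x < P.loc (h + 1) := by
  rw [points_eq] at hx
  by_cases hn : ∃ h, 1 ≤ h ∧ h ≤ n + 1 ∧ x ≤ P.loc h
  · classical
    obtain ⟨h1, h2, h3⟩ := Nat.find_spec hn
    rcases h3.eq_or_lt with h3 | h3
    · exact Or.inl ⟨_, h1, h2, h3⟩
    · have h4 : Nat.find hn ≠ 1 := fun e => by
        rw [e, loc_one] at h3
        linarith [hx.1]
      have h5 := Nat.find_min hn (m := Nat.find hn - 1) (by omega)
      refine Or.inr ⟨Nat.find hn - 1, by omega, by omega, ?_, ?_⟩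
      · by_contra h6
        exact h5 ⟨by omega, by omega, not_lt.1 h6⟩
      · rwa [Nat.sub_add_cancel h1]
  · exact absurd ⟨n + 1, by omega, le_rfl, hx.2⟩ hn

theorem LeftOf.edge {h : ℕ} {y : ℝ} (hn : h ≤ n) (hlt : P.loc h < y) (hle : y ≤ P.loc (h + 1)) :
    P.LeftOf h y := ⟨hn, fun _ => hlt, hle⟩

theorem isSlot_vertex {h : ℕ} (h1 : 1 ≤ h) (hn : h ≤ n + 1) :
    P.IsSlot (h - 1) (n + 1 - h) (P.loc h) :=
  ⟨LeftOf.vertex P h1 hn, LeftOf.vertex_rev P h1 hn, Or.inl ⟨by omega,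
    by rw [Nat.sub_add_cancel h1]⟩⟩

theorem isSlot_edge {h : ℕ} {y : ℝ} (h1 : 1 ≤ h) (hn : h ≤ n) (hlt : P.loc h < y)
    (hgt : y < P.loc (h + 1)) : P.IsSlot h (n + 1 - h) y :=
  ⟨LeftOf.edge P hn hlt hgt.le, LeftOf.edge_rev P hn hlt.le hgt h1, Or.inr (by omega)⟩

theorem loc_mem_points {h : ℕ} (h1 : 1 ≤ h) (hn : h ≤ n + 1) : P.loc h ∈ P.points := by
  rw [points_eq]
  exact ⟨P.loc_one ▸ P.loc_mono le_rfl hn h1, P.loc_mono h1 le_rfl hn⟩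

theorem mem_points_of_edge {h : ℕ} {y : ℝ} (h1 : 1 ≤ h) (hn : h ≤ n) (hlt : P.loc h < y)
    (hgt : y < P.loc (h + 1)) : y ∈ P.points := by
  have h2 := P.loc_mem_points h1 (by omega)
  have h3 := P.loc_mem_points (h := h + 1) (by omega) (by omega)
  rw [points_eq] at *
  exact ⟨h2.1.trans hlt.le, hgt.le.trans h3.2⟩

theorem exists_isSlot {x : ℝ} (hx : x ∈ P.points) : ∃ p q, P.IsSlot p q x := by
  rcases P.vertex_or_edge hx with ⟨h, h1, h2, rfl⟩ | ⟨h, h1, h2, h3, h4⟩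
  · exact ⟨_, _, P.isSlot_vertex h1 h2⟩
  · exact ⟨_, _, P.isSlot_edge h1 h2 h3 h4⟩

variable {P}

theorem LeftOf.mem_points {k : ℕ} {x : ℝ} (h : P.LeftOf k x) (hk : 1 ≤ k) : x ∈ P.points := by
  have h2 := P.loc_mem_points hk (by have := h.le; omega)
  have h3 := P.loc_mem_points (h := k + 1) (by omega) (by have := h.le; omega)
  rw [points_eq] at *
  exact ⟨h2.1.trans (h.lt hk).le, h.le_loc.trans h3.2⟩

/-- A farther sink has longer routes, and its bottlenecks are no larger. -/
theorem thetaL_mono {s : Fin (n + 1) → ℝ} (hs : ∀ j, 0 ≤ s j) {k k' : ℕ} {x x' : ℝ}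
    (h : P.LeftOf k x) (h' : P.LeftOf k' x') (hk : k ≤ k') (hx : x ≤ x') :
    P.thetaL x s ≤ P.thetaL x' s := by
  refine (P.thetaL_le_iff hs h (P.thetaL_nonneg _ _)).2 fun l h1 h2 h3 => ?_
  have h4 := (P.thetaL_le_iff hs h' (P.thetaL_nonneg _ _)).1 le_rfl l h1 (h2.trans hk) h3
  have h5 : bottleneck P.capac k' l ≤ bottleneck P.capac k l := bottleneck_anti le_rfl h2 hk
  have h6 : 0 < bottleneck P.capac k' l := bottleneck_pos (h2.trans hk) fun t h1 h2 =>
    P.capac_pos (by omega) (h2.trans h'.le)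
  have h7 := (pos_iff_pos_of_mul_pos (h3.trans_le h4)).1 h6
  exact h4.trans (mul_le_mul h5 (by linarith) h7.le (h6.le.trans h5))

theorem LeftOf.le_of_lt {k k' : ℕ} {x x' : ℝ} (h : P.LeftOf k x) (h' : P.LeftOf k' x')
    (hx : x ≤ x') : k ≤ k' := by
  by_contra hlt
  have h1 := h.lt (by omega)
  have h2 := P.loc_mono (k := k' + 1) (l := k) (by omega) (by have := h.le; omega) (by omega)
  linarith [h'.le_loc]

/-- Bounds the regrets from above, so that the supremum defining the maximum regret is a genuine
one. -/
theorem theta_le_theta_whi {x : ℝ} (hx : x ∈ P.points) {s : Fin (n + 1) → ℝ}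
    (hs : s ∈ P.scenarios) : P.theta x s ≤ P.theta x P.whi := by
  obtain ⟨p, q, h⟩ := P.exists_isSlot hx
  obtain ⟨h1, h2⟩ := (P.theta_le_iff (scenario_nonneg P.whi_mem_scenarios) h.left h.right
    (P.theta_nonneg x P.whi)).1 le_rfl
  exact (P.theta_le_iff (scenario_nonneg hs) h.left h.right (P.theta_nonneg x P.whi)).2
    ⟨h1.anti (partialSum_extend_mono fun j => (hs j).2),
      h2.anti (partialSum_extend_mono fun j => (hs j.rev).2)⟩

theorem thetaOpt_le {y : ℝ} (hy : y ∈ P.points) (s : Fin (n + 1) → ℝ) :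
    P.thetaOpt s ≤ P.theta y s :=
  csInf_le ⟨0, by rintro _ ⟨z, -, rfl⟩; exact P.theta_nonneg z s⟩ ⟨y, hy, rfl⟩

theorem points_nonempty : P.points.Nonempty := ⟨_, P.loc_mem_points le_rfl (by omega)⟩

theorem le_thetaOpt {s : Fin (n + 1) → ℝ} {r : ℝ} (h : ∀ y ∈ P.points, r ≤ P.theta y s) :
    r ≤ P.thetaOpt s :=
  le_csInf (points_nonempty.image _) (by rintro _ ⟨y, hy, rfl⟩; exact h y hy)

theorem regret_le_maxRegret {x : ℝ} (hx : x ∈ P.points) {s : Fin (n + 1) → ℝ}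
    (hs : s ∈ P.scenarios) : P.regret x s ≤ P.maxRegret x := by
  refine le_csSup ⟨P.theta x P.whi, ?_⟩ ⟨s, hs, rfl⟩
  rintro _ ⟨s', hs', rfl⟩
  have := theta_le_theta_whi hx hs'
  have : 0 ≤ P.thetaOpt s' := le_thetaOpt fun y _ => P.theta_nonneg y s'
  simp only [regret]
  linarith

theorem maxRegret_nonneg {x : ℝ} (hx : x ∈ P.points) : 0 ≤ P.maxRegret x :=
  le_trans (sub_nonneg.2 (thetaOpt_le hx _)) (regret_le_maxRegret hx P.whi_mem_scenarios)

theorem maxRegret_le {x r : ℝ}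
    (h : ∀ s ∈ P.scenarios, ∀ y ∈ P.points, P.theta x s - P.theta y s ≤ r) :
    P.maxRegret x ≤ r := by
  refine csSup_le (Set.Nonempty.image _ ⟨_, P.whi_mem_scenarios⟩) ?_
  rintro _ ⟨s, hs, rfl⟩
  have := le_thetaOpt (s := s) (r := P.theta x s - r) fun y hy => by linarith [h s hs y hy]
  simp only [regret]
  linarith

theorem rev_scenario {s : Fin (n + 1) → ℝ} (hs : s ∈ P.rev.scenarios) :
    ∃ s' ∈ P.scenarios, s = fun i => s' i.rev :=
  ⟨fun i => s i.rev, by rwa [← P.rev.mem_scenarios_rev, rev_rev] at hs, by simp⟩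

theorem maxRegret_rev_le {x : ℝ} (hx : x ∈ P.points) :
    P.rev.maxRegret (P.len - x) ≤ P.maxRegret x := by
  refine maxRegret_le fun s hs y hy => ?_
  obtain ⟨s, hs', rfl⟩ := rev_scenario hs
  have h1 := P.rev.mem_points_rev.2 hy
  rw [len_rev, rev_rev] at h1
  have h2 := P.theta_rev s (P.len - y)
  rw [sub_sub_cancel] at h2
  rw [theta_rev, h2]
  refine le_trans ?_ (regret_le_maxRegret hx hs')
  have := thetaOpt_le h1 s
  simp only [regret]
  linarith

theorem maxRegret_rev {x : ℝ} (hx : x ∈ P.points) :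
    P.rev.maxRegret (P.len - x) = P.maxRegret x := by
  refine le_antisymm (maxRegret_rev_le hx) ?_
  have := maxRegret_rev_le (P.mem_points_rev.2 hx)
  rwa [rev_rev, len_rev, sub_sub_cancel] at this

variable (P)

/-- The excess over `t` of the time in which `w` units of flow, including all the flow from the
vertices after `i`, can be evacuated from the first `i` vertices to the end of edge `k`, up to the
location of the sink. -/
noncomputable def excess (i k : ℕ) (w t : ℝ) : ℝ :=
  (w - P.tail i) / bottleneck P.capac k i - t - P.loc i

/-- `r` is the excess of some evacuation. -/
def IsExcess (k : ℕ) (r : ℝ) : Prop := r = -P.loc (k + 1) ∨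
  ∃ i p q y t, 1 ≤ i ∧ i ≤ k ∧ 0 < extend P.whi (i - 1) ∧ P.IsSlot p q y ∧
    (P.leftSide i p).start ≤ t - y ∧ (P.rightSide i q).start ≤ t - (P.len - y) ∧
    r = P.excess i k (P.slotWeight i p q y t) t

/-- The first time at which the smallest weights can be evacuated to vertex `h`. -/
noncomputable def vertexStart (i h : ℕ) : ℝ :=
  max ((P.leftSide i (h - 1)).start + P.loc h)
    ((P.rightSide i (n + 1 - h)).start + (P.len - P.loc h))

/-- `r` is at least the excess of every evacuation to vertex `h` at a breakpoint. -/
def BoundsVertex (i k h : ℕ) (r : ℝ) : Prop :=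
  (∀ c ∈ (P.leftSide i (h - 1)).breaks, ∀ t, t = max (P.vertexStart i h) (c + P.loc h) →
    P.excess i k (P.slotWeight i (h - 1) (n + 1 - h) (P.loc h) t) t ≤ r) ∧
  ∀ c ∈ (P.rightSide i (n + 1 - h)).breaks, ∀ t,
    t = max (P.vertexStart i h) (c + (P.len - P.loc h)) →
    P.excess i k (P.slotWeight i (h - 1) (n + 1 - h) (P.loc h) t) t ≤ r

/-- `r` is at least the excess of every evacuation into edge `h` at a pair of breakpoints of which
the second one is optimal. -/
def BoundsEdge (i k h : ℕ) (r : ℝ) : Prop :=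
  ∃ v, (P.rightSide i (n + 1 - h)).start ≤ v ∧
    (∀ c ∈ (P.rightSide i (n + 1 - h)).breaks,
      (P.rightSide i (n + 1 - h)).carry c / bottleneck P.capac k i - c / 2 ≤
        (P.rightSide i (n + 1 - h)).carry v / bottleneck P.capac k i - v / 2) ∧
    ∀ u ∈ (P.leftSide i h).breaks, P.loc h < (v - u + P.len) / 2 →
      (v - u + P.len) / 2 < P.loc (h + 1) →
      P.excess i k ((P.leftSide i h).carry u + (P.rightSide i (n + 1 - h)).carry v)
        ((u + v + P.len) / 2) ≤ r

/-- `α k` is the largest excess for edge `k`. -/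
structure IsTable (α : ℕ → ℝ) : Prop where
  excess : ∀ k, 1 ≤ k → k ≤ n → P.IsExcess k (α k)
  vertex : ∀ i k h, 1 ≤ i → i ≤ k → k ≤ n → 0 < extend P.whi (i - 1) → 1 ≤ h → h ≤ n + 1 →
    P.BoundsVertex i k h (α k)
  edge : ∀ i k h, 1 ≤ i → i ≤ k → k ≤ n → 0 < extend P.whi (i - 1) → 1 ≤ h → h ≤ n →
    P.BoundsEdge i k h (α k)

variable {P}

theorem slotWeight_mono {i p q : ℕ} (hi : 1 ≤ i) (hin : i ≤ n + 1) (hp : p ≤ n)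
    (hq : q ≤ n) {y : ℝ} :
    Monotone (P.slotWeight i p q y) := fun t t' ht => by
  have h1 := (P.leftSide_wf hi hp).carry_mono (sub_le_sub_right ht y)
  have h2 := (P.rightSide_wf hin hq).carry_mono (sub_le_sub_right ht (P.len - y))
  simp only [slotWeight]
  linarith

/-- No entry of the table is too large. The value −loc (k + 1) is harmless because a maximum regret
is nonnegative, and the other excesses are approached by scenarios. Allowing x ≤ x' is what later
compares a vertex with the interiors of its edges. -/
theorem IsExcess.add_le_maxRegret {k : ℕ} {r : ℝ} (hr : P.IsExcess k r) (hk : 1 ≤ k) {x x' : ℝ}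
    (hx : P.LeftOf k x) {k' : ℕ} (hx' : P.LeftOf k' x') (hxx : x ≤ x') :
    x + r ≤ P.maxRegret x' := by
  have hkk := hx.le_of_lt hx' hxx
  have hmem := hx'.mem_points (hk.trans hkk)
  rcases hr with rfl | ⟨i, p, q, y, t, hi, hik, hpos, hs, hL, hR, rfl⟩
  · have := maxRegret_nonneg hmem
    linarith [hx.le_loc]
  · have hkn := hx.le
    -- The scenario exists only strictly after the start, so the time t is increased by ε; the
    -- amount of flow does not decrease.
    refine le_of_forall_pos_le_add fun ε hε => ?_
    obtain ⟨s, hsc, h1, h2, h3⟩ := hs.exists_scenario (t := t + ε) hi (by omega) hpos (by linarith)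
      (by linarith)
    have hs0 := scenario_nonneg hsc
    have h4 := le_thetaL P hs0 hx hi hik h2
    have h5 := thetaL_mono hs0 hx hx' hkk hxx
    have h6 := regret_le_maxRegret hmem hsc
    have hy : y ∈ P.points := by
      rw [points_eq]
      have h1 := hs.left.le_loc
      have h2 := hs.right.le_loc
      have hp := hs.left.le
      have hq := hs.right.le
      have h3 := P.loc_mono (k := p + 1) (l := n + 1) (by omega) le_rfl (by omega)
      have h4 := P.rev.loc_mono (k := q + 1) (l := n + 1) (by omega) le_rfl (by omega)
      have h5 : P.rev.loc (n + 1) = P.len := P.len_rev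
      exact ⟨by linarith, by linarith⟩
    have h7 := thetaOpt_le hy s
    have h8 : P.thetaL x' s ≤ P.theta x' s := le_max_left _ _
    have h9 := slotWeight_mono (P := P) (y := y) hi (by omega : i ≤ n + 1) hs.left.le hs.right.le
      (by linarith : t ≤ t + ε)
    have hb : 0 < bottleneck P.capac k i :=
      bottleneck_pos hik fun t h1 h2 => P.capac_pos (by omega) (by omega)
    have h10 : (P.slotWeight i p q y t - P.tail i) / bottleneck P.capac k i ≤
        partialSum (extend s) i / bottleneck P.capac k i := by
      gcongr; linarith
    simp only [excess, regret] at *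
    linarith

theorem BoundsVertex.excess_le {i k h : ℕ} {r : ℝ} (H : P.BoundsVertex i k h r) (hi : 1 ≤ i)
    (hik : i ≤ k) (hkn : k ≤ n) (h1 : 1 ≤ h) (hn : h ≤ n + 1) {t : ℝ}
    (hL : (P.leftSide i (h - 1)).start ≤ t - P.loc h)
    (hR : (P.rightSide i (n + 1 - h)).start ≤ t - (P.len - P.loc h)) :
    P.excess i k (P.slotWeight i (h - 1) (n + 1 - h) (P.loc h) t) t ≤ r := by
  have hb : 0 < bottleneck P.capac k i :=
    bottleneck_pos hik fun t h1 h2 => P.capac_pos (by omega) (by omega)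
  obtain ⟨t', h2, h3⟩ := Side.exists_vertex_break
    (m := if h - 1 + (n + 1 - h) = n then P.mixed i (h - 1) else 0)
    (P.leftSide_wf hi (by omega : h - 1 ≤ n))
    (P.rightSide_wf (by omega : i ≤ n + 1) (by omega : n + 1 - h ≤ n)) hb
    (max_le (by linarith) (by linarith) :
      max ((P.leftSide i (h - 1)).start + P.loc h)
        ((P.rightSide i (n + 1 - h)).start + (P.len - P.loc h)) ≤ t)
  have h4 : P.excess i k (P.slotWeight i (h - 1) (n + 1 - h) (P.loc h) t) t ≤
      P.excess i k (P.slotWeight i (h - 1) (n + 1 - h) (P.loc h) t') t' := by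
    simp only [excess, slotWeight, sub_div]
    linarith
  rcases h2 with ⟨c, hc, h2⟩ | ⟨c, hc, h2⟩
  · exact h4.trans (H.1 c hc t' h2)
  · exact h4.trans (H.2 c hc t' h2)

/-- The entry bounds the excess at every point, although the table is defined by breakpoints only.
Vertices are reduced by `exists_vertex_break` and inner points of edges by `exists_edge_break`. -/
theorem IsTable.excess_le {α : ℕ → ℝ} (H : P.IsTable α) {i k : ℕ} (hi : 1 ≤ i) (hik : i ≤ k)
    (hkn : k ≤ n) (hpos : 0 < extend P.whi (i - 1)) {y : ℝ} (hy : y ∈ P.points) :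
    ∃ p q, P.IsSlot p q y ∧ ∀ t, (P.leftSide i p).start ≤ t - y →
      (P.rightSide i q).start ≤ t - (P.len - y) →
      P.excess i k (P.slotWeight i p q y t) t ≤ α k := by
  rcases P.vertex_or_edge hy with ⟨h, h1, h2, rfl⟩ | ⟨h, h1, h2, h3, h4⟩
  · exact ⟨_, _, P.isSlot_vertex h1 h2, fun t hL hR =>
      (H.vertex i k h hi hik hkn hpos h1 h2).excess_le hi hik hkn h1 h2 hL hR⟩
  refine ⟨_, _, P.isSlot_edge h1 h2 h3 h4, fun t hL hR => ?_⟩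
  have hb : 0 < bottleneck P.capac k i :=
    bottleneck_pos hik fun t h1 h2 => P.capac_pos (by omega) (by omega)
  obtain ⟨v₀, hv₀, hmax, hedge⟩ := H.edge i k h hi hik hkn hpos h1 h2
  have wL := P.leftSide_wf hi h2
  have wR := P.rightSide_wf (by omega : i ≤ n + 1) (by omega : n + 1 - h ≤ n)
  -- From u = t − y and v = t − (len − y) it follows that v − u = 2 y − len, which gives the bounds
  -- for y between the ends of the edge.
  obtain ⟨u, v, hu, hv, hle, hcase⟩ := Side.exists_edge_break (a := 2 * P.loc h - P.len)
    (b := 2 * P.loc (h + 1) - P.len) wL wR (fun l hl hl' => P.rightSide_fixed_before hl (by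
      change l ≤ n + 1 - h at hl'; omega)) hb hL hR (by linarith) (by linarith) hv₀ hmax
  have hw : P.excess i k (P.slotWeight i h (n + 1 - h) y t) t ≤
      P.excess i k ((P.leftSide i h).carry u + (P.rightSide i (n + 1 - h)).carry v)
        ((u + v + P.len) / 2) := by
    simp only [UncertainPath.excess, slotWeight, if_neg (show h + (n + 1 - h) ≠ n by omega),
        sub_div, add_zero]
    linarith
  refine hw.trans ?_
  rcases hcase with ⟨hub, rfl, ha, hb'⟩ | hy | hy
  · exact hedge u hub (by linarith) (by linarith)
  -- Here y is the left end of the edge. Vertex h leaves the left side and becomes the sink; its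
  -- mixed weight moves to the middle term. The last case is the mirror image at the right end.
  · have hT : u = (u + v + P.len) / 2 - P.loc h := by linarith
    have hT' : v = (u + v + P.len) / 2 - (P.len - P.loc h) := by linarith
    have hX : -(P.leftSide i h).X (P.leftSide i h).k ≤ u := by
      have h5 := (wR.start_le.1 hv).1
      change -P.rev.loc (n + 1 - h + 1) ≤ v at h5
      rw [loc_rev _ (by omega) (by omega), show n + 2 - (n + 1 - h + 1) = h by omega] at h5
      change -P.loc h ≤ u
      linarith
    have h5 := wL.shrink_start_le h1 hu hX
    have h6 := (P.leftSide i h).carry_le_shrink h1 u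
    change (P.leftSide i (h - 1)).start ≤ u at h5
    change (P.leftSide i h).carry u ≤ (P.leftSide i (h - 1)).carry u +
      (partialSum (P.mixed i) h - partialSum (P.mixed i) (h - 1)) at h6
    have h7 : partialSum (P.mixed i) h - partialSum (P.mixed i) (h - 1) = P.mixed i (h - 1) := by
      obtain ⟨j, rfl⟩ : ∃ j, h = j + 1 := ⟨h - 1, by omega⟩
      rw [partialSum_succ, Nat.add_sub_cancel]; ring
    refine le_trans ?_ ((H.vertex i k h hi hik hkn hpos h1 (by omega)).excess_le hi hik hkn h1
      (by omega) (t := (u + v + P.len) / 2) (by rwa [← hT]) (by rwa [← hT']))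
    simp only [UncertainPath.excess, slotWeight, if_pos (show h - 1 + (n + 1 - h) = n by omega),
        ← hT, ← hT']
    gcongr
    linarith
  · have hT : u = (u + v + P.len) / 2 - P.loc (h + 1) := by linarith
    have hT' : v = (u + v + P.len) / 2 - (P.len - P.loc (h + 1)) := by linarith
    have hX : -(P.rightSide i (n + 1 - h)).X (P.rightSide i (n + 1 - h)).k ≤ v := by
      have h5 := (wL.start_le.1 hu).1
      change -P.loc (h + 1) ≤ u at h5
      change -P.rev.loc (n + 1 - h) ≤ v
      rw [loc_rev _ (by omega) (by omega), show n + 2 - (n + 1 - h) = h + 1 by omega]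
      linarith
    have h5 := wR.shrink_start_le (by show 1 ≤ n + 1 - h; omega) hv hX
    have h6 := (P.rightSide i (n + 1 - h)).carry_le_shrink (by show 1 ≤ n + 1 - h; omega) v
    change (P.rightSide i (n + 1 - h - 1)).start ≤ v at h5
    change (P.rightSide i (n + 1 - h)).carry v ≤ (P.rightSide i (n + 1 - h - 1)).carry v +
      (partialSum (fun j => P.mixed i (n - j)) (n + 1 - h) -
        partialSum (fun j => P.mixed i (n - j)) (n + 1 - h - 1)) at h6
    have h7 : partialSum (fun j => P.mixed i (n - j)) (n + 1 - h) -
        partialSum (fun j => P.mixed i (n - j)) (n + 1 - h - 1) = P.mixed i h := by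
      rw [show n + 1 - h = n - h + 1 by omega, partialSum_succ, Nat.add_sub_cancel,
        show n - (n - h) = h by omega]; ring
    have hV := H.vertex i k (h + 1) hi hik hkn hpos (by omega) (by omega)
    have e : n + 1 - h - 1 = n + 1 - (h + 1) := by omega
    rw [e] at h5 h6
    refine le_trans ?_ (hV.excess_le hi hik hkn (by omega)
      (by omega) (t := (u + v + P.len) / 2) (by rwa [← hT, Nat.add_sub_cancel]) (by rwa [← hT']))
    simp only [UncertainPath.excess, slotWeight, Nat.add_sub_cancel,
      if_pos (show h + (n + 1 - (h + 1)) = n by omega), ← hT, ← hT']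
    rw [e] at h7
    rw [h7] at h6
    exact sub_le_sub_right (sub_le_sub_right (div_le_div_of_nonneg_right (by linarith) hb.le) _) _

/-- No entry of the table is too small: the vertex that realizes Θ_L has positive weight, so
`le_slotWeight` turns its term into an excess that is bounded by the table. -/
theorem IsTable.thetaL_sub_le {α : ℕ → ℝ} (H : P.IsTable α) {s : Fin (n + 1) → ℝ}
    (hs : s ∈ P.scenarios) {k : ℕ} {x y : ℝ} (hx : P.LeftOf k x) (hy : y ∈ P.points)
    (hlt : 0 < P.thetaL x s) : 1 ≤ k ∧ P.thetaL x s - P.theta y s ≤ x + α k := by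
  obtain ⟨i, hi, hik, hpos, hle⟩ := P.exists_thetaL_le (scenario_nonneg hs) hx hlt
  have hkn := hx.le
  have hpos' : 0 < extend P.whi (i - 1) := by
    have := (hs ⟨i - 1, by omega⟩).2
    rw [← extend_val s, ← extend_val P.whi] at this
    exact hpos.trans_le this
  obtain ⟨p, q, hslot, hbound⟩ := H.excess_le hi hik hkn hpos' hy
  obtain ⟨h1, h2, h3⟩ := hslot.le_slotWeight hi (by omega) hs hpos
  have h4 := hbound _ h1 h2
  have hb : 0 < bottleneck P.capac k i :=
    bottleneck_pos hik fun t h1 h2 => P.capac_pos (by omega) (by omega)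
  have h5 : partialSum (extend s) i / bottleneck P.capac k i ≤
    (P.slotWeight i p q y (P.theta y s) - P.tail i) / bottleneck P.capac k i := by gcongr
  simp only [UncertainPath.excess] at h4
  exact ⟨hi.trans hik, by linarith⟩

/-- The contribution to the maximum regret of the scenarios in which the flow from one side is the
last to arrive. -/
noncomputable def sideRegret (α : ℕ → ℝ) (k : ℕ) (x : ℝ) : ℝ := if k = 0 then 0 else max 0 (x + α k)

theorem IsTable.sideRegret_le {α : ℕ → ℝ} (H : P.IsTable α) {k k' : ℕ} {x x' : ℝ}
    (hx : P.LeftOf k x) (hx' : P.LeftOf k' x') (hxx : x ≤ x') (hmem : x' ∈ P.points) :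
    sideRegret α k x ≤ P.maxRegret x' := by
  unfold sideRegret
  split_ifs with h
  · exact maxRegret_nonneg hmem
  · exact max_le (maxRegret_nonneg hmem) ((H.excess k (by omega) hx.le).add_le_maxRegret (by omega)
      hx hx' hxx)

theorem IsTable.thetaL_sub_le_sideRegret {α : ℕ → ℝ} (H : P.IsTable α) {s : Fin (n + 1) → ℝ}
    (hs : s ∈ P.scenarios) {k : ℕ} {x y : ℝ} (hx : P.LeftOf k x) (hy : y ∈ P.points) :
    P.thetaL x s - P.theta y s ≤ sideRegret α k x := by
  have h0 := P.theta_nonneg y s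
  rcases (P.thetaL_nonneg x s).eq_or_lt with h | h
  · rw [← h]
    unfold sideRegret
    split_ifs
    · linarith
    · exact le_max_of_le_left (by linarith)
  · obtain ⟨h1, h2⟩ := H.thetaL_sub_le hs hx hy h
    rw [sideRegret, if_neg (by omega)]
    exact le_max_of_le_right h2

/-- The evacuation time is the maximum of those of the two sides, and for each side the scenario and
the rival sink are maximized together. The table β belongs to the reversed path. -/
theorem maxRegret_eq {α β : ℕ → ℝ} (Hα : P.IsTable α) (Hβ : P.rev.IsTable β) {p q : ℕ} {x : ℝ}
    (hx : x ∈ P.points) (hp : P.LeftOf p x) (hq : P.rev.LeftOf q (P.len - x)) :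
    P.maxRegret x = max (sideRegret α p x) (sideRegret β q (P.len - x)) := by
  refine le_antisymm (maxRegret_le fun s hs y hy => ?_) (max_le ?_ ?_)
  · rw [theta, sub_le_iff_le_add]
    refine max_le ?_ ?_
    · have := Hα.thetaL_sub_le_sideRegret hs hp hy
      linarith [le_max_left (sideRegret α p x) (sideRegret β q (P.len - x))]
    · have := Hβ.thetaL_sub_le_sideRegret (P.mem_scenarios_rev.2 hs) hq (P.mem_points_rev.2 hy)
      rw [theta_rev, ← thetaR_eq] at this
      linarith [le_max_right (sideRegret α p x) (sideRegret β q (P.len - x))]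
  · exact Hα.sideRegret_le hp hp le_rfl hx
  · rw [← maxRegret_rev hx]
    exact Hβ.sideRegret_le hq hq le_rfl (P.mem_points_rev.2 hx)

variable (P)

/-- The maximum regret at vertex `h`. -/
noncomputable def vertexRegret (α β : ℕ → ℝ) (h : ℕ) : ℝ :=
  max (sideRegret α (h - 1) (P.loc h)) (sideRegret β (n + 1 - h) (P.len - P.loc h))

/-- The point at which the regrets from both sides are equal if it lies in edge `h`. -/
noncomputable def balance (α β : ℕ → ℝ) (h : ℕ) : ℝ := (P.len + β (n + 1 - h) - α h) / 2

variable {P}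

theorem maxRegret_loc {α β : ℕ → ℝ} (Hα : P.IsTable α) (Hβ : P.rev.IsTable β) {h : ℕ} (h1 : 1 ≤ h)
    (hn : h ≤ n + 1) : P.maxRegret (P.loc h) = P.vertexRegret α β h :=
  maxRegret_eq Hα Hβ (P.loc_mem_points h1 hn) (LeftOf.vertex P h1 hn) (LeftOf.vertex_rev P h1 hn)

theorem maxRegret_edge {α β : ℕ → ℝ} (Hα : P.IsTable α) (Hβ : P.rev.IsTable β) {h : ℕ} (h1 : 1 ≤ h)
    (hn : h ≤ n) {x : ℝ} (hlt : P.loc h < x) (hgt : x < P.loc (h + 1)) :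
    P.maxRegret x = max 0 (max (x + α h) (P.len - x + β (n + 1 - h))) := by
  rw [maxRegret_eq Hα Hβ (P.mem_points_of_edge h1 hn hlt hgt) (LeftOf.edge P hn hlt hgt.le)
    (LeftOf.edge_rev P hn hlt.le hgt h1), sideRegret, sideRegret, if_neg (by omega),
    if_neg (by omega), max_max_max_comm, max_self]

theorem maxRegret_balance {α β : ℕ → ℝ} (Hα : P.IsTable α) (Hβ : P.rev.IsTable β) {h : ℕ}
    (h1 : 1 ≤ h) (hn : h ≤ n) (hlt : P.loc h < P.balance α β h)
    (hgt : P.balance α β h < P.loc (h + 1)) :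
    P.maxRegret (P.balance α β h) = max 0 (P.balance α β h + α h) := by
  rw [maxRegret_edge Hα Hβ h1 hn hlt hgt, show P.len - P.balance α β h + β (n + 1 - h) =
    P.balance α β h + α h by rw [balance]; ring, max_self]

/-- Inside an edge the maximum regret is convex, with lines of slopes 1 and −1 crossing at the
balance point. If that point is inside the edge, it is optimal there; otherwise the end of the edge
nearer to it is at least as good as the whole interior. -/
theorem isLeast_of_le {α β : ℕ → ℝ} (Hα : P.IsTable α) (Hβ : P.rev.IsTable β) {x : ℝ}
    (hx : x ∈ P.points) (hv : ∀ h, 1 ≤ h → h ≤ n + 1 → P.maxRegret x ≤ P.vertexRegret α β h)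
    (he : ∀ h, 1 ≤ h → h ≤ n → P.loc h < P.balance α β h → P.balance α β h < P.loc (h + 1) →
      P.maxRegret x ≤ max 0 (P.balance α β h + α h)) :
    IsLeast (P.maxRegret '' P.points) (P.maxRegret x) := by
  refine ⟨⟨x, hx, rfl⟩, ?_⟩
  rintro _ ⟨z, hz, rfl⟩
  rcases P.vertex_or_edge hz with ⟨h, h1, h2, rfl⟩ | ⟨h, h1, h2, h3, h4⟩
  · rw [maxRegret_loc Hα Hβ h1 h2]
    exact hv h h1 h2
  have hmem := P.mem_points_rev.2 hz
  have hzL := LeftOf.edge P h2 h3 h4.le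
  have hzR := LeftOf.edge_rev P h2 h3.le h4 h1
  have hEq := maxRegret_edge Hα Hβ h1 h2 h3 h4
  have hb : P.balance α β h = (P.len + β (n + 1 - h) - α h) / 2 := rfl
  -- At a vertex one side is seen through a different edge than from inside edge h. There
  -- `sideRegret_le` for two sinks is used; for the other side the formulas are compared directly.
  rcases le_or_gt (P.balance α β h) (P.loc h) with hle | hlt
  · refine (hv h h1 (by omega)).trans (max_le ?_ ?_)
    · exact Hα.sideRegret_le (LeftOf.vertex P h1 (by omega)) hzL h3.le hz
    · rw [sideRegret, if_neg (by omega), hEq]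
      exact max_le_max_left _ (le_max_of_le_left (by linarith))
  rcases le_or_gt (P.loc (h + 1)) (P.balance α β h) with hge | hgt
  · refine (hv (h + 1) (by omega) (by omega)).trans (max_le ?_ ?_)
    · rw [Nat.add_sub_cancel, sideRegret, if_neg (by omega), hEq]
      exact max_le_max_left _ (le_max_of_le_right (by linarith))
    · rw [← maxRegret_rev hz]
      exact Hβ.sideRegret_le (LeftOf.vertex_rev P (by omega) (by omega)) hzR (by linarith) hmem
  · refine (he h h1 h2 hlt hgt).trans ?_
    rw [hEq]
    refine max_le_max_left _ ?_
    rcases le_total (P.balance α β h) z with h5 | h5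
    · exact le_max_of_le_left (by linarith)
    · exact le_max_of_le_right (by linarith)

end UncertainPath

/-! ### Proof rules for loops -/

namespace RealRAM

namespace Store

variable (σ : Store) (v w m k : ℕ) (x y : ℝ) (a : Fin 32)

@[simp] theorem setI_I : (σ.setI v m).I = Function.update σ.I v m := rfl
@[simp] theorem setI_R : (σ.setI v m).R = σ.R := rfl
@[simp] theorem setI_A : (σ.setI v m).A = σ.A := rfl
@[simp] theorem setR_I : (σ.setR v x).I = σ.I := rfl
@[simp] theorem setR_R : (σ.setR v x).R = Function.update σ.R v x := rfl
@[simp] theorem setR_A : (σ.setR v x).A = σ.A := rfl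
@[simp] theorem setA_I : (σ.setA a m x).I = σ.I := rfl
@[simp] theorem setA_R : (σ.setA a m x).R = σ.R := rfl
@[simp] theorem setA_A : (σ.setA a m x).A = Function.update σ.A a (Function.update (σ.A a) m x) :=
  rfl

theorem setI_setI : (σ.setI v m).setI v k = σ.setI v k := by simp [setI]

theorem setR_setR : (σ.setR v x).setR v y = σ.setR v y := by simp [setR]

theorem setR_self : σ.setR v (σ.R v) = σ := by simp [setR]

end Store

/-- `τ` differs from `σ` only in variables and arrays to which `c` may assign. -/
structure Cmd.Frame (c : Cmd) (σ τ : Store) : Prop where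
  onI : ∀ x, c.writesI x = false → τ.I x = σ.I x
  onR : ∀ x, c.writesR x = false → τ.R x = σ.R x
  onA : ∀ x, c.writesA x = false → τ.A x = σ.A x

theorem Cmd.frame (c : Cmd) (σ : Store) : c.Frame σ (c.run σ) :=
  ⟨fun _ h => run_I_of_not_writesI h σ, fun _ h => run_R_of_not_writesR h σ,
    fun _ h => run_A_of_not_writesA h σ⟩

theorem iterate_frame (c : Cmd) (v : ℕ) (σ : Store) (k : ℕ) :
    (Cmd.loop v c).Frame σ (iterate c.run v σ k) := by
  induction k with
  | zero =>
    refine ⟨fun x h => ?_, fun _ _ => rfl, fun _ _ => rfl⟩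
    simp only [Cmd.writesI, Bool.or_eq_false_iff, beq_eq_false_iff_ne] at h
    simp [iterate, Function.update_of_ne h.1.symm]
  | succ k ih =>
    refine ⟨fun x h => ?_, fun x h => ?_, fun x h => ?_⟩
    · have h' := h
      simp only [Cmd.writesI, Bool.or_eq_false_iff, beq_eq_false_iff_ne] at h'
      simp [iterate, Function.update_of_ne h'.1.symm, Cmd.run_I_of_not_writesI h'.2, ih.onI x h]
    · exact (Cmd.run_R_of_not_writesR (c := c) h _).trans (ih.onR x h)
    · exact (Cmd.run_A_of_not_writesA (c := c) h _).trans (ih.onA x h)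

/-- Induction over the rounds of a loop. -/
theorem loop_induct {c : Cmd} {v : ℕ} {σ : Store} (Q : ℕ → Store → Prop)
    (h0 : Q 0 (σ.setI v 0))
    (hstep : ∀ k < σ.rounds, ∀ τ, (Cmd.loop v c).Frame σ τ → τ.I v = k → Q k τ →
      Q (k + 1) ((c.run τ).setI v (k + 1))) :
    Q σ.rounds ((Cmd.loop v c).run σ) := by
  have key : ∀ k ≤ σ.rounds, Q k (iterate c.run v σ k) := by
    intro k
    induction k with
    | zero => exact fun _ => h0
    | succ k ih =>
      exact fun hk => hstep k hk _ (iterate_frame c v σ k) (iterate_I_self _ _ _ _) (ih (by omega))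
  exact key _ le_rfl

/-- The body may change only the accumulator, so the final store is known completely. Since the
operation is commutative and associative, the rounds selected by the guard combine to a
`Finset.fold`, the form in which envelopes and crossings are defined. -/
theorem run_loop_fold {op : ℝ → ℝ → ℝ} [Std.Commutative op] [Std.Associative op] {c : Cmd}
    {v acc : ℕ} {σ : Store} (s : Finset ℕ) (f : ℕ → ℝ) (hs : ∀ j ∈ s, j < σ.rounds)
    (hc : ∀ j < σ.rounds, ∀ x, c.run ((σ.setR acc x).setI v j) =
      (σ.setR acc (if j ∈ s then op (f j) x else x)).setI v j) :
    (Cmd.loop v c).run σ = (σ.setR acc (s.fold op (σ.R acc) f)).setI v σ.rounds := by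
  have key : ∀ k ≤ σ.rounds, iterate c.run v σ k =
      (σ.setR acc ((s.filter (· < k)).fold op (σ.R acc) f)).setI v k := by
    intro k
    induction k with
    | zero => intro _; simp [iterate, Store.setR_self]
    | succ k ih =>
      intro hk
      rw [iterate, ih (by omega), hc k (by omega), Store.setI_setI]
      congr 2
      split_ifs with h
      · have : s.filter (· < k + 1) = insert k (s.filter (· < k)) := by
          ext j
          simp only [Finset.mem_filter, Finset.mem_insert]
          constructor
          · rintro ⟨h1, h2⟩
            rcases (Nat.lt_succ_iff.1 h2).eq_or_lt with h3 | h3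
            · exact Or.inl h3
            · exact Or.inr ⟨h1, h3⟩
          · rintro (rfl | ⟨h1, h2⟩)
            · exact ⟨h, by omega⟩
            · exact ⟨h1, by omega⟩
        rw [this, Finset.fold_insert (by simp)]
      · congr 1
        ext j
        simp only [Finset.mem_filter, and_congr_right_iff]
        intro hj
        have : j ≠ k := fun e => h (e ▸ hj)
        omega
  have := key _ le_rfl
  rwa [Finset.filter_true_of_mem hs] at this

theorem run_loop_max {b : BExpr} {e : RExpr} {v acc : ℕ} {σ : Store} (s : Finset ℕ) (f : ℕ → ℝ)
    (hs : ∀ j ∈ s, j < σ.rounds)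
    (hb : ∀ j < σ.rounds, ∀ x, b.eval ((σ.setR acc x).setI v j) ↔ j ∈ s)
    (he : ∀ j ∈ s, ∀ x, e.eval ((σ.setR acc x).setI v j) = f j) :
    (Cmd.loop v (.ite b (.rset acc (.max (.var acc) e)) .skip)).run σ =
      (σ.setR acc (s.fold max (σ.R acc) f)).setI v σ.rounds := by
  refine run_loop_fold s f hs fun j hj x => ?_
  by_cases h : j ∈ s
  · simp only [Cmd.run, if_pos ((hb j hj x).2 h), if_pos h, RExpr.eval, he j h x]
    simp [Store.setR, Store.setI, max_comm]
  · simp [Cmd.run, if_neg (mt (hb j hj x).1 h), if_neg h]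

theorem run_loop_min {b : BExpr} {e : RExpr} {v acc : ℕ} {σ : Store} (s : Finset ℕ) (f : ℕ → ℝ)
    (hs : ∀ j ∈ s, j < σ.rounds)
    (hb : ∀ j < σ.rounds, ∀ x, b.eval ((σ.setR acc x).setI v j) ↔ j ∈ s)
    (he : ∀ j ∈ s, ∀ x, e.eval ((σ.setR acc x).setI v j) = f j) :
    (Cmd.loop v (.ite b (.rset acc (.min (.var acc) e)) .skip)).run σ =
      (σ.setR acc (s.fold min (σ.R acc) f)).setI v σ.rounds := by
  refine run_loop_fold s f hs fun j hj x => ?_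
  by_cases h : j ∈ s
  · simp only [Cmd.run, if_pos ((hb j hj x).2 h), if_pos h, RExpr.eval, he j h x]
    simp [Store.setR, Store.setI, min_comm]
  · simp [Cmd.run, if_neg (mt (hb j hj x).1 h), if_neg h]

/-- A loop that fills an array. -/
theorem run_loop_store {b : BExpr} {c : Cmd} {a : Fin 32} {idx : IExpr} {e : RExpr} {v : ℕ}
    {σ : Store} (s : Finset ℕ) (g : ℕ → ℕ) (f : ℕ → ℝ) (hg : Function.Injective g)
    (hs : ∀ j ∈ s, j < σ.rounds) (hc : c.writesA a = false)
    (hb : ∀ j < σ.rounds, ∀ τ, (Cmd.loop v (.ite b (.seq c (.store a idx e)) .skip)).Frame σ τ →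
      τ.I v = j → (b.eval τ ↔ j ∈ s))
    (he : ∀ j ∈ s, ∀ τ, (Cmd.loop v (.ite b (.seq c (.store a idx e)) .skip)).Frame σ τ →
      τ.I v = j → idx.eval (c.run τ) = g j ∧ e.eval (c.run τ) = f j) :
    (∀ j ∈ s, ((Cmd.loop v (.ite b (.seq c (.store a idx e)) .skip)).run σ).A a (g j) = f j) ∧
    ∀ m, (∀ j ∈ s, g j ≠ m) →
      ((Cmd.loop v (.ite b (.seq c (.store a idx e)) .skip)).run σ).A a m = σ.A a m := by
  have key := loop_induct (c := .ite b (.seq c (.store a idx e)) .skip) (v := v) (σ := σ)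
    (fun k τ => (∀ j ∈ s, j < k → τ.A a (g j) = f j) ∧
      ∀ m, (∀ j ∈ s, g j ≠ m) → τ.A a m = σ.A a m)
    ⟨fun j _ h => absurd h (Nat.not_lt_zero j), fun _ _ => rfl⟩ (by
      rintro k hk τ hF hv ⟨h1, h2⟩
      by_cases h : k ∈ s
      · obtain ⟨e1, e2⟩ := he k h τ hF hv
        have hA : (c.run τ).A a = τ.A a := Cmd.run_A_of_not_writesA hc τ
        simp only [Cmd.run, if_pos ((hb k hk τ hF hv).2 h), Store.setI_A, Store.setA_A,
          Function.update_self, e1, e2, hA]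
        refine ⟨fun j hj hjk => ?_, fun m hm => ?_⟩
        · rcases (Nat.lt_succ_iff.1 hjk).eq_or_lt with rfl | h3
          · simp
          · rw [Function.update_of_ne (fun e => h3.ne (hg e)), h1 j hj h3]
        · rw [Function.update_of_ne (hm k h).symm, h2 m hm]
      · simp only [Cmd.run, if_neg (mt (hb k hk τ hF hv).1 h), Store.setI_A]
        refine ⟨fun j hj hjk => h1 j hj ?_, h2⟩
        have : j ≠ k := fun e => h (e ▸ hj)
        omega)
  exact ⟨fun j hj => key.1 j hj (hs j hj), key.2⟩

end RealRAM

/-! ## The program -/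

namespace RealRAM

theorem Cmd.run_seq (c₁ c₂ : Cmd) (σ : Store) : (seq c₁ c₂).run σ = c₂.run (c₁.run σ) := rfl

theorem Cmd.run_ite_pos {b : BExpr} {σ : Store} (h : b.eval σ) (c₁ c₂ : Cmd) :
    (ite b c₁ c₂).run σ = c₁.run σ := if_pos h

theorem Cmd.run_ite_neg {b : BExpr} {σ : Store} (h : ¬ b.eval σ) (c₁ c₂ : Cmd) :
    (ite b c₁ c₂).run σ = c₂.run σ := if_neg h

/-- Strict comparison. -/
def BExpr.rlt (a b : RExpr) : BExpr := .not (.rle b a)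

theorem BExpr.rlt_eval (a b : RExpr) (σ : Store) : (rlt a b).eval σ ↔ a.eval σ < b.eval σ :=
  not_le

theorem BExpr.ile_eval (a b : IExpr) (σ : Store) : (ile a b).eval σ ↔ a.eval σ ≤ b.eval σ := Iff.rfl

theorem BExpr.and_eval (a b : BExpr) (σ : Store) : (and a b).eval σ ↔ a.eval σ ∧ b.eval σ := Iff.rfl

end RealRAM

namespace RegretProgram

open RealRAM

/-! Index variables: `0` the number of edges, `1` the vertex `i`, `2` the vertex or edge `h`,
`3` and `4` the numbers of vertices on the two sides, `5` and `6` outer and `7`, `8`, `9` inner loop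
variables.  Arrays: `0`–`3` locations, capacities and prefix sums of the smallest and the largest
weights, `4`–`7` the same for the reversed path, `8`, `9` prefix sums of mixed weights, `10`
bottlenecks, `11`–`16` slopes, breakpoints and values for the two sides, `18`, `19` tables. -/

/-- Locations. -/
def aX : Bool → Fin 32 := fun s => if s then 4 else 0
/-- Capacities. -/
def aC : Bool → Fin 32 := fun s => if s then 5 else 1
/-- Prefix sums of the smallest weights. -/
def aA : Bool → Fin 32 := fun s => if s then 6 else 2
/-- Prefix sums of the largest weights. -/
def aH : Bool → Fin 32 := fun s => if s then 7 else 3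
/-- Prefix sums of the mixed weights. -/
def aB : Bool → Fin 32 := fun s => if s then 9 else 8
/-- Slopes. -/
def aS : Bool → Fin 32 := fun s => if s then 12 else 11
/-- Breakpoints. -/
def aU : Bool → Fin 32 := fun s => if s then 14 else 13
/-- Values at the breakpoints. -/
def aW : Bool → Fin 32 := fun s => if s then 16 else 15

/-- The number of vertices of a side. -/
def size (s : Bool) : IExpr := .var (if s then 4 else 3)
/-- The vertex `i`, as seen from a side. -/
def place (s : Bool) : IExpr := if s then .sub (.add (.var 0) (.const 2)) (.var 1) else .var 1
/-- The real variable for the start of a side. -/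
def rU (s : Bool) : ℕ := if s then 3 else 2
/-- The real variable for the amount of flow from a side. -/
def rW (s : Bool) : ℕ := if s then 7 else 6

/-- `c` for `v` from `a` to `b`. -/
def forIn (v : ℕ) (a b : IExpr) (c : Cmd) : Cmd :=
  .loop v (.ite (.and (.ile a (.var v)) (.ile (.var v) b)) c .skip)

/-- `r 8 :=` the least of the entries `l, …, k` of array `a`. -/
def leastOf (a : Fin 32) (k l : IExpr) : Cmd :=
  .seq (.rset 8 (.arr a l)) (.loop 8 (.ite (.and (.ile l (.var 8)) (.ile (.var 8) k))
    (.rset 8 (.min (.var 8) (.arr a (.var 8)))) .skip))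

/-- The slopes of a side. -/
def slopes (s : Bool) : Cmd :=
  .loop 7 (.ite (.ile (.var 7) (size s))
    (.seq (leastOf (aC s) (size s) (.var 7)) (.store (aS s) (.var 7) (.var 8))) .skip)

/-- The start of a side. -/
def start (s : Bool) : Cmd :=
  .seq (.rset (rU s) (.sub (.const 0) (.arr (aX s) (.add (size s) (.const 1)))))
  (.seq (.ite (.ile (place s) (size s))
    (.rset (rU s) (.max (.var (rU s)) (.sub (.const 0) (.arr (aX s) (place s))))) .skip)
  (.loop 7 (.ite (.and (.and (.ile (.const 1) (.var 7)) (.ile (.var 7) (size s)))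
      (.rlt (.const 0) (.arr (aA s) (.var 7))))
    (.rset (rU s) (.max (.var (rU s)) (.sub (.div (.arr (aA s) (.var 7)) (.arr (aS s) (.var 7)))
      (.arr (aX s) (.var 7))))) .skip)))

/-- The last intersection of the line number `7` with the slope `m` and a steeper line. -/
def crossing (s : Bool) (m : RExpr) : Cmd :=
  .seq (.rset 8 (.var (rU s)))
  (.loop 8 (.ite (.and (.and (.ile (.add (.var 7) (.const 1)) (.var 8)) (.ile (.var 8) (size s)))
      (.rlt m (.arr (aS s) (.var 8))))
    (.rset 8 (.max (.var 8) (.div (.sub (.add (.sub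
        (.sub (.arr (aB s) (size s)) (.arr (aB s) (.var 7)))
        (.sub (.arr (aB s) (size s)) (.arr (aB s) (.var 8))))
        (.mul m (.arr (aX s) (.var 7))))
        (.mul (.arr (aS s) (.var 8)) (.arr (aX s) (.var 8))))
      (.sub (.arr (aS s) (.var 8)) m)))) .skip))

/-- The breakpoints of a side. -/
def breakpoints (s : Bool) : Cmd :=
  .seq (.loop 7 (.ite (.ile (.var 7) (size s)) (.seq (crossing s (.const 0))
    (.store (aU s) (.add (.var 7) (.var 7)) (.var 8))) .skip))
  (.loop 7 (.ite (.ile (.var 7) (size s)) (.seq (crossing s (.arr (aS s) (.var 7)))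
    (.store (aU s) (.add (.add (.var 7) (.var 7)) (.const 1)) (.var 8))) .skip))

/-- Everything about a side. -/
def prepare (s : Bool) : Cmd := .seq (slopes s) (.seq (start s) (breakpoints s))

/-- The amount of flow from a side in terms of `r 9`. -/
def amount (s : Bool) : Cmd :=
  .seq (.rset (rW s) (.sub (.arr (aB s) (size s)) (.arr (aB s) (.const 0))))
  (.loop 9 (.ite (.ile (.var 9) (size s))
    (.rset (rW s) (.min (.var (rW s)) (.add (.mul (.arr (aS s) (.var 9))
      (.max (.add (.var 9) (.arr (aX s) (.var 9))) (.const 0)))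
      (.sub (.arr (aB s) (size s)) (.arr (aB s) (.var 9)))))) .skip))

/-- Bring entry `6` of the table to at least the excess for the weight `w` and the time `t`. -/
def raise (w t : RExpr) : Cmd :=
  .store 18 (.var 6) (.max (.arr 18 (.var 6)) (.sub (.sub
    (.div (.sub w (.sub (.arr 2 (.add (.var 0) (.const 1))) (.arr 2 (.var 1)))) (.arr 10 (.var 6)))
    t) (.arr 0 (.var 1))))

/-- The evacuations to vertex `h` at time `r 5`. -/
def atTime : Cmd :=
  .seq (.rset 9 (.sub (.var 5) (.arr 0 (.var 2))))
  (.seq (amount false)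
  (.seq (.rset 9 (.sub (.var 5) (.sub (.arr 0 (.add (.var 0) (.const 1))) (.arr 0 (.var 2)))))
  (.seq (amount true)
  (forIn 6 (.var 1) (.var 0) (raise (.add (.add (.var 6)
    (.sub (.arr 8 (.var 2)) (.arr 8 (.sub (.var 2) (.const 1))))) (.var 7)) (.var 5))))))

/-- The evacuations to vertex `h`. -/
def atVertex : Cmd :=
  .seq (.rset 4 (.max (.add (.var 2) (.arr 0 (.var 2)))
    (.add (.var 3) (.sub (.arr 0 (.add (.var 0) (.const 1))) (.arr 0 (.var 2))))))
  (.seq (forIn 5 (.const 0) (.add (.add (size false) (size false)) (.const 1))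
    (.seq (.rset 5 (.max (.var 4) (.add (.arr 13 (.var 5)) (.arr 0 (.var 2))))) atTime))
  (forIn 5 (.const 0) (.add (.add (size true) (size true)) (.const 1))
    (.seq (.rset 5 (.max (.var 4) (.add (.arr 14 (.var 5))
      (.sub (.arr 0 (.add (.var 0) (.const 1))) (.arr 0 (.var 2)))))) atTime)))

/-- The values at the breakpoints of a side. -/
def amounts (s : Bool) : Cmd :=
  .loop 5 (.ite (.ile (.var 5) (.add (.add (size s) (size s)) (.const 1)))
    (.seq (.seq (.rset 9 (.arr (aU s) (.var 5))) (amount s))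
      (.store (aW s) (.var 5) (.var (rW s)))) .skip)

/-- The best breakpoint of the right side: its position is `r 10` and its value is `r 11`. -/
def bestBreak : Cmd :=
  .seq (.rset 10 (.arr 14 (.const 0))) (.seq (.rset 11 (.arr 16 (.const 0)))
  (forIn 5 (.const 0) (.add (.add (size true) (size true)) (.const 1))
    (.ite (.rle (.sub (.div (.var 11) (.arr 10 (.var 6))) (.div (.var 10) (.const 2)))
        (.sub (.div (.arr 16 (.var 5)) (.arr 10 (.var 6))) (.div (.arr 14 (.var 5)) (.const 2))))
      (.seq (.rset 10 (.arr 14 (.var 5))) (.rset 11 (.arr 16 (.var 5)))) .skip)))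

/-- The evacuations into edge `h`. -/
def atEdge : Cmd :=
  .seq (amounts false) (.seq (amounts true) (forIn 6 (.var 1) (.var 0)
    (.seq bestBreak
    (forIn 5 (.const 0) (.add (.add (size false) (size false)) (.const 1))
      (.seq (.rset 13 (.div (.add (.sub (.var 10) (.arr 13 (.var 5)))
        (.arr 0 (.add (.var 0) (.const 1)))) (.const 2)))
      (.ite (.and (.rlt (.arr 0 (.var 2)) (.var 13))
          (.rlt (.var 13) (.arr 0 (.add (.var 2) (.const 1)))))
        (raise (.add (.arr 15 (.var 5)) (.var 11))
          (.div (.add (.add (.arr 13 (.var 5)) (.var 10))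
            (.arr 0 (.add (.var 0) (.const 1)))) (.const 2))) .skip))))))

/-- The mixed weights and the bottlenecks for vertex `i`. -/
def levels : Cmd :=
  .seq (.loop 7 (.ite (.ile (.var 7) (.add (.var 0) (.const 1)))
    (.seq (.ite (.ile (.var 7) (.var 1)) (.rset 8 (.arr 3 (.var 7)))
      (.rset 8 (.sub (.add (.arr 3 (.var 1)) (.arr 2 (.var 7))) (.arr 2 (.var 1)))))
      (.store 8 (.var 7) (.var 8))) .skip))
  (.seq (.loop 7 (.ite (.ile (.var 7) (.add (.var 0) (.const 1)))
    (.seq .skip (.store 9 (.var 7) (.sub (.arr 8 (.add (.var 0) (.const 1)))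
      (.arr 8 (.sub (.add (.var 0) (.const 1)) (.var 7)))))) .skip))
  (.loop 7 (.ite (.and (.ile (.var 1) (.var 7)) (.ile (.var 7) (.var 0)))
    (.seq (leastOf 1 (.var 7) (.var 1)) (.store 10 (.var 7) (.var 8))) .skip)))

/-- The evacuations to the vertices. -/
def allVertices : Cmd :=
  forIn 2 (.const 1) (.add (.var 0) (.const 1))
    (.seq (.iset 3 (.sub (.var 2) (.const 1)))
    (.seq (.iset 4 (.sub (.add (.var 0) (.const 1)) (.var 2)))
    (.seq (prepare false) (.seq (prepare true) atVertex))))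

/-- The evacuations into the edges. -/
def allEdges : Cmd :=
  forIn 2 (.const 1) (.var 0)
    (.seq (.iset 3 (.var 2))
    (.seq (.iset 4 (.sub (.add (.var 0) (.const 1)) (.var 2)))
    (.seq (prepare false) (.seq (prepare true) atEdge))))

/-- The table. -/
def table : Cmd :=
  .seq (.loop 7 (.ite (.ile (.var 7) (.var 0)) (.seq .skip
    (.store 18 (.var 7) (.sub (.const 0) (.arr 0 (.add (.var 7) (.const 1)))))) .skip))
  (.loop 1 (.ite (.and (.and (.ile (.const 1) (.var 1)) (.ile (.var 1) (.var 0)))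
      (.rlt (.arr 3 (.sub (.var 1) (.const 1))) (.arr 3 (.var 1))))
    (.seq levels (.seq allVertices allEdges)) .skip))

/-- The data of the reversed path. -/
def mirror : Cmd :=
  .seq (.loop 7 (.ite (.ile (.var 7) (.add (.var 0) (.const 1))) (.seq (.ite (.ile (.const 1)
      (.var 7))
      (.rset 8 (.sub (.arr 0 (.add (.var 0) (.const 1)))
        (.arr 0 (.sub (.add (.var 0) (.const 2)) (.var 7))))) (.rset 8 (.const 0)))
    (.store 4 (.var 7) (.var 8))) .skip))
  (.seq (.loop 7 (.ite (.ile (.var 7) (.var 0)) (.seq (.ite (.ile (.const 1) (.var 7))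
      (.rset 8 (.arr 1 (.sub (.add (.var 0) (.const 1)) (.var 7)))) (.rset 8 (.const 0)))
    (.store 5 (.var 7) (.var 8))) .skip))
  (.seq (.loop 7 (.ite (.ile (.var 7) (.add (.var 0) (.const 1))) (.seq .skip
    (.store 6 (.var 7) (.sub (.arr 2 (.add (.var 0) (.const 1)))
      (.arr 2 (.sub (.add (.var 0) (.const 1)) (.var 7)))))) .skip))
  (.loop 7 (.ite (.ile (.var 7) (.add (.var 0) (.const 1))) (.seq .skip
    (.store 7 (.var 7) (.sub (.arr 3 (.add (.var 0) (.const 1)))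
      (.arr 3 (.sub (.add (.var 0) (.const 1)) (.var 7)))))) .skip))))

/-- Copy entries `0, …, n + 1`. -/
def copy (a b : Fin 32) : Cmd :=
  .loop 7 (.ite (.ile (.var 7) (.add (.var 0) (.const 1)))
    (.seq .skip (.store b (.var 7) (.arr a (.var 7)))) .skip)

/-- Pass to the reversed path. -/
def turn : Cmd :=
  .seq mirror (.seq (.seq (copy 4 0) (.seq (copy 5 1) (.seq (copy 6 2) (copy 7 3)))) mirror)

/-- Move the input out of the way. -/
def rescue : Cmd :=
  .loop 7 (.seq (.store 24 (.add (.add (.var 0) (.const 1)) (.var 7)) (.cell (.var 7)))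
  (.seq (.store 25 (.add (.add (.var 0) (.const 1)) (.var 7)) (.cell (.add (.var 0) (.var 7))))
  (.seq (.store 26 (.add (.add (.var 0) (.const 1)) (.var 7))
    (.cell (.add (.add (.var 0) (.var 0)) (.var 7))))
  (.store 27 (.add (.add (.var 0) (.const 1)) (.var 7))
    (.cell (.add (.add (.add (.add (.var 0) (.var 0)) (.var 0)) (.const 1)) (.var 7)))))))

/-- The data of the path. -/
def load : Cmd :=
  .seq rescue
  (.seq (.store 0 (.const 0) (.const 0)) (.seq (.store 0 (.const 1) (.const 0))
  (.seq (.store 1 (.const 0) (.const 0)) (.seq (.store 2 (.const 0) (.const 0))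
  (.seq (.store 3 (.const 0) (.const 0))
  (.loop 7 (.ite (.ile (.const 1) (.var 7))
    (.seq (.store 0 (.add (.var 7) (.const 1)) (.add (.arr 0 (.var 7)) (.arr 24 (.add (.var 0)
      (.var 7)))))
    (.seq (.store 1 (.var 7) (.arr 25 (.add (.var 0) (.var 7))))
    (.seq (.store 2 (.var 7) (.add (.arr 2 (.sub (.var 7) (.const 1))) (.arr 26 (.add (.var 0)
      (.var 7)))))
    (.store 3 (.var 7) (.add (.arr 3 (.sub (.var 7) (.const 1))) (.arr 27 (.add (.var 0)
      (.var 7)))))))) .skip)))))))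

/-- The maximum regret at vertex `h`, into `r 10`. -/
def vertexValue : Cmd :=
  .seq (.rset 8 (.const 0)) (.seq (.rset 9 (.const 0))
  (.seq (.ite (.ile (.const 2) (.var 2)) (.rset 8 (.max (.const 0)
    (.add (.arr 0 (.var 2)) (.arr 18 (.sub (.var 2) (.const 1)))))) .skip)
  (.seq (.ite (.ile (.var 2) (.var 0)) (.rset 9 (.max (.const 0)
    (.add (.sub (.arr 0 (.add (.var 0) (.const 1))) (.arr 0 (.var 2)))
      (.arr 19 (.sub (.add (.var 0) (.const 1)) (.var 2)))))) .skip)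
  (.rset 10 (.max (.var 8) (.var 9))))))

/-- The best sink. -/
def minimize : Cmd :=
  .seq (.iset 2 (.const 1)) (.seq vertexValue
  (.seq (.rset 0 (.arr 0 (.var 2))) (.seq (.rset 1 (.var 10))
  (.seq (forIn 2 (.const 1) (.add (.var 0) (.const 1)) (.seq vertexValue
    (.ite (.rlt (.var 10) (.var 1)) (.seq (.rset 0 (.arr 0 (.var 2))) (.rset 1 (.var 10))) .skip)))
  (forIn 2 (.const 1) (.var 0)
    (.seq (.rset 8 (.div (.sub (.add (.arr 0 (.add (.var 0) (.const 1)))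
      (.arr 19 (.sub (.add (.var 0) (.const 1)) (.var 2)))) (.arr 18 (.var 2))) (.const 2)))
    (.seq (.rset 10 (.max (.const 0) (.add (.var 8) (.arr 18 (.var 2)))))
    (.ite (.and (.and (.rlt (.arr 0 (.var 2)) (.var 8))
        (.rlt (.var 8) (.arr 0 (.add (.var 2) (.const 1))))) (.rlt (.var 10) (.var 1)))
      (.seq (.rset 0 (.var 8)) (.rset 1 (.var 10))) .skip))))))))

/-- The whole program. -/
def main : Cmd :=
  .seq load (.seq turn (.seq table (.seq (copy 18 19) (.seq turn (.seq table minimize)))))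

theorem main_loopsOK : main.loopsOK = true := by decide
theorem main_writesI : main.writesI 0 = false := by decide
-- The deepest nests run over i, the vertex or edge h, a breakpoint or an edge k, and one more
-- vertex, breakpoint or edge. Amounts of flow do not depend on k and are computed outside the loop
-- over k.
theorem main_depth : main.depth = 4 := by decide

end RegretProgram

theorem bottleneck_congr {C C' : ℕ → ℝ} {k l : ℕ} (hl : l ≤ k)
    (h : ∀ t, l ≤ t → t ≤ k → C t = C' t) : bottleneck C k l = bottleneck C' k l := by
  unfold bottleneck
  rw [h l le_rfl hl]
  refine Finset.fold_congr fun t ht => ?_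
  rw [Finset.mem_Icc] at ht
  exact h t ht.1 ht.2

/-! ### Correctness of the computations for one side -/

namespace RegretProgram

open RealRAM

theorem leastOf_run {a : Fin 32} {k l : IExpr} {σ : Store} {kk ll : ℕ}
    (hk : ∀ x j, k.eval ((σ.setR 8 x).setI 8 j) = kk)
    (hl : ∀ x j, l.eval ((σ.setR 8 x).setI 8 j) = ll) (hl' : l.eval σ = ll)
    (hr : kk < σ.rounds) :
    (leastOf a k l).run σ = (σ.setR 8 (bottleneck (σ.A a) kk ll)).setI 8 σ.rounds := by
  have h := run_loop_min (v := 8) (acc := 8) (σ := σ.setR 8 (σ.A a ll))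
    (b := .and (.ile l (.var 8)) (.ile (.var 8) k)) (e := .arr a (.var 8))
    (Finset.Icc ll kk) (σ.A a)
    (fun j hj => by rw [Finset.mem_Icc] at hj; exact lt_of_le_of_lt hj.2 hr)
    (fun j _ x => by
      rw [Store.setR_setR, Finset.mem_Icc, BExpr.and_eval, BExpr.ile_eval, BExpr.ile_eval, hk, hl]
      simp [IExpr.eval])
    (fun j _ x => by simp [RExpr.eval, IExpr.eval])
  rw [Store.setR_setR] at h
  rw [leastOf, Cmd.run, Cmd.run, RExpr.eval, hl', h]
  simp [bottleneck, Store.rounds]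

/-- The data of a side are in the arrays. -/
structure Loaded (D : Side) (s : Bool) (σ : Store) : Prop where
  size : (size s).eval σ = D.k
  place : (place s).eval σ = D.idx
  rounds : 2 * D.k + 1 < σ.rounds
  X : ∀ l ≤ D.k + 1, σ.A (aX s) l = D.X l
  C : ∀ l ≤ D.k, σ.A (aC s) l = D.C l
  A : ∀ l ≤ D.k, σ.A (aA s) l = D.A l
  B : ∀ l ≤ D.k, σ.A (aB s) l = D.B l

/-- The command does not touch the data of a side. -/
def keepsLoaded (s : Bool) (c : Cmd) : Bool :=
  !c.writesI 0 && !c.writesI 1 && !c.writesI 3 && !c.writesI 4 &&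
    !c.writesA (aX s) && !c.writesA (aC s) && !c.writesA (aA s) && !c.writesA (aB s)

variable {D : Side} {s : Bool} {σ τ : Store} {c : Cmd}

theorem rounds_eq (h : τ.I 0 = σ.I 0) : τ.rounds = σ.rounds := by
  rw [Store.rounds, Store.rounds, h]

theorem Loaded.frame (h : Loaded D s σ) (hF : c.Frame σ τ) (hc : keepsLoaded s c = true) :
    Loaded D s τ := by
  simp only [keepsLoaded, Bool.and_eq_true, Bool.not_eq_true'] at hc
  obtain ⟨⟨⟨⟨⟨⟨⟨h0, h1⟩, h3⟩, h4⟩, hX⟩, hC⟩, hA⟩, hB⟩ := hc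
  have e0 := hF.onI 0 h0
  refine ⟨?_, ?_, by rw [rounds_eq e0]; exact h.rounds, by rw [hF.onA _ hX]; exact h.X,
    by rw [hF.onA _ hC]; exact h.C, by rw [hF.onA _ hA]; exact h.A, by rw [hF.onA _ hB]; exact h.B⟩
  · rw [← h.size]
    cases s
    · exact hF.onI 3 h3
    · exact hF.onI 4 h4
  · rw [← h.place]
    cases s
    · exact hF.onI 1 h1
    · simp [RegretProgram.place, IExpr.eval, hF.onI 1 h1, e0]

theorem Loaded.size_eq (h : Loaded D s σ) {v a : ℕ} (hv : 5 ≤ v) (x : ℝ) (j : ℕ) :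
    (RegretProgram.size s).eval ((σ.setR a x).setI v j) = D.k := by
  rw [← h.size]
  cases s <;> simp [RegretProgram.size, IExpr.eval, Function.update_apply] <;> omega

theorem Loaded.size_eq' (h : Loaded D s σ) {a : ℕ} (x : ℝ) :
    (RegretProgram.size s).eval (σ.setR a x) = D.k := h.size

theorem Loaded.slopes (h : Loaded D s σ) :
    ∀ l ≤ D.k, ((slopes s).run σ).A (aS s) l = D.slope l := by
  have hfr : ∀ τ, (RegretProgram.slopes s).Frame σ τ → Loaded D s τ := fun τ hF =>
    h.frame hF (by cases s <;> rfl)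
  have := (run_loop_store (v := 7) (σ := σ) (a := aS s) (b := .ile (.var 7) (RegretProgram.size s))
    (c := leastOf (aC s) (RegretProgram.size s) (.var 7)) (idx := .var 7) (e := .var 8)
    (Finset.range (D.k + 1)) id D.slope Function.injective_id
    (fun j hj => by have := h.rounds; rw [Finset.mem_range] at hj; omega) (by cases s <;> rfl)
    (fun j _ τ hF hv => by
      rw [Finset.mem_range, BExpr.ile_eval, (hfr τ hF).size]
      simp [IExpr.eval, hv])
    (fun j hj τ hF hv => by
      have h' := hfr τ hF
      rw [Finset.mem_range] at hj
      rw [leastOf_run (kk := D.k) (ll := j) (fun x i => h'.size_eq (by omega) x i)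
        (fun x i => by simp [IExpr.eval, hv])
        (show (IExpr.var 7).eval τ = j from hv) (by have := h'.rounds; omega)]
      refine ⟨by simp [IExpr.eval, hv], ?_⟩
      simp only [RExpr.eval, Store.setI_R, Store.setR_R, Function.update_self]
      exact bottleneck_congr (by omega) fun t _ ht => h'.C t ht)).1
  intro l hl
  exact this l (by rw [Finset.mem_range]; omega)

theorem Loaded.start (h : Loaded D s σ) (hS : ∀ l ≤ D.k, σ.A (aS s) l = D.slope l) :
    ((start s).run σ).R (rU s) = D.start := by
  set x₀ : ℝ := if D.idx ≤ D.k then max (-D.X (D.k + 1)) (-D.X D.idx) else -D.X (D.k + 1) with hx₀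
  have h1 : (Cmd.ite (.ile (RegretProgram.place s) (RegretProgram.size s))
      (.rset (rU s) (.max (.var (rU s)) (.sub (.const 0) (.arr (aX s) (RegretProgram.place s)))))
      .skip).run ((Cmd.rset (rU s) (.sub (.const 0)
        (.arr (aX s) (.add (RegretProgram.size s) (.const 1))))).run σ) =
      σ.setR (rU s) x₀ := by
    have e1 : (Cmd.rset (rU s) (.sub (.const 0)
        (.arr (aX s) (.add (RegretProgram.size s) (.const 1))))).run σ =
        σ.setR (rU s) (-D.X (D.k + 1)) := by
      simp [Cmd.run, RExpr.eval, IExpr.eval, h.size, h.X _ le_rfl]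
    have e2 : ∀ x, (RegretProgram.place s).eval (σ.setR (rU s) x) = D.idx := fun x => by
      rw [← h.place]; cases s <;> rfl
    rw [e1, Cmd.run]
    simp only [BExpr.ile_eval, h.size_eq', e2, Cmd.run, hx₀]
    split_ifs with hi
    · simp [RExpr.eval, e2, h.X _ (by omega : D.idx ≤ D.k + 1), Store.setR_setR]
    · rfl
  have h2 := run_loop_max (v := 7) (acc := rU s) (σ := σ.setR (rU s) x₀)
    (b := .and (.and (.ile (.const 1) (.var 7)) (.ile (.var 7) (RegretProgram.size s)))
      (.rlt (.const 0) (.arr (aA s) (.var 7))))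
    (e := .sub (.div (.arr (aA s) (.var 7)) (.arr (aS s) (.var 7))) (.arr (aX s) (.var 7)))
    ((Finset.Icc 1 D.k).filter fun l => 0 < D.A l) (fun l => D.A l / D.slope l - D.X l)
    (fun j hj => by
      simp only [Finset.mem_filter, Finset.mem_Icc] at hj
      have := h.rounds
      simp only [Store.rounds, Store.setR_I] at *
      omega)
    (fun j _ x => by
      simp only [Store.setR_setR, Finset.mem_filter, Finset.mem_Icc, BExpr.and_eval, BExpr.ile_eval,
        BExpr.rlt_eval, h.size_eq (show 5 ≤ 7 by omega)]
      simp only [IExpr.eval, RExpr.eval, Store.setI_I, Store.setI_A, Store.setR_A,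
        Function.update_self, Rat.cast_zero]
      refine and_congr_right fun hj => ?_
      rw [h.A j hj.2])
    (fun j hj x => by
      simp only [Finset.mem_filter, Finset.mem_Icc] at hj
      simp [IExpr.eval, RExpr.eval, h.A j hj.1.2, hS j hj.1.2, h.X j (by omega)])
  rw [RegretProgram.start, Cmd.run_seq, Cmd.run_seq, h1, h2]
  simp [Side.start, hx₀]

theorem Loaded.crossing (h : Loaded D s σ) (hS : ∀ l ≤ D.k, σ.A (aS s) l = D.slope l)
    (hU : σ.R (rU s) = D.start) {m : RExpr} {μ : ℝ} {l : ℕ} (hl : σ.I 7 = l) (hlk : l ≤ D.k)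
    (hm : ∀ x j, m.eval ((σ.setR 8 x).setI 8 j) = μ) :
    (crossing s m).run σ = (σ.setR 8 (lineCrossing D.k D.slope D.X (fun l => D.B D.k - D.B l)
      D.start l μ)).setI 8 σ.rounds := by
  have h2 := run_loop_max (v := 8) (acc := 8) (σ := σ.setR 8 D.start)
    (b := .and (.and (.ile (.add (.var 7) (.const 1)) (.var 8)) (.ile (.var 8)
      (RegretProgram.size s)))
      (.rlt m (.arr (aS s) (.var 8))))
    (e := .div (.sub (.add (.sub
        (.sub (.arr (aB s) (RegretProgram.size s)) (.arr (aB s) (.var 7)))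
        (.sub (.arr (aB s) (RegretProgram.size s)) (.arr (aB s) (.var 8))))
        (.mul m (.arr (aX s) (.var 7))))
        (.mul (.arr (aS s) (.var 8)) (.arr (aX s) (.var 8))))
      (.sub (.arr (aS s) (.var 8)) m))
    ((Finset.Ioc l D.k).filter fun j => μ < D.slope j)
    (fun j => (D.B D.k - D.B l - (D.B D.k - D.B j) + μ * D.X l - D.slope j * D.X j) /
      (D.slope j - μ))
    (fun j hj => by
      simp only [Finset.mem_filter, Finset.mem_Ioc] at hj
      have := h.rounds
      simp only [Store.rounds, Store.setR_I] at *
      omega)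
    (fun j _ x => by
      simp only [Store.setR_setR, Finset.mem_filter, Finset.mem_Ioc, BExpr.and_eval, BExpr.ile_eval,
        BExpr.rlt_eval, h.size_eq (show 5 ≤ 8 by omega), hm]
      simp only [IExpr.eval, RExpr.eval, Store.setI_I, Store.setI_A, Store.setR_A, Store.setR_I,
        Function.update_self, Function.update_of_ne (show (7 : ℕ) ≠ 8 by omega), hl,
          Nat.succ_le_iff]
      refine and_congr_right fun hj => ?_
      rw [hS j hj.2])
    (fun j hj x => by
      simp only [Finset.mem_filter, Finset.mem_Ioc] at hj
      simp only [Store.setR_setR, RExpr.eval, h.size_eq (show 5 ≤ 8 by omega), hm]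
      simp only [IExpr.eval, Store.setI_I, Store.setI_A, Store.setR_A, Store.setR_I,
        Function.update_self, Function.update_of_ne (show (7 : ℕ) ≠ 8 by omega), hl, hS j hj.1.2,
        h.X j (by omega), h.X l (by omega), h.B _ le_rfl, h.B j hj.1.2, h.B l hlk])
  rw [Store.setR_setR] at h2
  simp only [RegretProgram.crossing]
  rw [Cmd.run, Cmd.run, RExpr.eval, hU, h2]
  simp [lineCrossing, Store.rounds]

/-- The breakpoints and the slopes of a side are in the arrays. -/
structure Prepared (D : Side) (s : Bool) (σ : Store) : Prop extends Loaded D s σ where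
  slope : ∀ l ≤ D.k, σ.A (aS s) l = D.slope l
  start : σ.R (rU s) = D.start
  even : ∀ l ≤ D.k, σ.A (aU s) (l + l) =
    lineCrossing D.k D.slope D.X (fun l => D.B D.k - D.B l) D.start l 0
  odd : ∀ l ≤ D.k, σ.A (aU s) (l + l + 1) =
    lineCrossing D.k D.slope D.X (fun l => D.B D.k - D.B l) D.start l (D.slope l)

/-- The command does not touch anything about a side. -/
def keepsPrepared (s : Bool) (c : Cmd) : Bool :=
  keepsLoaded s c && !c.writesA (aS s) && !c.writesA (aU s) && !c.writesR (rU s)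

theorem Prepared.frame (h : Prepared D s σ) (hF : c.Frame σ τ) (hc : keepsPrepared s c = true) :
    Prepared D s τ := by
  simp only [keepsPrepared, Bool.and_eq_true, Bool.not_eq_true'] at hc
  obtain ⟨⟨⟨h0, hS⟩, hU⟩, hR⟩ := hc
  exact ⟨h.toLoaded.frame hF h0, by rw [hF.onA _ hS]; exact h.slope,
      by rw [hF.onR _ hR]; exact h.start,
    by rw [hF.onA _ hU]; exact h.even, by rw [hF.onA _ hU]; exact h.odd⟩

/-- One statement for both loops over the crossings. Its second part guarantees that the second
loop, which writes the odd entries, leaves the even ones alone. -/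
theorem Loaded.fill (h : Loaded D s σ) (hS : ∀ l ≤ D.k, σ.A (aS s) l = D.slope l)
    (hU : σ.R (rU s) = D.start) {m : RExpr} {idx : IExpr} (g : ℕ → ℕ) (μ : ℕ → ℝ)
    (hg : Function.Injective g)
    (hm : ∀ (τ : Store) l, l ≤ D.k → τ.I 7 = l → τ.A (aS s) l = D.slope l →
      ∀ x j, m.eval ((τ.setR 8 x).setI 8 j) = μ l)
    (hidx : ∀ (τ : Store) l x j, τ.I 7 = l → idx.eval ((τ.setR 8 x).setI 8 j) = g l) :
    (∀ l ≤ D.k, ((Cmd.loop 7 (.ite (.ile (.var 7) (RegretProgram.size s))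
      (.seq (RegretProgram.crossing s m) (.store (aU s) idx (.var 8))) .skip)).run σ).A (aU s)
        (g l) =
      lineCrossing D.k D.slope D.X (fun l => D.B D.k - D.B l) D.start l (μ l)) ∧
    ∀ j, (∀ l, g l ≠ j) → ((Cmd.loop 7 (.ite (.ile (.var 7) (RegretProgram.size s))
      (.seq (RegretProgram.crossing s m) (.store (aU s) idx (.var 8))) .skip)).run σ).A (aU s) j =
      σ.A (aU s) j := by
  have key := run_loop_store (v := 7) (σ := σ) (a := aU s)
    (b := .ile (.var 7) (RegretProgram.size s)) (c := RegretProgram.crossing s m) (idx := idx)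
    (e := .var 8) (Finset.range (D.k + 1)) g
    (fun l => lineCrossing D.k D.slope D.X (fun l => D.B D.k - D.B l) D.start l (μ l)) hg
    (fun j hj => by have := h.rounds; rw [Finset.mem_range] at hj; omega) (by cases s <;> rfl)
    (fun j _ τ hF hv => by
      rw [Finset.mem_range, BExpr.ile_eval, (h.frame hF (by cases s <;> rfl)).size]
      simp [IExpr.eval, hv])
    (fun j hj τ hF hv => by
      have h' := h.frame hF (by cases s <;> rfl)
      rw [Finset.mem_range] at hj
      have hS' : ∀ l ≤ D.k, τ.A (aS s) l = D.slope l := by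
        rw [hF.onA (aS s) (by cases s <;> rfl)]; exact hS
      have hU' : τ.R (rU s) = D.start := by rw [hF.onR (rU s) (by cases s <;> rfl)]; exact hU
      rw [h'.crossing hS' hU' hv (by omega) (hm τ j (by omega) hv (hS' j (by omega)))]
      exact ⟨hidx τ j _ _ hv, by simp [RExpr.eval]⟩)
  exact ⟨fun l hl => key.1 l (by rw [Finset.mem_range]; omega), fun j hj => key.2 j fun l _ => hj l⟩

theorem Loaded.prepare (h : Loaded D s σ) : Prepared D s ((prepare s).run σ) := by
  have h1 := h.frame (Cmd.frame (RegretProgram.slopes s) σ) (by cases s <;> rfl)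
  have S1 := h.slopes
  set σ₁ := (RegretProgram.slopes s).run σ
  have h2 := h1.frame (Cmd.frame (RegretProgram.start s) σ₁) (by cases s <;> rfl)
  have S2 := S1
  rw [← (Cmd.frame (RegretProgram.start s) σ₁).onA (aS s) (by cases s <;> rfl)] at S2
  have U2 := h1.start S1
  set σ₂ := (RegretProgram.start s).run σ₁
  have f3 := h2.fill S2 U2 (m := .const 0) (idx := .add (.var 7) (.var 7)) (fun l => l + l)
    (fun _ => 0) (fun a b hab => by simp only at hab; omega)
    (fun τ l _ _ _ x j => by simp [RExpr.eval]) (fun τ l x j hv => by simp [IExpr.eval, hv])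
  have F3 := Cmd.frame (Cmd.loop 7 (.ite (.ile (.var 7) (RegretProgram.size s))
      (.seq (RegretProgram.crossing s (.const 0))
        (.store (aU s) (.add (.var 7) (.var 7)) (.var 8))) .skip)) σ₂
  set σ₃ := (Cmd.loop 7 (.ite (.ile (.var 7) (RegretProgram.size s))
      (.seq (RegretProgram.crossing s (.const 0))
        (.store (aU s) (.add (.var 7) (.var 7)) (.var 8))) .skip)).run σ₂
  have h3 := h2.frame F3 (by cases s <;> rfl)
  have S3 := S2
  rw [← F3.onA (aS s) (by cases s <;> rfl)] at S3
  have U3 := U2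
  rw [← F3.onR (rU s) (by cases s <;> rfl)] at U3
  have f4 := h3.fill S3 U3 (m := .arr (aS s) (.var 7))
    (idx := .add (.add (.var 7) (.var 7)) (.const 1)) (fun l => l + l + 1)
    D.slope (fun a b hab => by simp only at hab; omega)
    (fun τ l _ hv hs x j => by simp [RExpr.eval, IExpr.eval, hv, hs])
    (fun τ l x j hv => by simp [IExpr.eval, hv])
  have F4 := Cmd.frame (Cmd.loop 7 (.ite (.ile (.var 7) (RegretProgram.size s))
      (.seq (RegretProgram.crossing s (.arr (aS s) (.var 7)))
        (.store (aU s) (.add (.add (.var 7) (.var 7)) (.const 1)) (.var 8))) .skip)) σ₃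
  refine ⟨h3.frame F4 (by cases s <;> rfl), ?_, ?_, fun l hl => ?_, f4.1⟩
  · have := S3
    rwa [← F4.onA (aS s) (by cases s <;> rfl)] at this
  · have := U3
    rwa [← F4.onR (rU s) (by cases s <;> rfl)] at this
  · rw [← f3.1 l hl]
    exact f4.2 _ fun j => by omega

/-- Together with `exists_of_mem_breaks`: entries 0, …, 2k + 1 of the array list exactly the
breakpoints. This direction keeps the candidates feasible, and the other one makes them exhaustive.
-/
theorem Prepared.mem_breaks (h : Prepared D s σ) {c : ℕ} (hc : c ≤ D.k + D.k + 1) :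
    σ.A (aU s) c ∈ D.breaks := by
  obtain ⟨l, rfl | rfl⟩ : ∃ l, c = l + l ∨ c = l + l + 1 := ⟨c / 2, by omega⟩
  · exact ⟨l, by omega, Or.inl (h.even l (by omega))⟩
  · exact ⟨l, by omega, Or.inr (h.odd l (by omega))⟩

theorem Prepared.exists_of_mem_breaks (h : Prepared D s σ) {x : ℝ} (hx : x ∈ D.breaks) :
    ∃ c ≤ D.k + D.k + 1, σ.A (aU s) c = x := by
  obtain ⟨l, hl, rfl | rfl⟩ := hx
  · exact ⟨l + l, by omega, h.even l hl⟩
  · exact ⟨l + l + 1, by omega, h.odd l hl⟩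

theorem Prepared.amount (h : Prepared D s σ) :
    (amount s).run σ = (σ.setR (rW s) (D.carry (σ.R 9))).setI 9 σ.rounds := by
  have hr : rW s ≠ 9 := by cases s <;> decide
  have h2 := run_loop_min (v := 9) (acc := rW s) (σ := σ.setR (rW s) (D.B D.k - D.B 0))
    (b := .ile (.var 9) (RegretProgram.size s))
    (e := .add (.mul (.arr (aS s) (.var 9))
      (.max (.add (.var 9) (.arr (aX s) (.var 9))) (.const 0)))
      (.sub (.arr (aB s) (RegretProgram.size s)) (.arr (aB s) (.var 9))))
    (Finset.Icc 0 D.k)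
    (fun l => truncLine (D.slope l) (D.X l) (D.B D.k - D.B l) (σ.R 9))
    (fun j hj => by
      rw [Finset.mem_Icc] at hj
      have := h.rounds
      simp only [Store.rounds, Store.setR_I] at *
      omega)
    (fun j _ x => by
      rw [Store.setR_setR, BExpr.ile_eval, h.size_eq (by omega)]
      simp [IExpr.eval])
    (fun j hj x => by
      rw [Finset.mem_Icc] at hj
      simp only [Store.setR_setR, RExpr.eval, h.size_eq (show 5 ≤ 9 by omega)]
      simp [IExpr.eval, truncLine, h.slope j hj.2, h.X j (by omega), h.B _ le_rfl, h.B j hj.2,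
        Function.update_of_ne hr.symm])
  rw [Store.setR_setR] at h2
  have e1 : (Cmd.rset (rW s) (.sub (.arr (aB s) (RegretProgram.size s)) (.arr (aB s)
      (.const 0)))).run σ =
      σ.setR (rW s) (D.B D.k - D.B 0) := by
    simp [Cmd.run, RExpr.eval, IExpr.eval, h.size, h.B _ le_rfl, h.B 0 (by omega)]
  simp only [RegretProgram.amount]
  rw [Cmd.run, e1, h2]
  simp [Side.carry, lineEnvelope, Store.rounds]

end RegretProgram

/-! ### Correctness of the evacuations to vertices -/

namespace RegretProgram

open RealRAM UncertainPath

variable {n : ℕ} {P : UncertainPath n} {i h p q : ℕ} {σ τ ρ : Store} {c : Cmd}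

/-- The data of a path are in the arrays. -/
structure Bank (P : UncertainPath n) (s : Bool) (σ : Store) : Prop where
  X : ∀ l ≤ n + 1, σ.A (aX s) l = P.loc l
  C : ∀ l ≤ n, σ.A (aC s) l = P.capac l
  A : ∀ l ≤ n + 1, σ.A (aA s) l = partialSum (extend P.wlo) l
  H : ∀ l ≤ n + 1, σ.A (aH s) l = partialSum (extend P.whi) l

/-- The command does not touch the data of a path. -/
def keepsBank (s : Bool) (c : Cmd) : Bool :=
  !c.writesA (aX s) && !c.writesA (aC s) && !c.writesA (aA s) && !c.writesA (aH s)

theorem Bank.frame {s : Bool} (h : Bank P s σ) (hF : c.Frame σ τ) (hc : keepsBank s c = true) :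
    Bank P s τ := by
  simp only [keepsBank, Bool.and_eq_true, Bool.not_eq_true'] at hc
  obtain ⟨⟨⟨hX, hC⟩, hA⟩, hH⟩ := hc
  exact ⟨by rw [hF.onA _ hX]; exact h.X, by rw [hF.onA _ hC]; exact h.C,
    by rw [hF.onA _ hA]; exact h.A, by rw [hF.onA _ hH]; exact h.H⟩

/-- The data for vertex `i` are in the arrays. -/
structure Context (P : UncertainPath n) (i : ℕ) (σ : Store) : Prop where
  size : σ.I 0 = n
  index : σ.I 1 = i
  left : Bank P false σ
  right : Bank P.rev true σ
  mixed : ∀ l ≤ n + 1, σ.A 8 l = partialSum (P.mixed i) l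
  mixed_rev : ∀ l ≤ n + 1, σ.A 9 l = partialSum (fun j => P.mixed i (n - j)) l
  bottleneck : ∀ k, i ≤ k → k ≤ n → σ.A 10 k = bottleneck P.capac k i
  one_le : 1 ≤ i
  le : i ≤ n
  pos : 0 < extend P.whi (i - 1)

/-- The command does not touch the data for vertex `i`. -/
def keepsContext (c : Cmd) : Bool :=
  !c.writesI 0 && !c.writesI 1 && keepsBank false c && keepsBank true c && !c.writesA 8 &&
    !c.writesA 9 && !c.writesA 10

theorem Context.frame (h : Context P i σ) (hF : c.Frame σ τ) (hc : keepsContext c = true) :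
    Context P i τ := by
  simp only [keepsContext, Bool.and_eq_true, Bool.not_eq_true'] at hc
  obtain ⟨⟨⟨⟨⟨⟨h0, h1⟩, hb⟩, hb'⟩, h8⟩, h9⟩, h10⟩ := hc
  exact ⟨by rw [hF.onI _ h0]; exact h.size, by rw [hF.onI _ h1]; exact h.index, h.left.frame hF hb,
    h.right.frame hF hb', by rw [hF.onA _ h8]; exact h.mixed,
      by rw [hF.onA _ h9]; exact h.mixed_rev,
    by rw [hF.onA _ h10]; exact h.bottleneck, h.one_le, h.le, h.pos⟩

/-- The data for vertex `i` and for a sink between the first `p` and the last `q` vertices are in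
the arrays. -/
structure SlotContext (P : UncertainPath n) (i h p q : ℕ) (σ : Store) : Prop
    extends Context P i σ where
  slot : σ.I 2 = h
  L : Prepared (P.leftSide i p) false σ
  R : Prepared (P.rightSide i q) true σ

/-- The command does not touch the data for a sink. -/
def keepsSlot (c : Cmd) : Bool :=
  keepsContext c && !c.writesI 2 && keepsPrepared false c && keepsPrepared true c

theorem SlotContext.frame (h' : SlotContext P i h p q σ) (hF : c.Frame σ τ)
    (hc : keepsSlot c = true) : SlotContext P i h p q τ := by
  simp only [keepsSlot, Bool.and_eq_true, Bool.not_eq_true'] at hc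
  obtain ⟨⟨⟨h0, h2⟩, hl⟩, hr⟩ := hc
  exact ⟨h'.toContext.frame hF h0, by rw [hF.onI _ h2]; exact h'.slot, h'.L.frame hF hl,
    h'.R.frame hF hr⟩

theorem Context.loaded_left (H : Context P i σ) (hp : σ.I 3 = p) (hpn : p ≤ n) :
    Loaded (P.leftSide i p) false σ where
  size := hp
  place := H.index
  rounds := by
    have := H.size
    simp only [leftSide, Store.rounds]; omega
  X l hl := H.left.X l (by simp only [leftSide] at hl; omega)
  C l hl := H.left.C l (by simp only [leftSide] at hl; omega)
  A l hl := H.left.A l (by simp only [leftSide] at hl; omega)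
  B l hl := H.mixed l (by simp only [leftSide] at hl; omega)

theorem Context.loaded_right (H : Context P i σ) (hq : σ.I 4 = q) (hqn : q ≤ n) :
    Loaded (P.rightSide i q) true σ where
  size := hq
  place := by simp [place, IExpr.eval, H.index, H.size, rightSide]
  rounds := by
    have := H.size
    simp only [rightSide, Store.rounds]; omega
  X l hl := H.right.X l (by simp only [rightSide] at hl; omega)
  C l hl := H.right.C l (by simp only [rightSide] at hl; omega)
  A l hl := H.right.A l (by simp only [rightSide] at hl; omega)
  B l hl := H.mixed_rev l (by simp only [rightSide] at hl; omega)

theorem Context.prepare (H : Context P i σ) (hh : σ.I 2 = h) (hp : σ.I 3 = p) (hpn : p ≤ n)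
    (hq : σ.I 4 = q) (hqn : q ≤ n) :
    SlotContext P i h p q ((prepare true).run ((prepare false).run σ)) := by
  have F1 := Cmd.frame (RegretProgram.prepare false) σ
  have L1 := (H.loaded_left hp hpn).prepare
  set σ₁ := (RegretProgram.prepare false).run σ
  have H1 := H.frame F1 rfl
  have F2 := Cmd.frame (RegretProgram.prepare true) σ₁
  have R2 := (H1.loaded_right ((F1.onI 4 rfl).trans hq) hqn).prepare
  exact ⟨H1.frame F2 rfl, (F2.onI 2 rfl).trans ((F1.onI 2 rfl).trans hh), L1.frame F2 rfl, R2⟩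

/-- The table grows, and its entries remain excesses. -/
structure Grows (P : UncertainPath n) (σ τ : Store) : Prop where
  le : ∀ k, σ.A 18 k ≤ τ.A 18 k
  excess : (∀ k, 1 ≤ k → k ≤ n → P.IsExcess k (σ.A 18 k)) →
    ∀ k, 1 ≤ k → k ≤ n → P.IsExcess k (τ.A 18 k)

theorem Grows.of_eq (h : τ.A 18 = σ.A 18) : Grows P σ τ :=
  ⟨fun k => by rw [h], fun h' => by rwa [h]⟩

theorem Grows.of_frame (hF : c.Frame σ τ) (h : c.writesA 18 = false) : Grows P σ τ :=
  Grows.of_eq (hF.onA 18 h)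

theorem Grows.trans (h : Grows P σ τ) (h' : Grows P τ ρ) : Grows P σ ρ :=
  ⟨fun k => (h.le k).trans (h'.le k), fun h'' => h'.excess (h.excess h'')⟩

/-- Entries of the table only grow, and the properties `S j` are inherited by larger tables. What
one round establishes thus still holds after the loop. -/
theorem loop_grows {v : ℕ} (S : ℕ → (ℕ → ℝ) → Prop)
    (hS : ∀ j α α', (∀ k, α k ≤ α' k) → S j α → S j α')
    (hbody : ∀ j < σ.rounds, ∀ τ, (Cmd.loop v c).Frame σ τ → τ.I v = j →
      Grows P τ (c.run τ) ∧ S j ((c.run τ).A 18)) :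
    Grows P σ ((Cmd.loop v c).run σ) ∧ ∀ j < σ.rounds, S j (((Cmd.loop v c).run σ).A 18) :=
  loop_induct (c := c) (v := v) (σ := σ) (fun k τ => Grows P σ τ ∧ ∀ j < k, S j (τ.A 18))
    ⟨Grows.of_eq rfl, fun j hj => absurd hj (Nat.not_lt_zero j)⟩ fun k hk τ hF hv ⟨h1, h2⟩ => by
      obtain ⟨h3, h4⟩ := hbody k hk τ hF hv
      refine ⟨h1.trans (h3.trans (Grows.of_eq rfl)), fun j hj => ?_⟩
      rcases (Nat.lt_succ_iff.1 hj).eq_or_lt with rfl | hj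
      · exact h4
      · exact hS j _ _ h3.le (h2 j hj)

theorem forIn_grows {v a b : ℕ} {lo hi : IExpr} (S : ℕ → (ℕ → ℝ) → Prop)
    (hS : ∀ j α α', (∀ k, α k ≤ α' k) → S j α → S j α') (hb : b < σ.rounds)
    (hlo : ∀ τ, (forIn v lo hi c).Frame σ τ → lo.eval τ = a)
    (hhi : ∀ τ, (forIn v lo hi c).Frame σ τ → hi.eval τ = b)
    (hbody : ∀ j, a ≤ j → j ≤ b → ∀ τ, (forIn v lo hi c).Frame σ τ → τ.I v = j →
      Grows P τ (c.run τ) ∧ S j ((c.run τ).A 18)) :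
    Grows P σ ((forIn v lo hi c).run σ) ∧
      ∀ j, a ≤ j → j ≤ b → S j (((forIn v lo hi c).run σ).A 18) := by
  have key := loop_grows (P := P) (σ := σ) (v := v)
    (c := .ite (.and (.ile lo (.var v)) (.ile (.var v) hi)) c .skip)
    (fun j α => a ≤ j → j ≤ b → S j α) (fun j α α' h h' h1 h2 => hS j α α' h (h' h1 h2))
    (fun j _ τ hF hv => by
      have e : (BExpr.and (.ile lo (.var v)) (.ile (.var v) hi)).eval τ ↔ a ≤ j ∧ j ≤ b := by
        rw [BExpr.and_eval, BExpr.ile_eval, BExpr.ile_eval, hlo τ hF, hhi τ hF, IExpr.eval, hv]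
      by_cases h : a ≤ j ∧ j ≤ b
      · rw [Cmd.run_ite_pos (e.2 h)]
        obtain ⟨h1, h2⟩ := hbody j h.1 h.2 τ hF hv
        exact ⟨h1, fun _ _ => h2⟩
      · rw [Cmd.run_ite_neg (mt e.1 h)]
        exact ⟨Grows.of_eq rfl, fun h1 h2 => absurd ⟨h1, h2⟩ h⟩)
  exact ⟨key.1, fun j h1 h2 => key.2 j (by omega) h1 h2⟩

/-- A maximum of two excesses is one of them, so raising an entry keeps it an excess while making it
an upper bound for the new candidate. -/
theorem Context.raise (H : Context P i σ) {k : ℕ} (hk : σ.I 6 = k) (hik : i ≤ k) (hkn : k ≤ n)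
    {w t : RExpr} {W T : ℝ} (hw : w.eval σ = W) (ht : t.eval σ = T)
    (hE : P.IsExcess k (P.excess i k W T)) :
    Grows P σ ((raise w t).run σ) ∧ P.excess i k W T ≤ ((raise w t).run σ).A 18 k := by
  have e : (RegretProgram.raise w t).run σ =
      σ.setA 18 k (max (σ.A 18 k) (P.excess i k W T)) := by
    have e1 : σ.A 2 (n + 1) = partialSum (extend P.wlo) (n + 1) := H.left.A _ le_rfl
    have e2 : σ.A 2 i = partialSum (extend P.wlo) i := H.left.A _ (by have := H.le; omega)
    have e3 : σ.A 0 i = P.loc i := H.left.X _ (by have := H.le; omega)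
    have e4 := H.bottleneck k hik hkn
    simp only [RegretProgram.raise, Cmd.run, RExpr.eval, IExpr.eval, hk, H.size, H.index, hw, ht,
        e1,
      e2, e3, e4, UncertainPath.excess, tail]
  rw [e]
  refine ⟨⟨fun j => ?_, fun hj j h1 h2 => ?_⟩, ?_⟩
  · simp only [Store.setA_A, Function.update_self, Function.update_apply]
    split_ifs with hjk
    · exact hjk ▸ le_max_left _ _
    · exact le_rfl
  · simp only [Store.setA_A, Function.update_self, Function.update_apply]
    split_ifs with hjk
    · subst hjk
      rcases max_choice (σ.A 18 j) (P.excess i j W T) with h | h <;> rw [h]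
      · exact hj j h1 h2
      · exact hE
    · exact hj j h1 h2
  · simp

/-- The two amounts are evaluated once and used for all k. The condition on T is what makes the
candidate an admissible excess. -/
theorem SlotContext.atTime (H : SlotContext P i h (h - 1) (n + 1 - h) σ) (h1 : 1 ≤ h)
    (hn : h ≤ n + 1) {T : ℝ} (hT : σ.R 5 = T) (hfeas : P.vertexStart i h ≤ T) :
    Grows P σ (atTime.run σ) ∧ ∀ k, i ≤ k → k ≤ n →
      P.excess i k (P.slotWeight i (h - 1) (n + 1 - h) (P.loc h) T) T ≤ (atTime.run σ).A 18 k := by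
  set c1 : Cmd := .rset 9 (.sub (.var 5) (.arr 0 (.var 2))) with hc1
  set c3 : Cmd := .rset 9 (.sub (.var 5) (.sub (.arr 0 (.add (.var 0) (.const 1))) (.arr 0
      (.var 2))))
    with hc3
  have F1 := Cmd.frame c1 σ
  have e1 : (c1.run σ).R 9 = T - P.loc h := by
    have e3 : σ.A 0 h = P.loc h := H.left.X _ hn
    simp [hc1, Cmd.run, RExpr.eval, IExpr.eval, H.slot, hT, e3]
  set σ₁ := c1.run σ
  have H1 := H.frame F1 rfl
  have e2 := H1.L.amount
  have F2 := Cmd.frame (amount false) σ₁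
  set σ₂ := (amount false).run σ₁
  have H2 := H1.frame F2 rfl
  have w2 : σ₂.R 6 = (P.leftSide i (h - 1)).carry (T - P.loc h) := by
    rw [e2, e1]; simp [rW]
  have F3 := Cmd.frame c3 σ₂
  have e3 : (c3.run σ₂).R 9 = T - (P.len - P.loc h) := by
    have e3 : σ₂.A 0 h = P.loc h := H2.left.X _ hn
    have e4 : σ₂.A 0 (n + 1) = P.len := H2.left.X _ le_rfl
    have e5 : σ₂.R 5 = T := (F2.onR 5 rfl).trans ((F1.onR 5 rfl).trans hT)
    simp [hc3, Cmd.run, RExpr.eval, IExpr.eval, H2.slot, H2.size, e3, e4, e5]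
  set σ₃ := c3.run σ₂
  have H3 := H2.frame F3 rfl
  have e4 := H3.R.amount
  have F4 := Cmd.frame (amount true) σ₃
  set σ₄ := (amount true).run σ₃
  have H4 := H3.frame F4 rfl
  have w4 : σ₄.R 7 = (P.rightSide i (n + 1 - h)).carry (T - (P.len - P.loc h)) := by
    rw [e4, e3]; simp [rW]
  have w4' : σ₄.R 6 = (P.leftSide i (h - 1)).carry (T - P.loc h) :=
    (F4.onR 6 rfl).trans ((F3.onR 6 rfl).trans w2)
  have t4 : σ₄.R 5 = T := (F4.onR 5 rfl).trans ((F3.onR 5 rfl).trans ((F2.onR 5 rfl).trans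
    ((F1.onR 5 rfl).trans hT)))
  have key := forIn_grows (P := P) (σ := σ₄) (v := 6) (a := i) (b := n) (lo := .var 1)
    (hi := .var 0)
    (c := raise (.add (.add (.var 6) (.sub (.arr 8 (.var 2)) (.arr 8 (.sub (.var 2) (.const 1)))))
      (.var 7)) (.var 5))
    (fun k α => P.excess i k (P.slotWeight i (h - 1) (n + 1 - h) (P.loc h) T) T ≤ α k)
    (fun j α α' h h' => h'.trans (h j)) (by have := H4.size; simp only [Store.rounds]; omega)
    (fun τ hF => (H4.toContext.frame hF rfl).index) (fun τ hF => (H4.toContext.frame hF rfl).size)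
    (fun k hik hkn τ hF hv => by
      have H5 := H4.frame hF rfl
      refine H5.toContext.raise hv hik hkn ?_ ((hF.onR 5 rfl).trans t4) (Or.inr ⟨i, h - 1,
          n + 1 - h,
        P.loc h, T, H.one_le, hik, H.pos, P.isSlot_vertex h1 hn, ?_, ?_, rfl⟩)
      · have e5 := H5.mixed h hn
        have e6 := H5.mixed (h - 1) (by omega)
        have e7 : partialSum (P.mixed i) h = partialSum (P.mixed i) (h - 1) +
              P.mixed i (h - 1) := by
          obtain ⟨j, rfl⟩ : ∃ j, h = j + 1 := ⟨h - 1, by omega⟩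
          rw [partialSum_succ, Nat.add_sub_cancel]
        simp only [RExpr.eval, IExpr.eval, H5.slot, e5, e6, e7, hF.onR 6 rfl, hF.onR 7 rfl, w4, w4',
          slotWeight, if_pos (show h - 1 + (n + 1 - h) = n by omega)]
        ring
      · linarith [(le_max_left _ _).trans hfeas]
      · linarith [(le_max_right _ _).trans hfeas])
  have G4 : Grows P σ σ₄ := ((Grows.of_frame F1 rfl).trans (Grows.of_frame F2 rfl)).trans
    ((Grows.of_frame F3 rfl).trans (Grows.of_frame F4 rfl))
  exact ⟨G4.trans key.1, key.2⟩

theorem SlotContext.atVertex (H : SlotContext P i h (h - 1) (n + 1 - h) σ) (h1 : 1 ≤ h)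
    (hn : h ≤ n + 1) :
    Grows P σ (atVertex.run σ) ∧ ∀ k, i ≤ k → k ≤ n → P.BoundsVertex i k h
      ((atVertex.run σ).A 18 k) := by
  set c1 : Cmd := .rset 4 (.max (.add (.var 2) (.arr 0 (.var 2)))
    (.add (.var 3) (.sub (.arr 0 (.add (.var 0) (.const 1))) (.arr 0 (.var 2))))) with hc1
  have loc_eq : ∀ {τ}, SlotContext P i h (h - 1) (n + 1 - h) τ → τ.A 0 h = P.loc h :=
    fun H => H.left.X _ hn
  have len_eq : ∀ {τ}, SlotContext P i h (h - 1) (n + 1 - h) τ → τ.A 0 (n + 1) = P.len :=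
    fun H => H.left.X _ le_rfl
  have F1 := Cmd.frame c1 σ
  have t1 : (c1.run σ).R 4 = P.vertexStart i h := by
    have e5 : σ.R 2 = _ := H.L.start
    have e6 : σ.R 3 = _ := H.R.start
    simp [hc1, Cmd.run, RExpr.eval, IExpr.eval, H.slot, H.size, loc_eq H, len_eq H, e5, e6,
        vertexStart]
  set σ₁ := c1.run σ
  have H1 := H.frame F1 rfl
  set body2 : Cmd := .seq (.rset 5 (.max (.var 4) (.add (.arr 13 (.var 5)) (.arr 0 (.var 2)))))
    RegretProgram.atTime with hbody2
  have key2 := forIn_grows (P := P) (σ := σ₁) (v := 5) (a := 0) (b := h - 1 + (h - 1) + 1)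
    (lo := .const 0) (hi := .add (.add (size false) (size false)) (.const 1)) (c := body2)
    (fun j α => ∀ k, i ≤ k → k ≤ n → ∀ t, t = max (P.vertexStart i h) (σ₁.A 13 j + P.loc h) →
      P.excess i k (P.slotWeight i (h - 1) (n + 1 - h) (P.loc h) t) t ≤ α k)
    (fun j α α' h h' k hik hkn t ht => (h' k hik hkn t ht).trans (h k))
    (by have := H1.size; simp only [Store.rounds]; omega) (fun _ _ => rfl)
    (fun τ hF => by
      have e : (size false).eval τ = h - 1 := (H1.frame hF rfl).L.size
      simp [IExpr.eval, e])
    (fun j _ hj τ hF hv => by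
      have H2 := H1.frame hF rfl
      set c2 : Cmd := .rset 5 (.max (.var 4) (.add (.arr 13 (.var 5)) (.arr 0 (.var 2))))
      have F3 := Cmd.frame c2 τ
      have e3 : (c2.run τ).R 5 = max (P.vertexStart i h) (σ₁.A 13 j + P.loc h) := by
        simp [c2, Cmd.run, RExpr.eval, IExpr.eval, hv, H2.slot, loc_eq H2, hF.onR 4 rfl, t1,
          hF.onA 13 rfl]
      have H3 := H2.frame F3 rfl
      obtain ⟨g1, g2⟩ := H3.atTime h1 hn e3 (le_max_left _ _)
      refine ⟨(Grows.of_frame F3 rfl).trans g1, ?_⟩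
      rintro k hik hkn t rfl
      exact g2 k hik hkn)
  have F2 := Cmd.frame (forIn 5 (.const 0) (.add (.add (size false) (size false))
      (.const 1)) body2) σ₁
  set σ₂ := (forIn 5 (.const 0) (.add (.add (size false) (size false)) (.const 1)) body2).run σ₁
  have H2 := H1.frame F2 rfl
  have t2 : σ₂.R 4 = P.vertexStart i h := (F2.onR 4 rfl).trans t1
  set body3 : Cmd := .seq (.rset 5 (.max (.var 4) (.add (.arr 14 (.var 5))
      (.sub (.arr 0 (.add (.var 0) (.const 1))) (.arr 0
        (.var 2)))))) RegretProgram.atTime with hbody3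
  have key3 := forIn_grows (P := P) (σ := σ₂) (v := 5) (a := 0) (b := n + 1 - h + (n + 1 - h) + 1)
    (lo := .const 0) (hi := .add (.add (size true) (size true)) (.const 1)) (c := body3)
    (fun j α => ∀ k, i ≤ k → k ≤ n → ∀ t, t = max (P.vertexStart i h) (σ₂.A 14 j +
      (P.len - P.loc h)) →
      P.excess i k (P.slotWeight i (h - 1) (n + 1 - h) (P.loc h) t) t ≤ α k)
    (fun j α α' h h' k hik hkn t ht => (h' k hik hkn t ht).trans (h k))
    (by have := H2.size; simp only [Store.rounds]; omega) (fun _ _ => rfl)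
    (fun τ hF => by
      have e : (size true).eval τ = n + 1 - h := (H2.frame hF rfl).R.size
      simp [IExpr.eval, e])
    (fun j _ hj τ hF hv => by
      have H3 := H2.frame hF rfl
      set c2 : Cmd := .rset 5 (.max (.var 4) (.add (.arr 14 (.var 5))
        (.sub (.arr 0 (.add (.var 0) (.const 1))) (.arr 0 (.var 2)))))
      have F3 := Cmd.frame c2 τ
      have e3 : (c2.run τ).R 5 = max (P.vertexStart i h) (σ₂.A 14 j + (P.len - P.loc h)) := by
        simp [c2, Cmd.run, RExpr.eval, IExpr.eval, hv, H3.slot, H3.size, loc_eq H3, len_eq H3,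
          hF.onR 4 rfl, t2, hF.onA 14 rfl]
      have H4 := H3.frame F3 rfl
      obtain ⟨g1, g2⟩ := H4.atTime h1 hn e3 (le_max_left _ _)
      refine ⟨(Grows.of_frame F3 rfl).trans g1, ?_⟩
      rintro k hik hkn t rfl
      exact g2 k hik hkn)
  refine ⟨(Grows.of_frame F1 rfl).trans (key2.1.trans key3.1),
      fun k hik hkn => ⟨fun x hx t ht => ?_,
    fun x hx t ht => ?_⟩⟩
  · obtain ⟨j, hj, rfl⟩ := H1.L.exists_of_mem_breaks hx
    exact (key2.2 j (Nat.zero_le _) hj k hik hkn t ht).trans (key3.1.le k)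
  · obtain ⟨j, hj, rfl⟩ := H2.R.exists_of_mem_breaks hx
    exact key3.2 j (Nat.zero_le _) hj k hik hkn t ht

end RegretProgram

/-! ### Correctness of the evacuations into edges -/

namespace RegretProgram

open RealRAM UncertainPath

variable {n : ℕ} {P : UncertainPath n} {i h : ℕ} {σ τ : Store} {c : Cmd}

/-- Tabulating the values at all breakpoints keeps the loop over k from evaluating envelopes again,
which would add a level of nesting. -/
theorem Prepared.amounts {D : Side} {s : Bool} (H : Prepared D s σ)
    (hr : D.k + D.k + 1 < σ.rounds) : ∀ j ≤ D.k + D.k + 1,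
    ((amounts s).run σ).A (aW s) j = D.carry (σ.A (aU s) j) := by
  have key := (run_loop_store (v := 5) (σ := σ) (a := aW s)
    (b := .ile (.var 5) (.add (.add (size s) (size s)) (.const 1)))
    (c := .seq (.rset 9 (.arr (aU s) (.var 5))) (RegretProgram.amount s)) (idx := .var 5)
    (e := .var (rW s))
    (Finset.range (D.k + D.k + 2)) id (fun j => D.carry (σ.A (aU s) j)) Function.injective_id
    (fun j hj => by rw [Finset.mem_range] at hj; omega) (by cases s <;> rfl)
    (fun j _ τ hF hv => by
      have e := (H.frame hF (by cases s <;> rfl)).size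
      rw [Finset.mem_range, BExpr.ile_eval]
      simp only [IExpr.eval, hv, e]
      omega)
    (fun j hj τ hF hv => by
      have H1 := H.frame hF (by cases s <;> rfl)
      have F2 := Cmd.frame (.rset 9 (.arr (aU s) (.var 5))) τ
      have H2 := H1.frame F2 (by cases s <;> rfl)
      have e : ((Cmd.rset 9 (.arr (aU s) (.var 5))).run τ).R 9 = σ.A (aU s) j := by
        rw [← hF.onA (aU s) (by cases s <;> rfl)]
        simp [Cmd.run, RExpr.eval, IExpr.eval, hv]
      have e' : ((Cmd.rset 9 (.arr (aU s) (.var 5))).run τ).I 5 = j := hv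
      rw [Cmd.run_seq, H2.amount, e]
      exact ⟨by simp [IExpr.eval, e'], by simp [RExpr.eval]⟩)).1
  exact fun j hj => key j (by rw [Finset.mem_range]; omega)

/-- The data for vertex `i` and for a sink inside edge `h` are in the arrays. -/
structure EdgeContext (P : UncertainPath n) (i h : ℕ) (σ : Store) : Prop
    extends SlotContext P i h h (n + 1 - h) σ where
  left_value : ∀ j ≤ h + h + 1, σ.A 15 j = (P.leftSide i h).carry (σ.A 13 j)
  right_value : ∀ j ≤ n + 1 - h + (n + 1 - h) + 1,
    σ.A 16 j = (P.rightSide i (n + 1 - h)).carry (σ.A 14 j)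

/-- The command does not touch the data for an edge. -/
def keepsEdge (c : Cmd) : Bool := keepsSlot c && !c.writesA 15 && !c.writesA 16

theorem EdgeContext.frame (h' : EdgeContext P i h σ) (hF : c.Frame σ τ)
    (hc : keepsEdge c = true) : EdgeContext P i h τ := by
  simp only [keepsEdge, Bool.and_eq_true, Bool.not_eq_true'] at hc
  obtain ⟨⟨h0, h15⟩, h16⟩ := hc
  have h0' := h0
  simp only [keepsSlot, keepsPrepared, Bool.and_eq_true, Bool.not_eq_true'] at h0'
  have h13 : c.writesA 13 = false := h0'.1.2.1.2
  have h14 : c.writesA 14 = false := h0'.2.1.2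
  exact ⟨h'.toSlotContext.frame hF h0, by rw [hF.onA _ h15, hF.onA _ h13]; exact h'.left_value,
    by rw [hF.onA _ h16, hF.onA _ h14]; exact h'.right_value⟩

/-- The maximizer depends on k through the bottleneck, so it is found for each k by a scan of the
tabulated values. The invariant is that the pair of variables is a feasible point with its value,
not worse than the breakpoints already seen. -/
theorem EdgeContext.bestBreak (H : EdgeContext P i h σ) {k : ℕ} (hk : σ.I 6 = k) (hik : i ≤ k)
    (hkn : k ≤ n) : ∃ v, (P.rightSide i (n + 1 - h)).start ≤ v ∧
    (bestBreak.run σ).R 10 = v ∧ (bestBreak.run σ).R 11 = (P.rightSide i (n + 1 - h)).carry v ∧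
    ∀ x ∈ (P.rightSide i (n + 1 - h)).breaks,
      (P.rightSide i (n + 1 - h)).carry x / bottleneck P.capac k i - x / 2 ≤
        (P.rightSide i (n + 1 - h)).carry v / bottleneck P.capac k i - v / 2 := by
  set D := P.rightSide i (n + 1 - h) with hD
  have hDk : D.k = n + 1 - h := rfl
  set μ := _root_.bottleneck P.capac k i
  set c1 : Cmd := .seq (.rset 10 (.arr 14 (.const 0))) (.rset 11 (.arr 16 (.const 0)))
  have F1 := Cmd.frame c1 σ
  have e10 : (c1.run σ).R 10 = σ.A 14 0 := by simp [c1, Cmd.run, RExpr.eval, IExpr.eval]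
  have e11 : (c1.run σ).R 11 = D.carry (σ.A 14 0) := by
    simp [c1, Cmd.run, RExpr.eval, IExpr.eval, H.right_value 0 (Nat.zero_le _), hD]
  set σ₁ := c1.run σ
  have H1 := H.frame F1 rfl
  have hk1 : σ₁.I 6 = k := (F1.onI 6 rfl).trans hk
  have key := loop_induct (v := 5) (σ := σ₁) (c := .ite (.and (.ile (.const 0) (.var 5))
      (.ile (.var 5) (.add (.add (size true) (size true)) (.const 1))))
      (.ite (.rle (.sub (.div (.var 11) (.arr 10 (.var 6))) (.div (.var 10) (.const 2)))
        (.sub (.div (.arr 16 (.var 5)) (.arr 10 (.var 6))) (.div (.arr 14 (.var 5)) (.const 2))))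
      (.seq (.rset 10 (.arr 14 (.var 5))) (.rset 11 (.arr 16 (.var 5)))) .skip) .skip)
    (fun j τ => D.start ≤ τ.R 10 ∧ τ.R 11 = D.carry (τ.R 10) ∧
      ∀ m < j, m ≤ n + 1 - h + (n + 1 - h) + 1 →
        D.carry (σ.A 14 m) / μ - σ.A 14 m / 2 ≤ τ.R 11 / μ - τ.R 10 / 2)
    ⟨by
      show D.start ≤ σ₁.R 10
      rw [e10]
      exact D.start_le_of_mem (H.R.mem_breaks (Nat.zero_le _)), by
      show σ₁.R 11 = D.carry (σ₁.R 10)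
      rw [e11, e10], fun m hm => absurd hm (Nat.not_lt_zero m)⟩
    (by
      rintro j hj τ hF hv ⟨h1, h2, h3⟩
      have H2 := H1.frame hF rfl
      have e14 : τ.A 14 = σ.A 14 := (hF.onA 14 rfl).trans (F1.onA 14 rfl)
      have e16 : τ.A 16 = σ.A 16 := (hF.onA 16 rfl).trans (F1.onA 16 rfl)
      have eM : τ.A 10 k = μ := H2.bottleneck k hik hkn
      have e6 : τ.I 6 = k := (hF.onI 6 rfl).trans hk1
      have es : (size true).eval τ = n + 1 - h := H2.R.size
      have eg : (BExpr.and (.ile (.const 0) (.var 5))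
          (.ile (.var 5) (.add (.add (size true) (size true)) (.const 1)))).eval τ ↔
          j ≤ n + 1 - h + (n + 1 - h) + 1 := by
        simp [BExpr.and_eval, BExpr.ile_eval, IExpr.eval, es, hv]
      by_cases hg : j ≤ n + 1 - h + (n + 1 - h) + 1
      · rw [Cmd.run_ite_pos (eg.2 hg)]
        have hval : τ.A 16 j = D.carry (τ.A 14 j) := H2.right_value j hg
        have er : (BExpr.rle (.sub (.div (.var 11) (.arr 10 (.var 6))) (.div (.var 10) (.const 2)))
            (.sub (.div (.arr 16 (.var 5)) (.arr 10 (.var 6)))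
              (.div (.arr 14 (.var 5)) (.const 2)))).eval τ ↔
            τ.R 11 / μ - τ.R 10 / 2 ≤ D.carry (σ.A 14 j) / μ - σ.A 14 j / 2 := by
          rw [← e14, ← hval]
          simp [BExpr.eval, RExpr.eval, IExpr.eval, e6, eM, hv]
        by_cases hle : τ.R 11 / μ - τ.R 10 / 2 ≤ D.carry (σ.A 14 j) / μ - σ.A 14 j / 2
        · rw [Cmd.run_ite_pos (er.2 hle)]
          have r10 : ((Cmd.seq (.rset 10 (.arr 14 (.var 5))) (.rset 11 (.arr 16
              (.var 5)))).run τ).R 10 =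
              σ.A 14 j := by simp [Cmd.run, RExpr.eval, IExpr.eval, hv, e14]
          have r11 : ((Cmd.seq (.rset 10 (.arr 14 (.var 5))) (.rset 11 (.arr 16
              (.var 5)))).run τ).R 11 =
              D.carry (σ.A 14 j) := by
            rw [← e14, ← hval]
            simp [Cmd.run, RExpr.eval, IExpr.eval, hv]
          simp only [Store.setI_R, r10, r11]
          refine ⟨D.start_le_of_mem (H.R.mem_breaks hg), trivial, fun m hm hm' => ?_⟩
          rcases (Nat.lt_succ_iff.1 hm).eq_or_lt with rfl | hm
          · exact le_rfl
          · exact (h3 m hm hm').trans hle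
        · rw [Cmd.run_ite_neg (mt er.1 hle)]
          refine ⟨h1, h2, fun m hm hm' => ?_⟩
          rcases (Nat.lt_succ_iff.1 hm).eq_or_lt with rfl | hm
          · exact (not_le.1 hle).le
          · exact h3 m hm hm'
      · rw [Cmd.run_ite_neg (mt eg.1 hg)]
        exact ⟨h1, h2, fun m hm hm' => h3 m (by omega) hm'⟩)
  obtain ⟨k1, k2, k3⟩ := key
  refine ⟨_, k1, rfl, k2, fun x hx => ?_⟩
  obtain ⟨m, hm, rfl⟩ := H.R.exists_of_mem_breaks hx
  rw [← k2]
  have := H1.R.rounds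
  rw [hDk] at hm
  change 2 * D.k + 1 < σ₁.rounds at this
  exact k3 m (by omega) hm

/-- The guard tests that the sink recovered from u and v is strictly inside the edge, which is what
makes the candidate an excess. The ends are covered by the vertices. -/
theorem EdgeContext.body (H : EdgeContext P i h σ) (h1 : 1 ≤ h) (hn : h ≤ n) {k : ℕ}
    (hk : σ.I 6 = k) (hik : i ≤ k) (hkn : k ≤ n) {v : ℝ}
    (hv : (P.rightSide i (n + 1 - h)).start ≤ v) (h10 : σ.R 10 = v)
    (h11 : σ.R 11 = (P.rightSide i (n + 1 - h)).carry v) {c : Cmd}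
    (hc : c = forIn 5 (.const 0) (.add (.add (size false) (size false)) (.const 1))
      (.seq (.rset 13 (.div (.add (.sub (.var 10) (.arr 13 (.var 5)))
        (.arr 0 (.add (.var 0) (.const 1)))) (.const 2)))
      (.ite (.and (.rlt (.arr 0 (.var 2)) (.var 13))
          (.rlt (.var 13) (.arr 0 (.add (.var 2) (.const 1)))))
        (raise (.add (.arr 15 (.var 5)) (.var 11))
          (.div (.add (.add (.arr 13 (.var 5)) (.var 10))
            (.arr 0 (.add (.var 0) (.const 1)))) (.const 2))) .skip))) :
    Grows P σ (c.run σ) ∧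
    ∀ u ∈ (P.leftSide i h).breaks, P.loc h < (v - u + P.len) / 2 →
      (v - u + P.len) / 2 < P.loc (h + 1) →
      P.excess i k ((P.leftSide i h).carry u + (P.rightSide i (n + 1 - h)).carry v)
        ((u + v + P.len) / 2) ≤ (c.run σ).A 18 k := by
  subst hc
  set c2 : Cmd := .rset 13 (.div (.add (.sub (.var 10) (.arr 13 (.var 5)))
        (.arr 0 (.add (.var 0) (.const 1)))) (.const 2)) with hc2
  set c3 : Cmd := raise (.add (.arr 15 (.var 5)) (.var 11))
          (.div (.add (.add (.arr 13 (.var 5)) (.var 10))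
            (.arr 0 (.add (.var 0) (.const 1)))) (.const 2)) with hc3
  have key := forIn_grows (P := P) (σ := σ) (v := 5) (a := 0) (b := h + h + 1)
    (lo := .const 0) (hi := .add (.add (size false) (size false)) (.const 1))
    (c := .seq c2 (.ite (.and (.rlt (.arr 0 (.var 2)) (.var 13))
          (.rlt (.var 13) (.arr 0 (.add (.var 2) (.const 1))))) c3 .skip))
    (fun j α => P.loc h < (v - σ.A 13 j + P.len) / 2 →
      (v - σ.A 13 j + P.len) / 2 < P.loc (h + 1) →
      P.excess i k ((P.leftSide i h).carry (σ.A 13 j) + (P.rightSide i (n + 1 - h)).carry v)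
        ((σ.A 13 j + v + P.len) / 2) ≤ α k)
    (fun j α α' h h' h1 h2 => (h' h1 h2).trans (h k))
    (by have := H.size; simp only [Store.rounds]; omega) (fun _ _ => rfl)
    (fun τ hF => by
      have e : (size false).eval τ = h := (H.frame hF rfl).L.size
      simp [IExpr.eval, e])
    (fun j _ hj τ hF hvj => by
      have H1 := H.frame hF rfl
      have F2 := Cmd.frame c2 τ
      have e13 : τ.A 13 = σ.A 13 := hF.onA 13 rfl
      have elen : τ.A 0 (n + 1) = P.len := H1.left.X _ le_rfl
      have e2 : (c2.run τ).R 13 = (v - σ.A 13 j + P.len) / 2 := by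
        simp [hc2, Cmd.run, RExpr.eval, IExpr.eval, hvj, e13, elen, H1.size, hF.onR 10 rfl, h10]
      set τ₂ := c2.run τ
      have H2 := H1.frame F2 rfl
      have e13' : τ₂.A 13 = σ.A 13 := (F2.onA 13 rfl).trans e13
      have r10 : τ₂.R 10 = v := (F2.onR 10 rfl).trans ((hF.onR 10 rfl).trans h10)
      have r11 : τ₂.R 11 = _ := (F2.onR 11 rfl).trans ((hF.onR 11 rfl).trans h11)
      have i5 : τ₂.I 5 = j := (F2.onI 5 rfl).trans hvj
      have i6 : τ₂.I 6 = k := (F2.onI 6 rfl).trans ((hF.onI 6 rfl).trans hk)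
      have elen' : τ₂.A 0 (n + 1) = P.len := H2.left.X _ le_rfl
      have eloc : τ₂.A 0 h = P.loc h := H2.left.X _ (by omega)
      have eloc' : τ₂.A 0 (h + 1) = P.loc (h + 1) := H2.left.X _ (by omega)
      have eg : (BExpr.and (.rlt (.arr 0 (.var 2)) (.var 13))
          (.rlt (.var 13) (.arr 0 (.add (.var 2) (.const 1))))).eval τ₂ ↔
          P.loc h < (v - σ.A 13 j + P.len) / 2 ∧ (v - σ.A 13 j + P.len) / 2 < P.loc (h + 1) := by
        simp only [BExpr.and_eval, BExpr.rlt_eval, RExpr.eval, IExpr.eval, H2.slot, eloc, eloc', e2]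
      rw [Cmd.run_seq]
      by_cases hg : P.loc h < (v - σ.A 13 j + P.len) / 2 ∧
        (v - σ.A 13 j + P.len) / 2 < P.loc (h + 1)
      · rw [Cmd.run_ite_pos (eg.2 hg)]
        have hu : (P.leftSide i h).start ≤ σ.A 13 j :=
          (P.leftSide i h).start_le_of_mem (H.L.mem_breaks hj)
        have hW := H2.left_value j hj
        rw [e13'] at hW
        -- The change of coordinates from (y, t) to (u, v) is inverted.
        have t1 : (σ.A 13 j + v + P.len) / 2 - (v - σ.A 13 j + P.len) / 2 = σ.A 13 j := by ring
        have t2 : (σ.A 13 j + v + P.len) / 2 - (P.len - (v - σ.A 13 j + P.len) / 2) = v := by ring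
        obtain ⟨g1, g2⟩ := H2.toContext.raise i6 hik hkn (w := .add (.arr 15 (.var 5)) (.var 11))
          (t := .div (.add (.add (.arr 13 (.var 5)) (.var 10))
            (.arr 0 (.add (.var 0) (.const 1)))) (.const 2))
          (W := (P.leftSide i h).carry (σ.A 13 j) + (P.rightSide i (n + 1 - h)).carry v)
          (T := (σ.A 13 j + v + P.len) / 2)
          (by simp only [RExpr.eval, IExpr.eval, i5, hW, r11])
          (by simp [RExpr.eval, IExpr.eval, i5, e13', r10, elen', H2.size])
          (Or.inr ⟨i, h, n + 1 - h, (v - σ.A 13 j + P.len) / 2, (σ.A 13 j + v + P.len) / 2,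
            H.one_le,
            hik, H.pos, P.isSlot_edge h1 hn hg.1 hg.2, by rwa [t1], by rwa [t2], by
              rw [slotWeight, t1, t2, if_neg (by omega), add_zero]⟩)
        exact ⟨(Grows.of_frame F2 rfl).trans g1, fun _ _ => g2⟩
      · rw [Cmd.run_ite_neg (mt eg.1 hg)]
        exact ⟨Grows.of_frame F2 rfl, fun h1 h2 => absurd ⟨h1, h2⟩ hg⟩)
  refine ⟨key.1, fun u hu h2 h3 => ?_⟩
  obtain ⟨j, hj, rfl⟩ := H.L.exists_of_mem_breaks hu
  exact key.2 j (Nat.zero_le _) hj h2 h3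

theorem BoundsEdge.mono {k : ℕ} {r r' : ℝ} (H : P.BoundsEdge i k h r) (hr : r ≤ r') :
    P.BoundsEdge i k h r' := by
  obtain ⟨v, h1, h2, h3⟩ := H
  exact ⟨v, h1, h2, fun u hu h4 h5 => (h3 u hu h4 h5).trans hr⟩

theorem BoundsVertex.mono {k : ℕ} {r r' : ℝ} (H : P.BoundsVertex i k h r) (hr : r ≤ r') :
    P.BoundsVertex i k h r' :=
  ⟨fun c hc t ht => (H.1 c hc t ht).trans hr, fun c hc t ht => (H.2 c hc t ht).trans hr⟩

theorem SlotContext.atEdge (H : SlotContext P i h h (n + 1 - h) σ) (h1 : 1 ≤ h) (hn : h ≤ n) :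
    Grows P σ (atEdge.run σ) ∧ ∀ k, i ≤ k → k ≤ n → P.BoundsEdge i k h ((atEdge.run σ).A 18 k) := by
  have F1 := Cmd.frame (amounts false) σ
  have W1 := H.L.amounts (by have := H.L.rounds; omega)
  set σ₁ := (amounts false).run σ
  have H1 := H.frame F1 rfl
  have F2 := Cmd.frame (amounts true) σ₁
  have W2 := H1.R.amounts (by have := H1.R.rounds; omega)
  set σ₂ := (amounts true).run σ₁
  have H2 : EdgeContext P i h σ₂ := by
    refine ⟨H1.frame F2 rfl, fun j hj => ?_, fun j hj => ?_⟩
    · rw [F2.onA 15 rfl, F2.onA 13 rfl, F1.onA 13 rfl]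
      exact W1 j hj
    · rw [F2.onA 14 rfl]
      exact W2 j hj
  have key := forIn_grows (P := P) (σ := σ₂) (v := 6) (a := i) (b := n) (lo := .var 1)
    (hi := .var 0)
    (c := .seq bestBreak (forIn 5 (.const 0) (.add (.add (size false) (size false)) (.const 1))
      (.seq (.rset 13 (.div (.add (.sub (.var 10) (.arr 13 (.var 5)))
        (.arr 0 (.add (.var 0) (.const 1)))) (.const 2)))
      (.ite (.and (.rlt (.arr 0 (.var 2)) (.var 13))
          (.rlt (.var 13) (.arr 0 (.add (.var 2) (.const 1)))))
        (raise (.add (.arr 15 (.var 5)) (.var 11))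
          (.div (.add (.add (.arr 13 (.var 5)) (.var 10))
            (.arr 0 (.add (.var 0) (.const 1)))) (.const 2))) .skip))))
    (fun k α => P.BoundsEdge i k h (α k)) (fun j α α' h h' => BoundsEdge.mono h' (h j))
    (by have := H2.size; simp only [Store.rounds]; omega)
    (fun τ hF => (H2.frame hF rfl).index) (fun τ hF => (H2.frame hF rfl).size)
    (fun k hik hkn τ hF hv => by
      have H3 := H2.frame hF rfl
      obtain ⟨v, v1, v2, v3, v4⟩ := H3.bestBreak hv hik hkn
      have F4 := Cmd.frame RegretProgram.bestBreak τ
      obtain ⟨g1, g2⟩ := (H3.frame F4 rfl).body h1 hn ((F4.onI 6 rfl).trans hv) hik hkn v1 v2 v3 rfl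
      exact ⟨(Grows.of_frame F4 rfl).trans g1, v, v1, v4, g2⟩)
  exact ⟨((Grows.of_frame F1 rfl).trans (Grows.of_frame F2 rfl)).trans key.1, key.2⟩

end RegretProgram

/-! ### Correctness of the table -/

namespace RegretProgram

open RealRAM UncertainPath

variable {n : ℕ} {P : UncertainPath n} {i h : ℕ} {σ τ : Store} {c : Cmd}

/-- Lets every prefix sum of mixed weights be computed in constant time from the stored prefix sums
of smallest and largest weights. -/
theorem mixed_partialSum (P : UncertainPath n) (i l : ℕ) : partialSum (P.mixed i) l =
    if l ≤ i then partialSum (extend P.whi) l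
    else partialSum (extend P.whi) i + partialSum (extend P.wlo) l -
      partialSum (extend P.wlo) i := by
  split_ifs with h
  · refine Finset.sum_congr rfl fun j hj => ?_
    rw [Finset.mem_range] at hj
    rw [mixed, if_pos (by omega)]
  · have : ∀ l, i ≤ l → partialSum (P.mixed i) l =
        partialSum (extend P.whi) i + partialSum (extend P.wlo) l -
            partialSum (extend P.wlo) i := by
      intro l hl
      induction l, hl using Nat.le_induction with
      | base =>
        have : partialSum (P.mixed i) i = partialSum (extend P.whi) i :=
          Finset.sum_congr rfl fun j hj => by
            rw [Finset.mem_range] at hj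
            rw [mixed, if_pos (by omega)]
        rw [this]; ring
      | succ l hl ih =>
        rw [partialSum_succ, ih, partialSum_succ, mixed, if_neg (by omega)]; ring
    exact this l (by omega)

theorem partialSum_reflect (w : ℕ → ℝ) {l m : ℕ} (hl : l ≤ m + 1) :
    partialSum (fun j => w (m - j)) l = partialSum w (m + 1) - partialSum w (m + 1 - l) := by
  induction l with
  | zero => simp [partialSum_zero]
  | succ l ih =>
    rw [partialSum_succ, ih (by omega), show m + 1 - l = m - l + 1 by omega,
        partialSum_succ w (m - l),
      show m + 1 - (l + 1) = m - l by omega]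
    ring

/-- A loop that fills entries `0, …, m` of an array. -/
theorem fill_upTo {hi : IExpr} {c : Cmd} {a : Fin 32} {e : RExpr} {m : ℕ} (f : ℕ → ℝ)
    (hc : c.writesA a = false) (hc7 : c.writesI 7 = false) (hm : m < σ.rounds)
    (hhi : ∀ τ, (Cmd.loop 7 (.ite (.ile (.var 7) hi) (.seq c (.store a
      (.var 7) e)) .skip)).Frame σ τ →
      hi.eval τ = m)
    (he : ∀ j ≤ m, ∀ τ,
      (Cmd.loop 7 (.ite (.ile (.var 7) hi) (.seq c (.store a (.var 7) e)) .skip)).Frame σ τ →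
      τ.I 7 = j → e.eval (c.run τ) = f j) :
    ∀ j ≤ m, ((Cmd.loop 7 (.ite (.ile (.var 7) hi) (.seq c (.store a
      (.var 7) e)) .skip)).run σ).A a j =
      f j := by
  have key := (run_loop_store (v := 7) (σ := σ) (a := a) (b := .ile (.var 7) hi) (c := c)
    (idx := .var 7) (e := e) (Finset.range (m + 1)) id f Function.injective_id
    (fun j hj => by rw [Finset.mem_range] at hj; omega) hc
    (fun j _ τ hF hv => by
      rw [Finset.mem_range, BExpr.ile_eval, hhi τ hF, IExpr.eval, hv]; omega)
    (fun j hj τ hF hv => by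
      rw [Finset.mem_range] at hj
      exact ⟨(Cmd.run_I_of_not_writesI hc7 τ).trans hv, he j (by omega) τ hF hv⟩)).1
  exact fun j hj => key j (by rw [Finset.mem_range]; omega)

theorem levels_context (h0 : σ.I 0 = n) (hi : σ.I 1 = i) (hl : Bank P false σ)
    (hr : Bank P.rev true σ) (h1 : 1 ≤ i) (hn : i ≤ n) (hpos : 0 < extend P.whi (i - 1)) :
    Context P i (levels.run σ) := by
  have hrd : ∀ {τ : Store}, τ.I 0 = n → n + 1 < τ.rounds := fun h => by
    simp only [Store.rounds]; omega
  set c1 : Cmd := .loop 7 (.ite (.ile (.var 7) (.add (.var 0) (.const 1)))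
    (.seq (.ite (.ile (.var 7) (.var 1)) (.rset 8 (.arr 3 (.var 7)))
      (.rset 8 (.sub (.add (.arr 3 (.var 1)) (.arr 2 (.var 7))) (.arr 2 (.var 1)))))
      (.store 8 (.var 7) (.var 8))) .skip) with hc1
  have m1 : ∀ j ≤ n + 1, (c1.run σ).A 8 j = partialSum (P.mixed i) j :=
    fill_upTo _ rfl rfl (hrd h0) (fun τ hF => by simp [IExpr.eval, hF.onI 0 rfl, h0])
      fun j hj τ hF hv => by
        have i1 : τ.I 1 = i := (hF.onI 1 rfl).trans hi
        have a3 : ∀ l ≤ n + 1, τ.A 3 l = _ := (hl.frame hF rfl).H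
        have a2 : ∀ l ≤ n + 1, τ.A 2 l = _ := (hl.frame hF rfl).A
        rw [mixed_partialSum]
        by_cases hji : j ≤ i
        · rw [Cmd.run_ite_pos (by simpa [BExpr.ile_eval, IExpr.eval, hv, i1] using hji), if_pos hji]
          simp [Cmd.run, RExpr.eval, IExpr.eval, hv, a3 j hj]
        · rw [Cmd.run_ite_neg (by simpa [BExpr.ile_eval, IExpr.eval, hv, i1] using hji), if_neg hji]
          simp [Cmd.run, RExpr.eval, IExpr.eval, hv, i1, a2 j hj, a3 i (by omega), a2 i (by omega)]
  have F1 := Cmd.frame c1 σ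
  set σ₁ := c1.run σ
  have n1 : σ₁.I 0 = n := (F1.onI 0 rfl).trans h0
  set c2 : Cmd := .loop 7 (.ite (.ile (.var 7) (.add (.var 0) (.const 1)))
    (.seq .skip (.store 9 (.var 7) (.sub (.arr 8 (.add (.var 0) (.const 1)))
      (.arr 8 (.sub (.add (.var 0) (.const 1)) (.var 7)))))) .skip) with hc2
  have m2 : ∀ j ≤ n + 1, (c2.run σ₁).A 9 j = partialSum (fun j => P.mixed i (n - j)) j :=
    fill_upTo _ rfl rfl (hrd n1) (fun τ hF => by simp [IExpr.eval, hF.onI 0 rfl, n1])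
      fun j hj τ hF hv => by
        have i0 : τ.I 0 = n := (hF.onI 0 rfl).trans n1
        rw [partialSum_reflect _ hj]
        simp [Cmd.run, RExpr.eval, IExpr.eval, hv, i0, hF.onA 8 rfl, m1]
  have F2 := Cmd.frame c2 σ₁
  set σ₂ := c2.run σ₁
  have n2 : σ₂.I 0 = n := (F2.onI 0 rfl).trans n1
  have i2 : σ₂.I 1 = i := (F2.onI 1 rfl).trans ((F1.onI 1 rfl).trans hi)
  have l2 : Bank P false σ₂ := (hl.frame F1 rfl).frame F2 rfl
  set c3 : Cmd := .loop 7 (.ite (.and (.ile (.var 1) (.var 7)) (.ile (.var 7) (.var 0)))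
    (.seq (leastOf 1 (.var 7) (.var 1)) (.store 10 (.var 7) (.var 8))) .skip) with hc3
  have F3 := Cmd.frame c3 σ₂
  have m3 := (run_loop_store (v := 7) (σ := σ₂) (a := 10)
    (b := .and (.ile (.var 1) (.var 7)) (.ile (.var 7) (.var 0)))
    (c := leastOf 1 (.var 7) (.var 1)) (idx := .var 7)
    (e := .var 8) (Finset.Icc i n) id (fun k => bottleneck P.capac k i) Function.injective_id
    (fun j hj => by rw [Finset.mem_Icc] at hj; have := hrd n2; omega) rfl
    (fun j _ τ hF hv => by
      rw [Finset.mem_Icc, BExpr.and_eval, BExpr.ile_eval, BExpr.ile_eval]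
      simp [IExpr.eval, hv, hF.onI 0 rfl, hF.onI 1 rfl, n2, i2])
    (fun j hj τ hF hv => by
      rw [Finset.mem_Icc] at hj
      have t1 : τ.I 1 = i := (hF.onI 1 rfl).trans i2
      have t0 : τ.I 0 = n := (hF.onI 0 rfl).trans n2
      rw [leastOf_run (kk := j) (ll := i) (fun x y => by simp [IExpr.eval, hv])
        (fun x y => by simp [IExpr.eval, t1])
        (show (IExpr.var 1).eval τ = i from t1) (by have := hrd t0; omega)]
      refine ⟨by simp [IExpr.eval, hv], ?_⟩
      simp only [RExpr.eval, Store.setI_R, Store.setR_R, Function.update_self]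
      exact bottleneck_congr hj.1 fun t _ ht => (l2.frame hF rfl).C t (ht.trans hj.2))).1
  have e : levels.run σ = c3.run σ₂ := rfl
  rw [e]
  refine ⟨(F3.onI 0 rfl).trans n2, (F3.onI 1 rfl).trans i2, l2.frame F3 rfl,
    ((hr.frame F1 rfl).frame F2 rfl).frame F3 rfl, ?_, ?_, ?_, h1, hn, hpos⟩
  · rw [F3.onA 8 rfl, F2.onA 8 rfl]; exact m1
  · rw [F3.onA 9 rfl]; exact m2
  · exact fun k h1 h2 => m3 k (Finset.mem_Icc.2 ⟨h1, h2⟩)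

theorem Context.allVertices (H : Context P i σ) :
    Grows P σ (allVertices.run σ) ∧ ∀ h, 1 ≤ h → h ≤ n + 1 → ∀ k, i ≤ k → k ≤ n →
      P.BoundsVertex i k h ((allVertices.run σ).A 18 k) := by
  refine forIn_grows (P := P) (σ := σ) (v := 2) (a := 1) (b := n + 1)
    (fun h α => ∀ k, i ≤ k → k ≤ n → P.BoundsVertex i k h (α k))
    (fun j α α' h h' k hik hkn => BoundsVertex.mono (h' k hik hkn) (h k))
    (by have := H.size; simp only [Store.rounds]; omega) (fun _ _ => rfl)
    (fun τ hF => by simp [IExpr.eval, (H.frame hF rfl).size]) (fun h h1 hn τ hF hv => ?_)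
  have H1 := H.frame hF rfl
  have F2 := Cmd.frame (.iset 3 (.sub (.var 2) (.const 1))) τ
  have p2 : ((Cmd.iset 3 (.sub (.var 2) (.const 1))).run τ).I 3 = h - 1 := by
    simp [Cmd.run, IExpr.eval, hv]
  set τ₂ := (Cmd.iset 3 (.sub (.var 2) (.const 1))).run τ with hτ₂
  have H2 := H1.frame F2 rfl
  have v2 : τ₂.I 2 = h := (F2.onI 2 rfl).trans hv
  have F3 := Cmd.frame (.iset 4 (.sub (.add (.var 0) (.const 1)) (.var 2))) τ₂
  have q3 : ((Cmd.iset 4 (.sub (.add (.var 0) (.const 1)) (.var 2))).run τ₂).I 4 = n + 1 - h := by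
    simp [Cmd.run, IExpr.eval, v2, H2.size]
  set τ₃ := (Cmd.iset 4 (.sub (.add (.var 0) (.const 1)) (.var 2))).run τ₂ with hτ₃
  have H3 := H2.frame F3 rfl
  have H5 := H3.prepare ((F3.onI 2 rfl).trans v2) ((F3.onI 3 rfl).trans p2) (by omega) q3 (by omega)
  obtain ⟨g1, g2⟩ := H5.atVertex h1 hn
  have G : Grows P τ ((RegretProgram.prepare true).run ((RegretProgram.prepare false).run τ₃)) :=
    ((Grows.of_frame F2 rfl).trans (Grows.of_frame F3 rfl)).trans
      ((Grows.of_frame (Cmd.frame (RegretProgram.prepare false) τ₃) rfl).trans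
        (Grows.of_frame (Cmd.frame (RegretProgram.prepare true) _) rfl))
  exact ⟨G.trans g1, g2⟩

theorem Context.allEdges (H : Context P i σ) :
    Grows P σ (allEdges.run σ) ∧ ∀ h, 1 ≤ h → h ≤ n → ∀ k, i ≤ k → k ≤ n →
      P.BoundsEdge i k h ((allEdges.run σ).A 18 k) := by
  refine forIn_grows (P := P) (σ := σ) (v := 2) (a := 1) (b := n)
    (fun h α => ∀ k, i ≤ k → k ≤ n → P.BoundsEdge i k h (α k))
    (fun j α α' h h' k hik hkn => BoundsEdge.mono (h' k hik hkn) (h k))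
    (by have := H.size; simp only [Store.rounds]; omega) (fun _ _ => rfl)
    (fun τ hF => by simp [IExpr.eval, (H.frame hF rfl).size]) (fun h h1 hn τ hF hv => ?_)
  have H1 := H.frame hF rfl
  have F2 := Cmd.frame (.iset 3 (.var 2)) τ
  have p2 : ((Cmd.iset 3 (.var 2)).run τ).I 3 = h := by
    simp [Cmd.run, IExpr.eval, hv]
  set τ₂ := (Cmd.iset 3 (.var 2)).run τ with hτ₂
  have H2 := H1.frame F2 rfl
  have v2 : τ₂.I 2 = h := (F2.onI 2 rfl).trans hv
  have F3 := Cmd.frame (.iset 4 (.sub (.add (.var 0) (.const 1)) (.var 2))) τ₂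
  have q3 : ((Cmd.iset 4 (.sub (.add (.var 0) (.const 1)) (.var 2))).run τ₂).I 4 = n + 1 - h := by
    simp [Cmd.run, IExpr.eval, v2, H2.size]
  set τ₃ := (Cmd.iset 4 (.sub (.add (.var 0) (.const 1)) (.var 2))).run τ₂ with hτ₃
  have H3 := H2.frame F3 rfl
  have H5 := H3.prepare ((F3.onI 2 rfl).trans v2) ((F3.onI 3 rfl).trans p2) (by omega) q3 (by omega)
  obtain ⟨g1, g2⟩ := H5.atEdge h1 hn
  have G : Grows P τ ((RegretProgram.prepare true).run ((RegretProgram.prepare false).run τ₃)) :=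
    ((Grows.of_frame F2 rfl).trans (Grows.of_frame F3 rfl)).trans
      ((Grows.of_frame (Cmd.frame (RegretProgram.prepare false) τ₃) rfl).trans
        (Grows.of_frame (Cmd.frame (RegretProgram.prepare true) _) rfl))
  exact ⟨G.trans g1, g2⟩

/-- The initial entries −loc (k + 1) are excesses by the first alternative of `IsExcess`, and every
later change keeps this. The bounds accumulate over the rounds by `loop_grows`. -/
theorem table_isTable (h0 : σ.I 0 = n) (hl : Bank P false σ) (hr : Bank P.rev true σ) :
    P.IsTable ((table.run σ).A 18) := by
  set c1 : Cmd := .loop 7 (.ite (.ile (.var 7) (.var 0)) (.seq .skip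
    (.store 18 (.var 7) (.sub (.const 0) (.arr 0 (.add (.var 7) (.const 1)))))) .skip) with hc1
  have m1 : ∀ j ≤ n, (c1.run σ).A 18 j = -P.loc (j + 1) :=
    fill_upTo _ rfl rfl (by simp only [Store.rounds]; omega)
      (fun τ hF => (hF.onI 0 rfl).trans h0) fun j hj τ hF hv => by
        have a0 : ∀ l ≤ n + 1, τ.A 0 l = _ := (hl.frame hF rfl).X
        simp [Cmd.run, RExpr.eval, IExpr.eval, hv, a0 (j + 1) (by omega)]
  have F1 := Cmd.frame c1 σ
  set σ₁ := c1.run σ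
  have n1 : σ₁.I 0 = n := (F1.onI 0 rfl).trans h0
  have l1 := hl.frame F1 rfl
  have r1 := hr.frame F1 rfl
  have key := loop_grows (P := P) (v := 1) (σ := σ₁)
    (c := .ite (.and (.and (.ile (.const 1) (.var 1)) (.ile (.var 1) (.var 0)))
      (.rlt (.arr 3 (.sub (.var 1) (.const 1))) (.arr 3 (.var 1)))) (.seq levels
        (.seq allVertices allEdges)) .skip)
    (fun i α => 1 ≤ i → 0 < extend P.whi (i - 1) → ∀ k, i ≤ k → k ≤ n →
      (∀ h, 1 ≤ h → h ≤ n + 1 → P.BoundsVertex i k h (α k)) ∧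
      ∀ h, 1 ≤ h → h ≤ n → P.BoundsEdge i k h (α k))
    (fun j α α' h h' h1 hpos k hik hkn =>
      ⟨fun m hm hm' => BoundsVertex.mono ((h' h1 hpos k hik hkn).1 m hm hm') (h k),
        fun m hm hm' => BoundsEdge.mono ((h' h1 hpos k hik hkn).2 m hm hm') (h k)⟩)
    (fun i _ τ hF hv => by
      have n2 : τ.I 0 = n := (hF.onI 0 rfl).trans n1
      have l2 := l1.frame hF rfl
      have r2 := r1.frame hF rfl
      -- Only prefix sums are stored, so that a largest weight is positive is tested as a strict
      -- increase between neighbouring entries.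
      have eg : (BExpr.and (.and (.ile (.const 1) (.var 1)) (.ile (.var 1) (.var 0)))
          (.rlt (.arr 3 (.sub (.var 1) (.const 1))) (.arr 3 (.var 1)))).eval τ ↔
          (1 ≤ i ∧ i ≤ n) ∧ 0 < extend P.whi (i - 1) := by
        simp only [BExpr.and_eval, BExpr.ile_eval, BExpr.rlt_eval, IExpr.eval, RExpr.eval, hv, n2]
        refine and_congr_right fun ⟨h1, h2⟩ => ?_
        have e1 : τ.A 3 i = _ := l2.H i (by omega)
        have e2 : τ.A 3 (i - 1) = _ := l2.H (i - 1) (by omega)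
        rw [e1, e2]
        obtain ⟨j, rfl⟩ : ∃ j, i = j + 1 := ⟨i - 1, by omega⟩
        rw [partialSum_succ, Nat.add_sub_cancel, lt_add_iff_pos_right]
      by_cases hg : (1 ≤ i ∧ i ≤ n) ∧ 0 < extend P.whi (i - 1)
      · rw [Cmd.run_ite_pos (eg.2 hg)]
        have H3 := levels_context n2 hv l2 r2 hg.1.1 hg.1.2 hg.2
        have G3 : Grows P τ (levels.run τ) := Grows.of_frame (Cmd.frame levels τ) rfl
        set τ₃ := levels.run τ
        obtain ⟨g4, s4⟩ := H3.allVertices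
        obtain ⟨g5, s5⟩ := (H3.frame (Cmd.frame allVertices τ₃) rfl).allEdges
        exact ⟨G3.trans (g4.trans g5), fun _ _ k hik hkn =>
          ⟨fun h h1 hn => BoundsVertex.mono (s4 h h1 hn k hik hkn) (g5.le k),
            fun h h1 hn => s5 h h1 hn k hik hkn⟩⟩
      · rw [Cmd.run_ite_neg (mt eg.1 hg)]
        exact ⟨Grows.of_eq rfl, fun h1 hpos k hik hkn => absurd ⟨⟨h1, hik.trans hkn⟩, hpos⟩ hg⟩)
  have e : table.run σ = (Cmd.loop 1 (.ite (.and (.and (.ile (.const 1) (.var 1))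
      (.ile (.var 1) (.var 0))) (.rlt (.arr 3 (.sub (.var 1) (.const 1))) (.arr 3 (.var 1))))
      (.seq levels (.seq allVertices allEdges)) .skip)).run σ₁ := rfl
  rw [e]
  have hr : ∀ i k, i ≤ k → k ≤ n → i < σ₁.rounds := fun i k h1 h2 => by
    simp only [Store.rounds]; omega
  exact ⟨key.1.excess fun k h1 h2 => Or.inl (m1 k h2),
    fun i k h h1 h2 h3 hpos h4 h5 => (key.2 i (hr i k h2 h3) h1 hpos k h2 h3).1 h h4 h5,
    fun i k h h1 h2 h3 hpos h4 h5 => (key.2 i (hr i k h2 h3) h1 hpos k h2 h3).2 h h4 h5⟩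

end RegretProgram

/-! ### Reversing the path in memory and loading the input -/

namespace RegretProgram

open RealRAM UncertainPath

variable {n : ℕ} {P : UncertainPath n} {σ τ : Store} {c : Cmd}

theorem copy_entry {a b : Fin 32} (hab : a ≠ b) (h0 : σ.I 0 = n) :
    ∀ j ≤ n + 1, ((copy a b).run σ).A b j = σ.A a j :=
  fill_upTo _ rfl rfl (by simp only [Store.rounds]; omega)
    (fun τ hF => by simp [IExpr.eval, hF.onI 0 rfl, h0]) fun j _ τ hF hv => by
      rw [← hF.onA a (by simp [Cmd.writesA, hab.symm])]
      simp [Cmd.run, RExpr.eval, IExpr.eval, hv]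

theorem mirror_bank (h0 : σ.I 0 = n) (hl : Bank P false σ) :
    Bank P false (mirror.run σ) ∧ Bank P.rev true (mirror.run σ) := by
  set c1 : Cmd := .loop 7 (.ite (.ile (.var 7) (.add (.var 0) (.const 1)))
    (.seq (.ite (.ile (.const 1) (.var 7)) (.rset 8 (.sub (.arr 0 (.add (.var 0) (.const 1)))
        (.arr 0 (.sub (.add (.var 0) (.const 2)) (.var 7))))) (.rset 8 (.const 0)))
    (.store 4 (.var 7) (.var 8))) .skip) with hc1
  set c2 : Cmd := .loop 7 (.ite (.ile (.var 7) (.var 0)) (.seq (.ite (.ile (.const 1) (.var 7))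
      (.rset 8 (.arr 1 (.sub (.add (.var 0) (.const 1)) (.var 7)))) (.rset 8 (.const 0)))
    (.store 5 (.var 7) (.var 8))) .skip) with hc2
  set c3 : Cmd := .loop 7 (.ite (.ile (.var 7) (.add (.var 0) (.const 1))) (.seq .skip
    (.store 6 (.var 7) (.sub (.arr 2 (.add (.var 0) (.const 1)))
      (.arr 2 (.sub (.add (.var 0) (.const 1)) (.var 7)))))) .skip) with hc3
  set c4 : Cmd := .loop 7 (.ite (.ile (.var 7) (.add (.var 0) (.const 1))) (.seq .skip
    (.store 7 (.var 7) (.sub (.arr 3 (.add (.var 0) (.const 1)))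
      (.arr 3 (.sub (.add (.var 0) (.const 1)) (.var 7)))))) .skip) with hc4
  have F1 := Cmd.frame c1 σ
  have m1 : ∀ j ≤ n + 1, (c1.run σ).A 4 j = P.rev.loc j :=
    fill_upTo _ rfl rfl (by simp only [Store.rounds]; omega)
      (fun τ hF => by simp [IExpr.eval, hF.onI 0 rfl, h0]) fun j hj τ hF hv => by
        have t0 : τ.I 0 = n := (hF.onI 0 rfl).trans h0
        have a0 : ∀ l ≤ n + 1, τ.A 0 l = _ := (hl.frame hF rfl).X
        by_cases hj1 : 1 ≤ j
        · rw [Cmd.run_ite_pos (by simpa [BExpr.ile_eval, IExpr.eval, hv] using hj1),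
            loc_rev P hj1 hj]
          simp [Cmd.run, RExpr.eval, IExpr.eval, hv, t0, a0 _ le_rfl, a0 (n + 2 - j) (by omega),
              len]
        · obtain rfl : j = 0 := by omega
          rw [Cmd.run_ite_neg (by simp [BExpr.ile_eval, IExpr.eval, hv])]
          simp [Cmd.run, RExpr.eval, loc, partialSum_zero]
  set σ₁ := c1.run σ
  have n1 : σ₁.I 0 = n := (F1.onI 0 rfl).trans h0
  have l1 := hl.frame F1 rfl
  have F2 := Cmd.frame c2 σ₁
  have m2 : ∀ j ≤ n, (c2.run σ₁).A 5 j = P.rev.capac j :=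
    fill_upTo _ rfl rfl (by simp only [Store.rounds]; omega)
      (fun τ hF => (hF.onI 0 rfl).trans n1) fun j hj τ hF hv => by
        have t0 : τ.I 0 = n := (hF.onI 0 rfl).trans n1
        have a1 : ∀ l ≤ n, τ.A 1 l = _ := (l1.frame hF rfl).C
        by_cases hj1 : 1 ≤ j
        · rw [Cmd.run_ite_pos (by simpa [BExpr.ile_eval, IExpr.eval, hv] using hj1),
            capac_rev P hj1 hj]
          simp [Cmd.run, RExpr.eval, IExpr.eval, hv, t0, a1 (n + 1 - j) (by omega)]
        · obtain rfl : j = 0 := by omega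
          rw [Cmd.run_ite_neg (by simp [BExpr.ile_eval, IExpr.eval, hv])]
          simp [Cmd.run, RExpr.eval, capac]
  set σ₂ := c2.run σ₁
  have n2 : σ₂.I 0 = n := (F2.onI 0 rfl).trans n1
  have l2 := l1.frame F2 rfl
  have F3 := Cmd.frame c3 σ₂
  have m3 : ∀ j ≤ n + 1, (c3.run σ₂).A 6 j = partialSum (extend P.rev.wlo) j :=
    fill_upTo _ rfl rfl (by simp only [Store.rounds]; omega)
      (fun τ hF => by simp [IExpr.eval, hF.onI 0 rfl, n2]) fun j hj τ hF hv => by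
        have t0 : τ.I 0 = n := (hF.onI 0 rfl).trans n2
        have a2 : ∀ l ≤ n + 1, τ.A 2 l = _ := (l2.frame hF rfl).A
        refine Eq.trans ?_ (partialSum_extend_rev P.wlo hj).symm
        simp [Cmd.run, RExpr.eval, IExpr.eval, hv, t0, a2 _ le_rfl, a2 (n + 1 - j) (by omega)]
  set σ₃ := c3.run σ₂
  have n3 : σ₃.I 0 = n := (F3.onI 0 rfl).trans n2
  have l3 := l2.frame F3 rfl
  have F4 := Cmd.frame c4 σ₃
  have m4 : ∀ j ≤ n + 1, (c4.run σ₃).A 7 j = partialSum (extend P.rev.whi) j :=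
    fill_upTo _ rfl rfl (by simp only [Store.rounds]; omega)
      (fun τ hF => by simp [IExpr.eval, hF.onI 0 rfl, n3]) fun j hj τ hF hv => by
        have t0 : τ.I 0 = n := (hF.onI 0 rfl).trans n3
        have a3 : ∀ l ≤ n + 1, τ.A 3 l = _ := (l3.frame hF rfl).H
        refine Eq.trans ?_ (partialSum_extend_rev P.whi hj).symm
        simp [Cmd.run, RExpr.eval, IExpr.eval, hv, t0, a3 _ le_rfl, a3 (n + 1 - j) (by omega)]
  have e : mirror.run σ = c4.run σ₃ := rfl
  rw [e]
  refine ⟨l3.frame F4 rfl, ?_, ?_, ?_, m4⟩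
  · rw [F4.onA (aX true) rfl, F3.onA (aX true) rfl, F2.onA (aX true) rfl]; exact m1
  · rw [F4.onA (aC true) rfl, F3.onA (aC true) rfl]; exact m2
  · rw [F4.onA (aA true) rfl]; exact m3

/-- The reversed data replace the original ones, and mirroring again restores the original as the
reversed path of the new one. No second copy is needed because reversal is an involution. -/
theorem turn_bank (h0 : σ.I 0 = n) (hl : Bank P false σ) :
    Bank P.rev false (turn.run σ) ∧ Bank P (true) (turn.run σ) := by
  have F1 := Cmd.frame mirror σ
  have r1 := (mirror_bank h0 hl).2
  set σ₁ := mirror.run σ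
  have n1 : σ₁.I 0 = n := (F1.onI 0 rfl).trans h0
  have F2 := Cmd.frame (copy 4 0) σ₁
  have m2 := copy_entry (a := 4) (b := 0) (by decide) n1
  set σ₂ := (copy 4 0).run σ₁
  have n2 : σ₂.I 0 = n := (F2.onI 0 rfl).trans n1
  have r2 := r1.frame F2 rfl
  have F3 := Cmd.frame (copy 5 1) σ₂
  have m3 := copy_entry (a := 5) (b := 1) (by decide) n2
  set σ₃ := (copy 5 1).run σ₂
  have n3 : σ₃.I 0 = n := (F3.onI 0 rfl).trans n2
  have r3 := r2.frame F3 rfl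
  have F4 := Cmd.frame (copy 6 2) σ₃
  have m4 := copy_entry (a := 6) (b := 2) (by decide) n3
  set σ₄ := (copy 6 2).run σ₃
  have n4 : σ₄.I 0 = n := (F4.onI 0 rfl).trans n3
  have r4 := r3.frame F4 rfl
  have F5 := Cmd.frame (copy 7 3) σ₄
  have m5 := copy_entry (a := 7) (b := 3) (by decide) n4
  set σ₅ := (copy 7 3).run σ₄
  have n5 : σ₅.I 0 = n := (F5.onI 0 rfl).trans n4
  have l5 : Bank P.rev false σ₅ := by
    refine ⟨fun l hl => ?_, fun l hl => ?_, fun l hl => ?_, fun l hl => ?_⟩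
    · rw [F5.onA (aX false) rfl, F4.onA (aX false) rfl, F3.onA (aX false) rfl]
      exact (m2 l hl).trans (r1.X l hl)
    · rw [F5.onA (aC false) rfl, F4.onA (aC false) rfl]
      exact (m3 l (by omega)).trans (r2.C l hl)
    · rw [F5.onA (aA false) rfl]
      exact (m4 l hl).trans (r3.A l hl)
    · exact (m5 l hl).trans (r4.H l hl)
  have := mirror_bank n5 l5
  rw [rev_rev] at this
  exact this

theorem setA_entry_of_ne (σ : Store) (a b : Fin 32) {m j : ℕ} (h : j ≠ m) (x : ℝ) :
    (σ.setA a m x).A b j = σ.A b j := by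
  rw [Store.setA_A]
  by_cases hab : b = a
  · subst hab
    rw [Function.update_self, Function.update_of_ne h]
  · rw [Function.update_of_ne hab]

theorem setA_of_ne (σ : Store) {a b : Fin 32} (h : b ≠ a) (m : ℕ) (x : ℝ) :
    (σ.setA a m x).A b = σ.A b := by
  rw [Store.setA_A, Function.update_of_ne h]

theorem setA_self (σ : Store) (a : Fin 32) (m : ℕ) (x : ℝ) : (σ.setA a m x).A a m = x := by
  simp

/-- The contents of a memory cell. -/
def rawCell (σ : Store) (x : ℕ) : ℝ := σ.A (Fin.ofNat 32 x) (x / 32)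

/-- The input is in the first cells. -/
structure Input (P : UncertainPath n) (σ : Store) : Prop where
  size : σ.I 0 = n
  d : ∀ j < n, rawCell σ j = extend P.d j
  c : ∀ j < n, rawCell σ (n + j) = extend P.c j
  wlo : ∀ j ≤ n, rawCell σ (n + n + j) = extend P.wlo j
  whi : ∀ j ≤ n, rawCell σ (n + n + n + 1 + j) = extend P.whi j

/-- The input fills cells 0, …, 4n + 1, across all of the interleaved arrays. Copying it to entries
from n + 1 on, that is, to cells from 32 (n + 1) on, destroys nothing that is still to be read. -/
theorem Input.rescue (H : Input P σ) : ∀ t ≤ n,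
    (rescue.run σ).A 24 (n + 1 + t) = rawCell σ t ∧
    (rescue.run σ).A 25 (n + 1 + t) = rawCell σ (n + t) ∧
    (rescue.run σ).A 26 (n + 1 + t) = rawCell σ (n + n + t) ∧
    (rescue.run σ).A 27 (n + 1 + t) = rawCell σ (n + n + n + 1 + t) := by
  have key := loop_induct (v := 7) (σ := σ)
    (c := .seq (.store 24 (.add (.add (.var 0) (.const 1)) (.var 7)) (.cell (.var 7)))
    (.seq (.store 25 (.add (.add (.var 0) (.const 1)) (.var 7)) (.cell (.add (.var 0) (.var 7))))
    (.seq (.store 26 (.add (.add (.var 0) (.const 1)) (.var 7))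
      (.cell (.add (.add (.var 0) (.var 0)) (.var 7))))
    (.store 27 (.add (.add (.var 0) (.const 1)) (.var 7))
      (.cell (.add (.add (.add (.add (.var 0) (.var 0)) (.var 0)) (.const 1)) (.var 7)))))))
    (fun k τ => (∀ a, ∀ j < n + 1, τ.A a j = σ.A a j) ∧ ∀ t ≤ n, t < k →
      τ.A 24 (n + 1 + t) = rawCell σ t ∧ τ.A 25 (n + 1 + t) = rawCell σ (n + t) ∧
      τ.A 26 (n + 1 + t) = rawCell σ (n + n + t) ∧
      τ.A 27 (n + 1 + t) = rawCell σ (n + n + n + 1 + t))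
    ⟨fun _ _ _ => rfl, fun _ _ h => absurd h (Nat.not_lt_zero _)⟩ (by
      rintro k hk τ hF hv ⟨h1, h2⟩
      have t0 : τ.I 0 = n := (hF.onI 0 rfl).trans H.size
      simp only [Cmd.run, IExpr.eval, RExpr.eval, Store.setA_I, t0, hv, Store.setI_A]
      refine ⟨fun a j hj => ?_, fun t ht htk => ?_⟩
      · rw [setA_entry_of_ne _ _ _ (by omega), setA_entry_of_ne _ _ _ (by omega),
          setA_entry_of_ne _ _ _ (by omega), setA_entry_of_ne _ _ _ (by omega), h1 a j hj]
      · rcases (Nat.lt_succ_iff.1 htk).eq_or_lt with rfl | htk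
        · refine ⟨?_, ?_, ?_, ?_⟩
          · rw [setA_of_ne _ (by decide), setA_of_ne _ (by decide), setA_of_ne _ (by decide),
              setA_self]
            exact h1 _ _ (by omega)
          · rw [setA_of_ne _ (by decide), setA_of_ne _ (by decide), setA_self,
              setA_entry_of_ne _ _ _ (by omega)]
            exact h1 _ _ (by omega)
          · rw [setA_of_ne _ (by decide), setA_self, setA_entry_of_ne _ _ _ (by omega),
              setA_entry_of_ne _ _ _ (by omega)]
            exact h1 _ _ (by omega)
          · rw [setA_self, setA_entry_of_ne _ _ _ (by omega), setA_entry_of_ne _ _ _ (by omega),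
              setA_entry_of_ne _ _ _ (by omega)]
            exact h1 _ _ (by omega)
        · have hne : n + 1 + t ≠ n + 1 + k := by omega
          simp only [setA_entry_of_ne _ _ _ hne]
          exact h2 t ht htk)
  exact fun t ht => key.2 t ht (by have := H.size; simp only [Store.rounds]; omega)

theorem Input.load (H : Input P σ) : Bank P false (load.run σ) := by
  have F1 := Cmd.frame RegretProgram.rescue σ
  have R1 := H.rescue
  set σ₁ := RegretProgram.rescue.run σ
  have n1 : σ₁.I 0 = n := (F1.onI 0 rfl).trans H.size
  set c2 : Cmd := .seq (.store 0 (.const 0) (.const 0)) (.seq (.store 0 (.const 1) (.const 0))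
    (.seq (.store 1 (.const 0) (.const 0)) (.seq (.store 2 (.const 0) (.const 0))
    (.store 3 (.const 0) (.const 0))))) with hc2
  have F2 := Cmd.frame c2 σ₁
  have z2 : (c2.run σ₁).A 0 0 = 0 ∧ (c2.run σ₁).A 0 1 = 0 ∧ (c2.run σ₁).A 1 0 = 0 ∧
      (c2.run σ₁).A 2 0 = 0 ∧ (c2.run σ₁).A 3 0 = 0 := by
    simp [hc2, Cmd.run, IExpr.eval, RExpr.eval]
  set σ₂ := c2.run σ₁
  have n2 : σ₂.I 0 = n := (F2.onI 0 rfl).trans n1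
  have key := loop_induct (v := 7) (σ := σ₂)
    (c := .ite (.ile (.const 1) (.var 7))
    (.seq (.store 0 (.add (.var 7) (.const 1))
      (.add (.arr 0 (.var 7)) (.arr 24 (.add (.var 0) (.var 7)))))
    (.seq (.store 1 (.var 7) (.arr 25 (.add (.var 0) (.var 7))))
    (.seq (.store 2 (.var 7)
      (.add (.arr 2 (.sub (.var 7) (.const 1))) (.arr 26 (.add (.var 0) (.var 7)))))
    (.store 3 (.var 7)
      (.add (.arr 3 (.sub (.var 7) (.const 1))) (.arr 27 (.add (.var 0) (.var 7)))))))) .skip)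
    -- Round k writes location k + 1 but entry k of the other arrays, hence the different ranges.
    -- The loop runs beyond the input, and the bounds on l discard the meaningless entries.
    (fun k τ => (∀ l ≤ n + 1, l ≤ 1 ∨ l ≤ k → τ.A 0 l = P.loc l) ∧
      (∀ l ≤ n, l = 0 ∨ l < k → τ.A 1 l = P.capac l) ∧
      (∀ l ≤ n + 1, l = 0 ∨ l < k → τ.A 2 l = partialSum (extend P.wlo) l) ∧
      ∀ l ≤ n + 1, l = 0 ∨ l < k → τ.A 3 l = partialSum (extend P.whi) l)
    (by
      refine ⟨fun l _ hl => ?_, fun l _ hl => ?_, fun l _ hl => ?_, fun l _ hl => ?_⟩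
      · obtain rfl | rfl : l = 0 ∨ l = 1 := by omega
        · exact z2.1.trans (partialSum_zero _).symm
        · exact z2.2.1.trans P.loc_one.symm
      · obtain rfl : l = 0 := by omega
        exact z2.2.2.1
      · obtain rfl : l = 0 := by omega
        exact z2.2.2.2.1.trans (partialSum_zero _).symm
      · obtain rfl : l = 0 := by omega
        exact z2.2.2.2.2.trans (partialSum_zero _).symm)
    (by
      rintro k hk τ hF hv ⟨h1, h2, h3, h4⟩
      have t0 : τ.I 0 = n := (hF.onI 0 rfl).trans n2
      by_cases hk1 : 1 ≤ k
      · rw [Cmd.run_ite_pos (by simpa [BExpr.ile_eval, IExpr.eval, hv] using hk1)]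
        obtain ⟨m, rfl⟩ : ∃ m, k = m + 1 := ⟨k - 1, by omega⟩
        have e24 : τ.A 24 = σ₁.A 24 := (hF.onA 24 rfl).trans (F2.onA 24 rfl)
        have e25 : τ.A 25 = σ₁.A 25 := (hF.onA 25 rfl).trans (F2.onA 25 rfl)
        have e26 : τ.A 26 = σ₁.A 26 := (hF.onA 26 rfl).trans (F2.onA 26 rfl)
        have e27 : τ.A 27 = σ₁.A 27 := (hF.onA 27 rfl).trans (F2.onA 27 rfl)
        have eidx : n + (m + 1) = n + 1 + m := by omega
        simp only [Cmd.run, IExpr.eval, RExpr.eval, Store.setA_I, t0, hv, Store.setI_A]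
        refine ⟨fun l hl hlk => ?_, fun l hl hlk => ?_, fun l hl hlk => ?_, fun l hl hlk => ?_⟩
        · rw [setA_of_ne _ (by decide), setA_of_ne _ (by decide), setA_of_ne _ (by decide)]
          by_cases hlm : l = m + 1 + 1
          · subst hlm
            rw [setA_self, e24, eidx, (R1 m (by omega)).1, H.d m (by omega),
              h1 (m + 1) (by omega) (by omega)]
            simp [loc, partialSum_succ]
          · rw [setA_entry_of_ne _ _ _ hlm, h1 l hl (by omega)]
        · rw [setA_of_ne _ (by decide), setA_of_ne _ (by decide)]
          by_cases hlm : l = m + 1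
          · subst hlm
            rw [setA_self, setA_of_ne _ (by decide), e25, eidx, (R1 m (by omega)).2.1,
              H.c m (by omega)]
            simp [capac]
          · rw [setA_entry_of_ne _ _ _ hlm, setA_of_ne _ (by decide), h2 l hl (by omega)]
        · rw [setA_of_ne _ (by decide)]
          by_cases hlm : l = m + 1
          · subst hlm
            rw [setA_self, setA_of_ne _ (by decide), setA_of_ne _ (by decide),
              setA_of_ne _ (by decide), setA_of_ne _ (by decide), e26, eidx,
              (R1 m (by omega)).2.2.1, H.wlo m (by omega), Nat.add_sub_cancel,
              h3 m (by omega) (by omega), partialSum_succ]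
          · rw [setA_entry_of_ne _ _ _ hlm, setA_of_ne _ (by decide), setA_of_ne _ (by decide),
              h3 l hl (by omega)]
        · by_cases hlm : l = m + 1
          · subst hlm
            rw [setA_self, setA_of_ne _ (by decide), setA_of_ne _ (by decide),
              setA_of_ne _ (by decide), setA_of_ne _ (by decide), setA_of_ne _ (by decide),
              setA_of_ne _ (by decide), e27, eidx,
              (R1 m (by omega)).2.2.2, H.whi m (by omega), Nat.add_sub_cancel,
              h4 m (by omega) (by omega), partialSum_succ]
          · rw [setA_entry_of_ne _ _ _ hlm, setA_of_ne _ (by decide), setA_of_ne _ (by decide),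
              setA_of_ne _ (by decide), h4 l hl (by omega)]
      · rw [Cmd.run_ite_neg (by simpa [BExpr.ile_eval, IExpr.eval, hv] using hk1)]
        exact ⟨fun l hl hlk => h1 l hl (by omega), fun l hl hlk => h2 l hl (by omega),
          fun l hl hlk => h3 l hl (by omega), fun l hl hlk => h4 l hl (by omega)⟩)
  obtain ⟨k1, k2, k3, k4⟩ := key
  have hr : n + 1 < σ₂.rounds := by simp only [Store.rounds]; omega
  exact ⟨fun l hl => k1 l hl (by omega), fun l hl => k2 l hl (by omega),
    fun l hl => k3 l hl (by omega), fun l hl => k4 l hl (by omega)⟩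

end RegretProgram

namespace UncertainPath

theorem IsTable.congr {n : ℕ} {P : UncertainPath n} {α β : ℕ → ℝ} (h : P.IsTable α)
    (hαβ : ∀ k, 1 ≤ k → k ≤ n → β k = α k) : P.IsTable β where
  excess k h1 h2 := by rw [hαβ k h1 h2]; exact h.excess k h1 h2
  vertex i k j h1 h2 h3 := by rw [hαβ k (h1.trans h2) h3]; exact h.vertex i k j h1 h2 h3
  edge i k j h1 h2 h3 := by rw [hαβ k (h1.trans h2) h3]; exact h.edge i k j h1 h2 h3

end UncertainPath

/-! ### The best sink and the whole program -/

namespace RegretProgram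

open RealRAM UncertainPath

variable {n : ℕ} {P : UncertainPath n} {h : ℕ} {σ : Store}

theorem vertexValue_eq (h0 : σ.I 0 = n) (hl : Bank P false σ) (hh : σ.I 2 = h) (h1 : 1 ≤ h)
    (hn : h ≤ n + 1) : (vertexValue.run σ).R 10 = P.vertexRegret (σ.A 18) (σ.A 19) h := by
  have a0 : ∀ l ≤ n + 1, σ.A 0 l = _ := hl.X
  have e1 : (Cmd.ite (.ile (.const 2) (.var 2)) (.rset 8 (.max (.const 0)
      (.add (.arr 0 (.var 2)) (.arr 18 (.sub (.var 2) (.const 1)))))) .skip).run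
      ((σ.setR 8 0).setR 9 0) =
      ((σ.setR 8 (sideRegret (σ.A 18) (h - 1) (P.loc h))).setR 9 0) := by
    by_cases h2 : 2 ≤ h
    · rw [Cmd.run_ite_pos (by simpa [BExpr.ile_eval, IExpr.eval, hh] using h2), sideRegret,
        if_neg (by omega)]
      simp only [Cmd.run, RExpr.eval, IExpr.eval, Store.setR_I, Store.setR_A, hh, a0 h hn,
          Rat.cast_zero]
      simp [Store.setR, Function.update_comm (show (8 : ℕ) ≠ 9 by omega)]
    · rw [Cmd.run_ite_neg (by simpa [BExpr.ile_eval, IExpr.eval, hh] using h2), sideRegret,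
        if_pos (by omega)]
      rfl
  have e2 : ∀ x : ℝ, (Cmd.ite (.ile (.var 2) (.var 0)) (.rset 9 (.max (.const 0)
      (.add (.sub (.arr 0 (.add (.var 0) (.const 1))) (.arr 0 (.var 2)))
        (.arr 19 (.sub (.add (.var 0) (.const 1)) (.var 2)))))) .skip).run
      ((σ.setR 8 x).setR 9 0) =
      ((σ.setR 8 x).setR 9 (sideRegret (σ.A 19) (n + 1 - h) (P.len - P.loc h))) := by
    intro x
    by_cases h2 : h ≤ n
    · rw [Cmd.run_ite_pos (by simpa [BExpr.ile_eval, IExpr.eval, hh, h0] using h2), sideRegret,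
        if_neg (by omega)]
      simp only [Cmd.run, RExpr.eval, IExpr.eval, Store.setR_I, Store.setR_A, hh, h0, a0 h hn,
        a0 _ le_rfl, Rat.cast_zero, Store.setR_setR, len]
    · rw [Cmd.run_ite_neg (by simpa [BExpr.ile_eval, IExpr.eval, hh, h0] using h2), sideRegret,
        if_pos (by omega)]
      rfl
  have e0 : (Cmd.rset 9 (.const 0)).run ((Cmd.rset 8 (.const 0)).run σ) =
      (σ.setR 8 0).setR 9 0 := by simp [Cmd.run, RExpr.eval]
  rw [vertexValue, Cmd.run_seq, Cmd.run_seq, Cmd.run_seq, Cmd.run_seq, e0, e1, e2]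
  simp [Cmd.run, RExpr.eval, vertexRegret]

/-- The current sink is not worse than the candidates in `S`. -/
structure Best (P : UncertainPath n) (σ : Store) (S : ℝ → Prop) : Prop where
  mem : σ.R 0 ∈ P.points
  value : P.maxRegret (σ.R 0) = σ.R 1
  le : ∀ r, S r → σ.R 1 ≤ r

/-- The values of the candidates. -/
def Candidates (P : UncertainPath n) (α β : ℕ → ℝ) (k l : ℕ) (r : ℝ) : Prop :=
  (∃ h, 1 ≤ h ∧ h ≤ n + 1 ∧ h < k ∧ r = P.vertexRegret α β h) ∨
  ∃ h, 1 ≤ h ∧ h ≤ n ∧ h < l ∧ P.loc h < P.balance α β h ∧ P.balance α β h < P.loc (h + 1) ∧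
    r = max 0 (P.balance α β h + α h)

/-- A running minimum, initialized at vertex 1, over the vertices and then over the balance points
inside their edges. These candidates suffice by `isLeast_of_le`. -/
theorem minimize_spec (h0 : σ.I 0 = n) (hl : Bank P false σ) (hα : P.IsTable (σ.A 18))
    (hβ : P.rev.IsTable (σ.A 19)) :
    (minimize.run σ).R 0 ∈ P.points ∧
    P.maxRegret ((minimize.run σ).R 0) = (minimize.run σ).R 1 ∧
    IsLeast (P.maxRegret '' P.points) ((minimize.run σ).R 1) := by
  set c1 : Cmd := .iset 2 (.const 1) with hc1
  have F1 := Cmd.frame c1 σ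
  have v1 : (c1.run σ).I 2 = 1 := by simp [hc1, Cmd.run, IExpr.eval]
  set σ₁ := c1.run σ
  have F2 := Cmd.frame vertexValue σ₁
  have n1 : σ₁.I 0 = n := (F1.onI 0 rfl).trans h0
  have e2 := vertexValue_eq n1 (hl.frame F1 rfl) v1 le_rfl (by omega)
  rw [F1.onA 18 rfl, F1.onA 19 rfl] at e2
  set σ₂ := vertexValue.run σ₁
  have n2 : σ₂.I 0 = n := (F2.onI 0 rfl).trans n1
  have l2 := (hl.frame F1 rfl).frame F2 rfl
  set c3 : Cmd := .seq (.rset 0 (.arr 0 (.var 2))) (.rset 1 (.var 10)) with hc3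
  have F3 := Cmd.frame c3 σ₂
  have r3 : (c3.run σ₂).R 0 = P.loc 1 ∧ (c3.run σ₂).R 1 = P.vertexRegret (σ.A 18) (σ.A 19) 1 := by
    have a0 : σ₂.A 0 1 = P.loc 1 := l2.X 1 (by omega)
    have i2 : σ₂.I 2 = 1 := (F2.onI 2 rfl).trans v1
    simp [hc3, Cmd.run, RExpr.eval, IExpr.eval, i2, a0, e2]
  set σ₃ := c3.run σ₂
  have n3 : σ₃.I 0 = n := (F3.onI 0 rfl).trans n2
  have l3 := l2.frame F3 rfl
  have a3 : σ₃.A 18 = σ.A 18 ∧ σ₃.A 19 = σ.A 19 :=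
    ⟨(F3.onA 18 rfl).trans ((F2.onA 18 rfl).trans (F1.onA 18 rfl)),
      (F3.onA 19 rfl).trans ((F2.onA 19 rfl).trans (F1.onA 19 rfl))⟩
  have B3 : Best P σ₃ (Candidates P (σ.A 18) (σ.A 19) 0 0) := by
    refine ⟨r3.1 ▸ P.loc_mem_points le_rfl (by omega), ?_, ?_⟩
    · rw [r3.1, r3.2]
      exact maxRegret_loc hα hβ le_rfl (by omega)
    · rintro r (⟨h, -, -, hk, -⟩ | ⟨h, -, -, hk, -⟩) <;> omega
  have key4 := loop_induct (v := 2) (σ := σ₃)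
    (c := .ite (.and (.ile (.const 1) (.var 2)) (.ile (.var 2) (.add (.var 0) (.const 1))))
      (.seq vertexValue (.ite (.rlt (.var 10) (.var 1))
        (.seq (.rset 0 (.arr 0 (.var 2))) (.rset 1 (.var 10))) .skip)) .skip)
    (fun k τ => Best P τ (Candidates P (σ.A 18) (σ.A 19) k 0)) ⟨B3.mem, B3.value, B3.le⟩ (by
      rintro k hk τ hF hv B
      have t0 : τ.I 0 = n := (hF.onI 0 rfl).trans n3
      have eg : (BExpr.and (.ile (.const 1) (.var 2))
          (.ile (.var 2) (.add (.var 0) (.const 1)))).eval τ ↔ 1 ≤ k ∧ k ≤ n + 1 := by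
        simp [BExpr.and_eval, BExpr.ile_eval, IExpr.eval, hv, t0]
      by_cases hg : 1 ≤ k ∧ k ≤ n + 1
      · rw [Cmd.run_ite_pos (eg.2 hg), Cmd.run_seq]
        have lτ := l3.frame hF rfl
        have e5 := vertexValue_eq t0 lτ hv hg.1 hg.2
        rw [hF.onA 18 rfl, hF.onA 19 rfl, a3.1, a3.2] at e5
        have F5 := Cmd.frame vertexValue τ
        set τ₅ := vertexValue.run τ
        have r0 : τ₅.R 0 = τ.R 0 := F5.onR 0 rfl
        have r1 : τ₅.R 1 = τ.R 1 := F5.onR 1 rfl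
        have i5 : τ₅.I 2 = k := (F5.onI 2 rfl).trans hv
        have a5 : τ₅.A 0 k = P.loc k := (lτ.frame F5 rfl).X k hg.2
        have step : ∀ x : Store, x.R 1 ≤ τ.R 1 → x.R 1 ≤ P.vertexRegret (σ.A 18) (σ.A 19) k →
            ∀ r, Candidates P (σ.A 18) (σ.A 19) (k + 1) 0 r → x.R 1 ≤ r := by
          rintro x hx hx' r (⟨h, h1, h2, h3, rfl⟩ | ⟨h, h1, h2, h3, -⟩)
          · rcases (Nat.lt_succ_iff.1 h3).eq_or_lt with rfl | h3
            · exact hx'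
            · exact hx.trans (B.le _ (Or.inl ⟨h, h1, h2, h3, rfl⟩))
          · omega
        by_cases hlt : τ₅.R 10 < τ₅.R 1
        · rw [Cmd.run_ite_pos ((BExpr.rlt_eval (.var 10) (.var 1) τ₅).2 hlt)]
          have w0 : ((Cmd.seq (.rset 0 (.arr 0 (.var 2))) (.rset 1 (.var 10))).run τ₅).R 0 =
              P.loc k := by
            simp [Cmd.run, RExpr.eval, IExpr.eval, i5, a5]
          have w1 : ((Cmd.seq (.rset 0 (.arr 0 (.var 2))) (.rset 1 (.var 10))).run τ₅).R 1 =
              P.vertexRegret (σ.A 18) (σ.A 19) k := by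
            simp [Cmd.run, RExpr.eval, e5]
          refine ⟨?_, ?_, step _ ?_ ?_⟩
          · rw [Store.setI_R, w0]; exact P.loc_mem_points hg.1 hg.2
          · rw [Store.setI_R, w0, w1]; exact maxRegret_loc hα hβ hg.1 hg.2
          · rw [Store.setI_R, w1, ← e5, ← r1]; exact hlt.le
          · rw [Store.setI_R, w1]
        · rw [Cmd.run_ite_neg (mt (BExpr.rlt_eval (.var 10) (.var 1) τ₅).1 hlt)]
          refine ⟨?_, ?_, step _ ?_ ?_⟩
          · rw [Cmd.run, Store.setI_R, r0]; exact B.mem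
          · rw [Cmd.run, Store.setI_R, r0, r1]; exact B.value
          · rw [Cmd.run, Store.setI_R, r1]
          · rw [Cmd.run, Store.setI_R, ← e5]; exact not_lt.1 hlt
      · rw [Cmd.run_ite_neg (mt eg.1 hg)]
        refine ⟨B.mem, B.value, ?_⟩
        rintro r (⟨h, h1, h2, h3, rfl⟩ | ⟨h, h1, h2, h3, -⟩)
        · exact B.le _ (Or.inl ⟨h, h1, h2, by omega, rfl⟩)
        · omega)
  set c4 : Cmd := forIn 2 (.const 1) (.add (.var 0) (.const 1)) (.seq vertexValue
    (.ite (.rlt (.var 10) (.var 1)) (.seq (.rset 0 (.arr 0 (.var 2))) (.rset 1 (.var 10))) .skip))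
    with hc4
  have F4 := Cmd.frame c4 σ₃
  change Best P (c4.run σ₃) _ at key4
  set σ₄ := c4.run σ₃
  have n4 : σ₄.I 0 = n := (F4.onI 0 rfl).trans n3
  have l4 := l3.frame F4 rfl
  have a4 : σ₄.A 18 = σ.A 18 ∧ σ₄.A 19 = σ.A 19 :=
    ⟨(F4.onA 18 rfl).trans a3.1, (F4.onA 19 rfl).trans a3.2⟩
  have key5 := loop_induct (v := 2) (σ := σ₄)
    (c := .ite (.and (.ile (.const 1) (.var 2)) (.ile (.var 2) (.var 0)))
      (.seq (.rset 8 (.div (.sub (.add (.arr 0 (.add (.var 0) (.const 1)))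
        (.arr 19 (.sub (.add (.var 0) (.const 1)) (.var 2)))) (.arr 18 (.var 2))) (.const 2)))
      (.seq (.rset 10 (.max (.const 0) (.add (.var 8) (.arr 18 (.var 2)))))
      (.ite (.and (.and (.rlt (.arr 0 (.var 2)) (.var 8))
          (.rlt (.var 8) (.arr 0 (.add (.var 2) (.const 1))))) (.rlt (.var 10) (.var 1)))
        (.seq (.rset 0 (.var 8)) (.rset 1 (.var 10))) .skip))) .skip)
    (fun k τ => Best P τ (Candidates P (σ.A 18) (σ.A 19) (n + 2) k))
    ⟨key4.mem, key4.value, by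
      rintro r (⟨h, h1, h2, -, rfl⟩ | ⟨h, h1, h2, h3, -⟩)
      · exact key4.le _ (Or.inl ⟨h, h1, h2, by simp only [Store.rounds]; omega, rfl⟩)
      · omega⟩ (by
      rintro k hk τ hF hv B
      have t0 : τ.I 0 = n := (hF.onI 0 rfl).trans n4
      have eg : (BExpr.and (.ile (.const 1) (.var 2)) (.ile (.var 2) (.var 0))).eval τ ↔
          1 ≤ k ∧ k ≤ n := by
        simp [BExpr.and_eval, BExpr.ile_eval, IExpr.eval, hv, t0]
      by_cases hg : 1 ≤ k ∧ k ≤ n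
      · rw [Cmd.run_ite_pos (eg.2 hg), Cmd.run_seq, Cmd.run_seq]
        have lτ := l4.frame hF rfl
        have A0 : ∀ l ≤ n + 1, τ.A 0 l = _ := lτ.X
        have A18 : τ.A 18 = σ.A 18 := (hF.onA 18 rfl).trans a4.1
        have A19 : τ.A 19 = σ.A 19 := (hF.onA 19 rfl).trans a4.2
        set b := P.balance (σ.A 18) (σ.A 19) k with hb
        have e8 : (Cmd.rset 8 (.div (.sub (.add (.arr 0 (.add (.var 0) (.const 1)))
            (.arr 19 (.sub (.add (.var 0) (.const 1)) (.var 2)))) (.arr 18 (.var 2)))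
            (.const 2))).run τ = τ.setR 8 b := by
          simp [Cmd.run, RExpr.eval, IExpr.eval, t0, hv, A18, A19, A0 _ le_rfl, hb, balance, len]
        have e10 : (Cmd.rset 10 (.max (.const 0) (.add (.var 8) (.arr 18 (.var 2))))).run
            (τ.setR 8 b) = (τ.setR 8 b).setR 10 (max 0 (b + σ.A 18 k)) := by
          simp [Cmd.run, RExpr.eval, IExpr.eval, hv, A18]
        rw [e8, e10]
        set τ₅ := (τ.setR 8 b).setR 10 (max 0 (b + σ.A 18 k)) with hτ₅
        have r0 : τ₅.R 0 = τ.R 0 := by simp [hτ₅]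
        have r1 : τ₅.R 1 = τ.R 1 := by simp [hτ₅]
        have r8 : τ₅.R 8 = b := by simp [hτ₅]
        have r10 : τ₅.R 10 = max 0 (b + σ.A 18 k) := by simp [hτ₅]
        have i2 : τ₅.I 2 = k := hv
        have A0' : τ₅.A 0 = τ.A 0 := rfl
        have eg' : (BExpr.and (.and (.rlt (.arr 0 (.var 2)) (.var 8))
            (.rlt (.var 8) (.arr 0 (.add (.var 2) (.const 1))))) (.rlt (.var 10)
              (.var 1))).eval τ₅ ↔
            (P.loc k < b ∧ b < P.loc (k + 1)) ∧ max 0 (b + σ.A 18 k) < τ.R 1 := by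
          simp only [BExpr.and_eval, BExpr.rlt_eval, RExpr.eval, IExpr.eval, r8, r10, r1, i2, A0',
            A0 k (by omega), A0 (k + 1) (by omega)]
        have step : ∀ x : Store, x.R 1 ≤ τ.R 1 →
            (P.loc k < b → b < P.loc (k + 1) → x.R 1 ≤ max 0 (b + σ.A 18 k)) →
            ∀ r, Candidates P (σ.A 18) (σ.A 19) (n + 2) (k + 1) r → x.R 1 ≤ r := by
          rintro x hx hx' r (⟨h, h1, h2, h3, rfl⟩ | ⟨h, h1, h2, h3, h4, h5, rfl⟩)
          · exact hx.trans (B.le _ (Or.inl ⟨h, h1, h2, h3, rfl⟩))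
          · rcases (Nat.lt_succ_iff.1 h3).eq_or_lt with rfl | h3
            · exact hx' h4 h5
            · exact hx.trans (B.le _ (Or.inr ⟨h, h1, h2, h3, h4, h5, rfl⟩))
        by_cases hlt : (P.loc k < b ∧ b < P.loc (k + 1)) ∧ max 0 (b + σ.A 18 k) < τ.R 1
        · rw [Cmd.run_ite_pos (eg'.2 hlt)]
          have w0 : ((Cmd.seq (.rset 0 (.var 8)) (.rset 1 (.var 10))).run τ₅).R 0 = b := by
            simp [Cmd.run, RExpr.eval, r8]
          have w1 : ((Cmd.seq (.rset 0 (.var 8)) (.rset 1 (.var 10))).run τ₅).R 1 =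
              max 0 (b + σ.A 18 k) := by
            simp [Cmd.run, RExpr.eval, r10]
          refine ⟨?_, ?_, step _ ?_ fun _ _ => ?_⟩
          · rw [Store.setI_R, w0]; exact P.mem_points_of_edge hg.1 hg.2 hlt.1.1 hlt.1.2
          · rw [Store.setI_R, w0, w1]; exact maxRegret_balance hα hβ hg.1 hg.2 hlt.1.1 hlt.1.2
          · rw [Store.setI_R, w1]; exact hlt.2.le
          · rw [Store.setI_R, w1]
        · rw [Cmd.run_ite_neg (mt eg'.1 hlt)]
          refine ⟨?_, ?_, step _ ?_ fun h1 h2 => ?_⟩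
          · rw [Cmd.run, Store.setI_R, r0]; exact B.mem
          · rw [Cmd.run, Store.setI_R, r0, r1]; exact B.value
          · rw [Cmd.run, Store.setI_R, r1]
          · rw [Cmd.run, Store.setI_R, r1]
            exact not_lt.1 fun h3 => hlt ⟨⟨h1, h2⟩, h3⟩
      · rw [Cmd.run_ite_neg (mt eg.1 hg)]
        refine ⟨B.mem, B.value, ?_⟩
        rintro r (⟨h, h1, h2, h3, rfl⟩ | ⟨h, h1, h2, h3, h4, h5, rfl⟩)
        · exact B.le _ (Or.inl ⟨h, h1, h2, h3, rfl⟩)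
        · exact B.le _ (Or.inr ⟨h, h1, h2, by omega, h4, h5, rfl⟩))
  change Best P (minimize.run σ) _ at key5
  refine ⟨key5.mem, key5.value, ?_⟩
  rw [← key5.value]
  refine isLeast_of_le hα hβ key5.mem (fun h h1 h2 => ?_) fun h h1 h2 h3 h4 => ?_
  · rw [key5.value]
    exact key5.le _ (Or.inl ⟨h, h1, h2, by omega, rfl⟩)
  · rw [key5.value]
    exact key5.le _ (Or.inr ⟨h, h1, h2, by simp only [Store.rounds]; omega, h3, h4, rfl⟩)

theorem main_spec (H : Input P σ) :
    (main.run σ).R 0 ∈ P.points ∧ P.maxRegret ((main.run σ).R 0) = (main.run σ).R 1 ∧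
    IsLeast (P.maxRegret '' P.points) ((main.run σ).R 1) := by
  have F1 := Cmd.frame load σ
  have l1 := H.load
  set σ₁ := load.run σ
  have n1 : σ₁.I 0 = n := (F1.onI 0 rfl).trans H.size
  have F2 := Cmd.frame turn σ₁
  obtain ⟨l2, r2⟩ := turn_bank n1 l1
  set σ₂ := turn.run σ₁
  have n2 : σ₂.I 0 = n := (F2.onI 0 rfl).trans n1
  have F3 := Cmd.frame table σ₂
  -- The path has been turned, so this first table is the one for the reversed path. It is saved in
  -- array 19 before the path is turned back and the second table overwrites array 18.
  have t3 := table_isTable n2 l2 (by rw [rev_rev]; exact r2)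
  set σ₃ := table.run σ₂
  have n3 : σ₃.I 0 = n := (F3.onI 0 rfl).trans n2
  have l3 := l2.frame F3 rfl
  have F4 := Cmd.frame (copy 18 19) σ₃
  have t4 := t3.congr fun k _ h2 => copy_entry (a := 18) (b := 19) (by decide) n3 k (by omega)
  set σ₄ := (copy 18 19).run σ₃
  have n4 : σ₄.I 0 = n := (F4.onI 0 rfl).trans n3
  have l4 := l3.frame F4 rfl
  have F5 := Cmd.frame turn σ₄
  obtain ⟨l5, r5⟩ := turn_bank n4 l4
  rw [rev_rev] at l5
  set σ₅ := turn.run σ₄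
  have n5 : σ₅.I 0 = n := (F5.onI 0 rfl).trans n4
  have F6 := Cmd.frame table σ₅
  have t6 := table_isTable n5 l5 r5
  set σ₆ := table.run σ₅
  have n6 : σ₆.I 0 = n := (F6.onI 0 rfl).trans n5
  have t6' : P.rev.IsTable (σ₆.A 19) := by
    rw [F6.onA 19 rfl, F5.onA 19 rfl]
    exact t4
  have e : main.run σ = minimize.run σ₆ := by
    simp only [main, Cmd.run_seq]
    rfl
  rw [e]
  exact minimize_spec n6 (l5.frame F6 rfl) t6 t6'

/-- The initial values of the variables and of the arrays. -/
noncomputable def initial (P : UncertainPath n) : Store where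
  I := Function.update (fun _ => 0) 0 n
  R _ := 0
  A a j := P.input.rmem (32 * j + a)

theorem rawCell_initial (P : UncertainPath n) (x : ℕ) : rawCell (initial P) x = P.input.rmem x := by
  simp only [rawCell, initial, Fin.ofNat]
  congr 1
  omega

theorem initial_sim (P : UncertainPath n) : Sim (initial P) P.input where
  I v := by
    by_cases hv : v = 0
    · simp [hv, initial, UncertainPath.input]
    · simp [hv, initial, UncertainPath.input]
  R _ := rfl
  A x := (rawCell_initial P x).symm

theorem initial_input (P : UncertainPath n) : Input P (initial P) where
  size := by simp [initial]
  d j hj := by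
    rw [rawCell_initial]
    simp [UncertainPath.input, List.getD_eq_getElem?_getD, List.getElem?_append, hj, extend]
  c j hj := by
    rw [rawCell_initial]
    simp [UncertainPath.input, List.getD_eq_getElem?_getD, List.getElem?_append, hj, extend]
  wlo j hj := by
    rw [rawCell_initial]
    simp [UncertainPath.input, List.getD_eq_getElem?_getD, List.getElem?_append, extend,
      -List.ofFn_succ, show ¬ n + n + j < n by omega, show ¬ n + n + j - n < n by omega,
      show n + n + j - n - n = j by omega, hj]
  whi j hj := by
    rw [rawCell_initial]
    simp [UncertainPath.input, List.getD_eq_getElem?_getD, List.getElem?_append, extend,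
      -List.ofFn_succ, show ¬ n + n + n + 1 + j < n by omega,
      show ¬ n + n + n + 1 + j - n < n by omega, show ¬ n + n + n + 1 + j ≤ n + n + n by omega,
      show n + n + n + 1 + j - n - n - (n + 1) = j by omega,
      show n + n + n + 1 + j ≤ n + (n + 1) + n + n by omega, hj]

/-- For n ≥ 3 the logarithm is at least 1 and 2n + 6 ≤ 8n, so the bound of order n^4 suffices. -/
theorem isBigO_pow_mul_log (C : ℕ) :
    Asymptotics.IsBigO Filter.atTop (fun n : ℕ => ((C * (2 * n + 6) ^ 4 + 2 : ℕ) : ℝ))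
      (fun n : ℕ => (n : ℝ) ^ 4 * Real.log (n : ℝ)) := by
  refine Asymptotics.IsBigO.of_bound ((C : ℝ) * 8 ^ 4 + 2) ?_
  filter_upwards [Filter.eventually_ge_atTop 3] with n hn
  have hn' : (3 : ℝ) ≤ n := by exact_mod_cast hn
  have hlog : 1 ≤ Real.log n := by
    rw [Real.le_log_iff_exp_le (by linarith)]
    linarith [Real.exp_one_lt_d9]
  have h4 : (1 : ℝ) ≤ (n : ℝ) ^ 4 := one_le_pow₀ (by linarith)
  have h6 : ((2 : ℝ) * n + 6) ^ 4 ≤ (8 * n) ^ 4 := by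
    gcongr
    linarith
  rw [Real.norm_of_nonneg (by positivity), Real.norm_of_nonneg (by positivity)]
  push_cast
  calc (C : ℝ) * (2 * n + 6) ^ 4 + 2 ≤ C * (8 * n) ^ 4 + 2 * (n : ℝ) ^ 4 := by
        gcongr; linarith
    _ = (C * 8 ^ 4 + 2) * ((n : ℝ) ^ 4 * 1) := by ring
    _ ≤ _ := by gcongr

end RegretProgram

theorem theorem1 :
    ∃ (prog : RealRAM.Program) (T : ℕ → ℕ),
      Asymptotics.IsBigO Filter.atTop (fun n : ℕ => (T n : ℝ))
        (fun n : ℕ => (n : ℝ) ^ 4 * Real.log (n : ℝ)) ∧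
      ∀ (n : ℕ) (P : UncertainPath n),
        ∃ (t : ℕ) (final : RealRAM.Config),
          RealRAM.HaltsIn prog P.input t final ∧ t ≤ T n ∧
          -- real register `0` holds an optimal sink, real register `1` the minmax regret value
          final.rreg 0 ∈ P.points ∧
          P.maxRegret (final.rreg 0) = P.minmaxRegret ∧
          final.rreg 1 = P.minmaxRegret ∧
          IsLeast (P.maxRegret '' P.points) P.minmaxRegret := by
  obtain ⟨C, hC⟩ := RegretProgram.main.exists_cost_le
  rw [RegretProgram.main_depth] at hC
  refine ⟨RegretProgram.main.program, fun n => C * (2 * n + 6) ^ 4 + 2,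
    RegretProgram.isBigO_pow_mul_log C, fun n P => ?_⟩
  obtain ⟨t, f, h1, h2, h3, h4⟩ := RealRAM.Cmd.program_correct RegretProgram.main_loopsOK
    RegretProgram.main_writesI (RegretProgram.initial_sim P) rfl
  obtain ⟨h5, h6, h7⟩ := RegretProgram.main_spec (RegretProgram.initial_input P)
  have hmin : P.minmaxRegret = f.rreg 1 := h7.csInf_eq.trans h4.symm
  -- With 2n + 5 rounds, the base of the cost bound is 2n + 6; the 2 added to the bound is for the
  -- closing copy instructions.
  have hr : (RegretProgram.initial P).rounds = 2 * n + 5 := by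
    simp [RealRAM.Store.rounds, RegretProgram.initial]
  refine ⟨t, f, h1, h2.trans ?_, h3 ▸ h5, ?_, hmin.symm, ?_⟩
  · rw [hr]
    exact Nat.add_le_add_right (hC _) 2
  · rw [h3, h6, hmin, h4]
  · rw [hmin, h4]
    exact h7
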